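/- **Theorem 4.2.** Let $d\ge 1$ and $1\le p<\infty$. Let $V\subset\mathbb R^d$ be either a bounded open set with $0\notin\overline V$ (with Lebesgue measure $dv$), or a compact $C^1$ hypersurface without boundary with $0\notin V$ (with surface measure $dv$). Let $\rho\in C^2(\mathbb R^d)$ satisfy $\mathrm{Hess}\,\rho(x)>0$ for $x\ne0$, $\nabla\rho(0)=0$, $\rho(0)=-1$ and $|\rho(x)|\to\infty$ as $|x|\to\infty$. Put $Z_s=\{\rho<s\}$ and $X=Z_1\setminus\overline{Z_0}$. For a bounded $C^1$ domain $Y$ with outer unit normal $\nu$, let $\Gamma_\pm(Y)=\{(x,v)\in\partial Y\times V:\pm v\cdot\nu(x)>0\}$, let $d\xi=|\nu(x)\cdot v|\,d\mu(x)\,dv$ on $\partial Y\times V$ ($d\mu$ the surface measure), let $\tau_\pm(x,v)=\inf\{s>0: x\pm sv\notin Y\}$ and $\tau=\tau_++\tau_-$, and let $W^p(Y\times V)$ be the set of $u$ with $\tau^{-1/p}u\in L^p(Y\times V)$ whose weak derivative $v\cdot\nabla_xu$ satisfies $\tau^{1-1/p}\,v\cdot\nabla_x u\in L^p(Y\times V)$.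 A transport solution on $Y$ is a $u\in W^p(Y\times V)$ with $$v\cdot\nabla_x u(x,v)+\sigma(x,v)u(x,v)=\int_V k(x,v',v)u(x,v')\,dv'\quad\text{a.e. in }Y\times V .$$ The trace of $u$ on $\Gamma_\pm(Y)$ is, for $d\xi$-a.e. $(x,v)$, the essential limit of $u(x\mp tv,v)$ as $t\to0^+$. Let $\mathcal G_-(s_2,s_1)=\{(x,v)\in\Gamma_-(Z_{s_2}):(x+\mathbb Rv)\cap Z_{s_1}=\emptyset\}$. Let $\sigma\in L^\infty(X\times V)$, and let $k\in L^\infty(X\times V\times V)$ if $p=1$, and $k\in L^\infty\big(X,L^p(V_v,L^{p/(p-1)}(V_{v'}))\big)$ if $p>1$ ($\sigma$ and $k$ real valued). Then there is $\varepsilon\in(0,1)$ such that: 1. For all $\beta\in L^p(\partial Z_0\times V,d\xi)$ and $\gamma\in L^p(\mathcal G_-(1,1-\varepsilon),d\xi)$ there is a transport solution $u\in W^p(X\times V)$ on $X$ with $u|_{\partial Z_0\times V}=\beta$ (both incoming and outgoing directions) and $u|_{\mathcal G_-(1,1-\varepsilon)}=\gamma$. If moreover $\sigma$ and $k$ are given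 on $Z_1$ and satisfy the same assumptions with $Z_1$ in place of $X$, then also: 2. (Exact boundary control.) For every transport solution $u_0\in W^p(Z_0\times V)$ on $Z_0$ and every $\gamma\in L^p(\mathcal G_-(1,1-\varepsilon),d\xi)$ there are $g\in L^p(\Gamma_-(Z_1),d\xi)$ and a transport solution $u\in W^p(Z_1\times V)$ on $Z_1$ with $u|_{\Gamma_-(Z_1)}=g$, $u|_{\mathcal G_-(1,1-\varepsilon)}=\gamma$ and $u=u_0$ a.e. on $Z_0\times V$. 3. (Failure of unique continuation.) If $d\ge2$ and $V\neq\emptyset$, there is a transport solution $w\in W^p(Z_1\times V)$ on $Z_1$ which vanishes a.e. on $Z_0\times V$ but does not vanish a.e. on $Z_1\times V$. -/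

import Mathlib

open MeasureTheory Filter Topology Set
open scoped ContDiff ENNReal NNReal

namespace Transport

/-- The ambient Euclidean space `ℝ^d`. -/
abbrev Space (d : ℕ) := EuclideanSpace ℝ (Fin d)

variable {d : ℕ}

/-! ### Velocity spaces -/

/-- A closed `C^1` surface of codimension one: compact, and near each of its points the zero set of
a `C^1` function with nonvanishing differential (hence embedded and without boundary). -/
def IsClosedHypersurface (V : Set (Space d)) : Prop :=
  IsCompact V ∧ ∀ v ∈ V, ∃ f : Space d → ℝ,
    ContDiffAt ℝ 1 f v ∧ fderiv ℝ f v ≠ 0 ∧ ∀ᶠ w in 𝓝 v, (w ∈ V ↔ f w = 0)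

/-- `V` is a velocity set with canonical measure `dv = m`: either a bounded open set staying away
from `0`, with Lebesgue measure, or a closed hypersurface avoiding `0`, with its surface measure
(the `(d-1)`-dimensional Hausdorff measure, normalized so that it agrees with Lebesgue measure on
hyperplanes). -/
def IsVelocitySpace (V : Set (Space d)) (m : Measure (Space d)) : Prop :=
  (IsOpen V ∧ Bornology.IsBounded V ∧ (0 : Space d) ∉ closure V ∧ m = volume.restrict V) ∨
  (IsClosedHypersurface V ∧ (0 : Space d) ∉ V ∧ m = (μHE[d - 1] : Measure (Space d)).restrict V)

/-! ### Boundary geometry of a domain `X` of class `C^1` -/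

/-- `n` is the outer unit normal to `X` at `x`: directions making an obtuse angle with `n` enter `X`
and directions making an acute angle with `n` leave `X`. -/
def IsOuterUnitNormal (X : Set (Space d)) (x n : Space d) : Prop :=
  ‖n‖ = 1 ∧
  (∀ w : Space d, inner ℝ n w < 0 → ∀ᶠ t in 𝓝[>] (0 : ℝ), x + t • w ∈ X) ∧
  (∀ w : Space d, 0 < inner ℝ n w → ∀ᶠ t in 𝓝[>] (0 : ℝ), x + t • w ∉ X)

/-- An outer unit normal is unique when it exists. -/
theorem IsOuterUnitNormal.unique {X : Set (Space d)} {x n n' : Space d}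
    (h : IsOuterUnitNormal X x n) (h' : IsOuterUnitNormal X x n') : n = n' := by
  by_contra hne
  have hlt : inner ℝ n n' < 1 := by
    have h1 := real_inner_le_norm n n'
    rw [h.1, h'.1, mul_one] at h1
    refine lt_of_le_of_ne h1 fun he => hne ?_
    exact (inner_eq_one_iff_of_norm_eq_one (𝕜 := ℝ) h.1 h'.1).1 he
  have hn : inner ℝ n n = (1 : ℝ) := by rw [real_inner_self_eq_norm_sq, h.1]; norm_num
  have hn' : inner ℝ n' n' = (1 : ℝ) := by rw [real_inner_self_eq_norm_sq, h'.1]; norm_num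
  have e1 := h.2.1 (n' - n) (by rw [inner_sub_right]; linarith)
  have e2 := h'.2.2 (n' - n) (by rw [inner_sub_right, real_inner_comm n n']; linarith)
  obtain ⟨t, h1, h2⟩ := (e1.and e2).exists
  exact h2 h1

open scoped Classical in
/-- The outer unit normal `ν(x)` (with the junk value `0` where it does not exist). -/
noncomputable def outerNormal (X : Set (Space d)) (x : Space d) : Space d :=
  if h : ∃ n, IsOuterUnitNormal X x n then h.choose else 0

/-- The incoming set `Γ_-(X)`. -/
def incoming (X V : Set (Space d)) : Set (Space d × Space d) :=
  {z | z.1 ∈ frontier X ∧ z.2 ∈ V ∧ inner ℝ (outerNormal X z.1) z.2 < (0 : ℝ)}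

/-- The outgoing set `Γ_+(X)`. -/
def outgoing (X V : Set (Space d)) : Set (Space d × Space d) :=
  {z | z.1 ∈ frontier X ∧ z.2 ∈ V ∧ (0 : ℝ) < inner ℝ (outerNormal X z.1) z.2}

/-- The measure `dξ(x,v) = |ν(x)·v| dμ(x) dv` on `∂X × V`, with `dμ` the surface measure. -/
noncomputable def boundaryMeasure (X : Set (Space d)) (m : Measure (Space d)) :
    Measure (Space d × Space d) :=
  (((μHE[d - 1] : Measure (Space d)).restrict (frontier X)).prod m).withDensity
    fun z => ENNReal.ofReal |inner ℝ (outerNormal X z.1) z.2|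

/-- The measure `dx dv` on `X × V`. -/
noncomputable def phaseMeasure (X : Set (Space d)) (m : Measure (Space d)) :
    Measure (Space d × Space d) :=
  (volume.restrict X).prod m

/-! ### The space `W^p` and its traces -/

/-- The exit time `inf {s > 0 | x + s v ∉ X}`; it is `τ_+(x,v)`, and at `-v` it is `τ_-(x,v)`. -/
noncomputable def exitTime (X : Set (Space d)) (x v : Space d) : ℝ :=
  sInf {s : ℝ | 0 < s ∧ x + s • v ∉ X}

/-- The travel time `τ = τ_- + τ_+`. -/
noncomputable def travelTime (X : Set (Space d)) (z : Space d × Space d) : ℝ :=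
  exitTime X z.1 (-z.2) + exitTime X z.1 z.2

/-- Test functions on `X × V`: restrictions to `X × V` of smooth functions, vanishing on `X × V`
outside a compact subset of `X × V`. -/
def IsTestFunction (X V : Set (Space d)) (φ : Space d × Space d → ℝ) : Prop :=
  ContDiff ℝ ∞ φ ∧ ∃ K, IsCompact K ∧ K ⊆ X ×ˢ V ∧ ∀ z ∈ X ×ˢ V, z ∉ K → φ z = 0

/-- The derivative `v · ∇_x φ` of a function of `(x,v)`. -/
noncomputable def transportDeriv (φ : Space d × Space d → ℝ) (z : Space d × Space d) : ℝ :=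
  fderiv ℝ (fun x => φ (x, z.2)) z.1 z.2

/-- `w` is the weak derivative `v · ∇_x u` on `X × V`. -/
def HasWeakTransportDeriv (X V : Set (Space d)) (m : Measure (Space d))
    (u w : Space d × Space d → ℝ) : Prop :=
  ∀ φ, IsTestFunction X V φ →
    ∫ z, u z * transportDeriv φ z ∂(phaseMeasure X m) = -∫ z, w z * φ z ∂(phaseMeasure X m)

/-- `u ∈ W^p(X × V)`, with `v · ∇_x u = w`: that is, `τ^{-1/p} u ∈ L^p`, `τ^{1-1/p} w ∈ L^p`. -/
def MemWp (X V : Set (Space d)) (m : Measure (Space d)) (p : ℝ)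
    (u w : Space d × Space d → ℝ) : Prop :=
  HasWeakTransportDeriv X V m u w ∧
  MemLp (fun z => travelTime X z ^ (-(1 / p)) * u z) (ENNReal.ofReal p) (phaseMeasure X m) ∧
  MemLp (fun z => travelTime X z ^ (1 - 1 / p) * w z) (ENNReal.ofReal p) (phaseMeasure X m)

/-- `u` has trace `g` on the set `S` of boundary points: for `dξ`-almost every `(x,v) ∈ S`, the
essential limit of `u` at `(x,v)` along the line `x + ℝ v`, taken from inside `X`, is `g (x,v)`.
Essential limits do not depend on the representative of `u`. -/
def HasTraceOn (X V : Set (Space d)) (m : Measure (Space d)) (u : Space d × Space d → ℝ)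
    (S : Set (Space d × Space d)) (g : Space d × Space d → ℝ) : Prop :=
  ∀ᵐ z ∂((boundaryMeasure X m).restrict S),
    (z ∈ incoming X V →
      Tendsto (fun t : ℝ => u (z.1 + t • z.2, z.2)) (𝓝[>] 0 ⊓ ae volume) (𝓝 (g z))) ∧
    (z ∈ outgoing X V →
      Tendsto (fun t : ℝ => u (z.1 - t • z.2, z.2)) (𝓝[>] 0 ⊓ ae volume) (𝓝 (g z)))

/-! ### The transport equation -/

/-- `σ ∈ L^∞(X × V)`. -/
def BoundedAbsorption (X : Set (Space d)) (m : Measure (Space d))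
    (σ : Space d × Space d → ℝ) : Prop :=
  MemLp σ ∞ (phaseMeasure X m)

/-- The assumption on the scattering coefficient `k x v' v`: it is in `L^∞(X × V × V)` if `p = 1`,
and in `L^∞(X, L^p(V_v, L^{p/(p-1)}(V_{v'})))` if `p > 1`. -/
def AdmissibleScattering (X : Set (Space d)) (m : Measure (Space d)) (p : ℝ)
    (k : Space d → Space d → Space d → ℝ) : Prop :=
  (p = 1 → MemLp (fun y : Space d × Space d × Space d => k y.1 y.2.1 y.2.2) ∞
    ((volume.restrict X).prod (m.prod m))) ∧
  (1 < p →
    AEStronglyMeasurable (fun y : Space d × Space d × Space d => k y.1 y.2.1 y.2.2)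
      ((volume.restrict X).prod (m.prod m)) ∧
    ∃ C : ℝ≥0, ∀ᵐ x ∂(volume.restrict X),
      ∫⁻ v, (∫⁻ v', ‖k x v' v‖ₑ ^ (p / (p - 1)) ∂m) ^ (p - 1) ∂m ≤ C)

/-- `u ∈ W^p(X × V)` solves `v · ∇_x u + σ u = ∫_V k(x,v',v) u(x,v') dv'` on `X × V`. -/
def IsTransportSolution (X V : Set (Space d)) (m : Measure (Space d)) (p : ℝ)
    (σ : Space d × Space d → ℝ) (k : Space d → Space d → Space d → ℝ)
    (u : Space d × Space d → ℝ) : Prop :=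
  ∃ w, MemWp X V m p u w ∧ ∀ᵐ z ∂(phaseMeasure X m),
    Integrable (fun v' => k z.1 v' z.2 * u (z.1, v')) m ∧
    w z + σ z * u z = ∫ v', k z.1 v' z.2 * u (z.1, v') ∂m

/-! ### The level sets -/

/-- Assumptions on `ρ`: `C^2`, positive definite Hessian off the origin, `∇ρ(0) = 0`,
`ρ(0) = -1`, and `|ρ(x)| → ∞` as `|x| → ∞`. -/
structure IsConvexProfile (ρ : Space d → ℝ) : Prop where
  contDiff : ContDiff ℝ 2 ρ
  hess_pos : ∀ x, x ≠ 0 → ∀ w, w ≠ 0 → 0 < iteratedFDeriv ℝ 2 ρ x ![w, w]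
  grad_zero : fderiv ℝ ρ 0 = 0
  value_zero : ρ 0 = -1
  tendsto_abs : Tendsto (fun x => |ρ x|) (cocompact (Space d)) atTop

/-- The sublevel set `Z_s = {ρ < s}`. -/
def sublevel (ρ : Space d → ℝ) (s : ℝ) : Set (Space d) := {x | ρ x < s}

/-- The shell `X = Z_1 \ closure Z_0`. -/
def shell (ρ : Space d → ℝ) : Set (Space d) := sublevel ρ 1 \ closure (sublevel ρ 0)

/-- `𝒢_-(s₂, s₁)`: incoming `(x,v)` for `Z_{s₂}` whose line `x + ℝ v` misses `Z_{s₁}`. -/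
def grazing (ρ : Space d → ℝ) (V : Set (Space d)) (s₂ s₁ : ℝ) : Set (Space d × Space d) :=
  {z | z ∈ incoming (sublevel ρ s₂) V ∧ ∀ t : ℝ, z.1 + t • z.2 ∉ sublevel ρ s₁}

end Transport

open Transport

/-! Along a line x + ℝv the equation is an ordinary differential equation whose right-hand side is
the collision term w = ∫ k u dv' - σu. Solutions are sought as u = U + Tw, where U is locally
constant along lines and carries the boundary data, and T = `lineOp` is a right inverse of v·∇.
There is freedom in T: a source at a point y of a line may be sent forward from y, or backward with
a minus sign, and any choice, made separately at every y, yields an antiderivative (`lineOp_flow`).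
The set `forwardSet` fixes the choice: on lines meeting Z_{1-ε} the influence of a source travels in
the direction of increasing ρ, and on lines missing Z_{1-ε} it travels forward.

This has two consequences. First, for sources in the shell, Tw vanishes where ρ ≤ 0 and at the
entrance points of the lines missing Z_{1-ε} (`lineOp_eq_zero_of_nonpos`,
`lineOp_eq_zero_of_grazing`), so the prescribed traces are those of U alone. Second, T is small in
L^p with the weight exp(-lρ), because influence moves towards smaller weights. Quantitatively
(`exists_kernel_bound`), uniform convexity gains a factor exp(-lη) between points at distance at
least δ; points closer than δ interact only during a short time; and on a line missing Z_{1-ε} two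
points of the shell are always closer than δ, while ρ varies by at most ε between them, so that the
weight does no harm there. Young's inequality along lines (`lintegral_conv_flow_rpow_le`) turns the
pointwise bound into an operator bound. The collision operator is bounded on L^p
(`exists_collision_bound`) and commutes with weights depending on x only (`collision_weight`). Hence
w ↦ collision (U + Tw) is a contraction when δ is small, then l large, then ε small
(`exists_fixed_point`, `exists_isShellSolvable`).

Boundary integrals against dξ are compared, up to constants, with phase space integrals by sweeping
level sets along lines (`exists_fluxBound`, `exists_levelMeasure_bounds`). This gives the extension
U its integrability (`exists_extension_of_traces`) and makes w integrable along almost every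
boundary line (`ae_integrable_of_crossing`). The travel time weights of W^p are traded for the chord
length `lineLen`, which is constant along lines (`exists_lineLen_le_travelTime_shell`).

For boundary control, a function with zero weak derivative is invariant under the flow, so a
solution on Z_0 has the form A₀ + Tw₀ with A₀ invariant (`exists_decomposition`). The function A₀ is
continued along lines, the lines missing Z_{1-ε} receive γ, and the shell problem is solved with
free term A + Tw₀. Its source does not reach Z_0, so the inner solution is unchanged
(`exists_extension_of_inner`). Failure of unique continuation is the same construction started from
the zero solution and from an invariant A that lives on the lines missing Z_{1-ε}; for d ≥ 2 these
have positive measure, since every direction is tangent to every level set (`measure_missing_pos`).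
-/

set_option linter.unusedSectionVars false
open MeasureTheory Filter Topology Set
open scoped ContDiff ENNReal NNReal

/-! ### Charts straightening the level sets of a C¹ function. -/

namespace Transport

section LevelChart

variable {E : Type*} [NormedAddCommGroup E] [InnerProductSpace ℝ E] [FiniteDimensional ℝ E]
  [MeasurableSpace E] [BorelSpace E]

/-- The rank one perturbation `x ↦ x + ℓ x • w` of the identity. -/
noncomputable def rankOnePerturb (ℓ : E →L[ℝ] ℝ) (w : E) : E →L[ℝ] E :=
  ContinuousLinearMap.id ℝ E + ℓ.smulRight w

/-- The matrix determinant lemma; every Jacobian in the charts below is reduced to it, without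
coordinates. -/
theorem det_rankOnePerturb (ℓ : E →L[ℝ] ℝ) (w : E) : (rankOnePerturb ℓ w).det = 1 + ℓ w := by
  have : ((rankOnePerturb ℓ w : E →L[ℝ] E) : E →ₗ[ℝ] E)
      = LinearMap.transvection (ℓ : E →ₗ[ℝ] ℝ) w := by
    ext x
    simp [rankOnePerturb, LinearMap.transvection.apply]
  rw [ContinuousLinearMap.det, this, LinearMap.transvection.det]
  rfl

/-- The local straightening `x ↦ x + (f x - ⟪e, x⟫) e` of the level sets of `f` along `e`. -/
noncomputable def straighten (f : E → ℝ) (e x : E) : E := x + (f x - inner ℝ e x) • e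

/-- The derivative of `straighten`. -/
noncomputable def straightenDeriv (f : E → ℝ) (e x : E) : E →L[ℝ] E :=
  rankOnePerturb (fderiv ℝ f x - innerSL ℝ e) e

theorem hasFDerivAt_straighten {f : E → ℝ} {x : E} (e : E) (hf : DifferentiableAt ℝ f x) :
    HasFDerivAt (straighten f e) (straightenDeriv f e x) x := by
  have h1 : HasFDerivAt (fun x => f x - inner ℝ e x) (fderiv ℝ f x - innerSL ℝ e) x :=
    hf.hasFDerivAt.sub (innerSL ℝ e).hasFDerivAt
  exact (hasFDerivAt_id x).add (h1.smul_const e)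

/-- The rank one formula gives 1 + (df(e) - ⟪e, e⟫), and ‖e‖ = 1. Thus straightening is locally
invertible exactly where f is transversal to e. -/
theorem det_straightenDeriv {f : E → ℝ} {e : E} (he : ‖e‖ = 1) (x : E) :
    (straightenDeriv f e x).det = fderiv ℝ f x e := by
  rw [straightenDeriv, det_rankOnePerturb]
  simp [he]

/-- A local chart of the level sets of a `C^1` function near a regular point. -/
structure LevelChart (f : E → ℝ) (y₀ e : E) (U : Set E) (c : ℝ) (K : ℝ≥0) (G : E → E) :
    Prop where
  norm_dir : ‖e‖ = 1
  isOpen : IsOpen U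
  isBounded : Bornology.IsBounded U
  mem : y₀ ∈ U
  pos : 0 < c
  differentiableAt : ∀ x ∈ U, DifferentiableAt ℝ f x
  le_deriv : ∀ x ∈ U, c⁻¹ ≤ fderiv ℝ f x e
  deriv_le : ∀ x ∈ U, fderiv ℝ f x e ≤ c
  isOpen_image : IsOpen (straighten f e '' U)
  measurable : Measurable G
  leftInv : ∀ x ∈ U, G (straighten f e x) = x
  lipschitz : LipschitzOnWith K G (straighten f e '' U)
  hasFDerivAt : ∀ x ∈ U, ∃ G' : E →L[ℝ] E, HasFDerivAt G G' (straighten f e x) ∧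
    (straightenDeriv f e x).comp G' = ContinuousLinearMap.id ℝ E

/-- The inverse function theorem for `straighten`, with e a unit vector along which f increases. The
set U is shrunk until the derivative bounds and the Lipschitz bound on the inverse hold uniformly.
-/
theorem exists_levelChart {f : E → ℝ} {y₀ : E} (hf : ContDiffAt ℝ 1 f y₀)
    (hd : fderiv ℝ f y₀ ≠ 0) : ∃ e U c K G, LevelChart f y₀ e U c K G := by
  obtain ⟨e, he, hpos⟩ : ∃ e : E, ‖e‖ = 1 ∧ 0 < fderiv ℝ f y₀ e := by
    obtain ⟨w, hw⟩ : ∃ w, fderiv ℝ f y₀ w ≠ 0 := by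
      by_contra! h
      exact hd (ContinuousLinearMap.ext h)
    have key : ∀ w, 0 < fderiv ℝ f y₀ w → ∃ e : E, ‖e‖ = 1 ∧ 0 < fderiv ℝ f y₀ e := by
      intro w hw
      have hw0 : w ≠ 0 := by rintro rfl; simp at hw
      refine ⟨‖w‖⁻¹ • w, norm_smul_inv_norm (𝕜 := ℝ) hw0, ?_⟩
      rw [map_smul, smul_eq_mul]
      have := norm_pos_iff.2 hw0
      positivity
    rcases lt_or_gt_of_ne hw with h | h
    · exact key (-w) (by simpa using h)
    · exact key w h
  have hS : ContDiffAt ℝ 1 (straighten f e) y₀ := by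
    exact contDiffAt_id.add ((hf.sub (innerSL ℝ e).contDiff.contDiffAt).smul contDiffAt_const)
  have hdet : (straightenDeriv f e y₀).det ≠ 0 := by rw [det_straightenDeriv he]; exact hpos.ne'
  let A : E ≃L[ℝ] E := (straightenDeriv f e y₀).toContinuousLinearEquivOfDetNeZero hdet
  have hA : HasFDerivAt (straighten f e) (A : E →L[ℝ] E) y₀ :=
    hasFDerivAt_straighten e (hf.differentiableAt one_ne_zero)
  let Φ := hS.toOpenPartialHomeomorph (straighten f e) hA one_ne_zero
  have hΦ : ⇑Φ = straighten f e := rfl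
  have hy₀ : y₀ ∈ Φ.source := hS.mem_toOpenPartialHomeomorph_source hA one_ne_zero
  have hG : ContDiffAt ℝ 1 Φ.symm (straighten f e y₀) := hS.to_localInverse hA one_ne_zero
  obtain ⟨K, N, hN, hlip⟩ := hG.exists_lipschitzOnWith
  have hGd : ∀ᶠ z in 𝓝 (straighten f e y₀), DifferentiableAt ℝ Φ.symm z :=
    (hG.eventually (by simp)).mono fun z hz => hz.differentiableAt one_ne_zero
  set a := fderiv ℝ f y₀ e with ha
  have hfd : ∀ᶠ x in 𝓝 y₀, DifferentiableAt ℝ f x :=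
    (hf.eventually (by simp)).mono fun z hz => hz.differentiableAt one_ne_zero
  have hcont : ContinuousAt (fun x => fderiv ℝ f x e) y₀ :=
    (hf.continuousAt_fderiv one_ne_zero).clm_apply continuousAt_const
  have h1 : ∀ᶠ x in 𝓝 y₀, a / 2 < fderiv ℝ f x e := hcont.eventually_const_lt (by linarith)
  have h2 : ∀ᶠ x in 𝓝 y₀, fderiv ℝ f x e < 2 * a := hcont.eventually_lt_const (by linarith)
  have hSc : ContinuousAt (straighten f e) y₀ := hS.continuousAt
  have hall : ∀ᶠ x in 𝓝 y₀, DifferentiableAt ℝ f x ∧ a / 2 < fderiv ℝ f x e ∧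
      fderiv ℝ f x e < 2 * a ∧ straighten f e x ∈ N ∧ DifferentiableAt ℝ Φ.symm (straighten f e x)
      ∧ x ∈ Φ.source ∧ x ∈ Metric.ball y₀ 1 := by
    filter_upwards [hfd, h1, h2, hSc.eventually hN, hSc.eventually hGd,
      Φ.open_source.mem_nhds hy₀, Metric.ball_mem_nhds y₀ one_pos] with x a1 a2 a3 a4 a5 a6 a7
    exact ⟨a1, a2, a3, a4, a5, a6, a7⟩
  obtain ⟨U, hU, hUo, hyU⟩ := mem_nhds_iff.1 hall
  have hUs : U ⊆ Φ.source := fun x hx => (hU hx).2.2.2.2.2.1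
  have himg : IsOpen (straighten f e '' U) := by
    rw [← hΦ]; exact Φ.isOpen_image_of_subset_source hUo hUs
  classical
  -- Extending the inverse by zero off the open image makes it measurable on the whole space.
  let G : E → E := (straighten f e '' U).indicator Φ.symm
  have hGW : ∀ z ∈ straighten f e '' U, G z = Φ.symm z := fun z hz => indicator_of_mem hz _
  have hGeq : ∀ x ∈ U, G =ᶠ[𝓝 (straighten f e x)] Φ.symm := fun x hx =>
    eventually_of_mem (himg.mem_nhds (mem_image_of_mem _ hx)) hGW
  have hcontW : ContinuousOn Φ.symm (straighten f e '' U) := by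
    refine Φ.symm.continuousOn.mono ?_
    rintro _ ⟨x, hx, rfl⟩
    exact Φ.map_source (hUs hx)
  -- One constant bounds the directional derivative on both sides: it stays between a/2 and 2a,
  -- where a is its value at y₀.
  refine ⟨e, U, max (2 * a) (2 / a), K, G, he, hUo, ?_, hyU, ?_, fun x hx => (hU hx).1, ?_, ?_,
    himg, ?_, ?_, ?_, ?_⟩
  · exact Metric.isBounded_ball.subset fun x hx => (hU hx).2.2.2.2.2.2
  · positivity
  · intro x hx
    have : (max (2 * a) (2 / a))⁻¹ ≤ (2 / a)⁻¹ := inv_anti₀ (by positivity) (le_max_right _ _)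
    rw [inv_div] at this
    exact this.trans (hU hx).2.1.le
  · intro x hx
    exact (hU hx).2.2.1.le.trans (le_max_left _ _)
  · have := hcontW.measurable_piecewise (continuousOn_const (c := (0 : E)) (s := (straighten f e '' U)ᶜ))
      himg.measurableSet
    rwa [show (fun _ : E => (0 : E)) = 0 from rfl, piecewise_eq_indicator] at this
  · intro x hx
    rw [hGW _ (mem_image_of_mem _ hx)]
    exact Φ.left_inv (hUs hx)
  · have h3 : LipschitzOnWith K Φ.symm (straighten f e '' U) := by
      refine hlip.mono ?_
      rintro _ ⟨x, hx, rfl⟩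
      exact (hU hx).2.2.2.1
    intro z hz z' hz'
    rw [hGW z hz, hGW z' hz']
    exact h3 hz hz'
  · intro x hx
    have hd1 : DifferentiableAt ℝ G (straighten f e x) :=
      (hU hx).2.2.2.2.1.congr_of_eventuallyEq (hGeq x hx)
    refine ⟨_, hd1.hasFDerivAt, ?_⟩
    have hGx : G (straighten f e x) = x := by
      rw [hGW _ (mem_image_of_mem _ hx)]; exact Φ.left_inv (hUs hx)
    have h4 : HasFDerivAt (straighten f e) (straightenDeriv f e x) (G (straighten f e x)) := by
      rw [hGx]; exact hasFDerivAt_straighten e (hU hx).1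
    have h5 := h4.comp _ hd1.hasFDerivAt
    have h6 : (straighten f e) ∘ G =ᶠ[𝓝 (straighten f e x)] id := by
      refine eventually_of_mem (himg.mem_nhds (mem_image_of_mem _ hx)) ?_
      rintro _ ⟨x', hx', rfl⟩
      simp only [Function.comp, id]
      rw [hGW _ (mem_image_of_mem _ hx')]
      exact Φ.right_inv (Φ.map_source (hUs hx'))
    exact (h5.congr_of_eventuallyEq h6.symm).unique (hasFDerivAt_id _)

end LevelChart

end Transport

/-! ### Hausdorff measure and flows in a level chart. -/

namespace Transport

section LevelChartMeasure

variable {E : Type*} [NormedAddCommGroup E] [InnerProductSpace ℝ E] [FiniteDimensional ℝ E]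
  [MeasurableSpace E] [BorelSpace E]

/-- Integration over `E` as an iterated integral over `e^⊥` and `ℝ e`. -/
theorem lintegral_orthogonal_line {e : E} (he : ‖e‖ = 1) {H : E → ℝ≥0∞} (hH : Measurable H) :
    ∫⁻ x, H x = ∫⁻ z : (ℝ ∙ e)ᗮ, ∫⁻ t : ℝ, H (z + t • e) := by
  have h1 := (ℝ ∙ e).measurePreserving_measurableEquivProd (0 : E)
  rw [InnerProductSpace.euclideanHausdorffMeasure_eq_volume] at h1
  have h2 : MeasurePreserving (LinearIsometryEquiv.toSpanUnitSingleton (𝕜 := ℝ) e he) :=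
    LinearIsometryEquiv.measurePreserving _
  rw [← (h1.symm _).lintegral_comp hH]
  have hm : Measurable fun a => H (((ℝ ∙ e).measurableEquivProd 0).symm a) :=
    hH.comp (MeasurableEquiv.measurable _)
  rw [Measure.volume_eq_prod, lintegral_prod_symm _ hm.aemeasurable]
  refine lintegral_congr fun z => ?_
  have h3 : Measurable fun s => H (((ℝ ∙ e).measurableEquivProd 0).symm (s, z)) :=
    hm.comp measurable_prodMk_right
  rw [← h2.lintegral_comp h3]
  refine lintegral_congr fun t => ?_
  simp [add_comm]

variable {f : E → ℝ} {y₀ e : E} {U : Set E} {c : ℝ} {K : ℝ≥0} {G : E → E}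

/-- On the zero set the chart is the orthogonal projection along e, so pieces of the level set are
graphs over e^⊥. -/
theorem straighten_of_mem {e x : E} (h : f x = 0) :
    straighten f e x = x - (inner ℝ e x) • e := by
  simp [straighten, h, sub_eq_add_neg]

/-- The projection to the orthogonal complement of `e`. -/
noncomputable def perpProj (e x : E) : (ℝ ∙ e)ᗮ := (ℝ ∙ e)ᗮ.orthogonalProjectionOnto x

theorem coe_perpProj {e : E} (he : ‖e‖ = 1) (x : E) :
    (perpProj e x : E) = x - (inner ℝ e x) • e := by
  rw [perpProj, ← Submodule.starProjection_apply, Submodule.starProjection_orthogonal_val,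
    Submodule.starProjection_unit_singleton ℝ he]

theorem perpProj_add {e : E} (he : ‖e‖ = 1) (z : (ℝ ∙ e)ᗮ) (t : ℝ) :
    perpProj e (z + t • e) = z ∧ inner ℝ e ((z : E) + t • e) = t := by
  have h : inner ℝ e (z : E) = 0 := Submodule.mem_orthogonal_singleton_iff_inner_right.1 z.2
  have h2 : inner ℝ e ((z : E) + t • e) = t := by
    rw [inner_add_right, h, inner_smul_right, real_inner_self_eq_norm_sq, he]; simp
  refine ⟨Subtype.ext ?_, h2⟩
  rw [coe_perpProj he, h2]; simp

/-- The part of `e^⊥` parametrizing the piece `B` of a level set. -/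
def chartDomain (e : E) (B : Set E) : Set (ℝ ∙ e)ᗮ := perpProj e '' B

namespace LevelChart

variable (hc : LevelChart f y₀ e U c K G) {B : Set E} (hBU : B ⊆ U) (hB0 : ∀ y ∈ B, f y = 0)
include hc hBU hB0

theorem coe_perpProj_eq {y : E} (hy : y ∈ B) : (perpProj e y : E) = straighten f e y := by
  rw [coe_perpProj hc.norm_dir, straighten_of_mem (hB0 y hy)]

theorem coe_perpProj_mem {y : E} (hy : y ∈ B) : (perpProj e y : E) ∈ straighten f e '' U := by
  rw [hc.coe_perpProj_eq hBU hB0 hy]; exact mem_image_of_mem _ (hBU hy)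

theorem chart_perpProj {y : E} (hy : y ∈ B) : G (perpProj e y : E) = y := by
  rw [hc.coe_perpProj_eq hBU hB0 hy, hc.leftInv y (hBU hy)]

/-- Trades an image for preimages under the measurable map G, which is how the chart domain is seen
to be measurable. -/
theorem mem_chartDomain_iff (z : (ℝ ∙ e)ᗮ) :
    z ∈ chartDomain e B ↔ (z : E) ∈ straighten f e '' U ∧ G z ∈ B := by
  constructor
  · rintro ⟨y, hy, rfl⟩
    exact ⟨hc.coe_perpProj_mem hBU hB0 hy, by rwa [hc.chart_perpProj hBU hB0 hy]⟩
  · rintro ⟨⟨x, hx, hxz⟩, h2⟩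
    rw [← hxz, hc.leftInv x hx] at h2
    refine ⟨x, h2, Subtype.ext ?_⟩
    rw [hc.coe_perpProj_eq hBU hB0 h2, hxz]

theorem measurableSet_chartDomain (hB : MeasurableSet B) : MeasurableSet (chartDomain e B) := by
  have : chartDomain e B = (Subtype.val ⁻¹' (straighten f e '' U)) ∩
      ((fun z : (ℝ ∙ e)ᗮ => G z) ⁻¹' B) := by
    ext z; exact hc.mem_chartDomain_iff hBU hB0 z
  rw [this]
  exact (hc.isOpen_image.measurableSet.preimage measurable_subtype_coe).inter
    (hB.preimage (hc.measurable.comp measurable_subtype_coe))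

/-- The inverse of the graph parametrization is an orthogonal projection, which is 1-Lipschitz and
so does not increase Hausdorff measure. Two-sided bounds up to constants are all that is needed, so
no area formula enters. -/
theorem map_chart_le :
    (volume.restrict (chartDomain e B)).map (fun z : (ℝ ∙ e)ᗮ => G z) ≤
      (μHE[Module.finrank ℝ (ℝ ∙ e)ᗮ] : Measure E).restrict B := by
  have hGm : Measurable (fun z : (ℝ ∙ e)ᗮ => G z) := hc.measurable.comp measurable_subtype_coe
  refine Measure.le_iff.2 fun A hA => ?_
  rw [Measure.map_apply hGm hA, Measure.restrict_apply (hGm hA), Measure.restrict_apply hA]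
  have hsub : (fun z : (ℝ ∙ e)ᗮ => G z) ⁻¹' A ∩ chartDomain e B ⊆ perpProj e '' (A ∩ B) := by
    rintro _ ⟨h1, ⟨y, hy, rfl⟩⟩
    rw [mem_preimage, hc.chart_perpProj hBU hB0 hy] at h1
    exact mem_image_of_mem _ ⟨h1, hy⟩
  refine (measure_mono hsub).trans ?_
  rw [← InnerProductSpace.euclideanHausdorffMeasure_eq_volume]
  have hl : LipschitzWith 1 (perpProj e) := by
    refine LipschitzWith.of_dist_le_mul fun x y => ?_
    rw [dist_eq_norm, dist_eq_norm, NNReal.coe_one, one_mul, perpProj, perpProj, ← map_sub]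
    exact ((ℝ ∙ e)ᗮ.orthogonalProjectionOnto.le_of_opNorm_le
      (Submodule.orthogonalProjectionOnto_norm_le _) _).trans (by simp)
  rw [Measure.euclideanHausdorffMeasure_def, Measure.euclideanHausdorffMeasure_def,
    Measure.smul_apply, Measure.smul_apply]
  have := hl.hausdorffMeasure_image_le (d := (Module.finrank ℝ (ℝ ∙ e)ᗮ : ℝ)) (by positivity) (A ∩ B)
  simp only [ENNReal.coe_one, ENNReal.one_rpow, one_mul] at this
  gcongr

/-- The graph parametrization is K-Lipschitz, so it enlarges Hausdorff measure at most by K to the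
dimension. -/
theorem restrict_le_map_chart :
    (μHE[Module.finrank ℝ (ℝ ∙ e)ᗮ] : Measure E).restrict B ≤
      (K : ℝ≥0∞) ^ Module.finrank ℝ (ℝ ∙ e)ᗮ •
        (volume.restrict (chartDomain e B)).map (fun z : (ℝ ∙ e)ᗮ => G z) := by
  have hGm : Measurable (fun z : (ℝ ∙ e)ᗮ => G z) := hc.measurable.comp measurable_subtype_coe
  refine Measure.le_iff.2 fun A hA => ?_
  rw [Measure.smul_apply, Measure.map_apply hGm hA, Measure.restrict_apply (hGm hA),
    Measure.restrict_apply hA, smul_eq_mul]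
  set D := (fun z : (ℝ ∙ e)ᗮ => G z) ⁻¹' A ∩ chartDomain e B
  have hsub : A ∩ B ⊆ (fun z : (ℝ ∙ e)ᗮ => G z) '' D := by
    rintro y ⟨h1, h2⟩
    refine ⟨perpProj e y, ⟨?_, mem_image_of_mem _ h2⟩, hc.chart_perpProj hBU hB0 h2⟩
    rw [mem_preimage, hc.chart_perpProj hBU hB0 h2]; exact h1
  refine (measure_mono hsub).trans ?_
  rw [← InnerProductSpace.euclideanHausdorffMeasure_eq_volume]
  have hl : LipschitzOnWith K (fun z : (ℝ ∙ e)ᗮ => G z) D := by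
    intro z hz z' hz'
    exact hc.lipschitz ((hc.mem_chartDomain_iff hBU hB0 z).1 hz.2).1
      ((hc.mem_chartDomain_iff hBU hB0 z').1 hz'.2).1
  rw [Measure.euclideanHausdorffMeasure_def, Measure.euclideanHausdorffMeasure_def,
    Measure.smul_apply, Measure.smul_apply, mul_smul_comm]
  have := hl.hausdorffMeasure_image_le (d := (Module.finrank ℝ (ℝ ∙ e)ᗮ : ℝ)) (by positivity)
  rw [ENNReal.rpow_natCast] at this
  gcongr

/-- The map `z + t e ↦ G z + t v`, the chart followed by the flow along `v`. -/
theorem lintegral_flow (hB : MeasurableSet B) {v : E}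
    (hinj : ∀ y ∈ B, ∀ y' ∈ B, ∀ t : ℝ, y' = y + t • v → t = 0) {F : E → ℝ≥0∞}
    (hF : Measurable F) :
    ∫⁻ x in {x | ∃ y ∈ B, ∃ t : ℝ, x = y + t • v}, F x =
      ∫⁻ z in chartDomain e B, ENNReal.ofReal |fderiv ℝ f (G z) v / fderiv ℝ f (G z) e| *
        ∫⁻ t : ℝ, F (G z + t • v) := by
  have he := hc.norm_dir
  set π := perpProj e with hπ
  have hπm : Measurable π := (ℝ ∙ e)ᗮ.orthogonalProjectionOnto.continuous.measurable
  set Q : Set E := π ⁻¹' chartDomain e B with hQ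
  have hQm : MeasurableSet Q := (hc.measurableSet_chartDomain hBU hB0 hB).preimage hπm
  set Ψ : E → E := fun q => G (π q) + (inner ℝ e q) • v with hΨ
  have hGB : ∀ z ∈ chartDomain e B, G z ∈ B := fun z hz =>
    ((hc.mem_chartDomain_iff hBU hB0 z).1 hz).2
  have himg : Ψ '' Q = {x | ∃ y ∈ B, ∃ t : ℝ, x = y + t • v} := by
    ext x
    constructor
    · rintro ⟨q, hq, rfl⟩
      exact ⟨_, hGB _ hq, _, rfl⟩
    · rintro ⟨y, hy, t, rfl⟩
      have h := perpProj_add he (perpProj e y) t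
      refine ⟨perpProj e y + t • e, ?_, ?_⟩
      · rw [hQ, mem_preimage, hπ, h.1]; exact mem_image_of_mem _ hy
      · simp only [hΨ, hπ]
        rw [h.1, h.2, hc.chart_perpProj hBU hB0 hy]
  -- If two images coincide, their base points lie on one line in direction v. Each such line meets
  -- B only once, so first the times and then the projections agree.
  have hinjΨ : InjOn Ψ Q := by
    intro q hq q' hq' h
    simp only [hΨ] at h
    have h1 : G (π q') = G (π q) + (inner ℝ e q - inner ℝ e q') • v := by
      rw [sub_smul, ← add_sub_assoc, h, add_sub_cancel_right]
    have h2 := hinj _ (hGB _ hq) _ (hGB _ hq') _ h1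
    rw [h2, zero_smul, add_zero] at h1
    obtain ⟨y, hy, hyq⟩ := hq
    obtain ⟨y', hy', hyq'⟩ := hq'
    have e1 : π q = π q' := by
      rw [← hyq, ← hyq'] at h1 ⊢
      rw [hc.chart_perpProj hBU hB0 hy, hc.chart_perpProj hBU hB0 hy'] at h1
      rw [h1]
    have e2 := congrArg (Subtype.val) e1
    rw [hπ, coe_perpProj he, coe_perpProj he] at e2
    rw [show (inner ℝ e q : ℝ) = inner ℝ e q' by linarith] at e2
    exact sub_left_injective e2
  have hderiv : ∀ q ∈ Q, ∃ L : E →L[ℝ] E, HasFDerivAt Ψ L q ∧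
      L.det = fderiv ℝ f (G (π q)) v / fderiv ℝ f (G (π q)) e := by
    intro q hq
    have hy := hGB _ hq
    set y := G (π q) with hyd
    obtain ⟨G', hG', hcomp⟩ := hc.hasFDerivAt y (hBU hy)
    have hSy : straighten f e y = (π q : E) := by
      obtain ⟨⟨x, hx, hxz⟩, -⟩ := (hc.mem_chartDomain_iff hBU hB0 (π q)).1 hq
      rw [hyd, ← hxz, hc.leftInv x hx]
    rw [hSy] at hG'
    set P : E →L[ℝ] E := ContinuousLinearMap.id ℝ E - (innerSL ℝ e).smulRight e with hP
    have hPd : HasFDerivAt (fun q => (π q : E)) P q := by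
      have : (fun q => (π q : E)) = P := by
        ext1 q; rw [hπ, coe_perpProj he]; simp [hP]
      rw [this]; exact P.hasFDerivAt
    have h1 : HasFDerivAt Ψ (G'.comp P + (innerSL ℝ e).smulRight v) q :=
      (HasFDerivAt.comp q (f := fun q => (π q : E)) hG' hPd).add
        ((innerSL ℝ e).hasFDerivAt.smul_const v)
    refine ⟨_, h1, ?_⟩
    -- Composing with the differential of the straightening cancels G' and leaves a rank one
    -- perturbation of the identity. The Jacobian of Ψ is therefore df(v), divided by the
    -- determinant df(e) of the straightening.
    have h2 : (straightenDeriv f e y).comp (G'.comp P + (innerSL ℝ e).smulRight v) =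
        rankOnePerturb (innerSL ℝ e) (straightenDeriv f e y v - e) := by
      rw [ContinuousLinearMap.comp_add, ← ContinuousLinearMap.comp_assoc, hcomp]
      ext x
      simp [hP, rankOnePerturb, smul_sub]
      abel
    have h3 := congrArg ContinuousLinearMap.det h2
    rw [det_rankOnePerturb, ContinuousLinearMap.det, ContinuousLinearMap.toLinearMap_comp,
      LinearMap.det_comp] at h3
    have h4 : (1 : ℝ) + innerSL ℝ e (straightenDeriv f e y v - e) = fderiv ℝ f y v := by
      simp [straightenDeriv, rankOnePerturb, inner_add_right, inner_sub_right, inner_smul_right, he]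
    rw [h4] at h3
    change (straightenDeriv f e y).det * ContinuousLinearMap.det _ = _ at h3
    rw [det_straightenDeriv he] at h3
    have hpos : 0 < fderiv ℝ f y e := (inv_pos.2 hc.pos).trans_le (hc.le_deriv y (hBU hy))
    rw [eq_div_iff hpos.ne', mul_comm]
    exact h3
  choose! L hL hdet using hderiv
  rw [← himg, lintegral_image_eq_lintegral_abs_det_fderiv_mul volume hQm
    (fun q hq => (hL q hq).hasFDerivWithinAt) hinjΨ]
  have hGm : Measurable (fun z : (ℝ ∙ e)ᗮ => G z) := hc.measurable.comp measurable_subtype_coe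
  have hJm : Measurable fun z : (ℝ ∙ e)ᗮ =>
      ENNReal.ofReal |fderiv ℝ f (G z) v / fderiv ℝ f (G z) e| := by
    have := ((measurable_fderiv_apply_const ℝ f v).comp hGm).div
      ((measurable_fderiv_apply_const ℝ f e).comp hGm)
    exact (measurable_norm.comp this).ennreal_ofReal
  rw [setLIntegral_congr_fun hQm (g := fun q =>
    ENNReal.ofReal |fderiv ℝ f (G (π q)) v / fderiv ℝ f (G (π q)) e| *
      F (G (π q) + (inner ℝ e q) • v)) (fun q hq => by rw [hdet q hq]),
    ← lintegral_indicator hQm, lintegral_orthogonal_line he,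
    ← lintegral_indicator (hc.measurableSet_chartDomain hBU hB0 hB)]
  · refine lintegral_congr fun z => ?_
    by_cases hz : z ∈ chartDomain e B
    · rw [indicator_of_mem hz, ← lintegral_const_mul]
      · refine lintegral_congr fun t => ?_
        have h := perpProj_add he z t
        rw [indicator_of_mem, hπ, h.1, h.2]
        rw [hQ, mem_preimage, hπ, h.1]; exact hz
      · exact hF.comp (by fun_prop)
    · rw [indicator_of_notMem hz]
      refine (lintegral_congr fun t => ?_).trans lintegral_zero
      rw [indicator_of_notMem]
      rw [hQ, mem_preimage, hπ, (perpProj_add he z t).1]; exact hz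
  · refine Measurable.indicator ?_ hQm
    refine (hJm.comp hπm).mul (hF.comp ?_)
    exact (hGm.comp hπm).add (by fun_prop)

end LevelChart

end LevelChartMeasure

end Transport

/-! ### Flux through a level set versus the volume of the swept tube. -/

namespace Transport

section LevelChartMeasure

variable {E : Type*} [NormedAddCommGroup E] [InnerProductSpace ℝ E] [FiniteDimensional ℝ E]
  [MeasurableSpace E] [BorelSpace E]

theorem finrank_orthogonal_line {e : E} (he : ‖e‖ = 1) :
    Module.finrank ℝ (ℝ ∙ e)ᗮ = Module.finrank ℝ E - 1 := by
  have h := Submodule.finrank_add_finrank_orthogonal (𝕜 := ℝ) (ℝ ∙ e)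
  rw [finrank_span_singleton (by rintro rfl; simp at he)] at h
  omega

/-- The set swept by the lines in direction `v` through the points of `B`. -/
def tube (B : Set E) (v : E) : Set E := {x | ∃ y ∈ B, ∃ t : ℝ, x = y + t • v}

/-- The integral of `F` over the lines in direction `v` through the points of `B`, with respect to
the flux measure `|∇f · v| dμ`. -/
noncomputable def flux (f : E → ℝ) (B : Set E) (v : E) (F : E → ℝ≥0∞) : ℝ≥0∞ :=
  ∫⁻ y, ENNReal.ofReal |fderiv ℝ f y v| * (∫⁻ t : ℝ, F (y + t • v))
    ∂((μHE[Module.finrank ℝ E - 1] : Measure E).restrict B)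

/-- `C` bounds the flux integrals over pieces of `A` by the volume integrals over tubes and
conversely. -/
def FluxBound (f : E → ℝ) (A : Set E) (C : ℝ≥0) : Prop :=
  ∀ (v : E) (B : Set E), B ⊆ A → MeasurableSet B →
    (∀ y ∈ B, ∀ y' ∈ B, ∀ t : ℝ, y' = y + t • v → t = 0) →
    ∀ F : E → ℝ≥0∞, Measurable F →
      flux f B v F ≤ C * ∫⁻ x in tube B v, F x ∧ ∫⁻ x in tube B v, F x ≤ C * flux f B v F

variable {f : E → ℝ} {y₀ e : E} {U : Set E} {c : ℝ} {K : ℝ≥0} {G : E → E}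

namespace LevelChart

variable (hc : LevelChart f y₀ e U c K G)
include hc

theorem abs_deriv_le {y : E} (hy : y ∈ U) (v : E) :
    |fderiv ℝ f y v| ≤ c * |fderiv ℝ f y v / fderiv ℝ f y e| ∧
    |fderiv ℝ f y v / fderiv ℝ f y e| ≤ c * |fderiv ℝ f y v| := by
  have h1 := hc.le_deriv y hy
  have h2 := hc.deriv_le y hy
  have hc0 := hc.pos
  have hpos : 0 < fderiv ℝ f y e := (inv_pos.2 hc0).trans_le h1
  rw [abs_div, abs_of_pos hpos]
  constructor
  · rw [← mul_div_assoc, le_div_iff₀ hpos, mul_comm]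
    gcongr
  · rw [div_le_iff₀ hpos]
    have : 1 ≤ c * fderiv ℝ f y e := by
      calc (1 : ℝ) = c * c⁻¹ := (mul_inv_cancel₀ hc0.ne').symm
        _ ≤ _ := by gcongr
    nlinarith [abs_nonneg (fderiv ℝ f y v)]

theorem measurable_flux (v : E) {F : E → ℝ≥0∞} (hF : Measurable F) :
    Measurable fun y => ENNReal.ofReal |fderiv ℝ f y v| * ∫⁻ t : ℝ, F (y + t • v) := by
  refine (measurable_norm.comp (measurable_fderiv_apply_const ℝ f v)).ennreal_ofReal.mul ?_
  refine Measurable.lintegral_prod_right' (f := fun p : E × ℝ => F (p.1 + p.2 • v)) ?_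
  exact hF.comp (by fun_prop)

variable {B : Set E} (hBU : B ⊆ U) (hB0 : ∀ y ∈ B, f y = 0)
include hBU hB0

/-- The Jacobian of the flow map is df(v)/df(e), where df(e) is pinched between 1/c and c; the
Lipschitz bound on the chart contributes the power of K. The constant does not depend on v. -/
theorem lintegral_flux_le (hB : MeasurableSet B) {v : E}
    (hinj : ∀ y ∈ B, ∀ y' ∈ B, ∀ t : ℝ, y' = y + t • v → t = 0) {F : E → ℝ≥0∞}
    (hF : Measurable F) :
    flux f B v F ≤
      (K : ℝ≥0∞) ^ (Module.finrank ℝ E - 1) * ENNReal.ofReal c *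
        ∫⁻ x in tube B v, F x := by
  have hGm : Measurable (fun z : (ℝ ∙ e)ᗮ => G z) := hc.measurable.comp measurable_subtype_coe
  rw [flux, ← finrank_orthogonal_line hc.norm_dir, tube, hc.lintegral_flow hBU hB0 hB hinj hF]
  refine (lintegral_mono' (hc.restrict_le_map_chart hBU hB0) le_rfl).trans ?_
  rw [lintegral_smul_measure, lintegral_map (measurable_flux hc v hF) hGm, smul_eq_mul, mul_assoc]
  gcongr
  rw [← lintegral_const_mul' _ _ ENNReal.ofReal_ne_top]
  refine setLIntegral_mono' (hc.measurableSet_chartDomain hBU hB0 hB) fun z hz => ?_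
  rw [← mul_assoc, ← ENNReal.ofReal_mul hc.pos.le]
  gcongr
  exact (hc.abs_deriv_le (hBU ((hc.mem_chartDomain_iff hBU hB0 z).1 hz).2) v).1

/-- Here the chart enters through the 1-Lipschitz projection only, so no power of K appears. -/
theorem lintegral_le_flux (hB : MeasurableSet B) {v : E}
    (hinj : ∀ y ∈ B, ∀ y' ∈ B, ∀ t : ℝ, y' = y + t • v → t = 0) {F : E → ℝ≥0∞}
    (hF : Measurable F) :
    ∫⁻ x in tube B v, F x ≤ ENNReal.ofReal c * flux f B v F := by
  have hGm : Measurable (fun z : (ℝ ∙ e)ᗮ => G z) := hc.measurable.comp measurable_subtype_coe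
  rw [flux, ← finrank_orthogonal_line hc.norm_dir, tube, hc.lintegral_flow hBU hB0 hB hinj hF]
  refine le_trans ?_ (mul_le_mul_right (lintegral_mono' (hc.map_chart_le hBU hB0) le_rfl) _)
  rw [lintegral_map (measurable_flux hc v hF) hGm,
    ← lintegral_const_mul' _ _ ENNReal.ofReal_ne_top]
  refine setLIntegral_mono' (hc.measurableSet_chartDomain hBU hB0 hB) fun z hz => ?_
  rw [← mul_assoc, ← ENNReal.ofReal_mul hc.pos.le]
  gcongr
  exact (hc.abs_deriv_le (hBU ((hc.mem_chartDomain_iff hBU hB0 z).1 hz).2) v).2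

/-- The projection of a bounded piece is bounded, hence of finite Lebesgue measure, and the chart
distorts measure by a finite factor. -/
theorem measure_lt_top : (μHE[Module.finrank ℝ E - 1] : Measure E) B < ⊤ := by
  rw [← finrank_orthogonal_line hc.norm_dir]
  have h := hc.restrict_le_map_chart hBU hB0 univ
  have hGm : Measurable (fun z : (ℝ ∙ e)ᗮ => G z) := hc.measurable.comp measurable_subtype_coe
  rw [Measure.restrict_apply_univ, Measure.smul_apply, Measure.map_apply hGm MeasurableSet.univ,
    preimage_univ, Measure.restrict_apply_univ, smul_eq_mul] at h
  refine h.trans_lt (ENNReal.mul_lt_top (by finiteness) ?_)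
  have : Bornology.IsBounded (chartDomain e B) :=
    ((ℝ ∙ e)ᗮ.orthogonalProjectionOnto.lipschitz.isBounded_image (hc.isBounded.subset hBU))
  exact this.measure_lt_top

end LevelChart

/-- A relatively open piece of the level set projects onto a nonempty open subset of e^⊥, and
projecting does not increase the measure. This is what makes the surface measure on a velocity
hypersurface charge open sets. -/
theorem LevelChart.measure_pos (hc : LevelChart f y₀ e U c K G) (h0 : f y₀ = 0) {O : Set E}
    (hO : IsOpen O) (hy : y₀ ∈ O) :
    0 < (μHE[Module.finrank ℝ E - 1] : Measure E) (O ∩ {y | f y = 0}) := by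
  set B := U ∩ O ∩ {y | f y = 0} with hB
  have hBU : B ⊆ U := fun y hy => hy.1.1
  have hB0 : ∀ y ∈ B, f y = 0 := fun y hy => hy.2
  have he := hc.norm_dir
  have hGc : ContinuousOn G (straighten f e '' U) := hc.lipschitz.continuousOn
  have hopen : IsOpen (chartDomain e B) := by
    have : chartDomain e B =
        (fun z : (ℝ ∙ e)ᗮ => (z : E)) ⁻¹' (straighten f e '' U ∩ G ⁻¹' O) := by
      ext z
      rw [hc.mem_chartDomain_iff hBU hB0, mem_preimage]
      constructor
      · rintro ⟨h1, h2⟩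
        exact ⟨h1, h2.1.2⟩
      · rintro ⟨⟨x, hx, hxz⟩, h2⟩
        refine ⟨⟨x, hx, hxz⟩, ?_⟩
        rw [mem_preimage, ← hxz, hc.leftInv x hx] at h2
        rw [← hxz, hc.leftInv x hx]
        refine ⟨⟨hx, h2⟩, ?_⟩
        -- The e-component of the straightened point equals f x, so orthogonality of z to e puts x
        -- on the zero set.
        have h3 : inner ℝ e (z : E) = 0 := Submodule.mem_orthogonal_singleton_iff_inner_right.1 z.2
        rw [← hxz, straighten, inner_add_right, inner_smul_right, real_inner_self_eq_norm_sq,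
          he] at h3
        simpa using h3
    rw [this]
    exact (hGc.isOpen_inter_preimage hc.isOpen_image hO).preimage continuous_subtype_val
  have hne : (chartDomain e B).Nonempty :=
    ⟨_, mem_image_of_mem _ (⟨⟨hc.mem, hy⟩, h0⟩ : y₀ ∈ B)⟩
  have hGm : Measurable (fun z : (ℝ ∙ e)ᗮ => G z) := hc.measurable.comp measurable_subtype_coe
  have h := hc.map_chart_le hBU hB0 univ
  rw [Measure.restrict_apply_univ, Measure.map_apply hGm MeasurableSet.univ,
    preimage_univ, Measure.restrict_apply_univ] at h
  rw [← finrank_orthogonal_line he]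
  exact ((hopen.measure_pos _ hne).trans_le h).trans_le
    (measure_mono fun y hy => ⟨hy.1.2, hy.2⟩)

/-- The `(dim - 1)`-dimensional measure of a compact set which is locally contained in a regular
level set is finite. -/
theorem measure_lt_top_of_locally_level {S : Set E} (hS : IsCompact S)
    (h : ∀ v ∈ S, ∃ f : E → ℝ, ContDiffAt ℝ 1 f v ∧ fderiv ℝ f v ≠ 0 ∧
      ∀ᶠ w in 𝓝 v, (w ∈ S → f w = 0)) :
    (μHE[Module.finrank ℝ E - 1] : Measure E) S < ⊤ := by
  refine hS.measure_lt_top_of_nhdsWithin fun v hv => ?_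
  obtain ⟨f, hf, hd, hev⟩ := h v hv
  obtain ⟨e, U, c, K, G, hc⟩ := exists_levelChart hf hd
  have hU : U ∩ {w | w ∈ S → f w = 0} ∈ 𝓝 v := inter_mem (hc.isOpen.mem_nhds hc.mem) hev
  refine ⟨U ∩ {w | w ∈ S → f w = 0} ∩ S, inter_mem (nhdsWithin_le_nhds hU) self_mem_nhdsWithin, ?_⟩
  exact hc.measure_lt_top (fun y hy => hy.1.1) fun y hy => hy.1.2 hy.2

theorem FluxBound.mono {f : E → ℝ} {A A' : Set E} {C : ℝ≥0} (h : FluxBound f A C) (hA : A' ⊆ A) :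
    FluxBound f A' C := fun v B hB => h v B (hB.trans hA)

theorem flux_mono {f : E → ℝ} {B B' : Set E} (h : B ⊆ B') (v : E) (F : E → ℝ≥0∞) :
    flux f B v F ≤ flux f B' v F := lintegral_mono' (Measure.restrict_mono_set _ h) le_rfl

theorem tube_mono {B B' : Set E} (h : B ⊆ B') (v : E) : tube B v ⊆ tube B' v :=
  fun _ ⟨y, hy, t, ht⟩ => ⟨y, h hy, t, ht⟩

/-- Cutting B along A splits the flux additively, while both partial tubes lie in the whole tube and
together cover it. Disjointness of the tubes is not needed, because the constants add. -/
theorem FluxBound.union {f : E → ℝ} {A A' : Set E} {C C' : ℝ≥0} (h : FluxBound f A C)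
    (hA : MeasurableSet A) (h' : FluxBound f A' C') : FluxBound f (A ∪ A') (C + C') := by
  intro v B hB hBm hinj F hF
  have h1 := h v (B ∩ A) inter_subset_right (hBm.inter hA)
    (fun y hy y' hy' => hinj y hy.1 y' hy'.1) F hF
  have h2 := h' v (B \ A) (fun y hy => (hB hy.1).resolve_left hy.2) (hBm.diff hA)
    (fun y hy y' hy' => hinj y hy.1 y' hy'.1) F hF
  have hflux : flux f B v F = flux f (B ∩ A) v F + flux f (B \ A) v F := by
    unfold flux
    exact (lintegral_inter_add_sdiff _ B hA).symm
  constructor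
  · rw [hflux, ENNReal.coe_add, add_mul]
    refine add_le_add (h1.1.trans ?_) (h2.1.trans ?_)
    · exact mul_le_mul_right (lintegral_mono_set (tube_mono inter_subset_left v)) _
    · exact mul_le_mul_right (lintegral_mono_set (tube_mono sdiff_subset v)) _
  · have htube : tube B v ⊆ tube (B ∩ A) v ∪ tube (B \ A) v := by
      rintro x ⟨y, hy, t, ht⟩
      by_cases hyA : y ∈ A
      · exact Or.inl ⟨y, ⟨hy, hyA⟩, t, ht⟩
      · exact Or.inr ⟨y, ⟨hy, hyA⟩, t, ht⟩
    refine (lintegral_mono_set htube).trans ((lintegral_union_le _ _ _).trans ?_)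
    rw [ENNReal.coe_add, add_mul]
    refine add_le_add (h1.2.trans ?_) (h2.2.trans ?_)
    · exact mul_le_mul_right (flux_mono inter_subset_left v F) _
    · exact mul_le_mul_right (flux_mono sdiff_subset v F) _

/-- Comparison of the flux measure on a compact regular level set, in direction `v`, with the volume
of the tube it sweeps. -/
theorem exists_fluxBound {f : E → ℝ} (hf : ContDiff ℝ 1 f) {S : Set E} (hS : IsCompact S)
    (h0 : ∀ y ∈ S, f y = 0) (hreg : ∀ y ∈ S, fderiv ℝ f y ≠ 0) :
    ∃ C : ℝ≥0, FluxBound f S C := by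
  -- The induction over compact pieces runs through arbitrary subsets, so the bound is carried by a
  -- measurable set containing each of them.
  have key : ∃ A, S ⊆ A ∧ MeasurableSet A ∧ ∃ C : ℝ≥0, FluxBound f A C := by
    refine hS.induction_on (p := fun S => ∃ A, S ⊆ A ∧ MeasurableSet A ∧
      ∃ C : ℝ≥0, FluxBound f A C) ?_ ?_ ?_ ?_
    · refine ⟨∅, Subset.rfl, MeasurableSet.empty, 0, fun v B hB _ _ F _ => ?_⟩
      obtain rfl := subset_empty_iff.1 hB
      simp [flux, tube]
    · rintro s t hst ⟨A, h1, h2⟩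
      exact ⟨A, hst.trans h1, h2⟩
    · rintro s t ⟨A, h1, h2, C, h3⟩ ⟨A', h1', h2', C', h3'⟩
      exact ⟨A ∪ A', union_subset_union h1 h1', h2.union h2', _, h3.union h2 h3'⟩
    · intro y hy
      obtain ⟨e, U, c, K, G, hc⟩ := exists_levelChart hf.contDiffAt (hreg y hy)
      have hm : MeasurableSet (U ∩ S) := hc.isOpen.measurableSet.inter hS.measurableSet
      refine ⟨U ∩ S, inter_mem (nhdsWithin_le_nhds (hc.isOpen.mem_nhds hc.mem))
        self_mem_nhdsWithin, U ∩ S, Subset.rfl, hm,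
        max (K ^ (Module.finrank ℝ E - 1) * c.toNNReal) c.toNNReal, ?_⟩
      intro v B hB hBm hinj F hF
      have hBU : B ⊆ U := hB.trans inter_subset_left
      have hB0 : ∀ y ∈ B, f y = 0 := fun y hy => h0 y (hB hy).2
      constructor
      · refine (hc.lintegral_flux_le hBU hB0 hBm hinj hF).trans ?_
        refine mul_le_mul_left ?_ _
        have := le_max_left (K ^ (Module.finrank ℝ E - 1) * c.toNNReal) c.toNNReal
        change (K : ℝ≥0∞) ^ (Module.finrank ℝ E - 1) * ((c.toNNReal : ℝ≥0) : ℝ≥0∞) ≤ _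
        exact_mod_cast this
      · refine (hc.lintegral_le_flux hBU hB0 hBm hinj hF).trans ?_
        refine mul_le_mul_left ?_ _
        have := le_max_right (K ^ (Module.finrank ℝ E - 1) * c.toNNReal) c.toNNReal
        change ((c.toNNReal : ℝ≥0) : ℝ≥0∞) ≤ _
        exact_mod_cast this
  obtain ⟨A, hA, -, C, hC⟩ := key
  exact ⟨C, hC.mono hA⟩

end LevelChartMeasure

end Transport

/-! ### Convexity of the profile and of its sublevel sets. -/

namespace Transport

variable {d : ℕ} {ρ : Space d → ℝ}

namespace IsConvexProfile

variable (hρ : IsConvexProfile ρ)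
include hρ

theorem continuous : Continuous ρ := hρ.contDiff.continuous

theorem differentiable : Differentiable ℝ ρ := hρ.contDiff.differentiable two_ne_zero

theorem continuous_fderiv : Continuous (fderiv ℝ ρ) := hρ.contDiff.continuous_fderiv two_ne_zero

theorem continuous_fderiv_apply : Continuous fun z : Space d × Space d => fderiv ℝ ρ z.1 z.2 :=
  (hρ.continuous_fderiv.comp continuous_fst).clm_apply continuous_snd

theorem hasDerivAt_line (x v : Space d) (t : ℝ) :
    HasDerivAt (fun t : ℝ => ρ (x + t • v)) (fderiv ℝ ρ (x + t • v) v) t := by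
  have h1 : HasDerivAt (fun t : ℝ => x + t • v) v t := by
    simpa using ((hasDerivAt_id t).smul_const v).const_add x
  exact (hρ.differentiable _).hasFDerivAt.comp_hasDerivAt t h1

theorem hasDerivAt_line_deriv (x v : Space d) (t : ℝ) :
    HasDerivAt (fun t : ℝ => fderiv ℝ ρ (x + t • v) v)
      (iteratedFDeriv ℝ 2 ρ (x + t • v) ![v, v]) t := by
  have h1 : HasDerivAt (fun t : ℝ => x + t • v) v t := by
    simpa using ((hasDerivAt_id t).smul_const v).const_add x
  have h2 : HasFDerivAt (fderiv ℝ ρ) (fderiv ℝ (fderiv ℝ ρ) (x + t • v)) (x + t • v) :=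
    ((hρ.contDiff.fderiv_right (m := 1) (by norm_num)).differentiable one_ne_zero _).hasFDerivAt
  have h3 : HasDerivAt (fun t : ℝ => fderiv ℝ ρ (x + t • v))
      (fderiv ℝ (fderiv ℝ ρ) (x + t • v) v) t := h2.comp_hasDerivAt t h1
  have h4 := h3.clm_apply (hasDerivAt_const t v)
  rw [iteratedFDeriv_two_apply]
  simp only [map_zero, add_zero] at h4
  exact h4

/-- The Hessian is positive off the origin, and a line meets the origin at most at one parameter.
Monotonicity on the two closed half-lines is glued there. -/
theorem strictMono_line_deriv (x : Space d) {v : Space d} (hv : v ≠ 0) :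
    StrictMono fun t : ℝ => fderiv ℝ ρ (x + t • v) v := by
  have hcont : Continuous fun t : ℝ => fderiv ℝ ρ (x + t • v) v :=
    continuous_iff_continuousAt.2 fun t => (hρ.hasDerivAt_line_deriv x v t).continuousAt
  by_cases h : ∃ t₀ : ℝ, x + t₀ • v = 0
  · obtain ⟨t₀, ht₀⟩ := h
    have hne : ∀ t, t ≠ t₀ → 0 < deriv (fun t : ℝ => fderiv ℝ ρ (x + t • v) v) t := by
      intro t ht
      rw [(hρ.hasDerivAt_line_deriv x v t).deriv]
      refine hρ.hess_pos _ (fun h0 => ht ?_) v hv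
      have : (t - t₀) • v = 0 := by rw [sub_smul, ← add_sub_add_left_eq_sub _ _ x, h0, ht₀, sub_zero]
      exact sub_eq_zero.1 ((smul_eq_zero.1 this).resolve_right hv)
    refine StrictMonoOn.Iic_union_Ici (a := t₀) ?_ ?_
    · refine strictMonoOn_of_deriv_pos (convex_Iic _) hcont.continuousOn fun t ht => hne t ?_
      rw [interior_Iic] at ht; exact ht.ne
    · refine strictMonoOn_of_deriv_pos (convex_Ici _) hcont.continuousOn fun t ht => hne t ?_
      rw [interior_Ici] at ht; exact ht.ne'
  · push Not at h
    refine strictMono_of_deriv_pos fun t => ?_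
    rw [(hρ.hasDerivAt_line_deriv x v t).deriv]
    exact hρ.hess_pos _ (h t) v hv

/-- The mean value theorem and the strict monotonicity of the derivative along the line. Nearly all
later uses of convexity go through this tangent inequality, strict or not. -/
theorem first_order_lt {x y : Space d} (h : x ≠ y) : ρ x + fderiv ℝ ρ x (y - x) < ρ y := by
  have hv : y - x ≠ 0 := sub_ne_zero.2 h.symm
  obtain ⟨c, hc, h1⟩ := exists_hasDerivAt_eq_slope (fun t : ℝ => ρ (x + t • (y - x)))
    (fun t => fderiv ℝ ρ (x + t • (y - x)) (y - x)) zero_lt_one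
    (fun t _ => (hρ.hasDerivAt_line x (y - x) t).continuousAt.continuousWithinAt)
    (fun t _ => hρ.hasDerivAt_line x (y - x) t)
  have h2 := hρ.strictMono_line_deriv x hv hc.1
  simp only [zero_smul, add_zero, one_smul, sub_zero, div_one, add_sub_cancel] at h1 h2
  linarith

theorem first_order_le (x y : Space d) : ρ x + fderiv ℝ ρ x (y - x) ≤ ρ y := by
  rcases eq_or_ne x y with rfl | h
  · simp
  · exact (hρ.first_order_lt h).le

theorem strictConvexOn : StrictConvexOn ℝ univ ρ := by
  refine ⟨convex_univ, fun x _ y _ hxy a b ha hb hab => ?_⟩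
  set z := a • x + b • y with hz
  obtain rfl : a = 1 - b := eq_sub_iff_add_eq.2 hab
  have hxz : x - z = b • (x - y) := by rw [hz]; module
  have hyz : y - z = (b - 1) • (x - y) := by rw [hz]; module
  have hne := sub_ne_zero.2 hxy
  have h1 := hρ.first_order_lt (x := z) (y := x)
    (by intro h; rw [h, sub_self] at hxz; exact (smul_ne_zero hb.ne' hne) hxz.symm)
  have h2 := hρ.first_order_le z y
  rw [hxz, map_smul, smul_eq_mul] at h1
  rw [hyz, map_smul, smul_eq_mul] at h2
  have h1' := mul_lt_mul_of_pos_left h1 ha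
  have h2' := mul_le_mul_of_nonneg_left h2 hb.le
  simp only [smul_eq_mul]
  nlinarith

theorem neg_one_lt {x : Space d} (hx : x ≠ 0) : -1 < ρ x := by
  have := hρ.first_order_lt hx.symm
  rwa [hρ.grad_zero, hρ.value_zero, zero_apply, add_zero] at this

theorem neg_one_le (x : Space d) : -1 ≤ ρ x := by
  rcases eq_or_ne x 0 with rfl | h
  · exact hρ.value_zero.ge
  · exact (hρ.neg_one_lt h).le

theorem ne_zero_of_neg_one_lt {x : Space d} (hx : -1 < ρ x) : x ≠ 0 := by
  rintro rfl
  rw [hρ.value_zero] at hx; exact lt_irrefl _ hx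

/-- The tangent inequality at x, evaluated at the minimum point 0. It shows that all levels above -1
are regular. -/
theorem fderiv_self_pos {x : Space d} (hx : -1 < ρ x) : 0 < fderiv ℝ ρ x x := by
  have h := hρ.first_order_le x 0
  rw [zero_sub, map_neg, hρ.value_zero] at h
  linarith

theorem fderiv_ne_zero {x : Space d} (hx : -1 < ρ x) : fderiv ℝ ρ x ≠ 0 := by
  intro h
  have := hρ.fderiv_self_pos hx
  rw [h] at this
  exact lt_irrefl _ this

/-- Since ρ is bounded below by -1, growth of |ρ| is growth of ρ. The maximum with 1 absorbs the
values of ρ in [-1, 0]. -/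
theorem isCompact_le (s : ℝ) : IsCompact {x | ρ x ≤ s} := by
  have h := hρ.tendsto_abs.eventually_gt_atTop (max s 1)
  obtain ⟨K, hK, hKs⟩ := mem_cocompact.1 h
  refine hK.of_isClosed_subset (isClosed_le hρ.continuous continuous_const) fun x hx => ?_
  by_contra hxK
  have h1 : max s 1 < |ρ x| := hKs hxK
  have h2 : |ρ x| ≤ max s 1 := by
    rw [abs_le]
    refine ⟨?_, hx.trans (le_max_left _ _)⟩
    have := hρ.neg_one_le x
    have := le_max_right s 1
    linarith
  exact absurd h1 h2.not_gt

theorem isCompact_level (s : ℝ) : IsCompact {x | ρ x = s} :=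
  (hρ.isCompact_le s).of_isClosed_subset (isClosed_eq hρ.continuous continuous_const)
    fun x hx => le_of_eq (show ρ x = s from hx)

theorem isOpen_sublevel (s : ℝ) : IsOpen (sublevel ρ s) := isOpen_lt hρ.continuous continuous_const

theorem isBounded_sublevel (s : ℝ) : Bornology.IsBounded (sublevel ρ s) :=
  (hρ.isCompact_le s).isBounded.subset fun x hx => le_of_lt (show ρ x < s from hx)

theorem convex_sublevel (s : ℝ) : Convex ℝ (sublevel ρ s) := by
  simpa [sublevel] using hρ.strictConvexOn.convexOn.convex_lt s

/-- A point of the level set is approached by shrinking it towards 0, where ρ = -1 < s: strict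
convexity makes ρ smaller than s on the open segment. -/
theorem closure_sublevel {s : ℝ} (hs : -1 < s) : closure (sublevel ρ s) = {x | ρ x ≤ s} := by
  refine Subset.antisymm (closure_minimal (fun x hx => le_of_lt (show ρ x < s from hx))
    (isClosed_le hρ.continuous continuous_const)) fun x hx => ?_
  rcases lt_or_eq_of_le (show ρ x ≤ s from hx) with h | h
  · exact subset_closure h
  have h0 : x ≠ 0 := hρ.ne_zero_of_neg_one_lt (h ▸ hs)
  have hlim : Tendsto (fun t : ℝ => (1 - t) • x) (𝓝[>] 0) (𝓝 x) := by
    have : Continuous fun t : ℝ => (1 - t) • x := by fun_prop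
    have h2 := this.tendsto 0
    simp only [sub_zero, one_smul] at h2
    exact h2.mono_left nhdsWithin_le_nhds
  refine mem_closure_of_tendsto hlim ?_
  filter_upwards [Ioo_mem_nhdsGT (zero_lt_one (α := ℝ))] with t ht
  have h3 := hρ.strictConvexOn.2 (mem_univ x) (mem_univ 0) h0 (sub_pos.2 ht.2) ht.1 (by ring)
  rw [smul_zero, add_zero, hρ.value_zero, h] at h3
  simp only [smul_eq_mul] at h3
  change ρ ((1 - t) • x) < s
  nlinarith [ht.1, ht.2]

theorem frontier_sublevel {s : ℝ} (hs : -1 < s) : frontier (sublevel ρ s) = {x | ρ x = s} := by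
  rw [frontier, hρ.closure_sublevel hs, (hρ.isOpen_sublevel s).interior_eq]
  ext x
  simp only [sublevel, Set.mem_sdiff, mem_ofPred_eq, not_lt]
  exact ⟨fun h => le_antisymm h.1 h.2, fun h => ⟨h.le, h.ge⟩⟩

theorem shell_eq : shell ρ = {x | 0 < ρ x ∧ ρ x < 1} := by
  rw [shell, hρ.closure_sublevel (by norm_num)]
  ext x
  simp only [sublevel, Set.mem_sdiff, mem_ofPred_eq, not_le]
  exact and_comm

theorem isOpen_shell : IsOpen (shell ρ) := by
  rw [hρ.shell_eq]
  exact (isOpen_lt continuous_const hρ.continuous).inter (isOpen_lt hρ.continuous continuous_const)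

theorem volume_level {s : ℝ} (hs : -1 < s) : volume {x | ρ x = s} = 0 := by
  rw [← hρ.frontier_sublevel hs]
  exact (hρ.convex_sublevel s).addHaar_frontier volume

/-- Uniform convexity of `ρ` on `{ρ ≤ 1}`. -/
theorem uniform_convexity {δ : ℝ} (hδ : 0 < δ) : ∃ η > 0, ∀ x y, ρ x ≤ 1 → ρ y ≤ 1 → δ ≤ dist x y →
    ρ (midpoint ℝ x y) + η ≤ (ρ x + ρ y) / 2 := by
  -- The convexity gap at midpoints is continuous and positive on this compact set of separated
  -- pairs; η is its minimum.
  set A : Set (Space d × Space d) := ({x | ρ x ≤ 1} ×ˢ {x | ρ x ≤ 1}) ∩ {z | δ ≤ dist z.1 z.2}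
  have hA : IsCompact A := ((hρ.isCompact_le 1).prod (hρ.isCompact_le 1)).inter_right
    (isClosed_le continuous_const continuous_dist)
  set q : Space d × Space d → ℝ := fun z => (ρ z.1 + ρ z.2) / 2 - ρ (midpoint ℝ z.1 z.2)
  have hq : Continuous q := by
    have := hρ.continuous
    have h2 : Continuous fun z : Space d × Space d => midpoint ℝ z.1 z.2 := by
      simp only [midpoint_eq_smul_add]; fun_prop
    fun_prop
  rcases A.eq_empty_or_nonempty with h | h
  · refine ⟨1, one_pos, fun x y hx hy hxy => ?_⟩
    have : (x, y) ∈ A := ⟨⟨hx, hy⟩, hxy⟩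
    rw [h] at this; exact this.elim
  · obtain ⟨z, hz, hmin⟩ := hA.exists_isMinOn h hq.continuousOn
    have hne : z.1 ≠ z.2 := by
      intro h
      have := hz.2
      simp only [mem_ofPred_eq, h, dist_self] at this
      linarith
    refine ⟨q z, ?_, fun x y hx hy hxy => ?_⟩
    · have := hρ.strictConvexOn.2 (mem_univ z.1) (mem_univ z.2) hne
        (half_pos one_pos) (half_pos one_pos) (add_halves (1 : ℝ))
      simp only [q, midpoint_eq_smul_add, smul_add, smul_eq_mul] at this ⊢
      simp only [one_div, invOf_eq_inv] at this ⊢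
      linarith
    · have h2 : q z ≤ q (x, y) := hmin (show (x, y) ∈ A from ⟨⟨hx, hy⟩, hxy⟩)
      simp only [q] at h2 ⊢
      linarith

/-- The intersection of a line with a sublevel set. -/
theorem exists_line_interval {s : ℝ} {x v : Space d} (hv : v ≠ 0)
    (hit : ∃ t : ℝ, ρ (x + t • v) < s) :
    ∃ a b : ℝ, a < b ∧ {t : ℝ | ρ (x + t • v) < s} = Ioo a b ∧
      ρ (x + a • v) = s ∧ ρ (x + b • v) = s ∧
      fderiv ℝ ρ (x + a • v) v < 0 ∧ 0 < fderiv ℝ ρ (x + b • v) v := by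
  set S : Set ℝ := {t : ℝ | ρ (x + t • v) < s} with hS
  have hcont : Continuous fun t : ℝ => ρ (x + t • v) := hρ.continuous.comp (by fun_prop)
  have hopen : IsOpen S := isOpen_lt hcont continuous_const
  have hne : S.Nonempty := hit
  have hconv : Convex ℝ S := by
    have : S = (AffineMap.lineMap x (x + v) : ℝ →ᵃ[ℝ] Space d) ⁻¹' sublevel ρ s := by
      ext t; simp [hS, sublevel, AffineMap.lineMap_apply, add_comm]
    rw [this]
    exact (hρ.convex_sublevel s).affine_preimage _
  have hbdd : Bornology.IsBounded S := by
    obtain ⟨R, hR⟩ := (hρ.isBounded_sublevel s).exists_norm_le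
    have hv' := norm_pos_iff.2 hv
    refine isBounded_iff_forall_norm_le.2 ⟨(R + ‖x‖) / ‖v‖, fun t ht => ?_⟩
    rw [le_div_iff₀ hv', ← norm_smul]
    have h1 := hR _ (show x + t • v ∈ sublevel ρ s from ht)
    calc ‖t • v‖ = ‖(x + t • v) - x‖ := by rw [add_sub_cancel_left]
      _ ≤ _ := (norm_sub_le _ _).trans (by linarith)
  have hbb := hbdd.bddBelow
  have hba := hbdd.bddAbove
  have ha : sInf S ∉ S := fun h => by
    obtain ⟨u, hu, hus⟩ := (mem_nhdsLT_iff_exists_Ioo_subset.1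
      (nhdsWithin_le_nhds (hopen.mem_nhds h) : S ∈ 𝓝[<] (sInf S)))
    obtain ⟨w, hw⟩ := exists_between (show u < sInf S from hu)
    exact absurd (csInf_le hbb (hus hw)) hw.2.not_ge
  have hb : sSup S ∉ S := fun h => by
    obtain ⟨u, hu, hus⟩ := (mem_nhdsGT_iff_exists_Ioo_subset.1
      (nhdsWithin_le_nhds (hopen.mem_nhds h) : S ∈ 𝓝[>] (sSup S)))
    obtain ⟨w, hw⟩ := exists_between (show sSup S < u from hu)
    exact absurd (le_csSup hba (hus hw)) hw.1.not_ge
  have hSI : S = Ioo (sInf S) (sSup S) := by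
    refine Subset.antisymm (fun t ht => ⟨?_, ?_⟩)
      ((show IsConnected S from ⟨hne, hconv.isPreconnected⟩).Ioo_csInf_csSup_subset hbb hba)
    · exact lt_of_le_of_ne (csInf_le hbb ht) (by rintro h; exact ha (h ▸ ht))
    · exact lt_of_le_of_ne (le_csSup hba ht) (by rintro h; exact hb (h ▸ ht))
  obtain ⟨t₀, ht₀⟩ := hne
  have ht₀' : t₀ ∈ Ioo (sInf S) (sSup S) := hSI ▸ ht₀
  have hcl : ∀ t ∈ closure S, ρ (x + t • v) ≤ s := fun t ht =>
    closure_minimal (fun t ht => le_of_lt (show ρ (x + t • v) < s from ht)) (isClosed_le hcont continuous_const) ht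
  have ea : ρ (x + sInf S • v) = s :=
    le_antisymm (hcl _ (csInf_mem_closure ⟨t₀, ht₀⟩ hbb)) (not_lt.1 ha)
  have eb : ρ (x + sSup S • v) = s :=
    le_antisymm (hcl _ (csSup_mem_closure ⟨t₀, ht₀⟩ hba)) (not_lt.1 hb)
  refine ⟨sInf S, sSup S, ht₀'.1.trans ht₀'.2, hSI, ea, eb, ?_, ?_⟩
  -- The endpoint has value s while an interior point of the chord lies strictly below s. The
  -- tangent inequality then forces the strict sign of the derivative.
  · have h := hρ.first_order_le (x + sInf S • v) (x + t₀ • v)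
    have e : x + t₀ • v - (x + sInf S • v) = (t₀ - sInf S) • v := by module
    rw [e, map_smul, smul_eq_mul, ea] at h
    have h2 : ρ (x + t₀ • v) < s := ht₀
    by_contra! h3
    nlinarith [ht₀'.1]
  · have h := hρ.first_order_le (x + sSup S • v) (x + t₀ • v)
    have e : x + t₀ • v - (x + sSup S • v) = (t₀ - sSup S) • v := by module
    rw [e, map_smul, smul_eq_mul, eb] at h
    have h2 : ρ (x + t₀ • v) < s := ht₀
    by_contra! h3
    nlinarith [ht₀'.2]

end IsConvexProfile

end Transport

/-! ### The free flow and integration along lines. -/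

namespace Transport

/-- Hölder's inequality against the constant 1, with no finiteness assumption on the measure. -/
theorem lintegral_rpow_le_measure_univ_mul {α : Type*} [MeasurableSpace α] {ν : Measure α}
    {g : α → ℝ≥0∞} (hg : AEMeasurable g ν) {p : ℝ} (hp : 1 ≤ p) :
    (∫⁻ a, g a ∂ν) ^ p ≤ ν univ ^ (p - 1) * ∫⁻ a, g a ^ p ∂ν := by
  rcases hp.eq_or_lt with rfl | hp1
  · simp
  have hp0 : 0 < p := by linarith
  have hpq := Real.HolderConjugate.conjExponent hp1
  have h := ENNReal.lintegral_mul_le_Lp_mul_Lq ν hpq hg (g := fun _ => 1) aemeasurable_const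
  simp only [Pi.mul_apply, mul_one, ENNReal.one_rpow, lintegral_one] at h
  calc (∫⁻ a, g a ∂ν) ^ p ≤ _ := ENNReal.rpow_le_rpow h hp0.le
    _ = _ := by
      rw [ENNReal.mul_rpow_of_nonneg _ _ hp0.le, ← ENNReal.rpow_mul, ← ENNReal.rpow_mul, mul_comm]
      congr 1
      · congr 1
        rw [Real.conjExponent]
        field_simp
      · rw [one_div, inv_mul_cancel₀ hp0.ne', ENNReal.rpow_one]

variable {d : ℕ}

/-- The free flow `(x, v) ↦ (x + s v, v)`. -/
def flow (s : ℝ) (z : Space d × Space d) : Space d × Space d := (z.1 + s • z.2, z.2)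

@[simp] theorem flow_fst (s : ℝ) (z : Space d × Space d) : (flow s z).1 = z.1 + s • z.2 := rfl
@[simp] theorem flow_snd (s : ℝ) (z : Space d × Space d) : (flow s z).2 = z.2 := rfl

@[simp] theorem flow_zero (z : Space d × Space d) : flow 0 z = z := by simp [flow]

theorem flow_flow (s t : ℝ) (z : Space d × Space d) : flow s (flow t z) = flow (s + t) z := by
  ext1 <;> simp [flow, add_smul, add_comm, add_left_comm]

theorem measurable_flow_uncurry : Measurable fun q : (Space d × Space d) × ℝ => flow q.2 q.1 := by
  unfold flow; fun_prop

theorem continuous_flow_uncurry : Continuous fun q : (Space d × Space d) × ℝ => flow q.2 q.1 := by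
  unfold flow; fun_prop

theorem measurable_flow (s : ℝ) : Measurable (flow (d := d) s) := by
  unfold flow; fun_prop

theorem measurable_flow_left (z : Space d × Space d) : Measurable fun s => flow s z := by
  unfold flow; fun_prop

/-- The length (in time) of the intersection with `Z` of the line through `z`. -/
noncomputable def lineLen (Z : Set (Space d)) (z : Space d × Space d) : ℝ≥0∞ :=
  volume {s : ℝ | z.1 + s • z.2 ∈ Z}

theorem lineLen_eq_lintegral {Z : Set (Space d)} (hZ : MeasurableSet Z) (z : Space d × Space d) :
    lineLen Z z = ∫⁻ s : ℝ, Z.indicator 1 (flow s z).1 := by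
  have : MeasurableSet {s : ℝ | z.1 + s • z.2 ∈ Z} :=
    (show Measurable fun s : ℝ => z.1 + s • z.2 by fun_prop) hZ
  rw [lineLen, ← lintegral_indicator_one this]
  rfl

theorem measurable_lineLen {Z : Set (Space d)} (hZ : MeasurableSet Z) :
    Measurable (lineLen (d := d) Z) := by
  simp only [funext (lineLen_eq_lintegral hZ)]
  refine Measurable.lintegral_prod_right'
    (f := fun q : (Space d × Space d) × ℝ => Z.indicator 1 (flow q.2 q.1).1) ?_
  exact (measurable_one.indicator hZ).comp (measurable_fst.comp measurable_flow_uncurry)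

theorem lineLen_flow (Z : Set (Space d)) (h : ℝ) (z : Space d × Space d) :
    lineLen Z (flow h z) = lineLen Z z := by
  unfold lineLen
  have : {s : ℝ | (flow h z).1 + s • (flow h z).2 ∈ Z} =
      (fun s => h + s) ⁻¹' {s : ℝ | z.1 + s • z.2 ∈ Z} := by
    ext s
    simp only [flow, mem_preimage, mem_ofPred_eq, add_smul, add_assoc]
  rw [this, measure_preimage_add]

variable {m : Measure (Space d)} [SFinite m]

/-- For each fixed velocity the flow is a translation, so with the factors swapped it is a skew
product over the identity. -/
theorem measurePreserving_flow (s : ℝ) :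
    MeasurePreserving (flow (d := d) s) ((volume : Measure (Space d)).prod m)
      ((volume : Measure (Space d)).prod m) := by
  have h1 : MeasurePreserving (fun q : Space d × Space d => (q.1, q.2 + s • q.1))
      (m.prod volume) (m.prod volume) := by
    refine (MeasurePreserving.id m).skew_product (g := fun v x => x + s • v) (by fun_prop) ?_
    exact Eventually.of_forall fun v => (measurePreserving_add_right volume (s • v)).map_eq
  have h2 : MeasurePreserving (Prod.swap : Space d × Space d → _) ((volume).prod m)
    (m.prod volume) := Measure.measurePreserving_swap
  have h3 : MeasurePreserving (Prod.swap : Space d × Space d → _) (m.prod volume)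
    ((volume).prod m) := Measure.measurePreserving_swap
  exact h3.comp (h1.comp h2)

/-- At each fixed time a null set pulls back to a null set. Fubini then turns properties true almost
everywhere in phase space into properties true at almost every time of almost every line. -/
theorem quasiMeasurePreserving_flow_uncurry :
    Measure.QuasiMeasurePreserving (fun q : (Space d × Space d) × ℝ => flow q.2 q.1)
      (((volume : Measure (Space d)).prod m).prod volume)
      ((volume : Measure (Space d)).prod m) := by
  refine ⟨measurable_flow_uncurry, Measure.AbsolutelyContinuous.mk fun N hN h0 => ?_⟩
  rw [Measure.map_apply measurable_flow_uncurry hN,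
    Measure.prod_apply_symm (measurable_flow_uncurry hN)]
  refine (lintegral_congr fun s => ?_).trans lintegral_zero
  exact ((measurePreserving_flow s).measure_preimage hN.nullMeasurableSet).trans h0

theorem ae_ae_flow {P : Space d × Space d → Prop}
    (h : ∀ᵐ z ∂((volume : Measure (Space d)).prod m), P z) :
    ∀ᵐ z ∂((volume : Measure (Space d)).prod m), ∀ᵐ s : ℝ, P (flow s z) :=
  Measure.ae_ae_of_ae_prod (quasiMeasurePreserving_flow_uncurry.ae h)

/-- Exchange of the integrals in phase space and along lines. -/
theorem lintegral_mul_lintegral_flow {a b : Space d × Space d → ℝ≥0∞} (ha : Measurable a)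
    (hb : Measurable b) :
    ∫⁻ z, a z * (∫⁻ s : ℝ, b (flow s z)) ∂((volume : Measure (Space d)).prod m) =
      ∫⁻ z, b z * (∫⁻ s : ℝ, a (flow s z)) ∂((volume : Measure (Space d)).prod m) := by
  have hbm : ∀ z : Space d × Space d, Measurable fun s => b (flow s z) := fun z =>
    hb.comp (measurable_flow_left z)
  have ham : ∀ z : Space d × Space d, Measurable fun s => a (flow (-s) z) := fun z =>
    ha.comp ((measurable_flow_left z).comp measurable_neg)
  calc _ = ∫⁻ z, ∫⁻ s : ℝ, a z * b (flow s z) ∂volume ∂((volume : Measure (Space d)).prod m) :=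
        lintegral_congr fun z => (lintegral_const_mul _ (hbm z)).symm
    _ = ∫⁻ s : ℝ, ∫⁻ z, a z * b (flow s z) ∂((volume : Measure (Space d)).prod m) :=
        lintegral_lintegral_swap
          ((ha.comp measurable_fst).mul (hb.comp measurable_flow_uncurry)).aemeasurable
    _ = ∫⁻ s : ℝ, ∫⁻ z, b z * a (flow (-s) z) ∂((volume : Measure (Space d)).prod m) := by
        refine lintegral_congr fun s => ?_
        rw [← (measurePreserving_flow (m := m) s).lintegral_comp
          (f := fun z => b z * a (flow (-s) z)) (hb.mul (ha.comp (measurable_flow _)))]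
        refine lintegral_congr fun z => ?_
        rw [flow_flow, neg_add_cancel, flow_zero, mul_comm]
    _ = ∫⁻ z, ∫⁻ s : ℝ, b z * a (flow (-s) z) ∂volume ∂((volume : Measure (Space d)).prod m) := by
        refine lintegral_lintegral_swap (Measurable.aemeasurable ?_)
        exact (hb.comp measurable_snd).mul (ha.comp (measurable_flow_uncurry.comp
          (measurable_snd.prodMk measurable_fst.neg)))
    _ = _ := by
        refine lintegral_congr fun z => ?_
        rw [lintegral_const_mul _ (ham z)]
        congr 1
        exact lintegral_neg_eq_self (fun s => a (flow s z))

/-- Young's inequality along lines. -/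
theorem lintegral_conv_flow_rpow_le {κ : ℝ → ℝ≥0∞} (hκ : Measurable κ)
    {g : Space d × Space d → ℝ≥0∞} (hg : Measurable g) {p : ℝ} (hp : 1 ≤ p) :
    ∫⁻ z, (∫⁻ s : ℝ, κ s * g (flow s z)) ^ p ∂((volume : Measure (Space d)).prod m) ≤
      (∫⁻ s, κ s) ^ p * ∫⁻ z, g z ^ p ∂((volume : Measure (Space d)).prod m) := by
  set μ := (volume : Measure (Space d)).prod m
  have hgm : ∀ z : Space d × Space d, Measurable fun s => g (flow s z) := fun z =>
    hg.comp (measurable_flow_left z)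
  -- Jensen's inequality on the line for the measure with density κ.
  have h1 : ∀ z, (∫⁻ s : ℝ, κ s * g (flow s z)) ^ p ≤
      (∫⁻ s, κ s) ^ (p - 1) * ∫⁻ s, κ s * g (flow s z) ^ p := by
    intro z
    have h := lintegral_rpow_le_measure_univ_mul (ν := volume.withDensity κ)
      (hgm z).aemeasurable hp
    rw [lintegral_withDensity_eq_lintegral_mul _ hκ (hgm z),
      lintegral_withDensity_eq_lintegral_mul _ hκ ((hgm z).pow_const p),
      withDensity_apply _ MeasurableSet.univ, Measure.restrict_univ] at h
    exact h
  have hm2 : Measurable fun q : (Space d × Space d) × ℝ => κ q.2 * g (flow q.2 q.1) ^ p :=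
    (hκ.comp measurable_snd).mul ((hg.comp measurable_flow_uncurry).pow_const p)
  calc _ ≤ ∫⁻ z, (∫⁻ s, κ s) ^ (p - 1) * ∫⁻ s, κ s * g (flow s z) ^ p ∂volume ∂μ :=
        lintegral_mono h1
    _ = (∫⁻ s, κ s) ^ (p - 1) * ∫⁻ z, ∫⁻ s, κ s * g (flow s z) ^ p ∂volume ∂μ :=
        lintegral_const_mul _ hm2.lintegral_prod_right'
    _ = (∫⁻ s, κ s) ^ (p - 1) * ∫⁻ s, ∫⁻ z, κ s * g (flow s z) ^ p ∂μ ∂volume := by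
        rw [lintegral_lintegral_swap hm2.aemeasurable]
    _ = (∫⁻ s, κ s) ^ (p - 1) * ∫⁻ s, κ s * ∫⁻ z, g z ^ p ∂μ ∂volume := by
        congr 1
        refine lintegral_congr fun s => ?_
        rw [← (measurePreserving_flow (m := m) s).lintegral_comp (hg.pow_const p)]
        exact lintegral_const_mul _ ((hg.comp (measurable_flow s)).pow_const p)
    _ = (∫⁻ s, κ s) ^ (p - 1) * (∫⁻ s, κ s) * ∫⁻ z, g z ^ p ∂μ := by
        rw [lintegral_mul_const _ hκ, mul_assoc]
    _ = _ := by
        congr 1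
        nth_rewrite 2 [← ENNReal.rpow_one (∫⁻ s, κ s)]
        rw [← ENNReal.rpow_add_of_nonneg _ _ (by linarith) zero_le_one, sub_add_cancel]

/-- Integrable functions with bounded support are integrable on almost every line. -/
theorem ae_integrable_line {g : Space d × Space d → ℝ} (hg : Measurable g)
    (hgi : Integrable g ((volume : Measure (Space d)).prod m)) {Z : Set (Space d)}
    (hZ : Bornology.IsBounded Z) (hsupp : ∀ z, z.1 ∉ Z → g z = 0) :
    ∀ᵐ z ∂((volume : Measure (Space d)).prod m), z.2 ≠ 0 → Integrable fun s : ℝ => g (flow s z) := by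
  set μ := (volume : Measure (Space d)).prod m
  have hge : Measurable fun z => ‖g z‖ₑ := hg.enorm
  -- Young's inequality needs a kernel of finite mass, so time is cut to the windows [-n, n]. The
  -- bounded support of g places all relevant times of a given line in one of them.
  have h1 : ∀ n : ℕ, ∀ᵐ z ∂μ, ∫⁻ s : ℝ, (Icc (-n : ℝ) n).indicator 1 s * ‖g (flow s z)‖ₑ < ⊤ := by
    intro n
    have hκ : Measurable ((Icc (-n : ℝ) n).indicator (1 : ℝ → ℝ≥0∞)) :=
      measurable_one.indicator measurableSet_Icc
    have h := lintegral_conv_flow_rpow_le (m := m) hκ hge le_rfl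
    simp only [ENNReal.rpow_one] at h
    refine ae_lt_top ?_ (h.trans_lt ?_).ne
    · exact Measurable.lintegral_prod_right'
        (f := fun q : (Space d × Space d) × ℝ => (Icc (-n : ℝ) n).indicator 1 q.2 *
          ‖g (flow q.2 q.1)‖ₑ)
        ((hκ.comp measurable_snd).mul (hge.comp measurable_flow_uncurry))
    · refine ENNReal.mul_lt_top ?_ hgi.2
      rw [lintegral_indicator_one measurableSet_Icc]
      simp
  filter_upwards [ae_all_iff.2 h1] with z hz hv
  refine ⟨(hg.comp (measurable_flow_left z)).aestronglyMeasurable, ?_⟩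
  obtain ⟨R, hR⟩ := hZ.exists_norm_le
  obtain ⟨n, hn⟩ := exists_nat_ge ((R + ‖z.1‖) / ‖z.2‖)
  refine lt_of_le_of_lt (lintegral_mono fun s => ?_) (hz n)
  by_cases hs : s ∈ Icc (-n : ℝ) n
  · simp [hs]
  · have : g (flow s z) = 0 := by
      refine hsupp _ fun hmem => hs ?_
      rw [mem_Icc, ← abs_le]
      refine le_trans ?_ hn
      rw [le_div_iff₀ (norm_pos_iff.2 hv), ← Real.norm_eq_abs, ← norm_smul]
      calc ‖s • z.2‖ = ‖(z.1 + s • z.2) - z.1‖ := by rw [add_sub_cancel_left]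
        _ ≤ _ := (norm_sub_le _ _).trans (by linarith [(hR _ hmem : ‖z.1 + s • z.2‖ ≤ R)])
    simp [this]

/-- The kernel of `lineOp`. -/
noncomputable def lineKernel (P : Set (Space d × Space d)) (s : ℝ) (z : Space d × Space d) : ℝ :=
  (Iio (0 : ℝ)).indicator 1 s * P.indicator 1 z - (Ioi (0 : ℝ)).indicator 1 s * Pᶜ.indicator 1 z

/-- Integration along lines: the integral of `g` over the points of `P` lying before `z`, minus the
integral of `g` over the points outside `P` lying after `z`. -/
noncomputable def lineOp (P : Set (Space d × Space d)) (g : Space d × Space d → ℝ)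
    (z : Space d × Space d) : ℝ :=
  ∫ s : ℝ, lineKernel P s (flow s z) * g (flow s z)

theorem abs_lineKernel_le (P : Set (Space d × Space d)) (s : ℝ) (z : Space d × Space d) :
    |lineKernel P s z| ≤ 1 := by
  unfold lineKernel
  rcases lt_trichotomy s 0 with h | h | h <;> by_cases hz : z ∈ P <;>
    simp [indicator, h, hz, h.not_gt]

theorem measurable_lineKernel {P : Set (Space d × Space d)} (hP : MeasurableSet P) :
    Measurable fun q : (Space d × Space d) × ℝ => lineKernel P q.2 q.1 := by
  unfold lineKernel
  exact (((measurable_one.indicator measurableSet_Iio).comp measurable_snd).mul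
    ((measurable_one.indicator hP).comp measurable_fst)).sub
    (((measurable_one.indicator measurableSet_Ioi).comp measurable_snd).mul
    ((measurable_one.indicator hP.compl).comp measurable_fst))

variable {P : Set (Space d × Space d)}

theorem measurable_lineOp_integrand (hP : MeasurableSet P) {g : Space d × Space d → ℝ}
    (hg : Measurable g) : Measurable fun q : (Space d × Space d) × ℝ =>
      lineKernel P q.2 (flow q.2 q.1) * g (flow q.2 q.1) :=
  ((measurable_lineKernel hP).comp (measurable_flow_uncurry.prodMk measurable_snd)).mul
    (hg.comp measurable_flow_uncurry)

theorem measurable_lineOp (hP : MeasurableSet P) {g : Space d × Space d → ℝ} (hg : Measurable g) :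
    Measurable (lineOp P g) :=
  ((measurable_lineOp_integrand hP hg).stronglyMeasurable.integral_prod_right').measurable

theorem integrable_lineOp_integrand (hP : MeasurableSet P) {g : Space d × Space d → ℝ}
    (hg : Measurable g) {z : Space d × Space d} (h : Integrable fun s : ℝ => g (flow s z)) :
    Integrable fun s : ℝ => lineKernel P s (flow s z) * g (flow s z) := by
  refine h.mono ((measurable_lineOp_integrand hP hg).comp
    measurable_prodMk_left).aestronglyMeasurable (Eventually.of_forall fun s => ?_)
  rw [norm_mul]
  exact mul_le_of_le_one_left (norm_nonneg _) (abs_lineKernel_le P s _)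

theorem enorm_lineOp_le (P : Set (Space d × Space d)) (g : Space d × Space d → ℝ)
    (z : Space d × Space d) : ‖lineOp P g z‖ₑ ≤ ∫⁻ s : ℝ, ‖g (flow s z)‖ₑ := by
  refine (enorm_integral_le_lintegral_enorm _).trans (lintegral_mono fun s => ?_)
  rw [enorm_mul]
  refine mul_le_of_le_one_left (by positivity) ?_
  rw [Real.enorm_eq_ofReal_abs]
  exact ENNReal.ofReal_le_one.2 (abs_lineKernel_le P s _)

theorem lineOp_add (hP : MeasurableSet P) {g g' : Space d × Space d → ℝ} (hg : Measurable g)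
    (hg' : Measurable g') {z : Space d × Space d} (h : Integrable fun s : ℝ => g (flow s z))
    (h' : Integrable fun s : ℝ => g' (flow s z)) :
    lineOp P (g + g') z = lineOp P g z + lineOp P g' z := by
  unfold lineOp
  rw [← integral_add (integrable_lineOp_integrand hP hg h) (integrable_lineOp_integrand hP hg' h')]
  simp [mul_add]

theorem integrable_line_flow {g : Space d × Space d → ℝ} {z : Space d × Space d}
    (h : Integrable fun s : ℝ => g (flow s z)) (t : ℝ) :
    Integrable fun s : ℝ => g (flow s (flow t z)) := by
  simp only [flow_flow]
  exact h.comp_add_right t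

/-- `lineOp P g` is an antiderivative of `g` along lines. -/
theorem lineOp_flow (hP : MeasurableSet P) {g : Space d × Space d → ℝ} (hg : Measurable g)
    {z : Space d × Space d} (h : Integrable fun s : ℝ => g (flow s z)) (t : ℝ) :
    lineOp P g (flow t z) = lineOp P g z + ∫ s in (0 : ℝ)..t, g (flow s z) := by
  have key : ∀ (z : Space d × Space d) (t : ℝ), 0 ≤ t →
      (Integrable fun s : ℝ => g (flow s z)) →
      lineOp P g (flow t z) = lineOp P g z + ∫ s in (0 : ℝ)..t, g (flow s z) := by
    intro z t ht h
    have h1 : lineOp P g (flow t z) =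
        ∫ r : ℝ, lineKernel P (r - t) (flow r z) * g (flow r z) := by
      rw [← integral_add_right_eq_self _ t]
      simp only [lineOp, flow_flow, add_sub_cancel_right]
    have hi2 : Integrable fun r : ℝ => lineKernel P (r - t) (flow r z) * g (flow r z) := by
      have := (integrable_lineOp_integrand hP hg (integrable_line_flow h t)).comp_sub_right t
      simpa only [flow_flow, sub_add_cancel] using this
    rw [← sub_eq_iff_eq_add', h1, lineOp, ← integral_sub hi2 (integrable_lineOp_integrand hP hg h),
      intervalIntegral.integral_of_le ht, ← integral_indicator measurableSet_Ioc]
    refine integral_congr_ae ?_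
    filter_upwards [(measure_eq_zero_iff_ae_notMem.1 (measure_singleton (0 : ℝ)) :
        ∀ᵐ r : ℝ, r ∉ ({0} : Set ℝ)),
      (measure_eq_zero_iff_ae_notMem.1 (measure_singleton t) : ∀ᵐ r : ℝ, r ∉ ({t} : Set ℝ))]
      with r hr0 hrt
    simp only [mem_singleton_iff] at hr0 hrt
    rw [← sub_mul]
    -- A source between times 0 and t passes from ahead of the base point to behind it. Its
    -- coefficient changes from 0 to 1 if it lies in P and from -1 to 0 if not, hence by 1 in both
    -- cases.
    have hk : lineKernel P (r - t) (flow r z) - lineKernel P r (flow r z) =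
        (Ioc 0 t).indicator 1 r := by
      unfold lineKernel
      rcases lt_or_gt_of_ne hr0 with h0 | h0
      · have e1 : r - t < 0 := by linarith
        simp [indicator, h0, e1, h0.not_gt, e1.not_gt]
      · rcases lt_or_gt_of_ne hrt with h2 | h2
        · by_cases hz : flow r z ∈ P <;>
            simp [indicator, h0, h2, h0.not_gt, h2.not_gt, h2.le, hz]
        · simp [indicator, h0, h2, h0.not_gt, h2.not_gt, h2.not_ge]
    rw [hk, indicator, indicator]
    split_ifs <;> simp
  rcases le_total 0 t with ht | ht
  · exact key z t ht h
  · have h2 := key (flow t z) (-t) (by linarith) (integrable_line_flow h t)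
    rw [flow_flow, neg_add_cancel, flow_zero] at h2
    simp only [flow_flow] at h2
    rw [intervalIntegral.integral_comp_add_right (fun s => g (flow s z)), zero_add,
      neg_add_cancel] at h2
    rw [h2, intervalIntegral.integral_symm]
    ring

/-- Hölder's inequality on a line, for functions supported in `Z`. -/
theorem enorm_lineOp_rpow_le (P : Set (Space d × Space d)) {Z : Set (Space d)}
    (hZ : MeasurableSet Z) {g : Space d × Space d → ℝ} (hg : Measurable g)
    (hsupp : ∀ z, z.1 ∉ Z → g z = 0) {p : ℝ} (hp : 1 ≤ p) (z : Space d × Space d) :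
    ‖lineOp P g z‖ₑ ^ p ≤ lineLen Z z ^ (p - 1) * ∫⁻ s, ‖g (flow s z)‖ₑ ^ p := by
  have hp0 : 0 < p := by linarith
  have hS : MeasurableSet {s : ℝ | z.1 + s • z.2 ∈ Z} :=
    (show Measurable fun s : ℝ => z.1 + s • z.2 by fun_prop) hZ
  have h2 : ∫⁻ s : ℝ, ‖g (flow s z)‖ₑ = ∫⁻ s in {s : ℝ | z.1 + s • z.2 ∈ Z}, ‖g (flow s z)‖ₑ := by
    rw [← lintegral_indicator hS]
    refine lintegral_congr fun s => ?_
    by_cases hs : z.1 + s • z.2 ∈ Z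
    · rw [indicator_of_mem (show s ∈ {s : ℝ | z.1 + s • z.2 ∈ Z} from hs)]
    · rw [indicator_of_notMem (show s ∉ {s : ℝ | z.1 + s • z.2 ∈ Z} from hs), hsupp _ hs,
        enorm_zero]
  calc ‖lineOp P g z‖ₑ ^ p ≤ (∫⁻ s : ℝ, ‖g (flow s z)‖ₑ) ^ p :=
        ENNReal.rpow_le_rpow (enorm_lineOp_le P g z) hp0.le
    _ ≤ _ := by
        rw [h2]
        refine (lintegral_rpow_le_measure_univ_mul
          (hg.enorm.comp (measurable_flow_left z)).aemeasurable hp).trans ?_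
        rw [Measure.restrict_apply_univ]
        exact mul_le_mul_right (lintegral_mono' Measure.restrict_le_self le_rfl) _

/-- Hölder's inequality along lines, for functions supported in `Z`. -/
theorem lintegral_lineLen_inv_mul_lineOp_le {Z : Set (Space d)} (hZ : MeasurableSet Z)
    {g : Space d × Space d → ℝ} (hg : Measurable g)
    (hsupp : ∀ z, z.1 ∉ Z → g z = 0) {p : ℝ} (hp : 1 ≤ p) :
    ∫⁻ z in Z ×ˢ univ, (lineLen Z z)⁻¹ * ‖lineOp P g z‖ₑ ^ p
        ∂((volume : Measure (Space d)).prod m) ≤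
      ∫⁻ z, lineLen Z z ^ (p - 1) * ‖g z‖ₑ ^ p ∂((volume : Measure (Space d)).prod m) := by
  have hp0 : 0 < p := by linarith
  have hge : Measurable fun z => ‖g z‖ₑ ^ p := hg.enorm.pow_const p
  have hlm := measurable_lineLen (d := d) hZ
  have hZu : MeasurableSet (Z ×ˢ (univ : Set (Space d))) := hZ.prod MeasurableSet.univ
  set a : Space d × Space d → ℝ≥0∞ := (Z ×ˢ univ).indicator
    (fun z => (lineLen Z z)⁻¹ * lineLen Z z ^ (p - 1)) with ha
  have ham : Measurable a := (hlm.inv.mul (hlm.pow_const _)).indicator hZu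
  rw [← lintegral_indicator hZu]
  calc _ ≤ ∫⁻ z, a z * ∫⁻ s, ‖g (flow s z)‖ₑ ^ p ∂volume ∂((volume : Measure (Space d)).prod m) := by
        refine lintegral_mono fun z => ?_
        by_cases hz : z ∈ Z ×ˢ (univ : Set (Space d))
        · rw [indicator_of_mem hz, ha, indicator_of_mem hz, mul_assoc]
          exact mul_le_mul_right (enorm_lineOp_rpow_le P hZ hg hsupp hp z) _
        · rw [indicator_of_notMem hz]; exact zero_le
    _ = ∫⁻ z, ‖g z‖ₑ ^ p * ∫⁻ s, a (flow s z) ∂volume ∂((volume : Measure (Space d)).prod m) :=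
        lintegral_mul_lintegral_flow ham hge
    _ ≤ _ := by
        refine lintegral_mono fun z => ?_
        -- Chord length is constant along the line, so the inverse weight is cancelled by the
        -- integration over the chord.
        have h3 : ∫⁻ s, a (flow s z) = (lineLen Z z)⁻¹ * lineLen Z z ^ (p - 1) * lineLen Z z := by
          nth_rewrite 3 [lineLen_eq_lintegral hZ z]
          rw [← lintegral_const_mul]
          · refine lintegral_congr fun s => ?_
            by_cases hs : (flow s z).1 ∈ Z
            · rw [ha, indicator_of_mem (by exact ⟨hs, mem_univ _⟩), indicator_of_mem hs,
                lineLen_flow, Pi.one_apply, mul_one]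
            · rw [ha, indicator_of_notMem (by exact fun h => hs h.1), indicator_of_notMem hs,
                mul_zero]
          · exact (measurable_one.indicator hZ).comp (measurable_fst.comp (measurable_flow_left z))
        rw [h3, mul_comm]
        refine mul_le_mul_left ?_ _
        rw [mul_right_comm]
        exact mul_le_of_le_one_left zero_le (ENNReal.inv_mul_le_one _)

end Transport

/-! ### Normals and boundary measures of the sublevel sets and of the shell. -/

namespace Transport

variable {d : ℕ} {ρ : Space d → ℝ}

theorem outerNormal_eq {X : Set (Space d)} {x n : Space d} (h : IsOuterUnitNormal X x n) :
    outerNormal X x = n := by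
  have hex : ∃ n, IsOuterUnitNormal X x n := ⟨n, h⟩
  rw [outerNormal, dif_pos hex]
  exact hex.choose_spec.unique h

/-- The normalized gradient. -/
noncomputable def unitGrad (ρ : Space d → ℝ) (x : Space d) : Space d :=
  ‖fderiv ℝ ρ x‖⁻¹ • (InnerProductSpace.toDual ℝ (Space d)).symm (fderiv ℝ ρ x)

theorem inner_unitGrad (x w : Space d) :
    inner ℝ (unitGrad ρ x) w = ‖fderiv ℝ ρ x‖⁻¹ * fderiv ℝ ρ x w := by
  rw [unitGrad, real_inner_smul_left, InnerProductSpace.toDual_symm_apply]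

theorem norm_unitGrad {x : Space d} (h : fderiv ℝ ρ x ≠ 0) : ‖unitGrad ρ x‖ = 1 := by
  rw [unitGrad, norm_smul, norm_inv, norm_norm, LinearIsometryEquiv.norm_map,
    inv_mul_cancel₀ (norm_ne_zero_iff.2 h)]

namespace IsConvexProfile

variable (hρ : IsConvexProfile ρ)
include hρ

/-- The derivative stays negative for short times, and the tangent inequality is then applied from
the later point back to x. -/
theorem eventually_lt_of_fderiv_neg {x w : Space d} (h : fderiv ℝ ρ x w < 0) :
    ∀ᶠ t in 𝓝[>] (0 : ℝ), ρ (x + t • w) < ρ x := by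
  have hcont : Continuous fun t : ℝ => fderiv ℝ ρ (x + t • w) w :=
    hρ.continuous_fderiv_apply.comp (f := fun t : ℝ => ((x + t • w : Space d), w)) (by fun_prop)
  have h1 : ∀ᶠ t in 𝓝 (0 : ℝ), fderiv ℝ ρ (x + t • w) w < 0 := by
    refine hcont.continuousAt.eventually_lt_const ?_
    simpa using h
  filter_upwards [nhdsWithin_le_nhds h1, self_mem_nhdsWithin] with t ht ht0
  have h2 := hρ.first_order_le (x + t • w) x
  rw [sub_add_cancel_left, map_neg, map_smul, smul_eq_mul] at h2
  have : t * fderiv ℝ ρ (x + t • w) w < 0 := mul_neg_of_pos_of_neg ht0 ht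
  linarith

theorem lt_of_fderiv_pos {x w : Space d} (h : 0 < fderiv ℝ ρ x w) {t : ℝ} (ht : 0 < t) :
    ρ x < ρ (x + t • w) := by
  have h2 := hρ.first_order_le x (x + t • w)
  rw [add_sub_cancel_left, map_smul, smul_eq_mul] at h2
  have := mul_pos ht h
  linarith

theorem isOuterUnitNormal_sublevel {s : ℝ} (hs : -1 < s) {x : Space d} (hx : ρ x = s) :
    IsOuterUnitNormal (sublevel ρ s) x (unitGrad ρ x) := by
  have h0 := hρ.fderiv_ne_zero (hx ▸ hs)
  have hpos : 0 < ‖fderiv ℝ ρ x‖⁻¹ := inv_pos.2 (norm_pos_iff.2 h0)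
  refine ⟨norm_unitGrad h0, fun w hw => ?_, fun w hw => ?_⟩
  · rw [inner_unitGrad] at hw
    rw [← hx]
    exact hρ.eventually_lt_of_fderiv_neg ((pos_iff_neg_of_mul_neg hw).1 hpos)
  · rw [inner_unitGrad] at hw
    filter_upwards [self_mem_nhdsWithin] with t ht
    rw [← hx]
    exact (hρ.lt_of_fderiv_pos ((pos_iff_pos_of_mul_pos hw).1 hpos) ht).not_gt

theorem isOuterUnitNormal_shell_outer {x : Space d} (hx : ρ x = 1) :
    IsOuterUnitNormal (shell ρ) x (unitGrad ρ x) := by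
  have h := hρ.isOuterUnitNormal_sublevel (by norm_num) hx
  refine ⟨h.1, fun w hw => ?_, fun w hw => ?_⟩
  · have hcont : Continuous fun t : ℝ => ρ (x + t • w) := hρ.continuous.comp (by fun_prop)
    have h1 : ∀ᶠ t in 𝓝 (0 : ℝ), 0 < ρ (x + t • w) := by
      refine hcont.continuousAt.eventually_const_lt ?_
      simp [hx]
    filter_upwards [h.2.1 w hw, nhdsWithin_le_nhds h1] with t ht1 ht2
    rw [hρ.shell_eq]
    exact ⟨ht2, ht1⟩
  · filter_upwards [h.2.2 w hw] with t ht hmem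
    exact ht hmem.1

/-- Along the inner boundary the shell lies on the side of larger ρ, so the normal is reversed and
incoming directions are those leaving Z_0. -/
theorem isOuterUnitNormal_shell_inner {x : Space d} (hx : ρ x = 0) :
    IsOuterUnitNormal (shell ρ) x (-unitGrad ρ x) := by
  have h := hρ.isOuterUnitNormal_sublevel (by norm_num) hx
  have h0 := hρ.fderiv_ne_zero (x := x) (by rw [hx]; norm_num)
  have hpos : 0 < ‖fderiv ℝ ρ x‖⁻¹ := inv_pos.2 (norm_pos_iff.2 h0)
  refine ⟨by rw [norm_neg, h.1], fun w hw => ?_, fun w hw => ?_⟩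
  · rw [inner_neg_left, Left.neg_neg_iff, inner_unitGrad] at hw
    have hw' := (pos_iff_pos_of_mul_pos hw).1 hpos
    have hcont : Continuous fun t : ℝ => ρ (x + t • w) := hρ.continuous.comp (by fun_prop)
    have h1 : ∀ᶠ t in 𝓝 (0 : ℝ), ρ (x + t • w) < 1 := by
      refine hcont.continuousAt.eventually_lt_const ?_
      simp [hx]
    filter_upwards [self_mem_nhdsWithin, nhdsWithin_le_nhds h1] with t ht1 ht2
    rw [hρ.shell_eq]
    refine ⟨?_, ht2⟩
    rw [← hx]
    exact hρ.lt_of_fderiv_pos hw' ht1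
  · rw [inner_neg_left, Left.neg_pos_iff] at hw
    filter_upwards [h.2.1 w hw] with t ht hmem
    rw [hρ.shell_eq] at hmem
    exact lt_asymm hmem.1 ht

theorem mem_incoming_iff {s : ℝ} (hs : -1 < s) (V : Set (Space d)) (z : Space d × Space d) :
    z ∈ incoming (sublevel ρ s) V ↔ ρ z.1 = s ∧ z.2 ∈ V ∧ fderiv ℝ ρ z.1 z.2 < 0 := by
  simp only [incoming, mem_ofPred_eq, hρ.frontier_sublevel hs]
  refine and_congr_right fun h => and_congr_right fun _ => ?_
  have h0 := hρ.fderiv_ne_zero (h ▸ hs)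
  rw [outerNormal_eq (hρ.isOuterUnitNormal_sublevel hs h), inner_unitGrad]
  have hpos := inv_pos.2 (norm_pos_iff.2 h0)
  exact ⟨fun h => (pos_iff_neg_of_mul_neg h).1 hpos, mul_neg_of_pos_of_neg hpos⟩

theorem mem_outgoing_iff {s : ℝ} (hs : -1 < s) (V : Set (Space d)) (z : Space d × Space d) :
    z ∈ outgoing (sublevel ρ s) V ↔ ρ z.1 = s ∧ z.2 ∈ V ∧ 0 < fderiv ℝ ρ z.1 z.2 := by
  simp only [outgoing, mem_ofPred_eq, hρ.frontier_sublevel hs]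
  refine and_congr_right fun h => and_congr_right fun _ => ?_
  have h0 := hρ.fderiv_ne_zero (h ▸ hs)
  rw [outerNormal_eq (hρ.isOuterUnitNormal_sublevel hs h), inner_unitGrad]
  exact mul_pos_iff_of_pos_left (inv_pos.2 (norm_pos_iff.2 h0))

/-- The opposite of the outer normal enters the shell, which provides points of the shell converging
to x. -/
theorem level_subset_frontier_shell {s : ℝ} (hs : s = 0 ∨ s = 1) {x : Space d} (hx : ρ x = s) :
    x ∈ frontier (shell ρ) := by
  have hs' : -1 < s := by rcases hs with rfl | rfl <;> norm_num
  have h0 := hρ.fderiv_ne_zero (hx ▸ hs')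
  have hpos : 0 < ‖fderiv ℝ ρ x‖⁻¹ := inv_pos.2 (norm_pos_iff.2 h0)
  rw [frontier, Set.mem_sdiff, hρ.isOpen_shell.interior_eq]
  constructor
  · obtain ⟨n, hn⟩ : ∃ n, IsOuterUnitNormal (shell ρ) x n := by
      rcases hs with rfl | rfl
      · exact ⟨_, hρ.isOuterUnitNormal_shell_inner hx⟩
      · exact ⟨_, hρ.isOuterUnitNormal_shell_outer hx⟩
    have h1 := hn.2.1 (-n) (by
      rw [inner_neg_right, real_inner_self_eq_norm_sq, hn.1]; norm_num)
    have h2 : Tendsto (fun t : ℝ => x + t • (-n)) (𝓝[>] 0) (𝓝 x) := by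
      have : Continuous fun t : ℝ => x + t • (-n) := by fun_prop
      have h3 := this.tendsto 0
      simp only [zero_smul, add_zero] at h3
      exact h3.mono_left nhdsWithin_le_nhds
    exact mem_closure_of_tendsto h2 h1
  · rw [hρ.shell_eq]
    rintro ⟨h1, h2⟩
    rcases hs with rfl | rfl <;> linarith

theorem frontier_shell : frontier (shell ρ) = {x | ρ x = 0} ∪ {x | ρ x = 1} := by
  refine Subset.antisymm (fun x hx => ?_) ?_
  · rw [frontier, Set.mem_sdiff, hρ.isOpen_shell.interior_eq] at hx
    have h1 : closure (shell ρ) ⊆ {x | 0 ≤ ρ x ∧ ρ x ≤ 1} := by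
      refine closure_minimal (fun x hx => ?_) ((isClosed_le continuous_const hρ.continuous).inter
        (isClosed_le hρ.continuous continuous_const))
      rw [hρ.shell_eq] at hx
      exact ⟨hx.1.le, hx.2.le⟩
    have h2 := h1 hx.1
    have h3 := hx.2
    rw [hρ.shell_eq] at h3
    by_contra h
    simp only [mem_union, mem_ofPred_eq, not_or] at h
    exact h3 ⟨lt_of_le_of_ne h2.1 (Ne.symm h.1), lt_of_le_of_ne h2.2 h.2⟩
  · rintro x (hx | hx)
    · exact hρ.level_subset_frontier_shell (Or.inl rfl) hx
    · exact hρ.level_subset_frontier_shell (Or.inr rfl) hx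

theorem mem_incoming_shell_iff (V : Set (Space d)) (z : Space d × Space d) :
    z ∈ incoming (shell ρ) V ↔ z.2 ∈ V ∧ ((ρ z.1 = 0 ∧ 0 < fderiv ℝ ρ z.1 z.2) ∨
      (ρ z.1 = 1 ∧ fderiv ℝ ρ z.1 z.2 < 0)) := by
  simp only [incoming, hρ.frontier_shell, mem_ofPred_eq, mem_union]
  have key : ∀ s : ℝ, -1 < s → ρ z.1 = s → 0 < ‖fderiv ℝ ρ z.1‖⁻¹ := fun s hs h =>
    inv_pos.2 (norm_pos_iff.2 (hρ.fderiv_ne_zero (h ▸ hs)))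
  constructor
  · rintro ⟨h | h, hV, hi⟩
    · refine ⟨hV, Or.inl ⟨h, ?_⟩⟩
      rw [outerNormal_eq (hρ.isOuterUnitNormal_shell_inner h), inner_neg_left, Left.neg_neg_iff,
        inner_unitGrad] at hi
      exact (pos_iff_pos_of_mul_pos hi).1 (key 0 (by norm_num) h)
    · refine ⟨hV, Or.inr ⟨h, ?_⟩⟩
      rw [outerNormal_eq (hρ.isOuterUnitNormal_shell_outer h), inner_unitGrad] at hi
      exact (pos_iff_neg_of_mul_neg hi).1 (key 1 (by norm_num) h)
  · rintro ⟨hV, ⟨h, hi⟩ | ⟨h, hi⟩⟩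
    · refine ⟨Or.inl h, hV, ?_⟩
      rw [outerNormal_eq (hρ.isOuterUnitNormal_shell_inner h), inner_neg_left, Left.neg_neg_iff,
        inner_unitGrad]
      exact mul_pos (key 0 (by norm_num) h) hi
    · refine ⟨Or.inr h, hV, ?_⟩
      rw [outerNormal_eq (hρ.isOuterUnitNormal_shell_outer h), inner_unitGrad]
      exact mul_neg_of_pos_of_neg (key 1 (by norm_num) h) hi

theorem mem_outgoing_shell_iff (V : Set (Space d)) (z : Space d × Space d) :
    z ∈ outgoing (shell ρ) V ↔ z.2 ∈ V ∧ ((ρ z.1 = 0 ∧ fderiv ℝ ρ z.1 z.2 < 0) ∨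
      (ρ z.1 = 1 ∧ 0 < fderiv ℝ ρ z.1 z.2)) := by
  simp only [outgoing, hρ.frontier_shell, mem_ofPred_eq, mem_union]
  have key : ∀ s : ℝ, -1 < s → ρ z.1 = s → 0 < ‖fderiv ℝ ρ z.1‖⁻¹ := fun s hs h =>
    inv_pos.2 (norm_pos_iff.2 (hρ.fderiv_ne_zero (h ▸ hs)))
  constructor
  · rintro ⟨h | h, hV, hi⟩
    · refine ⟨hV, Or.inl ⟨h, ?_⟩⟩
      rw [outerNormal_eq (hρ.isOuterUnitNormal_shell_inner h), inner_neg_left, Left.neg_pos_iff,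
        inner_unitGrad] at hi
      exact (pos_iff_neg_of_mul_neg hi).1 (key 0 (by norm_num) h)
    · refine ⟨hV, Or.inr ⟨h, ?_⟩⟩
      rw [outerNormal_eq (hρ.isOuterUnitNormal_shell_outer h), inner_unitGrad] at hi
      exact (pos_iff_pos_of_mul_pos hi).1 (key 1 (by norm_num) h)
  · rintro ⟨hV, ⟨h, hi⟩ | ⟨h, hi⟩⟩
    · refine ⟨Or.inl h, hV, ?_⟩
      rw [outerNormal_eq (hρ.isOuterUnitNormal_shell_inner h), inner_neg_left, Left.neg_pos_iff,
        inner_unitGrad]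
      exact mul_neg_of_pos_of_neg (key 0 (by norm_num) h) hi
    · refine ⟨Or.inr h, hV, ?_⟩
      rw [outerNormal_eq (hρ.isOuterUnitNormal_shell_outer h), inner_unitGrad]
      exact mul_pos (key 1 (by norm_num) h) hi

end IsConvexProfile

/-- The measure `|ν · v| dμ dv` on `{ρ = s} × V`, expressed with the gradient of `ρ`. -/
noncomputable def levelMeasure (ρ : Space d → ℝ) (s : ℝ) (m : Measure (Space d)) :
    Measure (Space d × Space d) :=
  (((μHE[d - 1] : Measure (Space d)).restrict {x | ρ x = s}).prod m).withDensity
    fun z => ENNReal.ofReal (‖fderiv ℝ ρ z.1‖⁻¹ * |fderiv ℝ ρ z.1 z.2|)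

namespace IsConvexProfile

variable (hρ : IsConvexProfile ρ)
include hρ

theorem measurableSet_level (s : ℝ) : MeasurableSet {x | ρ x = s} :=
  (hρ.isCompact_level s).measurableSet

theorem hausdorffMeasure_level_lt_top {s : ℝ} (hs : -1 < s) :
    (μHE[d - 1] : Measure (Space d)) {x | ρ x = s} < ⊤ := by
  have h := measure_lt_top_of_locally_level (hρ.isCompact_level s) (fun v hv =>
    ⟨fun x => ρ x - s, ((hρ.contDiff.of_le one_le_two).sub contDiff_const).contDiffAt, ?_,
      Eventually.of_forall fun w hw => sub_eq_zero.2 hw⟩)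
  · simpa using h
  · rw [fderiv_sub_const]
    exact hρ.fderiv_ne_zero ((show ρ v = s from hv) ▸ hs)

theorem isFiniteMeasure_level {s : ℝ} (hs : -1 < s) :
    IsFiniteMeasure ((μHE[d - 1] : Measure (Space d)).restrict {x | ρ x = s}) :=
  ⟨by rw [Measure.restrict_apply_univ]; exact hρ.hausdorffMeasure_level_lt_top hs⟩

variable {m : Measure (Space d)} [SFinite m]

theorem ae_level_prod {s : ℝ} (hs : -1 < s) :
    ∀ᵐ z ∂(((μHE[d - 1] : Measure (Space d)).restrict {x | ρ x = s}).prod m), ρ z.1 = s := by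
  have := hρ.isFiniteMeasure_level hs
  exact Measure.quasiMeasurePreserving_fst.ae (ae_restrict_mem (hρ.measurableSet_level s))

/-- The density, defined through a chosen normal, is replaced by an explicit expression in the
gradient whose measurability is visible. -/
theorem boundaryMeasure_sublevel {s : ℝ} (hs : -1 < s) :
    boundaryMeasure (sublevel ρ s) m = levelMeasure ρ s m := by
  unfold boundaryMeasure levelMeasure
  rw [hρ.frontier_sublevel hs]
  refine withDensity_congr_ae ?_
  filter_upwards [hρ.ae_level_prod hs] with z hz
  rw [outerNormal_eq (hρ.isOuterUnitNormal_sublevel hs hz), inner_unitGrad, abs_mul, abs_inv,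
    abs_norm]

/-- The normals of the shell and of the sublevel set differ at most by a sign, which the absolute
value removes. Boundary measures of both domains thus become the same `levelMeasure`. -/
theorem restrict_boundaryMeasure_shell {s : ℝ} (hs : s = 0 ∨ s = 1) {S : Set (Space d × Space d)}
    (hS : MeasurableSet S) (hSs : ∀ z ∈ S, ρ z.1 = s) :
    (boundaryMeasure (shell ρ) m).restrict S = (levelMeasure ρ s m).restrict S := by
  have hs' : -1 < s := by rcases hs with rfl | rfl <;> norm_num
  have hfin := hρ.isFiniteMeasure_level hs'
  have hle : {x | ρ x = s} ⊆ frontier (shell ρ) := fun x hx =>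
    hρ.level_subset_frontier_shell hs hx
  have hfr : MeasurableSet (frontier (shell ρ)) := isClosed_frontier.measurableSet
  have hfin2 : IsFiniteMeasure ((μHE[d - 1] : Measure (Space d)).restrict (frontier (shell ρ))) := by
    rw [hρ.frontier_shell]
    refine ⟨?_⟩
    rw [Measure.restrict_apply_univ]
    exact measure_union_lt_top (hρ.hausdorffMeasure_level_lt_top (by norm_num))
      (hρ.hausdorffMeasure_level_lt_top (by norm_num))
  have hlev := hρ.measurableSet_level s
  have hSu : S = ({x | ρ x = s} ×ˢ univ) ∩ S := by
    ext z; exact ⟨fun h => ⟨⟨hSs z h, mem_univ _⟩, h⟩, fun h => h.2⟩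
  have hprod : (((μHE[d - 1] : Measure (Space d)).restrict (frontier (shell ρ))).prod m).restrict S =
      (((μHE[d - 1] : Measure (Space d)).restrict {x | ρ x = s}).prod m).restrict S := by
    have e : ((μHE[d - 1] : Measure (Space d)).restrict {x | ρ x = s}).prod m =
        (((μHE[d - 1] : Measure (Space d)).restrict (frontier (shell ρ))).prod m).restrict
          ({x | ρ x = s} ×ˢ univ) := by
      rw [← Measure.prod_restrict, Measure.restrict_univ, Measure.restrict_restrict hlev,
        inter_eq_self_of_subset_left hle]
    rw [e, Measure.restrict_restrict hS]
    congr 1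
    rw [inter_comm, ← hSu]
  unfold boundaryMeasure levelMeasure
  rw [restrict_withDensity hS, restrict_withDensity hS, hprod]
  refine withDensity_congr_ae ?_
  filter_upwards [ae_restrict_mem hS] with z hz
  have hz' := hSs z hz
  have habs : |inner ℝ (outerNormal (shell ρ) z.1) z.2| = |inner ℝ (unitGrad ρ z.1) z.2| := by
    rcases hs with rfl | rfl
    · rw [outerNormal_eq (hρ.isOuterUnitNormal_shell_inner hz'), inner_neg_left, abs_neg]
    · rw [outerNormal_eq (hρ.isOuterUnitNormal_shell_outer hz')]
  rw [habs, inner_unitGrad, abs_mul, abs_inv, abs_norm]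

end IsConvexProfile

end Transport

/-! ### Crossing points of lines with level sets, and flux in phase space. -/

namespace Transport

variable {d : ℕ} {ρ : Space d → ℝ}

/-- The points of `{ρ = s}` at which the flow leaves (`ς = 1`) or enters (`ς = -1`) the sublevel set. -/
def crossingSet (ρ : Space d → ℝ) (s ς : ℝ) : Set (Space d × Space d) :=
  {z | ρ z.1 = s ∧ 0 < ς * fderiv ℝ ρ z.1 z.2}

/-- The part of a line lying before its exit from (`ς = 1`) or its entrance into (`ς = -1`) the
sublevel set. -/
def beforeCrossing (ρ : Space d → ℝ) (s ς : ℝ) : Set (Space d × Space d) :=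
  if 0 < ς then {z | ρ z.1 < s ∨ fderiv ℝ ρ z.1 z.2 ≤ 0} else {z | s ≤ ρ z.1 ∧ fderiv ℝ ρ z.1 z.2 < 0}

/-- The time at which a line leaves the set `Q`. -/
noncomputable def cutTime (Q : Set (Space d × Space d)) (z : Space d × Space d) : ℝ :=
  (∫⁻ t : ℝ, (Ioi 0).indicator 1 t * Q.indicator 1 (flow t z)).toReal -
    (∫⁻ t : ℝ, (Iio 0).indicator 1 t * Qᶜ.indicator 1 (flow t z)).toReal

/-- The point at which the line through `z` leaves or enters the sublevel set. -/
noncomputable def crossing (ρ : Space d → ℝ) (s ς : ℝ) (z : Space d × Space d) :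
    Space d × Space d :=
  flow (cutTime (beforeCrossing ρ s ς) z) z

theorem measurable_cutTime {Q : Set (Space d × Space d)} (hQ : MeasurableSet Q) :
    Measurable (cutTime Q) := by
  refine Measurable.sub (Measurable.ennreal_toReal ?_) (Measurable.ennreal_toReal ?_)
  · exact Measurable.lintegral_prod_right'
      (f := fun q : (Space d × Space d) × ℝ => (Ioi 0).indicator 1 q.2 * Q.indicator 1 (flow q.2 q.1))
      (((measurable_one.indicator measurableSet_Ioi).comp measurable_snd).mul
        ((measurable_one.indicator hQ).comp measurable_flow_uncurry))
  · exact Measurable.lintegral_prod_right'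
      (f := fun q : (Space d × Space d) × ℝ => (Iio 0).indicator 1 q.2 * Qᶜ.indicator 1 (flow q.2 q.1))
      (((measurable_one.indicator measurableSet_Iio).comp measurable_snd).mul
        ((measurable_one.indicator hQ.compl).comp measurable_flow_uncurry))

/-- The future length inside Q is the positive part of e and the past length outside Q is its
negative part. Writing the crossing time through integrals makes its measurability a consequence of
Fubini. -/
theorem cutTime_eq {Q : Set (Space d × Space d)} {z : Space d × Space d} {e : ℝ}
    (h1 : ∀ t < e, flow t z ∈ Q) (h2 : ∀ t > e, flow t z ∉ Q) : cutTime Q z = e := by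
  have hne : ∀ᵐ t : ℝ, t ≠ e := by
    have : volume ({e} : Set ℝ) = 0 := measure_singleton e
    exact measure_eq_zero_iff_ae_notMem.1 this
  have e1 : ∫⁻ t : ℝ, (Ioi 0).indicator 1 t * Q.indicator 1 (flow t z) = ENNReal.ofReal e := by
    rw [← sub_zero e, ← Real.volume_Ioo, ← lintegral_indicator_one measurableSet_Ioo]
    refine lintegral_congr_ae ?_
    filter_upwards [hne] with t ht
    rcases lt_or_gt_of_ne ht with h | h
    · simp [indicator, h1 t h, h]
    · simp [indicator, h2 t h, h.not_gt]
  have e2 : ∫⁻ t : ℝ, (Iio 0).indicator 1 t * Qᶜ.indicator 1 (flow t z) = ENNReal.ofReal (-e) := by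
    rw [← zero_sub e, ← Real.volume_Ioo, ← lintegral_indicator_one measurableSet_Ioo]
    refine lintegral_congr_ae ?_
    filter_upwards [hne] with t ht
    rcases lt_or_gt_of_ne ht with h | h
    · simp [indicator, h1 t h, h.not_gt]
    · simp [indicator, h2 t h, h]
  rw [cutTime, e1, e2, ENNReal.toReal_ofReal', ENNReal.toReal_ofReal']
  rcases le_total e 0 with h | h
  · rw [max_eq_right h, max_eq_left (by linarith)]; ring
  · rw [max_eq_left h, max_eq_right (by linarith)]; ring

namespace IsConvexProfile

variable (hρ : IsConvexProfile ρ)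
include hρ

theorem measurable_fderiv_apply : Measurable fun z : Space d × Space d => fderiv ℝ ρ z.1 z.2 :=
  hρ.continuous_fderiv_apply.measurable

theorem measurable_comp_fst : Measurable fun z : Space d × Space d => ρ z.1 :=
  (hρ.continuous.comp continuous_fst).measurable

theorem measurableSet_crossingSet (s ς : ℝ) : MeasurableSet (crossingSet ρ s ς) :=
  (measurableSet_eq_fun hρ.measurable_comp_fst measurable_const).inter
    (measurableSet_lt measurable_const (hρ.measurable_fderiv_apply.const_mul ς))

theorem measurableSet_beforeCrossing (s ς : ℝ) : MeasurableSet (beforeCrossing ρ s ς) := by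
  unfold beforeCrossing
  split_ifs
  · exact (measurableSet_lt hρ.measurable_comp_fst measurable_const).union
      (measurableSet_le hρ.measurable_fderiv_apply measurable_const)
  · exact (measurableSet_le measurable_const hρ.measurable_comp_fst).inter
      (measurableSet_lt hρ.measurable_fderiv_apply measurable_const)

theorem measurable_crossing (s ς : ℝ) : Measurable (crossing ρ s ς) :=
  measurable_flow_uncurry.comp
    (measurable_id.prodMk (measurable_cutTime (hρ.measurableSet_beforeCrossing s ς)))

theorem strictMono_flow_deriv {z : Space d × Space d} (hz : z.2 ≠ 0) :
    StrictMono fun t : ℝ => fderiv ℝ ρ (flow t z).1 z.2 :=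
  hρ.strictMono_line_deriv z.1 hz

theorem first_order_flow (z : Space d × Space d) (t u : ℝ) :
    ρ (flow t z).1 + (u - t) * fderiv ℝ ρ (flow t z).1 z.2 ≤ ρ (flow u z).1 := by
  have h := hρ.first_order_le (flow t z).1 (flow u z).1
  have e : (flow u z).1 - (flow t z).1 = (u - t) • z.2 := by simp only [flow_fst]; module
  rwa [e, map_smul, smul_eq_mul] at h

/-- The derivative of ρ along the line is strictly increasing. With the tangent inequality this
makes the times spent in `beforeCrossing` a half-line ending at the crossing. -/
theorem cutTime_beforeCrossing {s ς : ℝ} (hς : ς = 1 ∨ ς = -1) {z : Space d × Space d} (hz : z.2 ≠ 0)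
    {e : ℝ} (he : flow e z ∈ crossingSet ρ s ς) : cutTime (beforeCrossing ρ s ς) z = e := by
  have hmono := hρ.strictMono_flow_deriv hz
  obtain ⟨h1, h2⟩ := he
  rw [flow_snd] at h2
  refine cutTime_eq (fun t ht => ?_) (fun t ht => ?_)
  · have hm : fderiv ℝ ρ (flow t z).1 z.2 < fderiv ℝ ρ (flow e z).1 z.2 := hmono ht
    rcases hς with rfl | rfl
    · rw [beforeCrossing, if_pos one_pos]
      by_cases h3 : fderiv ℝ ρ (flow t z).1 z.2 ≤ 0
      · exact Or.inr h3
      · refine Or.inl ?_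
        have := hρ.first_order_flow z t e
        push Not at h3
        nlinarith [mul_pos (sub_pos.2 ht) h3]
    · rw [beforeCrossing, if_neg (by norm_num)]
      have h4 := hρ.first_order_flow z e t
      refine ⟨?_, ?_⟩
      · nlinarith
      · rw [flow_snd]; linarith
  · have hm : fderiv ℝ ρ (flow e z).1 z.2 < fderiv ℝ ρ (flow t z).1 z.2 := hmono ht
    rcases hς with rfl | rfl
    · rw [beforeCrossing, if_pos one_pos]
      have h4 := hρ.first_order_flow z e t
      rintro (h5 | h5)
      · nlinarith
      · rw [flow_snd] at h5; linarith
    · rw [beforeCrossing, if_neg (by norm_num)]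
      rintro ⟨h5, h6⟩
      rw [flow_snd] at h6
      have h4 := hρ.first_order_flow z t e
      nlinarith [mul_pos_of_neg_of_neg (sub_neg.2 ht) h6]

theorem crossing_eq {s ς : ℝ} (hς : ς = 1 ∨ ς = -1) {z : Space d × Space d} (hz : z.2 ≠ 0)
    {e : ℝ} (he : flow e z ∈ crossingSet ρ s ς) : crossing ρ s ς z = flow e z := by
  rw [crossing, hρ.cutTime_beforeCrossing hς hz he]

theorem exists_flow_mem_crossingSet {s ς : ℝ} (hς : ς = 1 ∨ ς = -1) {z : Space d × Space d}
    (hz : z.2 ≠ 0) (hit : ∃ t : ℝ, ρ (flow t z).1 < s) : ∃ e, flow e z ∈ crossingSet ρ s ς := by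
  obtain ⟨a, b, -, -, ha, hb, ha', hb'⟩ := hρ.exists_line_interval hz hit
  rcases hς with rfl | rfl
  · exact ⟨b, hb, by rw [one_mul]; exact hb'⟩
  · exact ⟨a, ha, by rw [neg_one_mul]; exact neg_pos.2 ha'⟩

/-- Crossings are transversal: moving against the sign ς makes ρ drop below s at once. -/
theorem hit_of_mem_crossingSet {s ς : ℝ} {z : Space d × Space d}
    (hz : z ∈ crossingSet ρ s ς) : ∃ t : ℝ, ρ (flow t z).1 < s := by
  obtain ⟨h1, h2⟩ := hz
  have h3 : fderiv ℝ ρ z.1 (-ς • z.2) < 0 := by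
    rw [map_smul, smul_eq_mul, neg_mul]; linarith
  obtain ⟨t, ht⟩ := (hρ.eventually_lt_of_fderiv_neg h3).exists
  refine ⟨t * -ς, ?_⟩
  rw [h1] at ht
  rwa [flow_fst, mul_smul]

theorem crossing_flow {s ς : ℝ} (hς : ς = 1 ∨ ς = -1) {z : Space d × Space d}
    (hz : z.2 ≠ 0) (hit : ∃ t : ℝ, ρ (flow t z).1 < s) (h : ℝ) :
    crossing ρ s ς (flow h z) = crossing ρ s ς z := by
  obtain ⟨e, he⟩ := hρ.exists_flow_mem_crossingSet hς hz hit
  have he' : flow (e - h) (flow h z) ∈ crossingSet ρ s ς := by rwa [flow_flow, sub_add_cancel]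
  rw [hρ.crossing_eq hς hz he, hρ.crossing_eq hς (z := flow h z) hz he', flow_flow, sub_add_cancel]

theorem crossing_self {s ς : ℝ} (hς : ς = 1 ∨ ς = -1) {z : Space d × Space d}
    (hz : z ∈ crossingSet ρ s ς) : crossing ρ s ς z = z := by
  have h0 : z.2 ≠ 0 := by
    rintro h
    have := hz.2
    rw [h, map_zero, mul_zero] at this
    exact lt_irrefl _ this
  have := hρ.crossing_eq hς h0 (e := 0) (by rwa [flow_zero])
  rwa [flow_zero] at this

/-- The crossing time is a function of the line, so a line has at most one crossing of each kind.
This is the injectivity required by `FluxBound`. -/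
theorem crossingSet_unique {s ς : ℝ} (hς : ς = 1 ∨ ς = -1) {z : Space d × Space d} {t : ℝ}
    (hz : z ∈ crossingSet ρ s ς) (ht : flow t z ∈ crossingSet ρ s ς) : t = 0 := by
  have h0 : z.2 ≠ 0 := by
    rintro h
    have := hz.2
    rw [h, map_zero, mul_zero] at this
    exact lt_irrefl _ this
  rw [← hρ.cutTime_beforeCrossing hς h0 ht, hρ.cutTime_beforeCrossing hς h0 (e := 0) (by rwa [flow_zero])]

variable {m : Measure (Space d)} [SFinite m]

/-- Comparison of the flux measure on a level set with phase space volume. -/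
theorem exists_levelMeasure_bounds {s : ℝ} (hs : -1 < s) : ∃ C : ℝ≥0, ∀ (m : Measure (Space d))
    [SFinite m] (ς : ℝ), (ς = 1 ∨ ς = -1) → ∀ F : Space d × Space d → ℝ≥0∞, Measurable F →
    (∫⁻ z in crossingSet ρ s ς, (∫⁻ t : ℝ, F (flow t z)) ∂(levelMeasure ρ s m) ≤
      C * ∫⁻ z, F z ∂((volume : Measure (Space d)).prod m)) ∧
    ((∀ᵐ v ∂m, v ≠ 0) →
      ∫⁻ z in {z | ∃ t : ℝ, ρ (flow t z).1 < s}, F z ∂((volume : Measure (Space d)).prod m) ≤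
      C * ∫⁻ z in crossingSet ρ s ς, (∫⁻ t : ℝ, F (flow t z)) ∂(levelMeasure ρ s m)) := by
  have hfin := hρ.isFiniteMeasure_level hs
  have hcd : ContDiff ℝ 1 fun x => ρ x - s := (hρ.contDiff.of_le one_le_two).sub contDiff_const
  obtain ⟨C₀, hC₀⟩ := exists_fluxBound hcd (hρ.isCompact_level s)
    (fun y hy => sub_eq_zero.2 hy) (fun y hy => by
      rw [fderiv_sub_const]
      exact hρ.fderiv_ne_zero ((show ρ y = s from hy) ▸ hs))
  -- On the compact level set the gradient and its inverse are bounded, which allows passing between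
  -- |∇ρ·v| and |ν·v|.
  obtain ⟨R, hR⟩ : ∃ R : ℝ, ∀ y, ρ y = s → ‖fderiv ℝ ρ y‖⁻¹ ≤ R ∧ ‖fderiv ℝ ρ y‖ ≤ R := by
    have hc1 : ContinuousOn (fun y => ‖fderiv ℝ ρ y‖⁻¹) {x | ρ x = s} :=
      hρ.continuous_fderiv.norm.continuousOn.inv₀ fun y hy =>
        norm_ne_zero_iff.2 (hρ.fderiv_ne_zero ((show ρ y = s from hy) ▸ hs))
    obtain ⟨R1, h1⟩ := (hρ.isCompact_level s).exists_bound_of_continuousOn hc1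
    obtain ⟨R2, h2⟩ := (hρ.isCompact_level s).exists_bound_of_continuousOn
      hρ.continuous_fderiv.norm.continuousOn
    refine ⟨max R1 R2, fun y hy => ⟨?_, ?_⟩⟩
    · exact (le_abs_self _).trans ((h1 y hy).trans (le_max_left _ _))
    · exact (le_abs_self _).trans ((h2 y hy).trans (le_max_right _ _))
  refine ⟨C₀ * R.toNNReal, fun m _ ς hς F hF => ?_⟩
  set μH : Measure (Space d) := (μHE[d - 1] : Measure (Space d))
  have hcs := hρ.measurableSet_crossingSet s ς
  set B : Space d → Set (Space d) := fun v => {y | (y, v) ∈ crossingSet ρ s ς} with hB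
  have hBm : ∀ v, MeasurableSet (B v) := fun v => measurable_prodMk_right hcs
  have hBs : ∀ v, B v ⊆ {x | ρ x = s} := fun v y hy => hy.1
  have hinj : ∀ v, ∀ y ∈ B v, ∀ y' ∈ B v, ∀ t : ℝ, y' = y + t • v → t = 0 := by
    intro v y hy y' hy' t h
    refine hρ.crossingSet_unique hς (z := (y, v)) hy (t := t) ?_
    have : flow t (y, v) = (y', v) := by rw [h]; rfl
    rw [this]; exact hy'
  have hJ : Measurable fun z : Space d × Space d => ∫⁻ t : ℝ, F (flow t z) :=
    Measurable.lintegral_prod_right' (f := fun q : (Space d × Space d) × ℝ => F (flow q.2 q.1))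
      (hF.comp measurable_flow_uncurry)
  have hdens : Measurable fun z : Space d × Space d =>
      ENNReal.ofReal (‖fderiv ℝ ρ z.1‖⁻¹ * |fderiv ℝ ρ z.1 z.2|) :=
    (((hρ.continuous_fderiv.norm.measurable.comp measurable_fst).inv).mul
      (measurable_norm.comp hρ.measurable_fderiv_apply)).ennreal_ofReal
  have hmain : ∫⁻ z in crossingSet ρ s ς, (∫⁻ t : ℝ, F (flow t z)) ∂(levelMeasure ρ s m) =
      ∫⁻ v, ∫⁻ y in B v, ENNReal.ofReal (‖fderiv ℝ ρ y‖⁻¹ * |fderiv ℝ ρ y v|) *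
        (∫⁻ t : ℝ, F (y + t • v, v)) ∂μH ∂m := by
    have h1 : Measurable ((crossingSet ρ s ς).indicator fun z : Space d × Space d =>
        ENNReal.ofReal (‖fderiv ℝ ρ z.1‖⁻¹ * |fderiv ℝ ρ z.1 z.2|) * ∫⁻ t : ℝ, F (flow t z)) :=
      (hdens.mul hJ).indicator hcs
    rw [levelMeasure, restrict_withDensity hcs, lintegral_withDensity_eq_lintegral_mul _ hdens hJ,
      ← lintegral_indicator hcs]
    simp only [Pi.mul_def]
    rw [lintegral_prod_symm' _ h1]
    refine lintegral_congr fun v => ?_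
    have e1 : ∀ y, (crossingSet ρ s ς).indicator (fun z : Space d × Space d =>
        ENNReal.ofReal (‖fderiv ℝ ρ z.1‖⁻¹ * |fderiv ℝ ρ z.1 z.2|) * ∫⁻ t : ℝ, F (flow t z)) (y, v) =
        (B v).indicator (fun y => ENNReal.ofReal (‖fderiv ℝ ρ y‖⁻¹ * |fderiv ℝ ρ y v|) *
        (∫⁻ t : ℝ, F (y + t • v, v))) y := by
      intro y
      by_cases hy : (y, v) ∈ crossingSet ρ s ς
      · rw [indicator_of_mem hy, indicator_of_mem (show y ∈ B v from hy)]; rfl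
      · rw [indicator_of_notMem hy, indicator_of_notMem (show y ∉ B v from hy)]
    simp only [e1]
    rw [lintegral_indicator (hBm v), Measure.restrict_restrict (hBm v),
      inter_eq_self_of_subset_left (hBs v)]
  have hflux : ∀ v, flux (fun x => ρ x - s) (B v) v (fun x => F (x, v)) =
      ∫⁻ y in B v, ENNReal.ofReal |fderiv ℝ ρ y v| * (∫⁻ t : ℝ, F (y + t • v, v)) ∂μH := by
    intro v
    rw [flux, finrank_euclideanSpace, Fintype.card_fin]
    simp only [fderiv_sub_const]
    rfl
  have hfluxm : Measurable fun v =>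
      ∫⁻ y in B v, ENNReal.ofReal |fderiv ℝ ρ y v| * (∫⁻ t : ℝ, F (y + t • v, v)) ∂μH := by
    have h1 : Measurable ((crossingSet ρ s ς).indicator fun z : Space d × Space d =>
        ENNReal.ofReal |fderiv ℝ ρ z.1 z.2| * ∫⁻ t : ℝ, F (flow t z)) :=
      ((measurable_norm.comp hρ.measurable_fderiv_apply).ennreal_ofReal.mul hJ).indicator hcs
    have h2 := h1.lintegral_prod_left' (μ := μH.restrict {x | ρ x = s})
    convert h2 using 2 with v
    have e1 : ∀ y, (crossingSet ρ s ς).indicator (fun z : Space d × Space d =>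
        ENNReal.ofReal |fderiv ℝ ρ z.1 z.2| * ∫⁻ t : ℝ, F (flow t z)) (y, v) =
        (B v).indicator (fun y => ENNReal.ofReal |fderiv ℝ ρ y v| *
        (∫⁻ t : ℝ, F (y + t • v, v))) y := by
      intro y
      by_cases hy : (y, v) ∈ crossingSet ρ s ς
      · rw [indicator_of_mem hy, indicator_of_mem (show y ∈ B v from hy)]; rfl
      · rw [indicator_of_notMem hy, indicator_of_notMem (show y ∉ B v from hy)]
    simp only [e1]
    rw [lintegral_indicator (hBm v), Measure.restrict_restrict (hBm v),
      inter_eq_self_of_subset_left (hBs v)]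
  have hFv : ∀ v, Measurable fun x => F (x, v) := fun v => hF.comp measurable_prodMk_right
  constructor
  · rw [hmain, lintegral_prod_symm' _ hF, ← lintegral_const_mul _ hF.lintegral_prod_left']
    refine lintegral_mono fun v => ?_
    calc _ ≤ ∫⁻ y in B v, (R.toNNReal : ℝ≥0∞) * (ENNReal.ofReal |fderiv ℝ ρ y v| *
          (∫⁻ t : ℝ, F (y + t • v, v))) ∂μH := by
          refine setLIntegral_mono' (hBm v) fun y hy => ?_
          rw [← mul_assoc, ENNReal.ofReal_mul (by positivity)]
          gcongr
          exact ENNReal.ofReal_le_ofReal (hR y hy.1).1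
      _ = (R.toNNReal : ℝ≥0∞) * flux (fun x => ρ x - s) (B v) v (fun x => F (x, v)) := by
          rw [hflux, lintegral_const_mul' _ _ ENNReal.coe_ne_top]
      _ ≤ R.toNNReal * (C₀ * ∫⁻ x, F (x, v)) := by
          gcongr
          exact ((hC₀ v (B v) (hBs v) (hBm v) (hinj v) _ (hFv v)).1).trans
            (mul_le_mul_right (lintegral_mono' Measure.restrict_le_self le_rfl) _)
      _ = _ := by rw [ENNReal.coe_mul]; ring
  · intro hm0
    have hHm : MeasurableSet {z : Space d × Space d | ∃ t : ℝ, ρ (flow t z).1 < s} := by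
      have : {z : Space d × Space d | ∃ t : ℝ, ρ (flow t z).1 < s} =
          ⋃ t : ℝ, {z | ρ (flow t z).1 < s} := by ext z; simp
      rw [this]
      refine (isOpen_iUnion fun t => isOpen_lt (hρ.continuous.comp ?_) continuous_const).measurableSet
      simp only [flow_fst]; fun_prop
    rw [hmain, ← lintegral_indicator hHm, lintegral_prod_symm' _ (hF.indicator hHm)]
    refine le_trans (b := ∫⁻ v, C₀ * R.toNNReal * ∫⁻ y in B v, ENNReal.ofReal
      (‖fderiv ℝ ρ y‖⁻¹ * |fderiv ℝ ρ y v|) * (∫⁻ t : ℝ, F (y + t • v, v)) ∂μH ∂m) ?_ ?_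
    · refine lintegral_mono_ae ?_
      filter_upwards [hm0] with v hv
      -- Every line with nonzero velocity that meets the sublevel set has a crossing of each kind,
      -- so for each v the hitting points lie in the tube over the crossing set.
      calc _ ≤ ∫⁻ x in tube (B v) v, F (x, v) := by
            refine (lintegral_mono fun x => ?_).trans (lintegral_indicator_le _ _)
            by_cases hx : (x, v) ∈ {z : Space d × Space d | ∃ t : ℝ, ρ (flow t z).1 < s}
            · rw [indicator_of_mem hx]
              refine (indicator_of_mem (s := tube (B v) v) ?_ (fun x => F (x, v))).ge
              obtain ⟨e, he⟩ := hρ.exists_flow_mem_crossingSet hς (z := (x, v)) hv hx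
              exact ⟨x + e • v, he, -e, by module⟩
            · rw [indicator_of_notMem hx]; exact zero_le
        _ ≤ C₀ * flux (fun x => ρ x - s) (B v) v (fun x => F (x, v)) :=
            (hC₀ v (B v) (hBs v) (hBm v) (hinj v) _ (hFv v)).2
        _ ≤ C₀ * ∫⁻ y in B v, (R.toNNReal : ℝ≥0∞) * (ENNReal.ofReal
              (‖fderiv ℝ ρ y‖⁻¹ * |fderiv ℝ ρ y v|) * (∫⁻ t : ℝ, F (y + t • v, v))) ∂μH := by
            rw [hflux]
            refine mul_le_mul_right (setLIntegral_mono' (hBm v) fun y hy => ?_) _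
            rw [← mul_assoc]
            gcongr
            change _ ≤ ENNReal.ofReal R * _
            rw [← ENNReal.ofReal_mul ((norm_nonneg _).trans (hR y hy.1).2)]
            refine ENNReal.ofReal_le_ofReal ?_
            rw [← mul_assoc]
            refine le_mul_of_one_le_left (abs_nonneg _) ?_
            have h0 : 0 < ‖fderiv ℝ ρ y‖ :=
              norm_pos_iff.2 (hρ.fderiv_ne_zero ((show ρ y = s from hy.1) ▸ hs))
            calc (1 : ℝ) = ‖fderiv ℝ ρ y‖ * ‖fderiv ℝ ρ y‖⁻¹ := (mul_inv_cancel₀ h0.ne').symm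
              _ ≤ _ := by
                have := (hR y hy.1).2
                gcongr
        _ = _ := by rw [lintegral_const_mul' _ _ ENNReal.coe_ne_top, mul_assoc]
    · rw [lintegral_const_mul' _ _ (by finiteness), ENNReal.coe_mul]

end IsConvexProfile

end Transport

/-! ### Travel times and chord lengths. -/

namespace Transport

variable {d : ℕ} {ρ : Space d → ℝ} {Z : Set (Space d)}

/-- Boundedness makes the set of exit times nonempty, so the infimum is not the default value 0.
Openness makes it positive and puts the exit point outside Z. -/
theorem exitTime_spec (hZ : IsOpen Z) (hb : Bornology.IsBounded Z) {x v : Space d} (hx : x ∈ Z)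
    (hv : v ≠ 0) : 0 < exitTime Z x v ∧ (∀ s, 0 ≤ s → s < exitTime Z x v → x + s • v ∈ Z) ∧
      x + exitTime Z x v • v ∉ Z := by
  set S : Set ℝ := {s : ℝ | 0 < s ∧ x + s • v ∉ Z} with hS
  have hbdd : BddBelow S := ⟨0, fun s hs => hs.1.le⟩
  have hcont : Continuous fun s : ℝ => x + s • v := by fun_prop
  have hne : S.Nonempty := by
    obtain ⟨R, hR⟩ := hb.exists_norm_le
    have hv' := norm_pos_iff.2 hv
    have hR0 : 0 ≤ R := (norm_nonneg x).trans (hR x hx)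
    refine ⟨(R + ‖x‖ + 1) / ‖v‖, by positivity, fun hmem => ?_⟩
    have h1 := hR _ hmem
    have h2 : ‖((R + ‖x‖ + 1) / ‖v‖) • v‖ = R + ‖x‖ + 1 := by
      rw [norm_smul, Real.norm_of_nonneg (by positivity)]; field_simp
    have h3 := norm_sub_norm_le (((R + ‖x‖ + 1) / ‖v‖) • v) (-x)
    rw [sub_neg_eq_add, norm_neg, h2, add_comm _ x] at h3
    linarith
  have hE : exitTime Z x v = sInf S := rfl
  have hpos : 0 < sInf S := by
    have h1 : ∀ᶠ s in 𝓝 (0 : ℝ), x + s • v ∈ Z :=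
      hcont.continuousAt.eventually_mem (hZ.mem_nhds (by simpa using hx))
    obtain ⟨ε, hε, hball⟩ := Metric.eventually_nhds_iff.1 h1
    refine lt_of_lt_of_le hε (le_csInf hne fun s hs => ?_)
    by_contra! h
    exact hs.2 (hball (by rw [Real.dist_eq, sub_zero, abs_of_pos hs.1]; exact h))
  refine ⟨hpos, fun s hs0 hs => ?_, ?_⟩
  · rcases hs0.eq_or_lt with rfl | h0
    · simpa using hx
    · by_contra h
      exact absurd (csInf_le hbdd (show s ∈ S from ⟨h0, h⟩)) hs.not_ge
  · have hcl : IsClosed {s : ℝ | x + s • v ∉ Z} := (hZ.isClosed_compl).preimage hcont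
    have h1 : sInf S ∈ closure S := csInf_mem_closure hne hbdd
    exact closure_minimal (fun s hs => hs.2) hcl h1

theorem exitTime_nonneg (Z : Set (Space d)) (x v : Space d) : 0 ≤ exitTime Z x v :=
  Real.sInf_nonneg fun _ hs => hs.1.le

theorem travelTime_pos (hZ : IsOpen Z) (hb : Bornology.IsBounded Z) {z : Space d × Space d}
    (hz : z.1 ∈ Z) (hv : z.2 ≠ 0) : 0 < travelTime Z z :=
  add_pos (exitTime_spec hZ hb hz (neg_ne_zero.2 hv)).1 (exitTime_spec hZ hb hz hv).1

theorem Ioo_subset_of_exitTime (hZ : IsOpen Z) (hb : Bornology.IsBounded Z)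
    {z : Space d × Space d} (hz : z.1 ∈ Z) (hv : z.2 ≠ 0) :
    Ioo (-exitTime Z z.1 (-z.2)) (exitTime Z z.1 z.2) ⊆ {s : ℝ | z.1 + s • z.2 ∈ Z} := by
  intro s hs
  rcases le_total 0 s with h | h
  · exact (exitTime_spec hZ hb hz hv).2.1 s h hs.2
  · have := (exitTime_spec hZ hb hz (neg_ne_zero.2 hv)).2.1 (-s) (by linarith) (by linarith [hs.1])
    rwa [neg_smul_neg] at this

theorem ofReal_travelTime_le_lineLen (hZ : IsOpen Z) (hb : Bornology.IsBounded Z)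
    {Z' : Set (Space d)} (hZZ : Z ⊆ Z')
    {z : Space d × Space d} (hz : z.1 ∈ Z) (hv : z.2 ≠ 0) :
    ENNReal.ofReal (travelTime Z z) ≤ lineLen Z' z := by
  calc ENNReal.ofReal (travelTime Z z)
      = volume (Ioo (-exitTime Z z.1 (-z.2)) (exitTime Z z.1 z.2)) := by
        rw [Real.volume_Ioo, travelTime]; congr 1; ring
    _ ≤ _ := measure_mono fun s hs => hZZ (Ioo_subset_of_exitTime hZ hb hz hv hs)

/-- The line meets a convex set in an interval, so one exterior point on each side confines the
whole chord. -/
theorem lineLen_le_of_forall (hZ : Convex ℝ Z) {z : Space d × Space d} (hz : z.1 ∈ Z) {a b : ℝ}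
    (ha : 0 ≤ a) (hb : 0 ≤ b) (ha' : z.1 + (-a) • z.2 ∉ Z) (hb' : z.1 + b • z.2 ∉ Z) :
    lineLen Z z ≤ ENNReal.ofReal (a + b) := by
  have hsub : {s : ℝ | z.1 + s • z.2 ∈ Z} ⊆ Ioo (-a) b := by
    have hconv : Convex ℝ {s : ℝ | z.1 + s • z.2 ∈ Z} := by
      have : {s : ℝ | z.1 + s • z.2 ∈ Z} =
          (AffineMap.lineMap z.1 (z.1 + z.2) : ℝ →ᵃ[ℝ] Space d) ⁻¹' Z := by
        ext t; simp [AffineMap.lineMap_apply, add_comm]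
      rw [this]
      exact hZ.affine_preimage _
    have hoc := hconv.ordConnected
    have h0 : (0 : ℝ) ∈ {s : ℝ | z.1 + s • z.2 ∈ Z} := by
      change z.1 + (0 : ℝ) • z.2 ∈ Z; simpa using hz
    intro s hs
    constructor
    · by_contra! h
      exact ha' (hoc.out hs h0 ⟨h, by linarith⟩)
    · by_contra! h
      exact hb' (hoc.out h0 hs ⟨hb, h⟩)
  refine (measure_mono hsub).trans ?_
  rw [Real.volume_Ioo]
  exact ENNReal.ofReal_le_ofReal (by linarith)

theorem lineLen_le_ofReal_travelTime (hZ : IsOpen Z) (hb : Bornology.IsBounded Z) (hc : Convex ℝ Z)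
    {z : Space d × Space d} (hz : z.1 ∈ Z) (hv : z.2 ≠ 0) :
    lineLen Z z ≤ ENNReal.ofReal (travelTime Z z) := by
  have h1 := exitTime_spec hZ hb hz hv
  have h2 := exitTime_spec hZ hb hz (neg_ne_zero.2 hv)
  refine lineLen_le_of_forall hc hz h2.1.le h1.1.le ?_ h1.2.2
  have := h2.2.2
  rwa [smul_neg, ← neg_smul] at this

/-- The tube lemma over a compact time interval. It yields the lower semicontinuity behind
measurability of the exit time. -/
theorem isOpen_forall_Icc {W : Set (Space d × Space d)} (hW : IsOpen W) (a : ℝ) :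
    IsOpen {z | ∀ s ∈ Icc (0 : ℝ) a, flow s z ∈ W} := by
  have h := isCompact_Icc (a := (0 : ℝ)) (b := a)
  rw [isOpen_iff_mem_nhds]
  intro z hz
  have := h.eventually_forall_of_forall_eventually (x₀ := z) (P := fun z s => flow s z ∈ W)
    fun s hs => (continuous_flow_uncurry.continuousAt (x := (z, s))).eventually_mem
      (hW.mem_nhds (hz s hs))
  exact this

/-- The exit time exceeds a ≥ 0 exactly when the closed segment up to time a stays in Z, an open
condition. The indicator restricts to points and velocities where `exitTime_spec` applies. -/
theorem measurable_indicator_exitTime (hZ : IsOpen Z) (hb : Bornology.IsBounded Z) :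
    Measurable ((Z ×ˢ {0}ᶜ).indicator fun z : Space d × Space d => exitTime Z z.1 z.2) := by
  have hO : IsOpen (Z ×ˢ ({0}ᶜ : Set (Space d))) := hZ.prod isOpen_compl_singleton
  refine measurable_of_Ioi fun a => ?_
  rcases lt_or_ge a 0 with ha | ha
  · convert MeasurableSet.univ using 1
    refine eq_univ_of_forall fun z => ?_
    refine lt_of_lt_of_le ha (indicator_nonneg (fun z _ => ?_) z)
    exact exitTime_nonneg _ _ _
  · convert (hO.inter (isOpen_forall_Icc (W := Z ×ˢ univ) (hZ.prod isOpen_univ) a)).measurableSet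
      using 1
    ext z
    rw [mem_preimage, mem_Ioi]
    by_cases hz : z ∈ Z ×ˢ ({0}ᶜ : Set (Space d))
    · rw [indicator_of_mem hz]
      have h := exitTime_spec hZ hb hz.1 hz.2
      constructor
      · intro h1
        exact ⟨hz, fun s hs => ⟨h.2.1 s hs.1 (hs.2.trans_lt h1), mem_univ _⟩⟩
      · rintro ⟨-, h2⟩
        by_contra! h3
        exact h.2.2 (h2 _ ⟨h.1.le, h3⟩).1
    · rw [indicator_of_notMem hz]
      exact ⟨fun h => absurd h ha.not_gt, fun h => absurd h.1 hz⟩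

theorem measurable_indicator_travelTime (hZ : IsOpen Z) (hb : Bornology.IsBounded Z) :
    Measurable ((Z ×ˢ {0}ᶜ).indicator (travelTime Z)) := by
  have h1 := measurable_indicator_exitTime hZ hb
  have h2 : Measurable fun z : Space d × Space d => ((z.1, -z.2) : Space d × Space d) := by fun_prop
  convert (h1.comp h2).add h1 using 1
  ext z
  by_cases hz : z ∈ Z ×ˢ ({0}ᶜ : Set (Space d))
  · have hz' : (z.1, -z.2) ∈ Z ×ˢ ({0}ᶜ : Set (Space d)) := ⟨hz.1, neg_ne_zero.2 hz.2⟩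
    simp only [Pi.add_apply, Function.comp, indicator_of_mem hz, indicator_of_mem hz']
    rfl
  · have hz' : (z.1, -z.2) ∉ Z ×ˢ ({0}ᶜ : Set (Space d)) := fun h =>
      hz ⟨h.1, fun h0 => h.2 (neg_eq_zero.2 h0)⟩
    simp only [Pi.add_apply, Function.comp, indicator_of_notMem hz, indicator_of_notMem hz',
      add_zero]

theorem exists_lineLen_le (hb : Bornology.IsBounded Z) {c : ℝ} (hc : 0 < c) :
    ∃ L : ℝ≥0, 0 < L ∧ ∀ z : Space d × Space d, c ≤ ‖z.2‖ → lineLen Z z ≤ L ∧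
      ∀ s : ℝ, z.1 ∈ Z → (flow s z).1 ∈ Z → |s| ≤ L := by
  obtain ⟨R, hR⟩ := hb.exists_norm_le
  have key : ∀ (z : Space d × Space d), c ≤ ‖z.2‖ → ∀ s t : ℝ, (flow s z).1 ∈ Z →
      (flow t z).1 ∈ Z → |s - t| ≤ 2 * |R| / c := by
    intro z hz s t hs ht
    rw [le_div_iff₀ hc]
    calc |s - t| * c ≤ |s - t| * ‖z.2‖ := by gcongr
      _ = ‖(flow s z).1 - (flow t z).1‖ := by
        rw [← Real.norm_eq_abs, ← norm_smul]; simp only [flow_fst]; congr 1; module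
      _ ≤ _ := (norm_sub_le _ _).trans (by linarith [hR _ hs, hR _ ht, le_abs_self R])
  -- Two times on one chord differ by at most the diameter divided by the minimal speed. The summand
  -- 1 keeps L positive even if R = 0.
  refine ⟨(2 * |R| / c + 1).toNNReal, Real.toNNReal_pos.2 (by positivity), fun z hz => ⟨?_, ?_⟩⟩
  · refine (Real.volume_le_diam _).trans (Metric.ediam_le fun s hs t ht => ?_)
    rw [edist_dist, Real.dist_eq]
    exact ENNReal.ofReal_le_ofReal ((key z hz s t hs ht).trans (by linarith))
  · intro s h0 hs
    have := key z hz s 0 hs (by simpa using h0)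
    rw [sub_zero] at this
    rw [Real.coe_toNNReal _ (by positivity)]
    linarith

namespace IsConvexProfile

variable (hρ : IsConvexProfile ρ)
include hρ

/-- Points of `{ρ ≤ 1}` at which the values of `ρ` differ by at least one are separated. -/
theorem exists_separation : ∃ δ > 0, ∀ x y, ρ x ≤ 1 → ρ y ≤ 1 → 1 ≤ ρ x - ρ y → δ ≤ dist x y := by
  have huc := (hρ.isCompact_le 1).uniformContinuousOn_of_continuous hρ.continuous.continuousOn
  rw [Metric.uniformContinuousOn_iff] at huc
  obtain ⟨δ, hδ, h⟩ := huc 1 one_pos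
  refine ⟨δ, hδ, fun x y hx hy hxy => ?_⟩
  by_contra! hlt
  have := h x hx y hy hlt
  rw [Real.dist_eq] at this
  exact absurd ((le_abs_self _).trans_lt this) hxy.not_gt

/-- In the shell, travel times are comparable to the length of the full chord of `Z_1`. -/
theorem exists_lineLen_le_travelTime_shell {c R : ℝ} (hc : 0 < c) (hR : 0 < R) : ∃ C : ℝ≥0, 0 < C ∧
    ∀ z : Space d × Space d, c ≤ ‖z.2‖ → ‖z.2‖ ≤ R → z.1 ∈ shell ρ →
      lineLen (sublevel ρ 1) z ≤ C * ENNReal.ofReal (travelTime (shell ρ) z) := by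
  obtain ⟨δ, hδ, hsep⟩ := hρ.exists_separation
  obtain ⟨L, hL, hLz⟩ := exists_lineLen_le (hρ.isBounded_sublevel 1) hc
  refine ⟨max 1 (L * (R / δ).toNNReal), by positivity, fun z hzc hzR hz => ?_⟩
  have hv : z.2 ≠ 0 := norm_pos_iff.1 (hc.trans_le hzc)
  have hbs : Bornology.IsBounded (shell ρ) := (hρ.isBounded_sublevel 1).subset fun x hx => hx.1
  have h1 := exitTime_spec hρ.isOpen_shell hbs hz hv
  have h2 := exitTime_spec hρ.isOpen_shell hbs hz (neg_ne_zero.2 hv)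
  set b := exitTime (shell ρ) z.1 z.2
  set a := exitTime (shell ρ) z.1 (-z.2)
  have hT : travelTime (shell ρ) z = a + b := rfl
  have hxb := h1.2.2
  have hxa := h2.2.2
  rw [smul_neg, ← neg_smul] at hxa
  have hz' := hz
  rw [hρ.shell_eq] at hxa hxb hz'
  simp only [mem_ofPred_eq, not_and_or, not_lt] at hxa hxb
  have hz0 : 0 < ρ z.1 := hz'.1
  have hz1 : ρ z.1 < 1 := hz'.2
  -- the closed chord lies in `{0 ≤ ρ ≤ 1}`
  have hcl : ∀ s ∈ Icc (-a) b, 0 ≤ ρ (z.1 + s • z.2) ∧ ρ (z.1 + s • z.2) ≤ 1 := by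
    have hcont : Continuous fun s : ℝ => ρ (z.1 + s • z.2) := hρ.continuous.comp (by fun_prop)
    have hcl : IsClosed {s : ℝ | 0 ≤ ρ (z.1 + s • z.2) ∧ ρ (z.1 + s • z.2) ≤ 1} :=
      (isClosed_le continuous_const hcont).inter (isClosed_le hcont continuous_const)
    have hsub := closure_minimal (fun s hs => ?_) hcl (s := Ioo (-a) b)
    · rw [closure_Ioo (by linarith [h1.1, h2.1])] at hsub
      exact hsub
    · have := Ioo_subset_of_exitTime hρ.isOpen_shell hbs hz hv hs
      rw [mem_ofPred_eq, hρ.shell_eq] at this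
      exact ⟨this.1.le, this.2.le⟩
  have hca := hcl (-a) ⟨le_rfl, by linarith [h1.1, h2.1]⟩
  have hcb := hcl b ⟨by linarith [h1.1, h2.1], le_rfl⟩
  -- If the ends lie on different boundary components, the chord has length at least δ, so its
  -- travel time is at least δ/R, while the full chord of Z_1 lasts at most L.
  have hsepcase : 1 ≤ |ρ (z.1 + b • z.2) - ρ (z.1 + (-a) • z.2)| →
      lineLen (sublevel ρ 1) z ≤
        ((L * (R / δ).toNNReal : ℝ≥0) : ℝ≥0∞) * ENNReal.ofReal (a + b) := by
    intro habs
    have hd : δ ≤ dist (z.1 + b • z.2) (z.1 + (-a) • z.2) := by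
      rcases le_abs.1 habs with h | h
      · exact hsep _ _ hcb.2 hca.2 h
      · rw [dist_comm]; exact hsep _ _ hca.2 hcb.2 (by linarith)
    have e : (z.1 + b • z.2) - (z.1 + (-a) • z.2) = (a + b) • z.2 := by module
    rw [dist_eq_norm, e, norm_smul, Real.norm_of_nonneg (by linarith [h1.1, h2.1])] at hd
    have h3 : 1 ≤ R / δ * (a + b) := by
      rw [div_mul_eq_mul_div, le_div_iff₀ hδ, one_mul]
      have : (a + b) * ‖z.2‖ ≤ (a + b) * R := by
        have := h1.1
        have := h2.1
        gcongr
      linarith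
    refine (hLz z hzc).1.trans ?_
    rw [ENNReal.coe_mul, mul_assoc]
    refine le_mul_of_one_le_right zero_le ?_
    change 1 ≤ ENNReal.ofReal (R / δ) * _
    rw [← ENNReal.ofReal_mul (by positivity)]
    exact ENNReal.one_le_ofReal.2 h3
  rw [hT]
  rcases hxa with hxa | hxa <;> rcases hxb with hxb | hxb
  · -- both ends on the inner boundary contradicts convexity
    exfalso
    have hconv := hρ.strictConvexOn.convexOn.convex_le 0
    have hoc : z.1 ∈ {x ∈ univ | ρ x ≤ 0} := by
      have hab : 0 < a + b := by linarith [h1.1, h2.1]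
      have := hconv (x := z.1 + (-a) • z.2) ⟨mem_univ _, hxa⟩ (y := z.1 + b • z.2) ⟨mem_univ _, hxb⟩
        (a := b / (a + b)) (b := a / (a + b)) (by have := h1.1; positivity)
        (by have := h2.1; positivity) (by field_simp; ring)
      convert this using 1
      have e1 : b / (a + b) + a / (a + b) = 1 := by field_simp; ring
      have e2 : (b / (a + b)) * -a + (a / (a + b)) * b = 0 := by ring
      calc z.1 = (b / (a + b) + a / (a + b)) • z.1 +
            ((b / (a + b)) * -a + (a / (a + b)) * b) • z.2 := by rw [e1, e2]; simp
        _ = _ := by module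
    exact absurd hoc.2 hz0.not_ge
  · refine (hsepcase ?_).trans ?_
    · rw [abs_of_nonneg] <;> linarith
    · gcongr; exact le_max_right _ _
  · refine (hsepcase ?_).trans ?_
    · rw [abs_of_nonpos] <;> linarith
    · gcongr; exact le_max_right _ _
  -- Both ends lie on the outer boundary, so the chord of the shell is already a full chord of Z_1.
  · refine (lineLen_le_of_forall (hρ.convex_sublevel 1) hz.1 h2.1.le h1.1.le
      (fun h => absurd (show ρ _ < 1 from h) hxa.not_gt)
      (fun h => absurd (show ρ _ < 1 from h) hxb.not_gt)).trans ?_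
    refine le_mul_of_one_le_left zero_le ?_
    exact_mod_cast le_max_left _ _

end IsConvexProfile

end Transport

/-! ### Velocity measures, and smallness of the weighted line kernel. -/

namespace Transport

variable {d : ℕ} {ρ : Space d → ℝ}

namespace IsVelocitySpace

variable {V : Set (Space d)} {m : Measure (Space d)} (hV : IsVelocitySpace V m)
include hV

theorem exists_norm_bounds : ∃ c R : ℝ, 0 < c ∧ 0 < R ∧ ∀ v ∈ V, c ≤ ‖v‖ ∧ ‖v‖ ≤ R := by
  obtain ⟨hb, h0⟩ : Bornology.IsBounded V ∧ (0 : Space d) ∉ closure V := by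
    rcases hV with ⟨-, hb, h0, -⟩ | ⟨hc, h0, -⟩
    · exact ⟨hb, h0⟩
    · exact ⟨hc.1.isBounded, by rwa [hc.1.isClosed.closure_eq]⟩
  obtain ⟨R, hR, hRV⟩ := hb.exists_pos_norm_le
  rw [Metric.mem_closure_iff] at h0
  push Not at h0
  obtain ⟨c, hc, hcV⟩ := h0
  exact ⟨c, R, hc, hR, fun v hv => ⟨by simpa using hcV v hv, hRV v hv⟩⟩

theorem measurableSet : MeasurableSet V := by
  rcases hV with ⟨ho, -⟩ | ⟨hc, -⟩
  · exact ho.measurableSet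
  · exact hc.1.measurableSet

theorem isFiniteMeasure : IsFiniteMeasure m := by
  refine ⟨?_⟩
  rcases hV with ⟨-, hb, -, rfl⟩ | ⟨hc, -, rfl⟩
  · rw [Measure.restrict_apply_univ]; exact hb.measure_lt_top
  · rw [Measure.restrict_apply_univ]
    have := measure_lt_top_of_locally_level hc.1 fun v hv => by
      obtain ⟨f, h1, h2, h3⟩ := hc.2 v hv
      exact ⟨f, h1, h2, h3.mono fun w hw => hw.1⟩
    rwa [finrank_euclideanSpace, Fintype.card_fin] at this

theorem ae_mem : ∀ᵐ v ∂m, v ∈ V := by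
  have hm := hV.measurableSet
  rcases hV with ⟨-, -, -, rfl⟩ | ⟨-, -, rfl⟩ <;> exact ae_restrict_mem hm

/-- Both kinds of velocity set are locally closed. This allows test functions to be built from
compactly supported functions on the whole phase space: the open factor localizes, the closed factor
keeps supports compact. -/
theorem exists_locallyClosed : ∃ U F : Set (Space d), IsOpen U ∧ IsClosed F ∧ V = U ∩ F := by
  rcases hV with ⟨ho, -⟩ | ⟨hc, -⟩
  · exact ⟨V, univ, ho, isClosed_univ, (inter_univ _).symm⟩
  · exact ⟨univ, V, isOpen_univ, hc.1.isClosed, (univ_inter _).symm⟩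

/-- On a hypersurface the local defining function gives a level chart, whose relatively open pieces
have positive measure. -/
theorem measure_pos {O : Set (Space d)} (hO : IsOpen O) (hne : (O ∩ V).Nonempty) : 0 < m O := by
  rcases hV with ⟨ho, -, -, rfl⟩ | ⟨hc, -, rfl⟩
  · rw [Measure.restrict_apply hO.measurableSet]
    exact (hO.inter ho).measure_pos _ hne
  · obtain ⟨v, hvO, hvV⟩ := hne
    obtain ⟨f, hf, hd, hev⟩ := hc.2 v hvV
    obtain ⟨N, hN, hNo, hvN⟩ := mem_nhds_iff.1 hev
    obtain ⟨e, U, c, K, G, hchart⟩ := exists_levelChart hf hd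
    have h := hchart.measure_pos ((hN hvN).1 hvV) (hO.inter hNo) ⟨hvO, hvN⟩
    rw [finrank_euclideanSpace, Fintype.card_fin] at h
    rw [Measure.restrict_apply hO.measurableSet]
    exact h.trans_le (measure_mono fun y hy => ⟨hy.1.1, (hN hy.1.2).2 hy.2⟩)

end IsVelocitySpace

/-- The points whose line misses `Z_{1-ε}`, together with the points at which the flow leaves the
sublevel sets of `ρ`. -/
def forwardSet (ρ : Space d → ℝ) (ε : ℝ) : Set (Space d × Space d) :=
  {z | (∀ t : ℝ, ¬ ρ (flow t z).1 < 1 - ε) ∨ 0 < fderiv ℝ ρ z.1 z.2}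

theorem continuous_flow (t : ℝ) : Continuous (flow (d := d) t) := by unfold flow; fun_prop

namespace IsConvexProfile

variable (hρ : IsConvexProfile ρ)
include hρ

theorem isOpen_hit (s : ℝ) : IsOpen {z : Space d × Space d | ∃ t : ℝ, ρ (flow t z).1 < s} := by
  have : {z : Space d × Space d | ∃ t : ℝ, ρ (flow t z).1 < s} =
      ⋃ t : ℝ, {z | ρ (flow t z).1 < s} := by ext z; simp
  rw [this]
  exact isOpen_iUnion fun t => isOpen_lt (hρ.continuous.comp (continuous_fst.comp
    (continuous_flow t))) continuous_const

theorem measurableSet_forwardSet (ε : ℝ) : MeasurableSet (forwardSet ρ ε) := by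
  refine MeasurableSet.union ?_ (measurableSet_lt measurable_const hρ.measurable_fderiv_apply)
  have h : {z : Space d × Space d | ∀ t : ℝ, ¬ ρ (flow t z).1 < 1 - ε} =
      {z | ∃ t : ℝ, ρ (flow t z).1 < 1 - ε}ᶜ := by ext z; simp
  change MeasurableSet {z : Space d × Space d | ∀ t : ℝ, ¬ ρ (flow t z).1 < 1 - ε}
  rw [h]
  exact (hρ.isOpen_hit (1 - ε)).measurableSet.compl

/-- The weighted line kernel is dominated by an integrable function with small integral. -/
theorem exists_kernel_bound {c : ℝ} (hc : 0 < c) {θ : ℝ} (hθ : 0 < θ) :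
    ∃ ε : ℝ, 0 < ε ∧ ε < 1 ∧ ∃ l : ℝ, 0 ≤ l ∧ ∃ κ : ℝ → ℝ≥0∞, Measurable κ ∧
      ∫⁻ s, κ s ≤ ENNReal.ofReal θ ∧ ∀ (z : Space d × Space d) (s : ℝ), c ≤ ‖z.2‖ → z.1 ∈ shell ρ →
        (flow s z).1 ∈ shell ρ → lineKernel (forwardSet ρ ε) s (flow s z) ≠ 0 →
        ENNReal.ofReal (Real.exp (-(l * (ρ z.1 - ρ (flow s z).1)))) ≤ κ s := by
  obtain ⟨L, hL, hLz⟩ := exists_lineLen_le (hρ.isBounded_sublevel 1) hc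
  -- Points closer than δ are less than θ/12 apart in time. With height 3 on a window of length θ/6
  -- this part of κ contributes θ/2.
  set δ := θ * c / 12 with hδ
  have hδ0 : 0 < δ := by positivity
  obtain ⟨η, hη, huc⟩ := hρ.uniform_convexity hδ0
  -- The weight is made strong enough that far pairs, over a window of length 2L, contribute at most
  -- θ/2.
  obtain ⟨l, hl0, hl⟩ : ∃ l : ℝ, 0 < l ∧ Real.exp (-(l * η)) * (2 * L) ≤ θ / 2 := by
    have hL' : (0 : ℝ) < L := hL
    have h1 : Tendsto (fun l : ℝ => Real.exp (-(l * η)) * (2 * L)) atTop (𝓝 (0 * (2 * L))) :=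
      ((Real.tendsto_exp_neg_atTop_nhds_zero.comp
        (tendsto_id.atTop_mul_const hη))).mul_const _
    rw [zero_mul] at h1
    obtain ⟨l, h2, h3⟩ := ((h1.eventually_le_const (half_pos hθ)).and (eventually_gt_atTop 0)).exists
    exact ⟨l, h3, h2⟩
  -- The constraints ensure ε < 1, ε < η, so that points of the shell on a line missing Z_{1-ε} are
  -- close, and lε ≤ 1, so that the weight varies on them by a factor of at most e < 3.
  set ε := min (1 / 2) (min (η / 2) (1 / l)) with hε
  have hε0 : 0 < ε := by positivity
  have hε1 : ε < 1 := (min_le_left _ _).trans_lt (by norm_num)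
  have hεη : ε < η := ((min_le_right _ _).trans (min_le_left _ _)).trans_lt (by linarith)
  have hεl : l * ε ≤ 1 := by
    have : ε ≤ 1 / l := (min_le_right _ _).trans (min_le_right _ _)
    calc l * ε ≤ l * (1 / l) := by gcongr
      _ = 1 := by field_simp
  refine ⟨ε, hε0, hε1, l, hl0.le, fun s => (Icc (-(δ / c)) (δ / c)).indicator
    (fun _ => ENNReal.ofReal 3) s + (Icc (-L : ℝ) L).indicator
      (fun _ => ENNReal.ofReal (Real.exp (-(l * η)))) s, ?_, ?_, ?_⟩
  · exact (measurable_const.indicator measurableSet_Icc).add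
      (measurable_const.indicator measurableSet_Icc)
  · rw [lintegral_add_left (measurable_const.indicator measurableSet_Icc),
      lintegral_indicator_const measurableSet_Icc, lintegral_indicator_const measurableSet_Icc,
      Real.volume_Icc, Real.volume_Icc, sub_neg_eq_add, sub_neg_eq_add,
      ← ENNReal.ofReal_mul (by norm_num),
      ← ENNReal.ofReal_mul (by positivity), ← ENNReal.ofReal_add (by positivity) (by positivity)]
    refine ENNReal.ofReal_le_ofReal ?_
    have e1 : δ / c = θ / 12 := by rw [hδ]; field_simp
    rw [e1]
    have e2 : Real.exp (-(l * η)) * ((L : ℝ) + L) = Real.exp (-(l * η)) * (2 * L) := by ring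
    rw [e2]
    linarith
  · intro z s hz hzX hsX hk
    have hzX' := hzX
    have hsX' := hsX
    rw [hρ.shell_eq] at hzX' hsX'
    set w := flow s z with hw
    have hdist : dist z.1 w.1 = |s| * ‖z.2‖ := by
      rw [dist_eq_norm, hw, flow_fst, sub_add_cancel_left, norm_neg, norm_smul, Real.norm_eq_abs]
    have hclose : dist z.1 w.1 < δ → s ∈ Icc (-(δ / c)) (δ / c) := by
      intro h
      rw [hdist] at h
      rw [mem_Icc, ← abs_le, le_div_iff₀ hc]
      exact (mul_le_mul_of_nonneg_left hz (abs_nonneg s)).trans h.le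
    have hsL : s ∈ Icc (-L : ℝ) L := by
      rw [mem_Icc, ← abs_le]
      exact (hLz z hz).2 s hzX.1 hsX.1
    by_cases hgr : ∀ t : ℝ, ¬ ρ (flow t w).1 < 1 - ε
    · -- grazing lines
      have hd : dist z.1 w.1 < δ := by
        by_contra! h
        have h1 := huc z.1 w.1 hzX'.2.le hsX'.2.le h
        -- Time -s/2 from w reaches the midpoint of z and w. At distance δ or more, uniform
        -- convexity would put it below 1 - η, hence inside Z_{1-ε}.
        refine hgr (-s / 2) ?_
        have e : (flow (-s / 2) w).1 = midpoint ℝ z.1 w.1 := by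
          rw [hw, midpoint_eq_smul_add, flow_flow, flow_fst, flow_fst, invOf_eq_inv]
          module
        rw [e]
        linarith [hzX'.2, hsX'.2]
      refine le_add_of_le_of_nonneg ?_ zero_le
      rw [indicator_of_mem (hclose hd)]
      refine ENNReal.ofReal_le_ofReal ?_
      have h0 : 1 - ε ≤ ρ z.1 := by
        have := hgr (-s)
        rw [hw, flow_flow, neg_add_cancel, flow_zero] at this
        exact not_lt.1 this
      have h2 : -(l * (ρ z.1 - ρ w.1)) ≤ 1 := by
        have : l * (ρ w.1 - ρ z.1) ≤ l * ε := by
          gcongr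
          linarith [hsX'.2]
        linarith
      exact (Real.exp_le_exp.2 h2).trans (Real.exp_one_lt_d9.le.trans (by norm_num))
    · -- other lines
      have hD : 0 ≤ fderiv ℝ ρ w.1 (z.1 - w.1) := by
        have e : z.1 - w.1 = (-s) • w.2 := by rw [hw, flow_fst, flow_snd]; module
        rw [e, map_smul, smul_eq_mul]
        -- A nonzero kernel forces the sign of ∇ρ·v at the source w to match the direction from w to
        -- z: influence goes uphill.
        rcases lt_trichotomy s 0 with h | h | h
        · have hP : w ∈ forwardSet ρ ε := by
            by_contra hP
            exact hk (by simp [lineKernel, indicator, h, hP, h.not_gt])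
          have := hP.resolve_left hgr
          exact mul_nonneg (by linarith) this.le
        · exact absurd (by simp [lineKernel, h]) hk
        · have hP : w ∉ forwardSet ρ ε := by
            intro hP
            exact hk (by simp [lineKernel, indicator, h, hP, h.not_gt])
          have : ¬ 0 < fderiv ℝ ρ w.1 w.2 := fun h => hP (Or.inr h)
          exact mul_nonneg_of_nonpos_of_nonpos (by linarith) (not_lt.1 this)
      have hle : ρ w.1 ≤ ρ z.1 := by linarith [hρ.first_order_le w.1 z.1]
      by_cases hd : dist z.1 w.1 < δ
      · refine le_add_of_le_of_nonneg ?_ zero_le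
        rw [indicator_of_mem (hclose hd)]
        refine ENNReal.ofReal_le_ofReal ?_
        have : Real.exp (-(l * (ρ z.1 - ρ w.1))) ≤ 1 := by
          rw [Real.exp_le_one_iff, neg_nonpos]
          exact mul_nonneg hl0.le (by linarith)
        linarith
      · refine le_add_of_nonneg_of_le zero_le ?_
        rw [indicator_of_mem hsL]
        refine ENNReal.ofReal_le_ofReal (Real.exp_le_exp.2 ?_)
        have h1 := huc z.1 w.1 hzX'.2.le hsX'.2.le (not_lt.1 hd)
        -- Going uphill from w, the midpoint is at least as high as w; the convexity gap then forces
        -- ρ(z) - ρ(w) ≥ 2η.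
        have h2 := hρ.first_order_le w.1 (midpoint ℝ z.1 w.1)
        have e : midpoint ℝ z.1 w.1 - w.1 = (1 / 2 : ℝ) • (z.1 - w.1) := by
          rw [midpoint_eq_smul_add, invOf_eq_inv]; module
        rw [e, map_smul, smul_eq_mul] at h2
        have h3 : η ≤ ρ z.1 - ρ w.1 := by linarith
        have := mul_le_mul_of_nonneg_left h3 hl0.le
        linarith

end IsConvexProfile

end Transport

/-! ### Boundedness of the collision operator on L^p. -/

namespace Transport

variable {d : ℕ}

/-- The collision term `∫ k(x,v',v) u(x,v') dv' - σ u`. -/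
noncomputable def collision (m : Measure (Space d)) (σ : Space d × Space d → ℝ)
    (k : Space d → Space d → Space d → ℝ) (u : Space d × Space d → ℝ) (z : Space d × Space d) : ℝ :=
  ∫ v', k z.1 v' z.2 * u (z.1, v') ∂m - σ z * u z

variable {X : Set (Space d)} {m : Measure (Space d)} [IsFiniteMeasure m] {p : ℝ}
  {σ : Space d × Space d → ℝ} {k : Space d → Space d → Space d → ℝ}

theorem ae_phase_of_ae {P : Space d → Prop} (h : ∀ᵐ x ∂(volume.restrict X), P x) :
    ∀ᵐ z ∂(phaseMeasure X m), P z.1 :=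
  Measure.quasiMeasurePreserving_fst.ae h

theorem ae_ae_of_ae_phase {P : Space d × Space d → Prop} (h : ∀ᵐ z ∂(phaseMeasure X m), P z) :
    ∀ᵐ z ∂(phaseMeasure X m), ∀ᵐ v' ∂m, P (z.1, v') :=
  ae_phase_of_ae (P := fun x => ∀ᵐ v' ∂m, P (x, v')) (Measure.ae_ae_of_ae_prod h)

theorem collision_congr {u u' : Space d × Space d → ℝ} (h : u =ᵐ[phaseMeasure X m] u') :
    collision m σ k u =ᵐ[phaseMeasure X m] collision m σ k u' := by
  filter_upwards [h, ae_ae_of_ae_phase h] with z h1 h2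
  unfold collision
  rw [h1]
  congr 1
  refine integral_congr_ae ?_
  filter_upwards [h2] with v' hv'
  rw [hv']

/-- Rearrangement of the variables `(x, v', v)` of the scattering coefficient. -/
theorem quasiMeasurePreserving_rearrange :
    Measure.QuasiMeasurePreserving
      (fun q : (Space d × Space d) × Space d => (q.1.1, (q.2, q.1.2)))
      ((phaseMeasure X m).prod m) ((volume.restrict X).prod (m.prod m)) := by
  have h1 : MeasurePreserving (MeasurableEquiv.prodAssoc : (Space d × Space d) × Space d ≃ᵐ _)
      ((phaseMeasure X m).prod m) ((volume.restrict X).prod (m.prod m)) :=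
    measurePreserving_prodAssoc _ _ _
  have h2 : MeasurePreserving (Prod.map id Prod.swap : Space d × Space d × Space d → _)
      ((volume.restrict X).prod (m.prod m)) ((volume.restrict X).prod (m.prod m)) :=
    (MeasurePreserving.id _).prod Measure.measurePreserving_swap
  exact (h2.comp h1).quasiMeasurePreserving

/-- A bound for the scattering operator with nonnegative kernel. -/
theorem exists_scattering_bound (hp : 1 ≤ p) (hk : AdmissibleScattering X m p k) :
    AEStronglyMeasurable (fun q : (Space d × Space d) × Space d => k q.1.1 q.2 q.1.2)
      ((phaseMeasure X m).prod m) ∧ ∃ C : ℝ≥0, ∀ u : Space d × Space d → ℝ≥0∞, Measurable u →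
      ∫⁻ z, (∫⁻ v', ‖k z.1 v' z.2‖ₑ * u (z.1, v') ∂m) ^ p ∂(phaseMeasure X m) ≤
        C * ∫⁻ z, u z ^ p ∂(phaseMeasure X m) := by
  have hu1 : ∀ u : Space d × Space d → ℝ≥0∞, Measurable u → ∀ x, Measurable fun v => u (x, v) :=
    fun u hu x => hu.comp measurable_prodMk_left
  rcases hp.eq_or_lt with h1 | h1
  · have hk1 := hk.1 h1.symm
    have hm := hk1.1.comp_quasiMeasurePreserving (quasiMeasurePreserving_rearrange (m := m) (X := X))
    refine ⟨hm, (eLpNormEssSup (fun y : Space d × Space d × Space d => k y.1 y.2.1 y.2.2)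
      ((volume.restrict X).prod (m.prod m))).toNNReal * (m univ).toNNReal, fun u hu => ?_⟩
    set C := eLpNormEssSup (fun y : Space d × Space d × Space d => k y.1 y.2.1 y.2.2)
      ((volume.restrict X).prod (m.prod m)) with hC
    have hCtop : C ≠ ⊤ := by
      have := hk1.2
      rw [eLpNorm_exponent_top] at this
      exact this.ne
    rw [ENNReal.coe_mul, ENNReal.coe_toNNReal hCtop, ENNReal.coe_toNNReal (measure_ne_top _ _)]
    simp only [← h1, ENNReal.rpow_one]
    have hb : ∀ᵐ q ∂((phaseMeasure X m).prod m),
        ‖k q.1.1 q.2 q.1.2‖ₑ ≤ C :=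
      quasiMeasurePreserving_rearrange.ae (enorm_ae_le_eLpNormEssSup _ _)
    have hum : Measurable fun x => ∫⁻ v', u (x, v') ∂m := hu.lintegral_prod_right'
    calc _ ≤ ∫⁻ z, C * ∫⁻ v', u (z.1, v') ∂m ∂(phaseMeasure X m) := by
          refine lintegral_mono_ae ?_
          filter_upwards [Measure.ae_ae_of_ae_prod hb] with z hz
          rw [← lintegral_const_mul _ (hu1 u hu z.1)]
          refine lintegral_mono_ae ?_
          filter_upwards [hz] with v' hv'
          gcongr
      _ = C * ∫⁻ x in X, ∫⁻ _ : Space d, ∫⁻ v', u (x, v') ∂m ∂m := by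
          have hf : Measurable fun z : Space d × Space d => ∫⁻ v', u (z.1, v') ∂m :=
            hum.comp measurable_fst
          rw [lintegral_const_mul _ hf, phaseMeasure, lintegral_prod _ hf.aemeasurable]
      _ = _ := by
          rw [phaseMeasure, lintegral_prod _ hu.aemeasurable, mul_assoc]
          congr 1
          rw [← lintegral_const_mul _ hum]
          refine lintegral_congr fun x => ?_
          rw [lintegral_const, mul_comm]
  · obtain ⟨hkm, C, hC⟩ := hk.2 h1
    have hm := hkm.comp_quasiMeasurePreserving (quasiMeasurePreserving_rearrange (m := m) (X := X))
    refine ⟨hm, C, fun u hu => ?_⟩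
    have hpq := Real.HolderConjugate.conjExponent h1
    have hp0 : 0 < p := by linarith
    have hup : Measurable fun z => u z ^ p := hu.pow_const p
    have hum : Measurable fun x => ∫⁻ v', u (x, v') ^ p ∂m := hup.lintegral_prod_right'
    have hkz : ∀ᵐ z ∂(phaseMeasure X m), AEMeasurable (fun v' => ‖k z.1 v' z.2‖ₑ) m := by
      filter_upwards [hm.prodMk_left] with z hz
      exact hz.enorm
    -- Hölder in v' separates the kernel from u. The kernel factor is then integrated over v and
    -- bounded uniformly in x.
    calc _ ≤ ∫⁻ z, (∫⁻ v', ‖k z.1 v' z.2‖ₑ ^ (p / (p - 1)) ∂m) ^ (p - 1) *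
          ∫⁻ v', u (z.1, v') ^ p ∂m ∂(phaseMeasure X m) := by
          refine lintegral_mono_ae ?_
          filter_upwards [hkz] with z hz
          have h := ENNReal.lintegral_mul_le_Lp_mul_Lq m hpq.symm hz (hu1 u hu z.1).aemeasurable
          refine (ENNReal.rpow_le_rpow h hp0.le).trans_eq ?_
          rw [ENNReal.mul_rpow_of_nonneg _ _ hp0.le, ← ENNReal.rpow_mul, ← ENNReal.rpow_mul]
          congr 1
          · rw [Real.conjExponent]
            congr 1
            field_simp
          · rw [one_div, inv_mul_cancel₀ hp0.ne', ENNReal.rpow_one]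
      _ ≤ ∫⁻ x in X, ∫⁻ v, (∫⁻ v', ‖k x v' v‖ₑ ^ (p / (p - 1)) ∂m) ^ (p - 1) *
          ∫⁻ v', u (x, v') ^ p ∂m ∂m := lintegral_prod_le _
      _ ≤ ∫⁻ x in X, C * ∫⁻ v', u (x, v') ^ p ∂m := by
          refine lintegral_mono_ae ?_
          have hkx : ∀ᵐ x ∂(volume.restrict X), AEMeasurable (fun v =>
              (∫⁻ v', ‖k x v' v‖ₑ ^ (p / (p - 1)) ∂m) ^ (p - 1)) m := by
            filter_upwards [hkm.prodMk_left] with x hx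
            have h2 : AEMeasurable (fun q : Space d × Space d => ‖k x q.2 q.1‖ₑ ^ (p / (p - 1)))
                (m.prod m) := by
              have := hx.comp_quasiMeasurePreserving
                (Measure.measurePreserving_swap (μ := m) (ν := m)).quasiMeasurePreserving
              exact this.enorm.pow_const _
            exact h2.lintegral_prod_right'.pow_const _
          filter_upwards [hC, hkx] with x hx hx2
          rw [lintegral_mul_const'' _ hx2]
          gcongr
      _ = _ := by
          rw [lintegral_const_mul _ hum, phaseMeasure, lintegral_prod _ hup.aemeasurable]

theorem memLp_iff_lintegral_lt_top {α : Type*} [MeasurableSpace α] {ν : Measure α} {g : α → ℝ}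
    (hp : 1 ≤ p) (hg : AEStronglyMeasurable g ν) :
    MemLp g (ENNReal.ofReal p) ν ↔ ∫⁻ a, ‖g a‖ₑ ^ p ∂ν < ⊤ := by
  have hp0 : 0 < p := by linarith
  have h0 : ENNReal.ofReal p ≠ 0 := by simpa using hp0
  rw [MemLp, and_iff_right hg, eLpNorm_lt_top_iff_lintegral_rpow_enorm_lt_top h0 ENNReal.ofReal_ne_top,
    ENNReal.toReal_ofReal hp0.le]

theorem enorm_sub_rpow_le (hp : 1 ≤ p) (a b : ℝ) :
    ‖a - b‖ₑ ^ p ≤ 2 ^ (p - 1) * (‖a‖ₑ ^ p + ‖b‖ₑ ^ p) := by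
  refine (ENNReal.rpow_le_rpow enorm_sub_le (by linarith)).trans ?_
  exact ENNReal.rpow_add_le_mul_rpow_add_rpow _ _ hp

/-- Boundedness of the collision operator on `L^p`. -/
theorem exists_collision_bound (hp : 1 ≤ p) (hσ : BoundedAbsorption X m σ)
    (hk : AdmissibleScattering X m p k) : ∃ C : ℝ≥0, ∀ u : Space d × Space d → ℝ,
      MemLp u (ENNReal.ofReal p) (phaseMeasure X m) →
      (∀ᵐ z ∂(phaseMeasure X m), Integrable (fun v' => k z.1 v' z.2 * u (z.1, v')) m) ∧
      AEStronglyMeasurable (collision m σ k u) (phaseMeasure X m) ∧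
      ∫⁻ z, ‖collision m σ k u z‖ₑ ^ p ∂(phaseMeasure X m) ≤
        C * ∫⁻ z, ‖u z‖ₑ ^ p ∂(phaseMeasure X m) := by
  obtain ⟨hkm, C, hC⟩ := exists_scattering_bound hp hk
  have hp0 : 0 < p := by linarith
  set Cσ := eLpNormEssSup σ (phaseMeasure X m) with hCσ
  have hCσtop : Cσ ≠ ⊤ := by
    have := hσ.2
    rw [eLpNorm_exponent_top] at this
    exact this.ne
  refine ⟨2 ^ (p - 1) * (C + Cσ.toNNReal ^ p), fun u hu => ?_⟩
  -- reduction to a measurable representative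
  have main : ∀ u : Space d × Space d → ℝ, Measurable u →
      MemLp u (ENNReal.ofReal p) (phaseMeasure X m) →
      (∀ᵐ z ∂(phaseMeasure X m), Integrable (fun v' => k z.1 v' z.2 * u (z.1, v')) m) ∧
      AEStronglyMeasurable (collision m σ k u) (phaseMeasure X m) ∧
      ∫⁻ z, ‖collision m σ k u z‖ₑ ^ p ∂(phaseMeasure X m) ≤
        (2 ^ (p - 1) * (C + Cσ.toNNReal ^ p) : ℝ≥0) * ∫⁻ z, ‖u z‖ₑ ^ p ∂(phaseMeasure X m) := by
    intro u hum hu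
    have hbd := hC (fun z => ‖u z‖ₑ) hum.enorm
    have hfin := (memLp_iff_lintegral_lt_top hp hu.1).1 hu
    have hprod : AEStronglyMeasurable (fun q : (Space d × Space d) × Space d =>
        k q.1.1 q.2 q.1.2 * u (q.1.1, q.2)) ((phaseMeasure X m).prod m) := by
      refine hkm.mul (Measurable.aestronglyMeasurable ?_)
      exact hum.comp (by fun_prop)
    have hKm : AEStronglyMeasurable (fun z => ∫ v', k z.1 v' z.2 * u (z.1, v') ∂m)
        (phaseMeasure X m) := hprod.integral_prod_right'
    have habs : AEMeasurable (fun z : Space d × Space d => (∫⁻ v', ‖k z.1 v' z.2‖ₑ * ‖u (z.1, v')‖ₑ ∂m) ^ p)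
        (phaseMeasure X m) := by
      have h2 := hprod.enorm
      simp only [enorm_mul] at h2
      exact h2.lintegral_prod_right'.pow_const p
    refine ⟨?_, hKm.sub (hσ.1.mul hu.1), ?_⟩
    · have hlt := ae_lt_top' habs (hbd.trans_lt (ENNReal.mul_lt_top ENNReal.coe_lt_top hfin)).ne
      filter_upwards [hlt, hprod.prodMk_left] with z h1 h2
      refine ⟨h2, ?_⟩
      rw [HasFiniteIntegral]
      simp only [enorm_mul]
      exact (ENNReal.rpow_lt_top_iff_of_pos hp0).1 h1
    · have hKle : ∀ z : Space d × Space d, ‖∫ v', k z.1 v' z.2 * u (z.1, v') ∂m‖ₑ ≤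
          ∫⁻ v', ‖k z.1 v' z.2‖ₑ * ‖u (z.1, v')‖ₑ ∂m := by
        intro z
        refine (enorm_integral_le_lintegral_enorm _).trans_eq ?_
        simp only [enorm_mul]
      have hu2 : Measurable fun z => ‖u z‖ₑ ^ p := hum.enorm.pow_const p
      calc _ ≤ ∫⁻ z, 2 ^ (p - 1) * ((∫⁻ v', ‖k z.1 v' z.2‖ₑ * ‖u (z.1, v')‖ₑ ∂m) ^ p +
            Cσ ^ p * ‖u z‖ₑ ^ p) ∂(phaseMeasure X m) := by
            refine lintegral_mono_ae ?_
            filter_upwards [enorm_ae_le_eLpNormEssSup σ (phaseMeasure X m)] with z hz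
            refine (enorm_sub_rpow_le hp _ _).trans ?_
            gcongr
            · exact hKle z
            · rw [enorm_mul, ENNReal.mul_rpow_of_nonneg _ _ hp0.le]
              gcongr
        _ = 2 ^ (p - 1) * (∫⁻ z, (∫⁻ v', ‖k z.1 v' z.2‖ₑ * ‖u (z.1, v')‖ₑ ∂m) ^ p ∂(phaseMeasure X m)
            + Cσ ^ p * ∫⁻ z, ‖u z‖ₑ ^ p ∂(phaseMeasure X m)) := by
            rw [lintegral_const_mul' _ _ (by finiteness), lintegral_add_right _ (hu2.const_mul _),
              lintegral_const_mul _ hu2]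
        _ ≤ 2 ^ (p - 1) * (C * ∫⁻ z, ‖u z‖ₑ ^ p ∂(phaseMeasure X m)
            + Cσ ^ p * ∫⁻ z, ‖u z‖ₑ ^ p ∂(phaseMeasure X m)) := by
            gcongr
        _ = _ := by
            rw [ENNReal.coe_mul, ENNReal.coe_add, ENNReal.coe_rpow_of_nonneg _ hp0.le,
              ENNReal.coe_toNNReal hCσtop, ENNReal.coe_rpow_of_nonneg _ (by linarith), ← add_mul,
              mul_assoc]
            simp
  obtain ⟨u', hu'm, huu'⟩ := hu.1.aemeasurable
  obtain ⟨h1, h2, h3⟩ := main u' hu'm (hu.ae_eq huu')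
  have hcc := collision_congr (σ := σ) (k := k) huu'
  refine ⟨?_, h2.congr hcc.symm, ?_⟩
  · filter_upwards [h1, ae_ae_of_ae_phase huu'] with z hz hz2
    refine hz.congr ?_
    filter_upwards [hz2] with v' hv'
    rw [hv']
  · have e1 : ∫⁻ z, ‖collision m σ k u z‖ₑ ^ p ∂(phaseMeasure X m) =
        ∫⁻ z, ‖collision m σ k u' z‖ₑ ^ p ∂(phaseMeasure X m) :=
      lintegral_congr_ae (hcc.mono fun z hz => by simp only [hz])
    have e2 : ∫⁻ z, ‖u z‖ₑ ^ p ∂(phaseMeasure X m) = ∫⁻ z, ‖u' z‖ₑ ^ p ∂(phaseMeasure X m) :=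
      lintegral_congr_ae (huu'.mono fun z hz => by simp only [hz])
    rw [e1, e2]
    exact h3

theorem collision_sub {u u' : Space d × Space d → ℝ} {z : Space d × Space d}
    (h : Integrable (fun v' => k z.1 v' z.2 * u (z.1, v')) m)
    (h' : Integrable (fun v' => k z.1 v' z.2 * u' (z.1, v')) m) :
    collision m σ k (u - u') z = collision m σ k u z - collision m σ k u' z := by
  unfold collision
  simp only [Pi.sub_apply, mul_sub]
  rw [integral_sub h h']
  ring

/-- The collision operator acts in the velocity only, so a weight in x passes through it. This is
why the weight must not depend on v. -/
theorem collision_weight (W : Space d → ℝ) (u : Space d × Space d → ℝ) (z : Space d × Space d) :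
    collision m σ k (fun z => W z.1 * u z) z = W z.1 * collision m σ k u z := by
  unfold collision
  rw [mul_sub, ← integral_const_mul]
  congr 1
  · congr 1; ext v'; ring
  · ring

end Transport

/-! ### The weighted contraction and solvability on the shell. -/

namespace Transport

variable {d : ℕ} {X : Set (Space d)} {m : Measure (Space d)} [IsFiniteMeasure m] {p : ℝ}

theorem phaseMeasure_eq_restrict (X : Set (Space d)) (m : Measure (Space d)) [SFinite m] :
    phaseMeasure X m = ((volume : Measure (Space d)).prod m).restrict (X ×ˢ univ) := by
  rw [phaseMeasure, ← Measure.prod_restrict, Measure.restrict_univ]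

theorem ae_phaseMeasure_of_ae {Q : Space d × Space d → Prop}
    (h : ∀ᵐ z ∂((volume : Measure (Space d)).prod m), Q z) : ∀ᵐ z ∂(phaseMeasure X m), Q z := by
  rw [phaseMeasure_eq_restrict]
  exact ae_restrict_of_ae h

theorem ae_phaseMeasure_mem (hX : MeasurableSet X) : ∀ᵐ z ∂(phaseMeasure X m), z.1 ∈ X := by
  rw [phaseMeasure_eq_restrict]
  filter_upwards [ae_restrict_mem (hX.prod MeasurableSet.univ)] with z hz using hz.1

theorem lintegral_eq_of_support (hX : MeasurableSet X) {F : Space d × Space d → ℝ≥0∞}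
    (hF : ∀ z, z.1 ∉ X → F z = 0) :
    ∫⁻ z, F z ∂((volume : Measure (Space d)).prod m) = ∫⁻ z, F z ∂(phaseMeasure X m) := by
  rw [phaseMeasure_eq_restrict, ← lintegral_indicator (hX.prod MeasurableSet.univ)]
  refine lintegral_congr fun z => ?_
  by_cases h : z.1 ∈ X
  · rw [indicator_of_mem (by simpa using h)]
  · rw [indicator_of_notMem (by simpa using h), hF z h]

theorem memLp_volume_prod (hp : 1 ≤ p) (hX : MeasurableSet X) {g : Space d × Space d → ℝ}
    (hg : Measurable g) (hsupp : ∀ z, z.1 ∉ X → g z = 0)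
    (hgp : MemLp g (ENNReal.ofReal p) (phaseMeasure X m)) :
    MemLp g (ENNReal.ofReal p) ((volume : Measure (Space d)).prod m) := by
  rw [memLp_iff_lintegral_lt_top hp hg.aestronglyMeasurable]
  rw [lintegral_eq_of_support hX]
  · exact (memLp_iff_lintegral_lt_top hp hgp.1).1 hgp
  · intro z hz
    rw [hsupp z hz]
    simp [show 0 < p by linarith]

theorem isFiniteMeasure_phaseMeasure (hb : Bornology.IsBounded X) :
    IsFiniteMeasure (phaseMeasure X m) := by
  have : IsFiniteMeasure ((volume : Measure (Space d)).restrict X) :=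
    ⟨by rw [Measure.restrict_apply_univ]; exact hb.measure_lt_top⟩
  unfold phaseMeasure
  infer_instance

/-- On a bounded domain the phase measure is finite, so L^p functions are integrable and Fubini
along the flow applies. -/
theorem ae_integrable_flow (hp : 1 ≤ p) (hX : MeasurableSet X) (hb : Bornology.IsBounded X)
    (h0 : ∀ᵐ v ∂m, v ≠ 0) {g : Space d × Space d → ℝ} (hg : Measurable g)
    (hsupp : ∀ z, z.1 ∉ X → g z = 0)
    (hgp : MemLp g (ENNReal.ofReal p) ((volume : Measure (Space d)).prod m)) :
    ∀ᵐ z ∂((volume : Measure (Space d)).prod m), Integrable fun s : ℝ => g (flow s z) := by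
  have hfin := isFiniteMeasure_phaseMeasure (m := m) hb
  have h1 : MemLp g (ENNReal.ofReal p) (phaseMeasure X m) := by
    rw [phaseMeasure_eq_restrict]; exact hgp.restrict _
  have h2 : Integrable g (phaseMeasure X m) :=
    h1.integrable (by simpa using hp)
  have h3 : Integrable g ((volume : Measure (Space d)).prod m) := by
    refine ⟨hg.aestronglyMeasurable, ?_⟩
    rw [HasFiniteIntegral, lintegral_eq_of_support hX]
    · exact h2.2
    · intro z hz; rw [hsupp z hz, enorm_zero]
  have h4 : ∀ᵐ z ∂((volume : Measure (Space d)).prod m), z.2 ≠ 0 :=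
    Measure.quasiMeasurePreserving_snd.ae h0
  filter_upwards [ae_integrable_line hg h3 hb hsupp, h4] with z hz hz0 using hz hz0

theorem ae_norm_le {c : ℝ} (hc : ∀ᵐ v ∂m, c ≤ ‖v‖) :
    ∀ᵐ z ∂((volume : Measure (Space d)).prod m), c ≤ ‖z.2‖ :=
  Measure.quasiMeasurePreserving_snd.ae hc

/-- Weighted estimate for the line operator, from a pointwise bound on the weighted kernel. -/
theorem lintegral_weight_lineOp_le (hp : 1 ≤ p) (hX : MeasurableSet X)
    {P : Set (Space d × Space d)} {c : ℝ} (hc : ∀ᵐ v ∂m, c ≤ ‖v‖)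
    {r : Space d → ℝ} (hr : Measurable r) {κ : ℝ → ℝ≥0∞} (hκ : Measurable κ)
    (hb : ∀ (z : Space d × Space d) (s : ℝ), c ≤ ‖z.2‖ → z.1 ∈ X →
        (flow s z).1 ∈ X → lineKernel P s (flow s z) ≠ 0 →
        ENNReal.ofReal (Real.exp (-(r z.1 - r (flow s z).1))) ≤ κ s)
    {g : Space d × Space d → ℝ} (hg : Measurable g) (hsupp : ∀ z, z.1 ∉ X → g z = 0) :
    ∫⁻ z, ‖Real.exp (-r z.1) * lineOp P g z‖ₑ ^ p ∂(phaseMeasure X m) ≤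
      (∫⁻ s, κ s) ^ p * ∫⁻ z, ‖Real.exp (-r z.1) * g z‖ₑ ^ p ∂(phaseMeasure X m) := by
  have hp0 : 0 < p := by linarith
  set G : Space d × Space d → ℝ := fun z => Real.exp (-r z.1) * g z with hG
  have hGm : Measurable G := (Real.measurable_exp.comp (hr.comp measurable_fst).neg).mul hg
  have hGs : ∀ z, z.1 ∉ X → G z = 0 := fun z hz => by simp [hG, hsupp z hz]
  rw [← lintegral_eq_of_support (F := fun z => ‖G z‖ₑ ^ p) hX
    (fun z hz => by simp [hGs z hz, hp0])]
  refine le_trans ?_ (lintegral_conv_flow_rpow_le hκ hGm.enorm hp)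
  rw [phaseMeasure_eq_restrict]
  refine le_trans ?_ (setLIntegral_le_lintegral (X ×ˢ univ) _)
  refine setLIntegral_mono_ae' (hX.prod MeasurableSet.univ) ?_
  filter_upwards [ae_norm_le hc] with z hz hzX
  refine ENNReal.rpow_le_rpow ?_ hp0.le
  have h1 : ‖lineOp P g z‖ₑ ≤ ∫⁻ s, ‖lineKernel P s (flow s z) * g (flow s z)‖ₑ :=
    enorm_integral_le_lintegral_enorm _
  rw [enorm_mul]
  refine (mul_le_mul_right h1 _).trans ?_
  rw [← lintegral_const_mul' _ _ enorm_ne_top]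
  refine lintegral_mono fun s => ?_
  by_cases hs : (flow s z).1 ∈ X
  swap
  · simp [hsupp _ hs]
  by_cases hk : lineKernel P s (flow s z) = 0
  · simp [hk]
  rw [hG, enorm_mul, enorm_mul, ← mul_assoc, ← mul_assoc]
  refine mul_le_mul_left ?_ _
  have hk1 : ‖lineKernel P s (flow s z)‖ₑ ≤ 1 := by
    rw [← ofReal_norm, Real.norm_eq_abs]
    exact ENNReal.ofReal_le_one.2 (abs_lineKernel_le _ _ _)
  calc _ ≤ ‖Real.exp (-r z.1)‖ₑ * 1 := mul_le_mul_right hk1 _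
    -- The weight is moved from z to the source point; the quotient of the two weights is what κ
    -- dominates.
    _ = ENNReal.ofReal (Real.exp (-(r z.1 - r (flow s z).1))) *
        ‖Real.exp (-r (flow s z).1)‖ₑ := by
        rw [mul_one, Real.enorm_eq_ofReal (Real.exp_pos _).le,
          Real.enorm_eq_ofReal (Real.exp_pos _).le, ← ENNReal.ofReal_mul (Real.exp_pos _).le,
          ← Real.exp_add]
        congr 2
        ring
    _ ≤ _ := mul_le_mul_left (hb z s hz hzX.1 hs hk) _

/-- Solvability of the transport equation, in integrated form, when the line operator is a strict
contraction relative to the collision operator in a weighted space. -/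
theorem exists_fixed_point (hp : 1 ≤ p) (hX : MeasurableSet X) (hbd : Bornology.IsBounded X)
    {P : Set (Space d × Space d)} (hP : MeasurableSet P) {c : ℝ} (hc0 : 0 < c)
    (hc : ∀ᵐ v ∂m, c ≤ ‖v‖)
    {σ : Space d × Space d → ℝ} {k : Space d → Space d → Space d → ℝ} {C : ℝ≥0}
    (hC : ∀ u : Space d × Space d → ℝ, MemLp u (ENNReal.ofReal p) (phaseMeasure X m) →
      (∀ᵐ z ∂(phaseMeasure X m), Integrable (fun v' => k z.1 v' z.2 * u (z.1, v')) m) ∧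
      AEStronglyMeasurable (collision m σ k u) (phaseMeasure X m) ∧
      ∫⁻ z, ‖collision m σ k u z‖ₑ ^ p ∂(phaseMeasure X m) ≤
        C * ∫⁻ z, ‖u z‖ₑ ^ p ∂(phaseMeasure X m))
    {r : Space d → ℝ} (hr : Measurable r) {B : ℝ} (hrB : ∀ x ∈ X, |r x| ≤ B) {κ : ℝ → ℝ≥0∞}
    (hκ : Measurable κ) (hκC : C * (∫⁻ s, κ s) ^ p ≤ (1 / 2 : ℝ≥0) ^ p)
    (hκ1 : ∫⁻ s, κ s < ⊤)
    (hb : ∀ (z : Space d × Space d) (s : ℝ), c ≤ ‖z.2‖ → z.1 ∈ X →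
        (flow s z).1 ∈ X → lineKernel P s (flow s z) ≠ 0 →
        ENNReal.ofReal (Real.exp (-(r z.1 - r (flow s z).1))) ≤ κ s)
    {U : Space d × Space d → ℝ} (hU : MemLp U (ENNReal.ofReal p) (phaseMeasure X m)) :
    ∃ w : Space d × Space d → ℝ, Measurable w ∧ (∀ z, z.1 ∉ X → w z = 0) ∧
      MemLp w (ENNReal.ofReal p) ((volume : Measure (Space d)).prod m) ∧
      ∀ᵐ z ∂(phaseMeasure X m), w z = collision m σ k (U + lineOp P w) z := by
  have hp0 : 0 < p := by linarith
  have hfact : Fact (1 ≤ ENNReal.ofReal p) := ⟨by simpa using hp⟩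
  set ν := phaseMeasure X m with hν
  have hXae : ∀ᵐ z ∂ν, z.1 ∈ X := ae_phaseMeasure_mem hX
  have hv0 : ∀ᵐ v ∂m, v ≠ 0 := hc.mono fun v hv h => by simp [h] at hv; linarith
  set W : Space d → ℝ := fun x => Real.exp (-r x) with hW
  have hWm : Measurable W := Real.measurable_exp.comp hr.neg
  have hWm2 : Measurable fun z : Space d × Space d => W z.1 := hWm.comp measurable_fst
  have hWpos : ∀ x, 0 < W x := fun x => Real.exp_pos _
  -- multiplication by the weight
  have hmulW : ∀ f : Space d × Space d → ℝ, MemLp f (ENNReal.ofReal p) ν →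
      MemLp (fun z => W z.1 * f z) (ENNReal.ofReal p) ν := by
    intro f hf
    refine MemLp.of_le_mul (c := Real.exp B) hf (hWm2.aestronglyMeasurable.mul hf.1) ?_
    filter_upwards [hXae] with z hz
    rw [norm_mul]
    refine mul_le_mul_of_nonneg_right ?_ (norm_nonneg _)
    rw [Real.norm_of_nonneg (hWpos _).le]
    exact Real.exp_le_exp.2 (by linarith [(abs_le.1 (hrB _ hz)).1])
  have hdivW : ∀ f : Space d × Space d → ℝ, AEStronglyMeasurable f ν →
      MemLp (fun z => W z.1 * f z) (ENNReal.ofReal p) ν → MemLp f (ENNReal.ofReal p) ν := by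
    intro f hfm hf
    refine MemLp.of_le_mul (c := Real.exp B) hf hfm ?_
    filter_upwards [hXae] with z hz
    rw [norm_mul, ← mul_assoc, Real.norm_of_nonneg (hWpos _).le]
    refine le_mul_of_one_le_left (norm_nonneg _) ?_
    rw [hW, ← Real.exp_add]
    exact Real.one_le_exp (by linarith [(abs_le.1 (hrB _ hz)).2])
  -- sources
  let src : (Space d × Space d → ℝ) → Space d × Space d → ℝ := fun f =>
    (X ×ˢ univ).indicator fun z => (W z.1)⁻¹ * f z
  have hsrcm : ∀ f, Measurable f → Measurable (src f) := fun f hf =>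
    (hWm2.inv.mul hf).indicator (hX.prod MeasurableSet.univ)
  have hsrc0 : ∀ f z, z.1 ∉ X → src f z = 0 := fun f z hz =>
    indicator_of_notMem (by simpa using hz) _
  have hsrcW : ∀ f, ∀ z, z.1 ∈ X → W z.1 * src f z = f z := fun f z hz => by
    have : src f z = (W z.1)⁻¹ * f z := indicator_of_mem (by simpa using hz) _
    rw [this, mul_inv_cancel_left₀ (hWpos _).ne']
  have hsrcp : ∀ f, Measurable f → MemLp f (ENNReal.ofReal p) ν →
      MemLp (src f) (ENNReal.ofReal p) ((volume : Measure (Space d)).prod m) := by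
    intro f hf hfp
    refine memLp_volume_prod hp hX (hsrcm f hf) (hsrc0 f) (hdivW _ (hsrcm f hf).aestronglyMeasurable ?_)
    refine hfp.ae_eq ?_
    filter_upwards [hXae] with z hz using (hsrcW f z hz).symm
  -- weighted estimate
  have hest : ∀ f, Measurable f → ∫⁻ z, ‖W z.1 * lineOp P (src f) z‖ₑ ^ p ∂ν ≤
      (∫⁻ s, κ s) ^ p * ∫⁻ z, ‖f z‖ₑ ^ p ∂ν := by
    intro f hf
    refine (lintegral_weight_lineOp_le hp hX hc hr hκ hb (hsrcm f hf) (hsrc0 f)).trans_eq ?_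
    congr 1
    refine lintegral_congr_ae ?_
    filter_upwards [hXae] with z hz
    rw [← hsrcW f z hz]
  have hlinp : ∀ f, Measurable f → MemLp f (ENNReal.ofReal p) ν →
      MemLp (lineOp P (src f)) (ENNReal.ofReal p) ν := by
    intro f hf hfp
    have hm := measurable_lineOp hP (hsrcm f hf)
    refine hdivW _ hm.aestronglyMeasurable ?_
    refine (memLp_iff_lintegral_lt_top hp (hWm2.mul hm).aestronglyMeasurable).2 ?_
    refine (hest f hf).trans_lt (ENNReal.mul_lt_top ?_ ((memLp_iff_lintegral_lt_top hp hfp.1).1 hfp))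
    exact ENNReal.rpow_lt_top_of_nonneg hp0.le hκ1.ne
  -- the map
  have hu : ∀ f : Lp ℝ (ENNReal.ofReal p) ν, MemLp (U + lineOp P (src f)) (ENNReal.ofReal p) ν :=
    fun f => hU.add (hlinp f (Lp.stronglyMeasurable f).measurable (Lp.memLp f))
  have hcol : ∀ f : Lp ℝ (ENNReal.ofReal p) ν,
      MemLp (fun z => W z.1 * collision m σ k (U + lineOp P (src f)) z) (ENNReal.ofReal p) ν := by
    intro f
    obtain ⟨-, h2, h3⟩ := hC _ (hu f)
    refine hmulW _ ((memLp_iff_lintegral_lt_top hp h2).2 (h3.trans_lt ?_))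
    exact ENNReal.mul_lt_top ENNReal.coe_lt_top ((memLp_iff_lintegral_lt_top hp (hu f).1).1 (hu f))
  -- The unknown is the weighted source f = W·w rather than u, so the contraction takes place in the
  -- unweighted L^p.
  let F : Lp ℝ (ENNReal.ofReal p) ν → Lp ℝ (ENNReal.ofReal p) ν := fun f => (hcol f).toLp _
  have hcontr : ContractingWith (1 / 2 : ℝ≥0) F := by
    refine ⟨by rw [div_lt_one] <;> norm_num, fun f f' => ?_⟩
    have hfm := (Lp.stronglyMeasurable f).measurable
    have hfm' := (Lp.stronglyMeasurable f').measurable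
    have hfi := ae_integrable_flow hp hX hbd hv0 (hsrcm f hfm) (hsrc0 f)
      (hsrcp f hfm (Lp.memLp f))
    have hfi' := ae_integrable_flow hp hX hbd hv0 (hsrcm f' hfm') (hsrc0 f')
      (hsrcp f' hfm' (Lp.memLp f'))
    set D : Space d × Space d → ℝ := fun z => f z - f' z with hD
    have hDm : Measurable D := hfm.sub hfm'
    have hDp : MemLp D (ENNReal.ofReal p) ν := (Lp.memLp f).sub (Lp.memLp f')
    have hsD : src D = fun z => src f z - src f' z := by
      funext z
      by_cases hz : z.1 ∈ X
      · simp only [src, indicator_of_mem (show z ∈ X ×ˢ (univ : Set (Space d)) by simpa using hz), hD]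
        ring
      · rw [hsrc0 _ _ hz, hsrc0 _ _ hz, hsrc0 _ _ hz, sub_zero]
    -- Linearity holds on almost every line only, because the line integrals have to exist.
    have hlin : ∀ᵐ z ∂ν, lineOp P (src f) z - lineOp P (src f') z = lineOp P (src D) z := by
      refine ae_phaseMeasure_of_ae ?_
      filter_upwards [hfi, hfi'] with z hz hz'
      rw [hsD]
      unfold lineOp
      rw [← integral_sub (integrable_lineOp_integrand hP (hsrcm f hfm) hz)
        (integrable_lineOp_integrand hP (hsrcm f' hfm') hz')]
      simp only [mul_sub]
    -- The free term U cancels in the difference, so the Lipschitz constant does not depend on it.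
    have hdiff : ∀ᵐ z ∂ν, W z.1 * collision m σ k (U + lineOp P (src f)) z -
        W z.1 * collision m σ k (U + lineOp P (src f')) z =
        collision m σ k (fun z => W z.1 * lineOp P (src D) z) z := by
      have hcc : collision m σ k ((U + lineOp P (src f)) - (U + lineOp P (src f'))) =ᵐ[ν]
          collision m σ k (lineOp P (src D)) := by
        refine collision_congr ?_
        filter_upwards [hlin] with z hz
        simp only [Pi.sub_apply, Pi.add_apply]
        rw [← hz]; ring
      filter_upwards [(hC _ (hu f)).1, (hC _ (hu f')).1, hcc] with z h1 h2 h3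
      rw [collision_weight, ← h3, collision_sub h1 h2]
      ring
    rw [Lp.edist_toLp_toLp, Lp.edist_def]
    have hp1 : ENNReal.ofReal p ≠ 0 := by simpa using hp0
    rw [eLpNorm_eq_lintegral_rpow_enorm_toReal hp1 ENNReal.ofReal_ne_top,
      eLpNorm_eq_lintegral_rpow_enorm_toReal hp1 ENNReal.ofReal_ne_top,
      ENNReal.toReal_ofReal hp0.le]
    have hle : ∫⁻ z, ‖((fun z => W z.1 * collision m σ k (U + lineOp P (src f)) z) -
        fun z => W z.1 * collision m σ k (U + lineOp P (src f')) z) z‖ₑ ^ p ∂ν ≤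
        (1 / 2 : ℝ≥0) ^ p * ∫⁻ z, ‖(⇑f - ⇑f') z‖ₑ ^ p ∂ν := by
      calc _ = ∫⁻ z, ‖collision m σ k (fun z => W z.1 * lineOp P (src D) z) z‖ₑ ^ p ∂ν :=
            lintegral_congr_ae (hdiff.mono fun z hz => by simp only [Pi.sub_apply, hz])
        _ ≤ C * ∫⁻ z, ‖W z.1 * lineOp P (src D) z‖ₑ ^ p ∂ν :=
            (hC _ (hmulW _ (hlinp D hDm hDp))).2.2
        _ ≤ C * ((∫⁻ s, κ s) ^ p * ∫⁻ z, ‖D z‖ₑ ^ p ∂ν) := mul_le_mul_right (hest D hDm) _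
        _ ≤ _ := by
            rw [← mul_assoc]
            exact mul_le_mul_left hκC _
    refine (ENNReal.rpow_le_rpow hle (by positivity)).trans_eq ?_
    rw [ENNReal.mul_rpow_of_nonneg _ _ (by positivity), ← ENNReal.rpow_mul,
      mul_one_div_cancel hp0.ne', ENNReal.rpow_one]
  set f := hcontr.fixedPoint F with hf
  have hfix : F f = f := hcontr.fixedPoint_isFixedPt
  have hfm := (Lp.stronglyMeasurable f).measurable
  refine ⟨src f, hsrcm f hfm, hsrc0 f, hsrcp f hfm (Lp.memLp f), ?_⟩
  have h1 : F f =ᵐ[ν] fun z => W z.1 * collision m σ k (U + lineOp P (src f)) z :=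
    (hcol f).coeFn_toLp
  rw [hfix] at h1
  filter_upwards [h1, hXae] with z hz hzX
  have := hsrcW f z hzX
  rw [hz] at this
  exact mul_left_cancel₀ (hWpos _).ne' this

/-- Solvability on the shell, in integrated form: for every `U ∈ L^p` there is a source `w` such
that `u = U + lineOp w` satisfies `w = collision u`. -/
def IsShellSolvable (ρ : Space d → ℝ) (m : Measure (Space d)) (p : ℝ) (σ : Space d × Space d → ℝ)
    (k : Space d → Space d → Space d → ℝ) (ε : ℝ) : Prop :=
  ∀ U : Space d × Space d → ℝ, MemLp U (ENNReal.ofReal p) (phaseMeasure (shell ρ) m) →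
    ∃ w : Space d × Space d → ℝ, Measurable w ∧ (∀ z, z.1 ∉ shell ρ → w z = 0) ∧
      MemLp w (ENNReal.ofReal p) ((volume : Measure (Space d)).prod m) ∧
      ∀ᵐ z ∂(phaseMeasure (shell ρ) m),
        w z = collision m σ k (U + lineOp (forwardSet ρ ε) w) z

/-- Solutions on the shell, in integrated form. -/
theorem IsConvexProfile.exists_isShellSolvable {ρ : Space d → ℝ} (hρ : IsConvexProfile ρ)
    (hp : 1 ≤ p) {c : ℝ} (hc0 : 0 < c) (hc : ∀ᵐ v ∂m, c ≤ ‖v‖)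
    {σ : Space d × Space d → ℝ} (hσ : BoundedAbsorption (shell ρ) m σ)
    {k : Space d → Space d → Space d → ℝ} (hk : AdmissibleScattering (shell ρ) m p k) :
    ∃ ε : ℝ, 0 < ε ∧ ε < 1 ∧ IsShellSolvable ρ m p σ k ε := by
  have hp0 : 0 < p := by linarith
  obtain ⟨C, hC⟩ := exists_collision_bound hp hσ hk
  have hC1 : (0 : ℝ) < C + 1 := by positivity
  -- With this θ, Cθ^p ≤ (1/2)^p, because C ≤ (C + 1)^p for p ≥ 1.
  obtain ⟨ε, hε0, hε1, l, hl, κ, hκ, hκθ, hb⟩ := hρ.exists_kernel_bound hc0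
    (θ := (1 / 2) / (C + 1)) (by positivity)
  refine ⟨ε, hε0, hε1, fun U hU => ?_⟩
  refine exists_fixed_point hp hρ.isOpen_shell.measurableSet
    ((hρ.isBounded_sublevel 1).subset sdiff_subset) (hρ.measurableSet_forwardSet ε) hc0 hc hC
    (r := fun x => l * ρ x) (hρ.continuous.measurable.const_mul l) (B := l) ?_ hκ ?_
    (hκθ.trans_lt ENNReal.ofReal_lt_top) ?_ hU
  · intro x hx
    rw [hρ.shell_eq] at hx
    rw [abs_mul, abs_of_nonneg hl]
    exact mul_le_of_le_one_right hl (abs_le.2 ⟨by linarith [hx.1], hx.2.le⟩)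
  · have e : ENNReal.ofReal ((1 / 2) / (C + 1)) = ((1 / 2) / (C + 1) : ℝ≥0) := by
      rw [ENNReal.ofReal, Real.toNNReal_of_nonneg (by positivity)]
      congr 1
    calc (C : ℝ≥0∞) * (∫⁻ s, κ s) ^ p ≤ C * (((1 / 2) / (C + 1) : ℝ≥0) : ℝ≥0∞) ^ p := by
          rw [← e]; gcongr
      _ ≤ _ := by
          rw [← ENNReal.coe_rpow_of_nonneg _ hp0.le, ← ENNReal.coe_rpow_of_nonneg _ hp0.le,
            ← ENNReal.coe_mul, ENNReal.coe_le_coe, NNReal.div_rpow, mul_div_assoc',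
            div_le_iff₀ (by positivity), mul_comm]
          refine mul_le_mul_right ?_ _
          calc C ≤ (C + 1) ^ (1 : ℝ) := by rw [NNReal.rpow_one]; exact le_self_add
            _ ≤ (C + 1) ^ p := NNReal.rpow_le_rpow_of_exponent_le le_add_self hp
  · intro z s h1 h2 h3 h4
    have := hb z s h1 h2 h3 h4
    rwa [mul_sub] at this

end Transport

/-! ### Test functions along lines. -/

namespace Transport

variable {d : ℕ} {X V : Set (Space d)}

theorem exists_abs_le_of_flow_mem (hb : Bornology.IsBounded X) {z : Space d × Space d}
    (hz : z.2 ≠ 0) : ∃ L : ℝ, ∀ s : ℝ, (flow s z).1 ∈ X → |s| ≤ L := by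
  obtain ⟨R, -, hR⟩ := hb.exists_pos_norm_le
  refine ⟨(R + ‖z.1‖) / ‖z.2‖, fun s hs => ?_⟩
  rw [le_div_iff₀ (norm_pos_iff.2 hz), ← Real.norm_eq_abs, ← norm_smul]
  calc ‖s • z.2‖ = ‖(flow s z).1 - z.1‖ := by rw [flow_fst, add_sub_cancel_left]
    _ ≤ _ := (norm_sub_le _ _).trans (by linarith [hR _ hs])

theorem hasDerivAt_flow (t : ℝ) (z : Space d × Space d) :
    HasDerivAt (fun t : ℝ => flow t z) (z.2, 0) t := by
  have h1 : HasDerivAt (fun t : ℝ => z.1 + t • z.2) z.2 t := by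
    simpa using ((hasDerivAt_id t).smul_const z.2).const_add z.1
  exact h1.prodMk (hasDerivAt_const t z.2)

section TestFunction

variable {φ : Space d × Space d → ℝ}

theorem transportDeriv_eq (hφ : ContDiff ℝ ∞ φ) (z : Space d × Space d) :
    transportDeriv φ z = fderiv ℝ φ z (z.2, 0) := by
  have h1 : HasFDerivAt (fun x => φ (x, z.2))
      ((fderiv ℝ φ z).comp (ContinuousLinearMap.inl ℝ (Space d) (Space d))) z.1 :=
    ((hφ.differentiable (by simp)) z).hasFDerivAt.comp z.1 (hasFDerivAt_prodMk_left z.1 z.2)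
  rw [transportDeriv, h1.fderiv]
  rfl

theorem continuous_transportDeriv (hφ : ContDiff ℝ ∞ φ) : Continuous (transportDeriv φ) := by
  have : transportDeriv φ = fun z => fderiv ℝ φ z (z.2, 0) := funext (transportDeriv_eq hφ)
  rw [this]
  have := hφ.continuous_fderiv (by simp)
  fun_prop

theorem hasDerivAt_comp_flow (hφ : ContDiff ℝ ∞ φ) (t : ℝ) (z : Space d × Space d) :
    HasDerivAt (fun t : ℝ => φ (flow t z)) (transportDeriv φ (flow t z)) t := by
  rw [transportDeriv_eq hφ]
  exact ((hφ.differentiable (by simp)) _).hasFDerivAt.comp_hasDerivAt t (hasDerivAt_flow t z)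

namespace IsTestFunction

variable (hφ : IsTestFunction X V φ)
include hφ

/-- A test function may be nonzero outside X, hence the cut-off. No jump occurs at ∂X: near a time
outside X the line avoids the compact set K, and there the cut-off function vanishes. -/
theorem hasDerivAt_indicator (hX : IsOpen X) {z : Space d × Space d} (hz : z.2 ∈ V) (t : ℝ) :
    HasDerivAt (fun t : ℝ => (X ×ˢ univ).indicator φ (flow t z))
      ((X ×ˢ univ).indicator (transportDeriv φ) (flow t z)) t := by
  obtain ⟨hc, K, hK, hKX, h0⟩ := hφ
  have hcont : Continuous fun t : ℝ => flow t z :=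
    continuous_flow_uncurry.comp (by fun_prop : Continuous fun t : ℝ => (z, t))
  by_cases ht : (flow t z).1 ∈ X
  · rw [indicator_of_mem (show flow t z ∈ X ×ˢ univ from ⟨ht, trivial⟩)]
    refine (hasDerivAt_comp_flow hc t z).congr_of_eventuallyEq ?_
    filter_upwards [(hX.preimage (continuous_fst.comp hcont)).mem_nhds ht] with s hs
    exact indicator_of_mem (show flow s z ∈ X ×ˢ univ from ⟨hs, trivial⟩) _
  · rw [indicator_of_notMem (fun h => ht h.1)]
    refine (hasDerivAt_const t (0 : ℝ)).congr_of_eventuallyEq ?_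
    have hn : flow t z ∈ Kᶜ := fun h => ht (hKX h).1
    filter_upwards [(hK.isClosed.isOpen_compl.preimage hcont).mem_nhds hn] with s hs
    by_cases hsX : (flow s z).1 ∈ X
    · rw [indicator_of_mem (show flow s z ∈ X ×ˢ univ from ⟨hsX, trivial⟩)]
      exact h0 _ ⟨hsX, hz⟩ hs
    · exact indicator_of_notMem (fun h => hsX h.1) _

/-- On K the bounds come from compactness. Off K the cut-off function vanishes locally along each
line with velocity in V, hence so does its derivative. -/
theorem exists_bound (hX : IsOpen X) : ∃ M : ℝ, 0 ≤ M ∧ ∀ z : Space d × Space d, z.2 ∈ V →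
    |(X ×ˢ univ).indicator φ z| ≤ M ∧ |(X ×ˢ univ).indicator (transportDeriv φ) z| ≤ M := by
  have hd := fun (z : Space d × Space d) (hz : z.2 ∈ V) => hφ.hasDerivAt_indicator hX hz 0
  obtain ⟨hc, K, hK, hKX, h0⟩ := hφ
  obtain ⟨M, hM⟩ := hK.exists_bound_of_continuousOn hc.continuous.continuousOn
  obtain ⟨M', hM'⟩ := hK.exists_bound_of_continuousOn (continuous_transportDeriv hc).continuousOn
  refine ⟨max 0 (max M M'), le_max_left _ _, fun z hz => ?_⟩
  by_cases hzX : z.1 ∈ X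
  swap
  · have hzX' : z ∉ X ×ˢ (univ : Set (Space d)) := fun h => hzX h.1
    simp [indicator_of_notMem hzX']
  by_cases hzK : z ∈ K
  · rw [indicator_of_mem (show z ∈ X ×ˢ univ from ⟨hzX, trivial⟩),
      indicator_of_mem (show z ∈ X ×ˢ univ from ⟨hzX, trivial⟩)]
    exact ⟨(hM z hzK).trans ((le_max_left _ _).trans (le_max_right _ _)),
      (hM' z hzK).trans ((le_max_right _ _).trans (le_max_right _ _))⟩
  · have e1 : (X ×ˢ univ).indicator φ z = 0 := by
      rw [indicator_of_mem (show z ∈ X ×ˢ univ from ⟨hzX, trivial⟩)]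
      exact h0 z ⟨hzX, hz⟩ hzK
    have e2 : (X ×ˢ univ).indicator (transportDeriv φ) z = 0 := by
      have h1 := hd z hz
      rw [flow_zero] at h1
      refine h1.unique ((hasDerivAt_const (0 : ℝ) (0 : ℝ)).congr_of_eventuallyEq ?_)
      have hcont : Continuous fun t : ℝ => flow t z :=
        continuous_flow_uncurry.comp (by fun_prop : Continuous fun t : ℝ => (z, t))
      have hn : (fun t : ℝ => flow t z) 0 ∈ Kᶜ := by simpa using hzK
      filter_upwards [(hK.isClosed.isOpen_compl.preimage hcont).mem_nhds hn] with s hs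
      by_cases hsX : (flow s z).1 ∈ X
      · rw [indicator_of_mem (show flow s z ∈ X ×ˢ univ from ⟨hsX, trivial⟩)]
        exact h0 _ ⟨hsX, hz⟩ hs
      · exact indicator_of_notMem (fun h => hsX h.1) _
    rw [e1, e2]
    simp

omit hφ in
theorem measurable_indicator_transportDeriv (hX : IsOpen X) (hφ : ContDiff ℝ ∞ φ) :
    Measurable ((X ×ˢ univ).indicator (transportDeriv φ)) :=
  (continuous_transportDeriv hφ).measurable.indicator (hX.measurableSet.prod MeasurableSet.univ)

theorem integrable_indicator_transportDeriv (hX : IsOpen X) (hb : Bornology.IsBounded X)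
    {z : Space d × Space d} (hz : z.2 ∈ V) (hz0 : z.2 ≠ 0) :
    Integrable fun t : ℝ => (X ×ˢ univ).indicator (transportDeriv φ) (flow t z) := by
  obtain ⟨M, hM0, hM⟩ := hφ.exists_bound hX
  obtain ⟨L, hL⟩ := exists_abs_le_of_flow_mem hb hz0
  have hi : Integrable ((Icc (-L) L).indicator fun _ : ℝ => M) :=
    (integrableOn_const (by simp)).integrable_indicator measurableSet_Icc
  refine hi.mono' ((measurable_indicator_transportDeriv hX hφ.1).comp
    (measurable_flow_left z)).aestronglyMeasurable (Eventually.of_forall fun t => ?_)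
  by_cases ht : (flow t z).1 ∈ X
  · rw [indicator_of_mem (show t ∈ Icc (-L) L from abs_le.1 (hL t ht))]
    exact (hM (flow t z) hz).2
  · rw [indicator_of_notMem (fun h => ht h.1), norm_zero]
    exact indicator_nonneg (fun _ _ => hM0) _

/-- The transposed kernel integrates the derivative of φ over one half-line starting at z. By the
fundamental theorem of calculus both half-lines give -φ(z), so the choice of P does not matter. -/
theorem integral_lineKernel_mul (hX : IsOpen X) (hb : Bornology.IsBounded X)
    (P : Set (Space d × Space d)) {z : Space d × Space d} (hz : z.2 ∈ V) (hz0 : z.2 ≠ 0) :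
    ∫ s : ℝ, (X ×ˢ univ).indicator (transportDeriv φ) (flow (-s) z) * lineKernel P s z =
      -(X ×ˢ univ).indicator φ z := by
  set f := fun t : ℝ => (X ×ˢ univ).indicator φ (flow t z)
  set f' := fun t : ℝ => (X ×ˢ univ).indicator (transportDeriv φ) (flow t z) with hf'
  have hd : ∀ t, HasDerivAt f (f' t) t := fun t => hφ.hasDerivAt_indicator hX hz t
  have hi : Integrable f' := hφ.integrable_indicator_transportDeriv hX hb hz hz0
  obtain ⟨L, hL⟩ := exists_abs_le_of_flow_mem hb hz0
  have hf0 : ∀ t, L < |t| → f t = 0 := fun t ht =>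
    indicator_of_notMem (fun h => (hL t h.1).not_gt ht) _
  have h1 : Tendsto f atTop (𝓝 0) := by
    refine tendsto_const_nhds.congr' ?_
    filter_upwards [eventually_gt_atTop L] with t ht
    exact (hf0 t (ht.trans_le (le_abs_self t))).symm
  have h2 : Tendsto f atBot (𝓝 0) := by
    refine tendsto_const_nhds.congr' ?_
    filter_upwards [eventually_lt_atBot (-L)] with t ht
    exact (hf0 t ((lt_neg_of_lt_neg ht).trans_le (neg_le_abs t))).symm
  have e0 : (X ×ˢ univ).indicator φ z = f 0 := by simp [f]
  rw [e0]
  have e1 : ∫ t in Ioi (0 : ℝ), f' t = 0 - f 0 :=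
    integral_Ioi_of_hasDerivAt_of_tendsto' (fun x _ => hd x) hi.integrableOn h1
  have e2 : ∫ t in Iic (0 : ℝ), f' t = f 0 - 0 :=
    integral_Iic_of_hasDerivAt_of_tendsto' (fun x _ => hd x) hi.integrableOn h2
  have e3 : ∫ s : ℝ, (X ×ˢ univ).indicator (transportDeriv φ) (flow (-s) z) * lineKernel P s z =
      ∫ s : ℝ, f' s * lineKernel P (-s) z := by
    rw [← integral_neg_eq_self]
    simp only [neg_neg, hf']
  rw [e3]
  by_cases hP : z ∈ P
  · have : ∀ s, f' s * lineKernel P (-s) z = (Ioi (0 : ℝ)).indicator f' s := by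
      intro s
      by_cases hs : 0 < s <;> simp [lineKernel, indicator, hP, hs]
    simp only [this]
    rw [integral_indicator measurableSet_Ioi, e1, zero_sub]
  · have : ∀ s, f' s * lineKernel P (-s) z = -(Iio (0 : ℝ)).indicator f' s := by
      intro s
      by_cases hs : s < 0 <;> simp [lineKernel, indicator, hP, hs]
    simp only [this]
    rw [integral_neg, integral_indicator measurableSet_Iio, ← integral_Iic_eq_integral_Iio, e2,
      sub_zero]

end IsTestFunction

end TestFunction

section Fubini

variable {m : Measure (Space d)} [SFinite m]

theorem measurePreserving_flow_prod :
    MeasurePreserving (fun q : ℝ × (Space d × Space d) => (q.1, flow q.1 q.2))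
      ((volume : Measure ℝ).prod ((volume : Measure (Space d)).prod m))
      ((volume : Measure ℝ).prod ((volume : Measure (Space d)).prod m)) := by
  refine (MeasurePreserving.id (volume : Measure ℝ)).skew_product ?_
    (Eventually.of_forall fun s => (measurePreserving_flow s).map_eq)
  exact measurable_flow_uncurry.comp measurable_swap

/-- Change of base point in an integral along lines. -/
theorem integral_integral_flow {G : ℝ × (Space d × Space d) → ℝ}
    (hG : Integrable G ((volume : Measure ℝ).prod ((volume : Measure (Space d)).prod m))) :
    ∫ z, (∫ s, G (s, flow s z)) ∂((volume : Measure (Space d)).prod m) =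
      ∫ z, (∫ s, G (s, z)) ∂((volume : Measure (Space d)).prod m) := by
  have hΦ := measurePreserving_flow_prod (d := d) (m := m)
  have hG' := (hΦ.integrable_comp hG.1).2 hG
  rw [← integral_prod_symm G hG]
  have h1 := integral_prod_symm _ hG'
  simp only [Function.comp_apply] at h1
  rw [← h1]
  have h2 := integral_map hΦ.measurable.aemeasurable (f := G) (by rw [hΦ.map_eq]; exact hG.1)
  rw [hΦ.map_eq] at h2
  exact h2.symm

end Fubini

end Transport

/-! ### Weak derivatives of line integrals and of locally invariant functions. -/

namespace Transport

variable {d : ℕ} {X V : Set (Space d)} {m : Measure (Space d)} [IsFiniteMeasure m]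

theorem integrable_mul_of_lintegral_le {h : ℝ × (Space d × Space d) → ℝ} (hm : Measurable h)
    {C : ℝ≥0∞} (hC : C ≠ ⊤)
    (hh : ∀ᵐ y ∂((volume : Measure (Space d)).prod m), ∫⁻ s, ‖h (s, y)‖ₑ ≤ C)
    {w : Space d × Space d → ℝ} (hw : Measurable w)
    (hwi : Integrable w ((volume : Measure (Space d)).prod m)) :
    Integrable (fun q : ℝ × (Space d × Space d) => h q * w q.2)
      ((volume : Measure ℝ).prod ((volume : Measure (Space d)).prod m)) := by
  have hmeas : Measurable fun q : ℝ × (Space d × Space d) => h q * w q.2 :=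
    hm.mul (hw.comp measurable_snd)
  refine ⟨hmeas.aestronglyMeasurable, ?_⟩
  rw [HasFiniteIntegral, lintegral_prod_symm _ hmeas.enorm.aemeasurable]
  calc _ ≤ ∫⁻ y, C * ‖w y‖ₑ ∂((volume : Measure (Space d)).prod m) := by
        refine lintegral_mono_ae ?_
        filter_upwards [hh] with y hy
        simp only [enorm_mul]
        rw [lintegral_mul_const' _ _ enorm_ne_top]
        exact mul_le_mul_left hy _
    _ < ⊤ := by
        rw [lintegral_const_mul' _ _ hC]
        exact ENNReal.mul_lt_top hC.lt_top hwi.2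

theorem integral_phaseMeasure (hX : MeasurableSet X) (f : Space d × Space d → ℝ) :
    ∫ z, f z ∂(phaseMeasure X m) =
      ∫ z, (X ×ˢ univ).indicator f z ∂((volume : Measure (Space d)).prod m) := by
  rw [phaseMeasure_eq_restrict, integral_indicator (hX.prod MeasurableSet.univ)]

theorem ae_snd_of_ae {Q : Space d → Prop} (h : ∀ᵐ v ∂m, Q v) :
    ∀ᵐ z ∂((volume : Measure (Space d)).prod m), Q z.2 :=
  Measure.quasiMeasurePreserving_snd.ae h

theorem lintegral_neg_flow (hX : MeasurableSet X) (y : Space d × Space d) :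
    ∫⁻ s : ℝ, X.indicator (1 : Space d → ℝ≥0∞) (flow (-s) y).1 = lineLen X y := by
  rw [lineLen_eq_lintegral hX,
    ← lintegral_neg_eq_self (fun s : ℝ => X.indicator (1 : Space d → ℝ≥0∞) (flow s y).1)]

/-- `lineOp P w` is a primitive of `w` in the sense of weak derivatives. -/
theorem hasWeakTransportDeriv_lineOp (hX : IsOpen X) (hb : Bornology.IsBounded X)
    (hV : ∀ᵐ v ∂m, v ∈ V) {c : ℝ} (hc0 : 0 < c) (hc : ∀ᵐ v ∂m, c ≤ ‖v‖)
    {P : Set (Space d × Space d)} (hP : MeasurableSet P)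
    {w : Space d × Space d → ℝ} (hw : Measurable w)
    (hwi : Integrable w ((volume : Measure (Space d)).prod m)) :
    HasWeakTransportDeriv X V m (lineOp P w) w := by
  intro φ hφ
  obtain ⟨M, hM0, hM⟩ := hφ.exists_bound hX
  obtain ⟨L, -, hL⟩ := exists_lineLen_le hb hc0
  have hψm := IsTestFunction.measurable_indicator_transportDeriv hX hφ.1
  set ψ' := (X ×ˢ univ).indicator (transportDeriv φ) with hψ'
  have hneg : Measurable fun q : ℝ × (Space d × Space d) => flow (-q.1) q.2 :=
    measurable_flow_uncurry.comp (measurable_snd.prodMk measurable_fst.neg)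
  have hint : Integrable (fun q : ℝ × (Space d × Space d) =>
      (ψ' (flow (-q.1) q.2) * lineKernel P q.1 q.2) * w q.2)
      ((volume : Measure ℝ).prod ((volume : Measure (Space d)).prod m)) := by
    refine integrable_mul_of_lintegral_le (C := ENNReal.ofReal M * L) ?_ (by finiteness) ?_ hw hwi
    · exact (hψm.comp hneg).mul ((measurable_lineKernel hP).comp measurable_swap)
    · filter_upwards [ae_snd_of_ae hV, ae_snd_of_ae hc] with y hy hyc
      calc _ ≤ ∫⁻ s : ℝ, ENNReal.ofReal M * X.indicator (1 : Space d → ℝ≥0∞) (flow (-s) y).1 := by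
            refine lintegral_mono fun s => ?_
            rw [Real.enorm_eq_ofReal_abs, abs_mul]
            by_cases hs : (flow (-s) y).1 ∈ X
            · rw [indicator_of_mem hs, Pi.one_apply, mul_one]
              refine ENNReal.ofReal_le_ofReal ?_
              calc _ ≤ M * 1 := mul_le_mul (hM (flow (-s) y) hy).2 (abs_lineKernel_le _ _ _) (abs_nonneg _) hM0
                _ = M := mul_one M
            · have h0 : ψ' (flow (-s) y) = 0 := indicator_of_notMem (fun h => hs h.1) _
              simp [h0]
        _ = ENNReal.ofReal M * lineLen X y := by
            rw [lintegral_const_mul' _ _ ENNReal.ofReal_ne_top, lintegral_neg_flow hX.measurableSet]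
        _ ≤ _ := mul_le_mul_right (hL y hyc).1 _
  -- The base point is moved from z to the source, so that the inner integral becomes the one
  -- computed in `integral_lineKernel_mul`.
  have hswap := integral_integral_flow hint
  rw [integral_phaseMeasure hX.measurableSet, integral_phaseMeasure hX.measurableSet]
  have e1 : ∀ z, (X ×ˢ univ).indicator (fun z => lineOp P w z * transportDeriv φ z) z =
      ∫ s, (ψ' (flow (-s) (flow s z)) * lineKernel P s (flow s z)) * w (flow s z) := by
    intro z
    simp only [flow_flow, neg_add_cancel, flow_zero, mul_assoc]
    rw [integral_const_mul, mul_comm]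
    exact indicator_mul_right (X ×ˢ univ) (lineOp P w) (transportDeriv φ)
  simp only [e1]
  rw [hswap, ← integral_neg]
  refine integral_congr_ae ?_
  filter_upwards [ae_snd_of_ae hV, ae_snd_of_ae hc] with y hy hyc
  have hy0 : y.2 ≠ 0 := fun h => by rw [h, norm_zero] at hyc; linarith
  rw [integral_mul_const, hφ.integral_lineKernel_mul hX hb P hy hy0, neg_mul, mul_comm,
    ← indicator_mul_right]

theorem lineLen_pos (hX : IsOpen X) (hb : Bornology.IsBounded X) {z : Space d × Space d}
    (hz : z.1 ∈ X) (hz0 : z.2 ≠ 0) : 0 < lineLen X z :=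
  (ENNReal.ofReal_pos.2 (travelTime_pos hX hb hz hz0)).trans_le
    (ofReal_travelTime_le_lineLen hX hb subset_rfl hz hz0)

/-- A function which is locally constant along lines has vanishing weak derivative. -/
theorem hasWeakTransportDeriv_zero (hX : IsOpen X) (hb : Bornology.IsBounded X)
    (hV : ∀ᵐ v ∂m, v ∈ V) {c : ℝ} (hc0 : 0 < c) (hc : ∀ᵐ v ∂m, c ≤ ‖v‖)
    {U : Space d × Space d → ℝ} (hU : Measurable U) (hUi : Integrable U (phaseMeasure X m))
    (hloc : ∀ z, z.1 ∈ X → z.2 ∈ V → ∀ᶠ t in 𝓝 (0 : ℝ), U (flow t z) = U z) :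
    HasWeakTransportDeriv X V m U fun _ => 0 := by
  intro φ hφ
  obtain ⟨M, hM0, hM⟩ := hφ.exists_bound hX
  obtain ⟨L, -, hL⟩ := exists_lineLen_le hb hc0
  have hψm := IsTestFunction.measurable_indicator_transportDeriv hX hφ.1
  set ψ' := (X ×ˢ univ).indicator (transportDeriv φ) with hψ'
  set ψ := (X ×ˢ univ).indicator φ with hψ
  have hneg : Measurable fun q : ℝ × (Space d × Space d) => flow (-q.1) q.2 :=
    measurable_flow_uncurry.comp (measurable_snd.prodMk measurable_fst.neg)
  have hUX : Integrable ((X ×ˢ univ).indicator U) ((volume : Measure (Space d)).prod m) := by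
    rw [integrable_indicator_iff (hX.measurableSet.prod MeasurableSet.univ)]
    rwa [phaseMeasure_eq_restrict] at hUi
  have hUψ : Integrable (fun z => U z * ψ' z) ((volume : Measure (Space d)).prod m) := by
    have := hUX.bdd_mul (c := M) hψm.aestronglyMeasurable
      (by filter_upwards [ae_snd_of_ae hV] with y hy using (hM y hy).2)
    refine this.congr (Eventually.of_forall fun z => ?_)
    by_cases hz : z ∈ X ×ˢ (univ : Set (Space d))
    · simp [hψ', indicator_of_mem hz, mul_comm]
    · simp [hψ', indicator_of_notMem hz]
  -- a cut-off with integral one along lines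
  set a : Space d × Space d → ℝ := (X ×ˢ univ).indicator fun z => (lineLen X z).toReal⁻¹ with ha
  have ham : Measurable a :=
    (measurable_lineLen hX.measurableSet).ennreal_toReal.inv.indicator
      (hX.measurableSet.prod MeasurableSet.univ)
  have hline : ∀ y : Space d × Space d, ∫⁻ s : ℝ, ‖a (flow (-s) y)‖ₑ =
      ENNReal.ofReal (lineLen X y).toReal⁻¹ * lineLen X y := by
    intro y
    rw [← lintegral_neg_flow hX.measurableSet y, ← lintegral_const_mul' _ _ ENNReal.ofReal_ne_top,
      lintegral_neg_flow hX.measurableSet y]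
    refine lintegral_congr fun s => ?_
    by_cases hs : (flow (-s) y).1 ∈ X
    · rw [indicator_of_mem hs, ha, indicator_of_mem (show flow (-s) y ∈ X ×ˢ univ from ⟨hs, trivial⟩),
        lineLen_flow, Real.enorm_of_nonneg (by positivity)]
      simp
    · rw [indicator_of_notMem hs, ha, indicator_of_notMem (fun h => hs h.1)]
      simp
  have hline1 : ∀ y : Space d × Space d, c ≤ ‖y.2‖ → ∫⁻ s : ℝ, ‖a (flow (-s) y)‖ₑ ≤ 1 := by
    intro y hy
    rw [hline]
    have hfin : lineLen X y ≠ ⊤ := ((hL y hy).1.trans_lt ENNReal.coe_lt_top).ne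
    rcases eq_or_ne (lineLen X y) 0 with h0 | h0
    · simp [h0]
    · rw [ENNReal.ofReal_inv_of_pos (ENNReal.toReal_pos h0 hfin), ENNReal.ofReal_toReal hfin,
        ENNReal.inv_mul_cancel h0 hfin]
  have hint : Integrable (fun q : ℝ × (Space d × Space d) =>
      a (flow (-q.1) q.2) * (U q.2 * ψ' q.2))
      ((volume : Measure ℝ).prod ((volume : Measure (Space d)).prod m)) := by
    refine integrable_mul_of_lintegral_le (C := 1) (ham.comp hneg) (by finiteness) ?_
      (hU.mul hψm) hUψ
    filter_upwards [ae_snd_of_ae hc] with y hyc using hline1 y hyc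
  have hswap := integral_integral_flow hint
  have e1 : ∫ z, (∫ s, a (flow (-s) z) * (U z * ψ' z)) ∂((volume : Measure (Space d)).prod m) =
      ∫ z, U z * transportDeriv φ z ∂(phaseMeasure X m) := by
    rw [integral_phaseMeasure hX.measurableSet]
    refine integral_congr_ae ?_
    filter_upwards [ae_snd_of_ae hc] with y hyc
    have hy0 : y.2 ≠ 0 := fun h => by rw [h, norm_zero] at hyc; linarith
    rw [integral_mul_const]
    by_cases hy : y.1 ∈ X
    swap
    · have hyX : y ∉ X ×ˢ (univ : Set (Space d)) := fun h => hy h.1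
      simp [hψ', indicator_of_notMem hyX]
    have hyX : y ∈ X ×ˢ (univ : Set (Space d)) := ⟨hy, trivial⟩
    rw [hψ', indicator_of_mem hyX, indicator_of_mem hyX]
    have hfin : lineLen X y ≠ ⊤ := ((hL y hyc).1.trans_lt ENNReal.coe_lt_top).ne
    have h0 : lineLen X y ≠ 0 := (lineLen_pos hX hb hy hy0).ne'
    have : ∫ s : ℝ, a (flow (-s) y) = 1 := by
      rw [integral_eq_lintegral_of_nonneg_ae (Eventually.of_forall fun s =>
        indicator_nonneg (fun _ _ => by positivity) _)
        (ham.comp (hneg.comp measurable_prodMk_right)).aestronglyMeasurable]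
      have h1 := hline y
      rw [ENNReal.ofReal_inv_of_pos (ENNReal.toReal_pos h0 hfin), ENNReal.ofReal_toReal hfin,
        ENNReal.inv_mul_cancel h0 hfin] at h1
      rw [← ENNReal.toReal_one, ← h1]
      congr 1
      refine lintegral_congr fun s => ?_
      rw [Real.enorm_of_nonneg]
      exact indicator_nonneg (fun _ _ => by positivity) _
    rw [this, one_mul]
  -- The factor 1 = ∫ a ds has been inserted. After the change of base point, a(z) multiplies the
  -- integral of U·∂φ over the whole line, which is the integral of an exact derivative.
  rw [← e1, ← hswap]
  simp only [zero_mul, integral_zero, neg_zero]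
  refine integral_eq_zero_of_ae ?_
  filter_upwards [ae_snd_of_ae hc, ae_snd_of_ae hV] with z hzc hzV
  have hz0 : z.2 ≠ 0 := fun h => by rw [h, norm_zero] at hzc; linarith
  simp only [flow_flow, neg_add_cancel, flow_zero, Pi.zero_apply]
  rw [integral_const_mul, mul_eq_zero]
  right
  -- On lines without integrability the Bochner integral is zero by convention, which is the value
  -- wanted.
  by_cases hi : Integrable fun s => U (flow s z) * ψ' (flow s z)
  swap
  · exact integral_undef hi
  obtain ⟨L', hL'⟩ := exists_abs_le_of_flow_mem hb hz0
  have hf0 : ∀ t, L' < |t| → U (flow t z) * ψ (flow t z) = 0 := fun t ht => by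
    rw [hψ, indicator_of_notMem (fun h => (hL' t h.1).not_gt ht), mul_zero]
  have hd : ∀ t, HasDerivAt (fun t => U (flow t z) * ψ (flow t z)) (U (flow t z) * ψ' (flow t z)) t := by
    intro t
    have h1 : HasDerivAt (fun s => ψ (flow s z)) (ψ' (flow t z)) t :=
      hφ.hasDerivAt_indicator hX hzV t
    by_cases ht : (flow t z).1 ∈ X
    · refine (h1.const_mul (U (flow t z))).congr_of_eventuallyEq ?_
      have h2 : Tendsto (fun s : ℝ => s - t) (𝓝 t) (𝓝 0) := by
        have : Continuous fun s : ℝ => s - t := by fun_prop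
        simpa using this.tendsto t
      filter_upwards [h2.eventually (hloc (flow t z) ht hzV)] with s hs
      rw [flow_flow, sub_add_cancel] at hs
      rw [hs]
    · have e0 : ψ' (flow t z) = 0 := indicator_of_notMem (fun h => ht h.1) _
      rw [e0, mul_zero]
      refine (hasDerivAt_const t (0 : ℝ)).congr_of_eventuallyEq ?_
      obtain ⟨-, K, hK, hKX, hK0⟩ := hφ
      have hcont : Continuous fun t : ℝ => flow t z :=
        continuous_flow_uncurry.comp (by fun_prop : Continuous fun t : ℝ => (z, t))
      have hn : flow t z ∈ Kᶜ := fun h => ht (hKX h).1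
      filter_upwards [(hK.isClosed.isOpen_compl.preimage hcont).mem_nhds hn] with s hs
      rw [mul_eq_zero]; right
      by_cases hsX : (flow s z).1 ∈ X
      · rw [hψ, indicator_of_mem (show flow s z ∈ X ×ˢ univ from ⟨hsX, trivial⟩)]
        exact hK0 _ ⟨hsX, hzV⟩ hs
      · exact indicator_of_notMem (fun h => hsX h.1) _
  have h1 : Tendsto (fun t => U (flow t z) * ψ (flow t z)) atTop (𝓝 0) := by
    refine tendsto_const_nhds.congr' ?_
    filter_upwards [eventually_gt_atTop L'] with t ht
    exact (hf0 t (ht.trans_le (le_abs_self t))).symm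
  have h2 : Tendsto (fun t => U (flow t z) * ψ (flow t z)) atBot (𝓝 0) := by
    refine tendsto_const_nhds.congr' ?_
    filter_upwards [eventually_lt_atBot (-L')] with t ht
    exact (hf0 t ((lt_neg_of_lt_neg ht).trans_le (neg_le_abs t))).symm
  rw [integral_of_hasDerivAt_of_tendsto hd hi h2 h1, sub_zero]

theorem IsTestFunction.integrable_mul (hX : IsOpen X) (hV : ∀ᵐ v ∂m, v ∈ V)
    {φ : Space d × Space d → ℝ} (hφ : IsTestFunction X V φ) {f : Space d × Space d → ℝ}
    (hf : Integrable f (phaseMeasure X m)) :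
    Integrable (fun z => f z * φ z) (phaseMeasure X m) ∧
      Integrable (fun z => f z * transportDeriv φ z) (phaseMeasure X m) := by
  obtain ⟨M, hM0, hM⟩ := hφ.exists_bound hX
  have h := ae_phaseMeasure_of_ae (X := X) (ae_snd_of_ae hV)
  have h2 := ae_phaseMeasure_mem (m := m) hX.measurableSet
  refine ⟨hf.mul_bdd (c := M) hφ.1.continuous.aestronglyMeasurable ?_,
    hf.mul_bdd (c := M) (continuous_transportDeriv hφ.1).aestronglyMeasurable ?_⟩
  · filter_upwards [h, h2] with z hz hz2
    have := (hM z hz).1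
    rwa [indicator_of_mem (show z ∈ X ×ˢ univ from ⟨hz2, trivial⟩)] at this
  · filter_upwards [h, h2] with z hz hz2
    have := (hM z hz).2
    rwa [indicator_of_mem (show z ∈ X ×ˢ univ from ⟨hz2, trivial⟩)] at this

theorem HasWeakTransportDeriv.add (hX : IsOpen X) (hV : ∀ᵐ v ∂m, v ∈ V)
    {u u' w w' : Space d × Space d → ℝ} (h : HasWeakTransportDeriv X V m u w)
    (h' : HasWeakTransportDeriv X V m u' w') (hu : Integrable u (phaseMeasure X m))
    (hu' : Integrable u' (phaseMeasure X m)) (hw : Integrable w (phaseMeasure X m))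
    (hw' : Integrable w' (phaseMeasure X m)) :
    HasWeakTransportDeriv X V m (u + u') (w + w') := by
  intro φ hφ
  simp only [Pi.add_apply, add_mul]
  rw [integral_add (hφ.integrable_mul hX hV hu).2 (hφ.integrable_mul hX hV hu').2,
    integral_add (hφ.integrable_mul hX hV hw).1 (hφ.integrable_mul hX hV hw').1, h φ hφ, h' φ hφ,
    neg_add]

theorem HasWeakTransportDeriv.sub (hX : IsOpen X) (hV : ∀ᵐ v ∂m, v ∈ V)
    {u u' w w' : Space d × Space d → ℝ} (h : HasWeakTransportDeriv X V m u w)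
    (h' : HasWeakTransportDeriv X V m u' w') (hu : Integrable u (phaseMeasure X m))
    (hu' : Integrable u' (phaseMeasure X m)) (hw : Integrable w (phaseMeasure X m))
    (hw' : Integrable w' (phaseMeasure X m)) :
    HasWeakTransportDeriv X V m (u - u') (w - w') := by
  intro φ hφ
  simp only [Pi.sub_apply, sub_mul]
  rw [integral_sub (hφ.integrable_mul hX hV hu).2 (hφ.integrable_mul hX hV hu').2,
    integral_sub (hφ.integrable_mul hX hV hw).1 (hφ.integrable_mul hX hV hw').1, h φ hφ, h' φ hφ]
  ring

theorem HasWeakTransportDeriv.congr {u u' w w' : Space d × Space d → ℝ}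
    (h : HasWeakTransportDeriv X V m u w) (hu : u =ᵐ[phaseMeasure X m] u')
    (hw : w =ᵐ[phaseMeasure X m] w') : HasWeakTransportDeriv X V m u' w' := by
  intro φ hφ
  have e1 : ∫ z, u' z * transportDeriv φ z ∂(phaseMeasure X m) =
      ∫ z, u z * transportDeriv φ z ∂(phaseMeasure X m) :=
    integral_congr_ae (hu.mono fun z hz => by simp only [hz])
  have e2 : ∫ z, w' z * φ z ∂(phaseMeasure X m) = ∫ z, w z * φ z ∂(phaseMeasure X m) :=
    integral_congr_ae (hw.mono fun z hz => by simp only [hz])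
  rw [e1, e2, h φ hφ]

end Transport

/-! ### Functions with vanishing weak derivative. -/

namespace Transport

variable {d : ℕ} {Z V : Set (Space d)} {m : Measure (Space d)} [IsFiniteMeasure m]

theorem contDiff_flow (s : ℝ) : ContDiff ℝ ∞ (flow (d := d) s) := by
  unfold flow
  fun_prop

theorem transportDeriv_comp_flow {g : Space d × Space d → ℝ} (hg : ContDiff ℝ ∞ g) (s : ℝ)
    (z : Space d × Space d) :
    transportDeriv (fun z => g (flow s z)) z = transportDeriv g (flow s z) := by
  have h1 := hasDerivAt_comp_flow (hg.comp (contDiff_flow s)) 0 z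
  have h2 := hasDerivAt_comp_flow hg s z
  rw [flow_zero] at h1
  refine h1.unique ?_
  have h3 : HasDerivAt (fun t : ℝ => s + t) 1 0 := by simpa using (hasDerivAt_id (0 : ℝ)).const_add s
  have h4 : HasDerivAt (fun t => g (flow t z)) (transportDeriv g (flow s z)) (s + 0) := by
    rwa [add_zero]
  have h5 := h4.comp (0 : ℝ) h3
  rw [mul_one] at h5
  refine h5.congr_of_eventuallyEq (Eventually.of_forall fun t => ?_)
  simp [flow_flow]

/-- A function with vanishing weak derivative is invariant under the flow. -/
theorem ae_flow_eq_of_hasWeakTransportDeriv_zero (hZ : IsOpen Z) (hc : Convex ℝ Z)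
    {O F : Set (Space d)} (hO : IsOpen O) (hF : IsClosed F) (hVOF : V = O ∩ F)
    (hV : ∀ᵐ v ∂m, v ∈ V) {D : Space d × Space d → ℝ} (hDi : Integrable D (phaseMeasure Z m))
    (hD : HasWeakTransportDeriv Z V m D fun _ => 0) (h : ℝ) :
    ∀ᵐ z ∂((volume : Measure (Space d)).prod m), z.1 ∈ Z → (flow h z).1 ∈ Z →
      (Z ×ˢ univ).indicator D (flow h z) = (Z ×ˢ univ).indicator D z := by
  set μ := (volume : Measure (Space d)).prod m with hμ
  set D₁ := (Z ×ˢ univ).indicator D with hD₁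
  have hD₁i : Integrable D₁ μ := by
    rw [hD₁, integrable_indicator_iff (hZ.measurableSet.prod MeasurableSet.univ)]
    rwa [phaseMeasure_eq_restrict] at hDi
  have hmp := measurePreserving_flow (d := d) (m := m) h
  have hfi : Integrable (fun z => D₁ (flow h z)) μ := (hmp.integrable_comp hD₁i.1).2 hD₁i
  set Ω : Set (Space d × Space d) := {z | z.1 ∈ Z ∧ (flow h z).1 ∈ Z ∧ z.2 ∈ O} with hΩ
  have hΩo : IsOpen Ω :=
    (hZ.preimage continuous_fst).inter
      ((hZ.preimage (continuous_fst.comp (continuous_flow h))).inter (hO.preimage continuous_snd))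
  have key : ∀ᵐ z ∂μ, z ∈ Ω → D₁ (flow h z) - D₁ z = 0 := by
    refine hΩo.ae_eq_zero_of_integral_contDiff_smul_eq_zero
      ((hfi.sub hD₁i).locallyIntegrable.locallyIntegrableOn Ω) fun g hg hgc hgΩ => ?_
    obtain ⟨B, hB⟩ := hgc.exists_bound_of_continuous hg.continuous
    have hg'c : Continuous (transportDeriv g) := continuous_transportDeriv hg
    obtain ⟨B', hB'⟩ : ∃ B', ∀ z, ‖transportDeriv g z‖ ≤ B' := by
      refine HasCompactSupport.exists_bound_of_continuous ?_ hg'c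
      refine hgc.mono' ?_
      intro z hz
      by_contra hzt
      refine hz ?_
      rw [transportDeriv_eq hg, fderiv_of_notMem_tsupport ℝ hzt]
      rfl
    have hbdd : ∀ s : ℝ, Integrable (fun z => D₁ z * g (flow (-s) z)) μ := fun s =>
      hD₁i.mul_bdd (c := B) (hg.continuous.comp (continuous_flow (-s))).aestronglyMeasurable
        (Eventually.of_forall fun z => hB _)
    -- The pairing of D with the translates of g along the flow has derivative -h times a pairing
    -- with a transport derivative. That pairing vanishes as long as the translate is a test
    -- function.
    have hconst : ∀ r ∈ Icc (0 : ℝ) 1, ∫ z, D₁ z * g (flow (-(r * h)) z) ∂μ =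
        ∫ z, D₁ z * g (flow (-(0 * h)) z) ∂μ := by
      have hder : ∀ r : ℝ, HasDerivAt (fun r : ℝ => ∫ z, D₁ z * g (flow (-(r * h)) z) ∂μ)
          (∫ z, D₁ z * (transportDeriv g (flow (-(r * h)) z) * (-h)) ∂μ) r := by
        intro r
        refine (hasDerivAt_integral_of_dominated_loc_of_deriv_le (s := univ)
          (F' := fun (r : ℝ) z => D₁ z * (transportDeriv g (flow (-(r * h)) z) * (-h)))
          (bound := fun z => ‖D₁ z‖ * (B' * |h|)) univ_mem ?_ (hbdd _) ?_ ?_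
          (hD₁i.norm.mul_const _) ?_).2
        · exact Eventually.of_forall fun r => (hbdd _).1
        · exact hD₁i.1.mul ((hg'c.comp (continuous_flow _)).aestronglyMeasurable.mul
            aestronglyMeasurable_const)
        · refine Eventually.of_forall fun z r _ => ?_
          rw [norm_mul, norm_mul, norm_neg, Real.norm_eq_abs h]
          gcongr
          exact hB' _
        · refine Eventually.of_forall fun z r _ => ?_
          have h1 := hasDerivAt_comp_flow hg (-(r * h)) z
          have h2 : HasDerivAt (fun r : ℝ => -(r * h)) (-h) r := by
            have h3 := ((hasDerivAt_id r).mul_const h).neg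
            rw [one_mul] at h3
            exact h3
          exact (h1.comp r h2).const_mul (D₁ z)
      refine constant_of_has_deriv_right_zero
        (fun r _ => (hder r).continuousAt.continuousWithinAt) fun r hr => ?_
      refine HasDerivAt.hasDerivWithinAt ?_
      suffices hz : ∫ z, D₁ z * (transportDeriv g (flow (-(r * h)) z) * (-h)) ∂μ = 0 by
        have := hder r
        rwa [hz] at this
      -- Convexity keeps the translated support inside Z, since g is supported where both endpoints
      -- lie in Z. Cutting with the closed set F places the compact set in Z × V.
      have htest : IsTestFunction Z V fun z => g (flow (-(r * h)) z) := by
        refine ⟨hg.comp (contDiff_flow _),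
          flow (r * h) '' (tsupport g ∩ univ ×ˢ F), ?_, ?_, ?_⟩
        · exact (hgc.isCompact.inter_right (isClosed_univ.prod hF)).image (continuous_flow _)
        · rintro _ ⟨z, ⟨hz, -, hzF⟩, rfl⟩
          obtain ⟨h1, h2, h3⟩ := hgΩ hz
          refine ⟨?_, ?_⟩
          · have := hc h1 h2 (sub_nonneg.2 hr.2.le) hr.1 (sub_add_cancel 1 r)
            convert this using 1
            simp only [flow_fst]
            module
          · rw [hVOF]; exact ⟨h3, hzF⟩
        · intro z hz hzK
          by_contra hne
          refine hzK ⟨flow (-(r * h)) z, ⟨subset_tsupport _ hne, trivial, ?_⟩, ?_⟩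
          · have := hz.2; rw [hVOF] at this; exact this.2
          · simp [flow_flow]
      have h0 := hD _ htest
      simp only [zero_mul, integral_zero, neg_zero] at h0
      rw [integral_phaseMeasure hZ.measurableSet] at h0
      have e : ∀ z, D₁ z * (transportDeriv g (flow (-(r * h)) z) * (-h)) =
          (Z ×ˢ univ).indicator (fun z => D z * transportDeriv (fun z => g (flow (-(r * h)) z)) z) z
            * (-h) := by
        intro z
        rw [← mul_assoc, hD₁]
        congr 1
        by_cases hz : z ∈ Z ×ˢ (univ : Set (Space d))
        · rw [indicator_of_mem hz, indicator_of_mem hz, transportDeriv_comp_flow hg]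
        · rw [indicator_of_notMem hz, indicator_of_notMem hz, zero_mul]
      rw [integral_congr_ae (Eventually.of_forall e), integral_mul_const, h0, zero_mul]
    have h1 := hconst 1 (by simp)
    simp only [one_mul, zero_mul, neg_zero, flow_zero] at h1
    simp only [smul_eq_mul, mul_sub]
    have hb1 : Integrable (fun z => g z * D₁ (flow h z)) μ :=
      hfi.bdd_mul (c := B) hg.continuous.aestronglyMeasurable (Eventually.of_forall hB)
    have hb2 : Integrable (fun z => g z * D₁ z) μ :=
      hD₁i.bdd_mul (c := B) hg.continuous.aestronglyMeasurable (Eventually.of_forall hB)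
    rw [integral_sub hb1 hb2, sub_eq_zero]
    have e2 : ∫ z, g z * D₁ (flow h z) ∂μ = ∫ z, D₁ z * g (flow (-h) z) ∂μ := by
      have := integral_map hmp.measurable.aemeasurable
        (f := fun z => D₁ z * g (flow (-h) z)) (by rw [hmp.map_eq]; exact (hbdd h).1)
      rw [hmp.map_eq] at this
      rw [this]
      simp [flow_flow, mul_comm, hμ]
    rw [e2, h1]
    simp only [mul_comm]
  filter_upwards [key, ae_snd_of_ae hV] with z hz hzV h1 h2
  rw [hVOF] at hzV
  exact sub_eq_zero.1 (hz ⟨h1, h2, hzV.1⟩)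

/-- The average of `D` over the chord of `Z` through a point. -/
noncomputable def chordAverage (Z : Set (Space d)) (D : Space d × Space d → ℝ)
    (z : Space d × Space d) : ℝ :=
  (lineLen Z z).toReal⁻¹ * ∫ s : ℝ, (Z ×ˢ univ).indicator D (flow s z)

theorem chordAverage_flow (Z : Set (Space d)) (D : Space d × Space d → ℝ) (h : ℝ)
    (z : Space d × Space d) : chordAverage Z D (flow h z) = chordAverage Z D z := by
  unfold chordAverage
  rw [lineLen_flow]
  congr 1
  simp only [flow_flow]
  exact integral_add_right_eq_self (fun s => (Z ×ˢ univ).indicator D (flow s z)) h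

theorem measurable_chordAverage (hZ : MeasurableSet Z) {D : Space d × Space d → ℝ}
    (hD : Measurable D) : Measurable (chordAverage Z D) := by
  refine (measurable_lineLen hZ).ennreal_toReal.inv.mul ?_
  have : Measurable fun q : (Space d × Space d) × ℝ => (Z ×ˢ univ).indicator D (flow q.2 q.1) :=
    (hD.indicator (hZ.prod MeasurableSet.univ)).comp measurable_flow_uncurry
  exact this.stronglyMeasurable.integral_prod_right'.measurable

/-- A function with vanishing weak derivative agrees with its average over chords. -/
theorem ae_eq_chordAverage (hZ : IsOpen Z) (hb : Bornology.IsBounded Z) (hc : Convex ℝ Z)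
    {O F : Set (Space d)} (hO : IsOpen O) (hF : IsClosed F) (hVOF : V = O ∩ F)
    (hV : ∀ᵐ v ∂m, v ∈ V) {c : ℝ} (hc0 : 0 < c) (hcm : ∀ᵐ v ∂m, c ≤ ‖v‖)
    {D : Space d × Space d → ℝ} (hDm : Measurable D) (hDi : Integrable D (phaseMeasure Z m))
    (hD : HasWeakTransportDeriv Z V m D fun _ => 0) :
    D =ᵐ[phaseMeasure Z m] chordAverage Z D := by
  set D₁ := (Z ×ˢ univ).indicator D with hD₁
  have hD₁m : Measurable D₁ := hDm.indicator (hZ.measurableSet.prod MeasurableSet.univ)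
  obtain ⟨L, -, hL⟩ := exists_lineLen_le hb hc0
  have h1 : ∀ᵐ s : ℝ, ∀ᵐ z ∂((volume : Measure (Space d)).prod m), z.1 ∈ Z → (flow s z).1 ∈ Z →
      D₁ (flow s z) = D₁ z := Eventually.of_forall fun s =>
    ae_flow_eq_of_hasWeakTransportDeriv_zero hZ hc hO hF hVOF hV hDi hD s
  have hflow : Measurable fun q : ℝ × (Space d × Space d) => flow q.1 q.2 :=
    measurable_flow_uncurry.comp measurable_swap
  -- From invariance for every s at almost every z to almost every s for almost every z; the
  -- exchange requires joint measurability.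
  have h2 := (Measure.ae_ae_comm (μ := (volume : Measure ℝ))
    (ν := (volume : Measure (Space d)).prod m)
    (p := fun s z => z.1 ∈ Z → (flow s z).1 ∈ Z → D₁ (flow s z) = D₁ z) ?_).1 h1
  · filter_upwards [ae_phaseMeasure_of_ae (X := Z) h2, ae_phaseMeasure_mem hZ.measurableSet,
      ae_phaseMeasure_of_ae (X := Z) (ae_snd_of_ae hcm)] with z hz hzZ hzc
    have hz0 : z.2 ≠ 0 := fun h => by rw [h, norm_zero] at hzc; linarith
    have hfin : lineLen Z z ≠ ⊤ := ((hL z hzc).1.trans_lt ENNReal.coe_lt_top).ne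
    have h0 : lineLen Z z ≠ 0 := (lineLen_pos hZ hb hzZ hz0).ne'
    have hDz : D₁ z = D z := indicator_of_mem (show z ∈ Z ×ˢ univ from ⟨hzZ, trivial⟩) _
    have e : ∫ s : ℝ, D₁ (flow s z) = ∫ s : ℝ, {s : ℝ | z.1 + s • z.2 ∈ Z}.indicator
        (fun _ => D z) s := by
      refine integral_congr_ae ?_
      filter_upwards [hz] with s hs
      by_cases hsZ : (flow s z).1 ∈ Z
      · rw [indicator_of_mem (show s ∈ {s : ℝ | z.1 + s • z.2 ∈ Z} from hsZ), hs hzZ hsZ, hDz]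
      · rw [indicator_of_notMem (show s ∉ {s : ℝ | z.1 + s • z.2 ∈ Z} from hsZ), hD₁,
          indicator_of_notMem (fun h => hsZ h.1)]
    have hms : MeasurableSet {s : ℝ | z.1 + s • z.2 ∈ Z} :=
      (measurable_fst.comp (measurable_flow_left z)) hZ.measurableSet
    rw [chordAverage, ← hD₁, e, integral_indicator hms, setIntegral_const, smul_eq_mul]
    change D z = (lineLen Z z).toReal⁻¹ * ((lineLen Z z).toReal * D z)
    rw [inv_mul_cancel_left₀ (ENNReal.toReal_pos h0 hfin).ne']
  · have m1 : MeasurableSet {q : ℝ × (Space d × Space d) | q.2.1 ∈ Z} :=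
      (measurable_fst.comp measurable_snd) hZ.measurableSet
    have m2 : MeasurableSet {q : ℝ × (Space d × Space d) | (flow q.1 q.2).1 ∈ Z} :=
      (measurable_fst.comp hflow) hZ.measurableSet
    have m3 : MeasurableSet {q : ℝ × (Space d × Space d) | D₁ (flow q.1 q.2) = D₁ q.2} :=
      measurableSet_eq_fun (hD₁m.comp hflow) (hD₁m.comp measurable_snd)
    exact m1.imp (m2.imp m3)

end Transport

/-! ### Membership in W^p. -/

namespace Transport

variable {d : ℕ} {X Z V : Set (Space d)} {m : Measure (Space d)} [IsFiniteMeasure m] {p : ℝ}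

theorem phaseMeasure_mono (h : X ⊆ Z) (m : Measure (Space d)) [SFinite m] :
    phaseMeasure X m ≤ phaseMeasure Z m := by
  rw [phaseMeasure_eq_restrict, phaseMeasure_eq_restrict]
  exact Measure.restrict_mono (prod_mono h subset_rfl) le_rfl

theorem memLp_of_lineLen_inv (hp : 1 ≤ p) (hb : Bornology.IsBounded Z) {c : ℝ} (hc0 : 0 < c)
    (hc : ∀ᵐ v ∂m, c ≤ ‖v‖) {u : Space d × Space d → ℝ}
    (hu : AEStronglyMeasurable u (phaseMeasure X m))
    (hup : ∫⁻ z, (lineLen Z z)⁻¹ * ‖u z‖ₑ ^ p ∂(phaseMeasure X m) < ⊤) :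
    MemLp u (ENNReal.ofReal p) (phaseMeasure X m) := by
  obtain ⟨L, hL0, hL⟩ := exists_lineLen_le hb hc0
  rw [memLp_iff_lintegral_lt_top hp hu]
  calc _ ≤ ∫⁻ z, L * ((lineLen Z z)⁻¹ * ‖u z‖ₑ ^ p) ∂(phaseMeasure X m) := by
        refine lintegral_mono_ae ?_
        filter_upwards [ae_phaseMeasure_of_ae (X := X) (ae_snd_of_ae hc)] with z hz
        rw [← mul_assoc]
        refine le_mul_of_one_le_left zero_le ?_
        calc (1 : ℝ≥0∞) = L * (L : ℝ≥0∞)⁻¹ := by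
              rw [ENNReal.mul_inv_cancel (by simpa using hL0.ne') ENNReal.coe_ne_top]
          _ ≤ _ := mul_le_mul_right (ENNReal.inv_le_inv.2 (hL z hz).1) _
    _ < ⊤ := by
        rw [lintegral_const_mul' _ _ ENNReal.coe_ne_top]
        exact ENNReal.mul_lt_top ENNReal.coe_lt_top hup

/-- The singular weight costs nothing for line integrals: Hölder on the chord and integration along
it leave the factor lineLen^(p-1), which is bounded. -/
theorem lintegral_lineLen_inv_lineOp_lt_top (hp : 1 ≤ p) (hZ : MeasurableSet Z)
    (hb : Bornology.IsBounded Z) {c : ℝ} (hc0 : 0 < c)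
    (hc : ∀ᵐ v ∂m, c ≤ ‖v‖) {P : Set (Space d × Space d)}
    {w : Space d × Space d → ℝ} (hw : Measurable w) (hsupp : ∀ z, z.1 ∉ Z → w z = 0)
    (hwp : MemLp w (ENNReal.ofReal p) ((volume : Measure (Space d)).prod m)) :
    ∫⁻ z, (lineLen Z z)⁻¹ * ‖lineOp P w z‖ₑ ^ p ∂(phaseMeasure Z m) < ⊤ := by
  obtain ⟨L, hL0, hL⟩ := exists_lineLen_le hb hc0
  rw [phaseMeasure_eq_restrict]
  refine (lintegral_lineLen_inv_mul_lineOp_le hZ hw hsupp hp).trans_lt ?_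
  calc _ ≤ ∫⁻ z, (L : ℝ≥0∞) ^ (p - 1) * ‖w z‖ₑ ^ p ∂((volume : Measure (Space d)).prod m) := by
        refine lintegral_mono_ae ?_
        filter_upwards [ae_snd_of_ae hc] with z hz
        exact mul_le_mul_left (ENNReal.rpow_le_rpow (hL z hz).1 (by linarith)) _
    _ < ⊤ := by
        have hfin : (L : ℝ≥0∞) ^ (p - 1) ≠ ⊤ :=
          (ENNReal.rpow_lt_top_of_nonneg (by linarith) ENNReal.coe_ne_top).ne
        rw [lintegral_const_mul' _ _ hfin]
        exact ENNReal.mul_lt_top hfin.lt_top ((memLp_iff_lintegral_lt_top hp hwp.1).1 hwp)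

theorem aestronglyMeasurable_travelTime (hX : IsOpen X) (hb : Bornology.IsBounded X)
    (h0 : ∀ᵐ v ∂m, v ≠ 0) : AEStronglyMeasurable (travelTime X) (phaseMeasure X m) := by
  refine (measurable_indicator_travelTime hX hb).aestronglyMeasurable.congr ?_
  filter_upwards [ae_phaseMeasure_of_ae (X := X) (ae_snd_of_ae h0),
    ae_phaseMeasure_mem (m := m) hX.measurableSet] with z hz hzX
  exact indicator_of_mem (show z ∈ X ×ˢ {0}ᶜ from ⟨hzX, hz⟩) _

theorem enorm_travelTime_rpow_mul (hp : 1 ≤ p) {τ : ℝ} (hτ : 0 < τ) (q a : ℝ) :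
    ‖τ ^ q * a‖ₑ ^ p = ENNReal.ofReal τ ^ (q * p) * ‖a‖ₑ ^ p := by
  have hp0 : 0 < p := by linarith
  rw [enorm_mul, ENNReal.mul_rpow_of_nonneg _ _ hp0.le, Real.enorm_of_nonneg (by positivity),
    ← ENNReal.ofReal_rpow_of_pos hτ, ENNReal.rpow_mul]

theorem ne_zero_of_le_norm {c : ℝ} (hc0 : 0 < c) {v : Space d} (hv : c ≤ ‖v‖) : v ≠ 0 :=
  norm_pos_iff.1 (hc0.trans_le hv)

/-- When the chord length in Z is dominated by the travel time in X, the weight 1/τ is dominated by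
the inverse chord length, which is invariant under the flow and measurable. -/
theorem memLp_travelTime_rpow_neg_mul (hp : 1 ≤ p) (hX : IsOpen X) (hb : Bornology.IsBounded X)
    {c : ℝ} (hc0 : 0 < c) (hc : ∀ᵐ v ∂m, c ≤ ‖v‖) {C : ℝ≥0} (hC0 : 0 < C)
    (hC : ∀ᵐ z ∂(phaseMeasure X m), lineLen Z z ≤ C * ENNReal.ofReal (travelTime X z))
    {u : Space d × Space d → ℝ} (hu : AEStronglyMeasurable u (phaseMeasure X m))
    (hup : ∫⁻ z, (lineLen Z z)⁻¹ * ‖u z‖ₑ ^ p ∂(phaseMeasure X m) < ⊤) :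
    MemLp (fun z => travelTime X z ^ (-(1 / p)) * u z) (ENNReal.ofReal p) (phaseMeasure X m) := by
  have hp0 : 0 < p := by linarith
  have h0 : ∀ᵐ v ∂m, v ≠ 0 := hc.mono fun v => ne_zero_of_le_norm hc0
  have hτm := aestronglyMeasurable_travelTime (m := m) hX hb h0
  have hm : AEStronglyMeasurable (fun z => travelTime X z ^ (-(1 / p)) * u z) (phaseMeasure X m) :=
    (hτm.aemeasurable.pow_const _).aestronglyMeasurable.mul hu
  rw [memLp_iff_lintegral_lt_top hp hm]
  calc _ ≤ ∫⁻ z, C * ((lineLen Z z)⁻¹ * ‖u z‖ₑ ^ p) ∂(phaseMeasure X m) := by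
        refine lintegral_mono_ae ?_
        filter_upwards [hC, ae_phaseMeasure_of_ae (X := X) (ae_snd_of_ae h0),
          ae_phaseMeasure_mem (m := m) hX.measurableSet] with z hz hz0 hzX
        have hτ := travelTime_pos hX hb hzX hz0
        rw [enorm_travelTime_rpow_mul hp hτ, ← mul_assoc]
        refine mul_le_mul_left ?_ _
        rw [neg_mul, one_div, inv_mul_cancel₀ hp0.ne', ENNReal.rpow_neg_one]
        have hC' : (C : ℝ≥0∞) ≠ 0 := by simpa using hC0.ne'
        calc (ENNReal.ofReal (travelTime X z))⁻¹
            = C * (C * ENNReal.ofReal (travelTime X z))⁻¹ := by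
              rw [ENNReal.mul_inv (Or.inl hC') (Or.inl ENNReal.coe_ne_top), ← mul_assoc,
                ENNReal.mul_inv_cancel hC' ENNReal.coe_ne_top, one_mul]
          _ ≤ _ := mul_le_mul_right (ENNReal.inv_le_inv.2 hz) _
    _ < ⊤ := by
        rw [lintegral_const_mul' _ _ ENNReal.coe_ne_top]
        exact ENNReal.mul_lt_top ENNReal.coe_lt_top hup

theorem memLp_travelTime_rpow_mul (hp : 1 ≤ p) (hX : IsOpen X) (hb : Bornology.IsBounded X)
    {c : ℝ} (hc0 : 0 < c) (hc : ∀ᵐ v ∂m, c ≤ ‖v‖)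
    {w : Space d × Space d → ℝ} (hw : MemLp w (ENNReal.ofReal p) (phaseMeasure X m)) :
    MemLp (fun z => travelTime X z ^ (1 - 1 / p) * w z) (ENNReal.ofReal p) (phaseMeasure X m) := by
  have hp0 : 0 < p := by linarith
  obtain ⟨L, hL0, hL⟩ := exists_lineLen_le hb hc0
  have h0 : ∀ᵐ v ∂m, v ≠ 0 := hc.mono fun v => ne_zero_of_le_norm hc0
  have hτm := aestronglyMeasurable_travelTime (m := m) hX hb h0
  have hq : 0 ≤ 1 - 1 / p := by rw [sub_nonneg, div_le_one hp0]; exact hp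
  refine MemLp.of_le_mul (c := (L : ℝ) ^ (1 - 1 / p)) hw
    ((hτm.aemeasurable.pow_const _).aestronglyMeasurable.mul hw.1) ?_
  filter_upwards [ae_phaseMeasure_of_ae (X := X) (ae_snd_of_ae hc),
    ae_phaseMeasure_mem (m := m) hX.measurableSet] with z hzc hzX
  have hz0 := ne_zero_of_le_norm hc0 hzc
  have hτ := travelTime_pos hX hb hzX hz0
  have hτL : travelTime X z ≤ L := by
    have := (ofReal_travelTime_le_lineLen hX hb subset_rfl hzX hz0).trans (hL z hzc).1
    rw [← ENNReal.ofReal_coe_nnreal] at this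
    exact (ENNReal.ofReal_le_ofReal_iff L.2).1 this
  rw [norm_mul]
  refine mul_le_mul_of_nonneg_right ?_ (norm_nonneg _)
  rw [Real.norm_of_nonneg (by positivity)]
  exact Real.rpow_le_rpow hτ.le hτL hq

theorem integrable_of_support (hp : 1 ≤ p) (hZ : MeasurableSet Z)
    (hb : Bornology.IsBounded Z) {w : Space d × Space d → ℝ} (hw : Measurable w)
    (hsupp : ∀ z, z.1 ∉ Z → w z = 0)
    (hwp : MemLp w (ENNReal.ofReal p) ((volume : Measure (Space d)).prod m)) :
    Integrable w ((volume : Measure (Space d)).prod m) := by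
  have := isFiniteMeasure_phaseMeasure (m := m) hb
  have h1 : MemLp w (ENNReal.ofReal p) (phaseMeasure Z m) := by
    rw [phaseMeasure_eq_restrict]; exact hwp.restrict _
  refine ⟨hw.aestronglyMeasurable, ?_⟩
  rw [HasFiniteIntegral, lintegral_eq_of_support hZ fun z hz => by rw [hsupp z hz, enorm_zero]]
  exact (h1.integrable (by simpa using hp)).2

/-- A function solving the transport equation in integrated form is a transport solution. -/
theorem isTransportSolution_add_lineOp (hp : 1 ≤ p) (hX : IsOpen X)
    (hZ : MeasurableSet Z) (hb : Bornology.IsBounded Z) (hXZ : X ⊆ Z) (hV : ∀ᵐ v ∂m, v ∈ V)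
    {c : ℝ} (hc0 : 0 < c) (hc : ∀ᵐ v ∂m, c ≤ ‖v‖) {C : ℝ≥0} (hC0 : 0 < C)
    (hC : ∀ᵐ z ∂(phaseMeasure X m), lineLen Z z ≤ C * ENNReal.ofReal (travelTime X z))
    {σ : Space d × Space d → ℝ} {k : Space d → Space d → Space d → ℝ}
    (hσ : BoundedAbsorption X m σ) (hk : AdmissibleScattering X m p k)
    {U : Space d × Space d → ℝ} (hU : Measurable U)
    (hloc : ∀ z, z.1 ∈ X → z.2 ∈ V → ∀ᶠ t in 𝓝 (0 : ℝ), U (flow t z) = U z)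
    (hUp : ∫⁻ z, (lineLen Z z)⁻¹ * ‖U z‖ₑ ^ p ∂(phaseMeasure X m) < ⊤)
    {P : Set (Space d × Space d)} (hP : MeasurableSet P)
    {w : Space d × Space d → ℝ} (hw : Measurable w) (hsupp : ∀ z, z.1 ∉ Z → w z = 0)
    (hwp : MemLp w (ENNReal.ofReal p) ((volume : Measure (Space d)).prod m))
    (heq : ∀ᵐ z ∂(phaseMeasure X m), w z = collision m σ k (U + lineOp P w) z) :
    IsTransportSolution X V m p σ k (U + lineOp P w) := by
  have hbX := hb.subset hXZ
  have := isFiniteMeasure_phaseMeasure (m := m) hbX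
  have hp1 : 1 ≤ ENNReal.ofReal p := by simpa using hp
  have hp0 : 0 < p := by linarith
  have hlm := measurable_lineOp hP hw
  have hlp : ∫⁻ z, (lineLen Z z)⁻¹ * ‖lineOp P w z‖ₑ ^ p ∂(phaseMeasure X m) < ⊤ :=
    (lintegral_mono' (phaseMeasure_mono hXZ m) le_rfl).trans_lt
      (lintegral_lineLen_inv_lineOp_lt_top hp hZ hb hc0 hc hw hsupp hwp)
  have hwX : MemLp w (ENNReal.ofReal p) (phaseMeasure X m) := by
    rw [phaseMeasure_eq_restrict]; exact hwp.restrict _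
  have hwi := integrable_of_support hp hZ hb hw hsupp hwp
  have hUX := memLp_of_lineLen_inv hp hb hc0 hc hU.aestronglyMeasurable hUp
  have hlX := memLp_of_lineLen_inv hp hb hc0 hc hlm.aestronglyMeasurable hlp
  have hup : ∫⁻ z, (lineLen Z z)⁻¹ * ‖(U + lineOp P w) z‖ₑ ^ p ∂(phaseMeasure X m) < ⊤ := by
    calc _ ≤ ∫⁻ z, 2 ^ (p - 1) * ((lineLen Z z)⁻¹ * ‖U z‖ₑ ^ p + (lineLen Z z)⁻¹ *
          ‖lineOp P w z‖ₑ ^ p) ∂(phaseMeasure X m) := by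
          refine lintegral_mono fun z => ?_
          rw [← mul_add, mul_left_comm]
          refine mul_le_mul_right ?_ _
          have := enorm_sub_rpow_le hp (U z) (-lineOp P w z)
          rwa [sub_neg_eq_add, enorm_neg] at this
      _ < ⊤ := by
          rw [lintegral_const_mul' _ _ (by finiteness), lintegral_add_left]
          · exact ENNReal.mul_lt_top (by finiteness) (ENNReal.add_lt_top.2 ⟨hUp, hlp⟩)
          · exact (measurable_lineLen hZ).inv.mul (hU.enorm.pow_const p)
  obtain ⟨K, hK⟩ := exists_collision_bound hp hσ hk
  have huX : MemLp (U + lineOp P w) (ENNReal.ofReal p) (phaseMeasure X m) := hUX.add hlX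
  refine ⟨w, ⟨?_, ?_, ?_⟩, ?_⟩
  · have h1 := HasWeakTransportDeriv.add hX hV
      (hasWeakTransportDeriv_zero hX hbX hV hc0 hc hU (hUX.integrable hp1) hloc)
      (hasWeakTransportDeriv_lineOp hX hbX hV hc0 hc hP hw hwi) (hUX.integrable hp1)
      (hlX.integrable hp1) (integrable_const 0) (hwX.integrable hp1)
    refine h1.congr (EventuallyEq.refl _ _) (Eventually.of_forall fun z => ?_)
    simp
  · exact memLp_travelTime_rpow_neg_mul hp hX hbX hc0 hc hC0 hC (hU.add hlm).aestronglyMeasurable hup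
  · exact memLp_travelTime_rpow_mul hp hX hbX hc0 hc hwX
  · filter_upwards [heq, (hK _ huX).1] with z hz hz1
    refine ⟨hz1, ?_⟩
    rw [hz, collision]
    ring

end Transport

/-! ### Traces of line integrals. -/

namespace Transport

variable {d : ℕ} {Z V : Set (Space d)} {m : Measure (Space d)} {p : ℝ} {ρ : Space d → ℝ}

/-- Along an integrable line the operator is a primitive, hence continuous, so its trace is its
pointwise value. -/
theorem tendsto_lineOp_flow {P : Set (Space d × Space d)} (hP : MeasurableSet P)
    {w : Space d × Space d → ℝ} (hw : Measurable w) {z : Space d × Space d}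
    (h : Integrable fun s : ℝ => w (flow s z)) :
    Tendsto (fun t => lineOp P w (flow t z)) (𝓝 0) (𝓝 (lineOp P w z)) := by
  have h1 : Continuous fun t => lineOp P w (flow t z) := by
    simp only [lineOp_flow hP hw h]
    exact continuous_const.add (intervalIntegral.continuous_primitive
      (fun a b => h.intervalIntegrable) 0)
  have := h1.tendsto 0
  rwa [flow_zero] at this

/-- A criterion for traces. -/
theorem hasTraceOn_add_lineOp {X : Set (Space d)} {P : Set (Space d × Space d)}
    (hP : MeasurableSet P) {w : Space d × Space d → ℝ} (hw : Measurable w)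
    {U g : Space d × Space d → ℝ} {S : Set (Space d × Space d)}
    (hS : ∀ᵐ z ∂((boundaryMeasure X m).restrict S),
      (z ∈ incoming X V → (Integrable fun s : ℝ => w (flow s z)) ∧
        ∀ᶠ t in 𝓝[>] (0 : ℝ), U (flow t z) = g z - lineOp P w z) ∧
      (z ∈ outgoing X V → (Integrable fun s : ℝ => w (flow s z)) ∧
        ∀ᶠ t in 𝓝[>] (0 : ℝ), U (flow (-t) z) = g z - lineOp P w z)) :
    HasTraceOn X V m (U + lineOp P w) S g := by
  filter_upwards [hS] with z hz
  constructor
  · intro h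
    obtain ⟨h1, h2⟩ := hz.1 h
    refine Tendsto.mono_left ?_ inf_le_left
    have h3 := (tendsto_lineOp_flow hP hw h1).mono_left
      (nhdsWithin_le_nhds (s := Ioi (0 : ℝ))) |>.const_add (g z - lineOp P w z)
    rw [sub_add_cancel] at h3
    refine h3.congr' ?_
    filter_upwards [h2] with t ht
    rw [← ht]
    rfl
  · intro h
    obtain ⟨h1, h2⟩ := hz.2 h
    refine Tendsto.mono_left ?_ inf_le_left
    have hneg : Tendsto (fun t : ℝ => -t) (𝓝[>] 0) (𝓝 0) := by
      have : Tendsto (fun t : ℝ => -t) (𝓝 0) (𝓝 (-0)) := continuous_neg.tendsto 0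
      rw [neg_zero] at this
      exact this.mono_left nhdsWithin_le_nhds
    have h3 := ((tendsto_lineOp_flow hP hw h1).comp hneg).const_add (g z - lineOp P w z)
    rw [sub_add_cancel] at h3
    refine h3.congr' ?_
    filter_upwards [h2] with t ht
    simp only [Function.comp_apply]
    rw [← ht, sub_eq_add_neg z.1, ← neg_smul]
    rfl

/-- At points of the inner sublevel set, the line operator does not see the sources outside. -/
theorem IsConvexProfile.lineOp_eq_zero_of_nonpos (hρ : IsConvexProfile ρ) {ε : ℝ} (hε : ε < 1)
    {w : Space d × Space d → ℝ} (hsupp : ∀ z, z.1 ∉ shell ρ → w z = 0) {z : Space d × Space d}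
    (hz : ρ z.1 ≤ 0) : lineOp (forwardSet ρ ε) w z = 0 := by
  refine integral_eq_zero_of_ae (Eventually.of_forall fun s => ?_)
  simp only [Pi.zero_apply, mul_eq_zero]
  by_cases hs : (flow s z).1 ∈ shell ρ
  swap
  · exact Or.inr (hsupp _ hs)
  left
  have hs' := hs
  rw [hρ.shell_eq] at hs'
  have h1 := hρ.first_order_flow z s 0
  rw [flow_zero] at h1
  have h2 : 0 < ρ (flow s z).1 := hs'.1
  -- The tangent inequality at the source, with ρ positive there and nonpositive at z, shows that z
  -- lies downhill of the source, hence on the side its influence never reaches.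
  have h3 : 0 < s * fderiv ℝ ρ (flow s z).1 z.2 := by linarith
  have hit : ¬ ∀ t : ℝ, ¬ ρ (flow t (flow s z)).1 < 1 - ε := by
    push Not
    refine ⟨-s, ?_⟩
    rw [flow_flow, neg_add_cancel, flow_zero]
    linarith
  rcases lt_trichotomy s 0 with h | h | h
  · have hD : fderiv ℝ ρ (flow s z).1 z.2 < 0 := by
      by_contra! h0
      nlinarith
    have hP : flow s z ∉ forwardSet ρ ε := fun hP => hP.elim hit fun h0 => lt_asymm hD h0
    simp [lineKernel, indicator, h, hP, h.not_gt]
  · simp [h] at h3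
  · have hP : flow s z ∈ forwardSet ρ ε := Or.inr (pos_of_mul_pos_right h3 h.le)
    simp [lineKernel, indicator, h, hP, h.not_gt]

/-- At entrance points of lines missing `Z_{1-ε}`, the line operator vanishes. -/
theorem IsConvexProfile.lineOp_eq_zero_of_grazing (hρ : IsConvexProfile ρ) {ε : ℝ}
    {w : Space d × Space d → ℝ} (hsupp : ∀ z, z.1 ∉ sublevel ρ 1 → w z = 0) {z : Space d × Space d}
    (hz : z ∈ crossingSet ρ 1 (-1)) (hgr : ∀ t : ℝ, ¬ ρ (flow t z).1 < 1 - ε) :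
    lineOp (forwardSet ρ ε) w z = 0 := by
  refine integral_eq_zero_of_ae (Eventually.of_forall fun s => ?_)
  simp only [Pi.zero_apply, mul_eq_zero]
  by_cases hs : (flow s z).1 ∈ sublevel ρ 1
  swap
  · exact Or.inr (hsupp _ hs)
  left
  have h1 := hρ.first_order_flow z 0 s
  rw [flow_zero] at h1
  have h2 : ρ (flow s z).1 < 1 := hs
  obtain ⟨h4, h5⟩ := hz
  have h3 : s * fderiv ℝ ρ z.1 z.2 < 0 := by linarith
  -- Sources in Z_1 lie after the entrance point, and on this line influence travels forward only.
  have hs0 : 0 < s := by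
    by_contra! h0
    nlinarith
  have hP : flow s z ∈ forwardSet ρ ε := Or.inl fun t => by rw [flow_flow]; exact hgr _
  simp [lineKernel, indicator, hs0, hP, hs0.not_gt]

namespace IsConvexProfile

variable (hρ : IsConvexProfile ρ)
include hρ

theorem ae_levelMeasure_of_ae [SFinite m] {s : ℝ} (hs : -1 < s) {Q : Space d → Prop}
    (h : ∀ᵐ v ∂m, Q v) : ∀ᵐ z ∂(levelMeasure ρ s m), Q z.2 := by
  have := hρ.isFiniteMeasure_level hs
  have h1 : ∀ᵐ z ∂(((μHE[d - 1] : Measure (Space d)).restrict {x | ρ x = s}).prod m), Q z.2 :=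
    Measure.quasiMeasurePreserving_snd.ae h
  exact (withDensity_absolutelyContinuous _ _).ae_le h1

theorem snd_ne_zero_of_mem_crossingSet {s ς : ℝ} {z : Space d × Space d}
    (hz : z ∈ crossingSet ρ s ς) : z.2 ≠ 0 := fun h => by
  have := hz.2
  rw [h, map_zero, mul_zero] at this
  exact this.false

/-- The flux comparison bounds the boundary integral of the line integrals of |w| by the L¹ norm of
w. Tangential points belong to neither crossing set and are excluded. -/
theorem ae_integrable_of_crossing [SFinite m] {s : ℝ} (hs : -1 < s)
    {w : Space d × Space d → ℝ} (hw : Measurable w)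
    (hwi : Integrable w ((volume : Measure (Space d)).prod m)) :
    ∀ᵐ z ∂(levelMeasure ρ s m), ρ z.1 = s → fderiv ℝ ρ z.1 z.2 ≠ 0 →
      Integrable fun t : ℝ => w (flow t z) := by
  obtain ⟨C, hC⟩ := hρ.exists_levelMeasure_bounds hs
  have key : ∀ ς : ℝ, (ς = 1 ∨ ς = -1) → ∀ᵐ z ∂(levelMeasure ρ s m), z ∈ crossingSet ρ s ς →
      Integrable fun t : ℝ => w (flow t z) := by
    intro ς hς
    have h1 := (hC m ς hς (fun z => ‖w z‖ₑ) hw.enorm).1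
    have hm : Measurable fun z : Space d × Space d => ∫⁻ t : ℝ, ‖w (flow t z)‖ₑ :=
      (hw.comp measurable_flow_uncurry).enorm.lintegral_prod_right'
    have h2 := ae_lt_top hm (h1.trans_lt (ENNReal.mul_lt_top ENNReal.coe_lt_top hwi.2)).ne
    rw [ae_restrict_iff' (hρ.measurableSet_crossingSet s ς)] at h2
    filter_upwards [h2] with z hz hzc
    exact ⟨(hw.comp (measurable_flow_left z)).aestronglyMeasurable, hz hzc⟩
  filter_upwards [key 1 (Or.inl rfl), key (-1) (Or.inr rfl)] with z h1 h2 hz hD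
  rcases hD.lt_or_gt with h | h
  · exact h2 ⟨hz, by linarith⟩
  · exact h1 ⟨hz, by linarith⟩

theorem lintegral_indicator_flow (hZ : MeasurableSet Z) (z : Space d × Space d) (a : ℝ≥0∞) :
    ∫⁻ t : ℝ, a * Z.indicator (1 : Space d → ℝ≥0∞) (flow t z).1 = a * lineLen Z z := by
  rw [lineLen_eq_lintegral hZ, lintegral_const_mul]
  exact (measurable_one.indicator hZ).comp (measurable_fst.comp (measurable_flow_left z))

/-- Extension of boundary data along lines, on a flow-invariant set `N` of lines. -/
theorem exists_lintegral_crossing_le {s : ℝ} (hs : -1 < s) (hZ : MeasurableSet Z) : ∃ C : ℝ≥0,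
    ∀ (m : Measure (Space d)) [SFinite m], (∀ᵐ v ∂m, v ≠ 0) → ∀ ς : ℝ, (ς = 1 ∨ ς = -1) →
    ∀ N : Set (Space d × Space d), MeasurableSet N → (∀ t z, flow t z ∈ N ↔ z ∈ N) →
    ∀ f : Space d × Space d → ℝ≥0∞, Measurable f →
    ∫⁻ z in {z | ∃ t : ℝ, ρ (flow t z).1 < s},
        (N ∩ Z ×ˢ univ).indicator (fun z => (lineLen Z z)⁻¹ * f (crossing ρ s ς z)) z
        ∂((volume : Measure (Space d)).prod m) ≤
      C * ∫⁻ z in crossingSet ρ s ς, N.indicator f z ∂(levelMeasure ρ s m) := by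
  obtain ⟨C, hC⟩ := hρ.exists_levelMeasure_bounds hs
  refine ⟨C, fun m _ hm ς hς N hN hinv f hf => ?_⟩
  refine ((hC m ς hς _ ?_).2 hm).trans (mul_le_mul_right ?_ _)
  · exact ((measurable_lineLen hZ).inv.mul (hf.comp (hρ.measurable_crossing s ς))).indicator
      (hN.inter (hZ.prod MeasurableSet.univ))
  refine setLIntegral_mono' (hρ.measurableSet_crossingSet s ς) fun z hz => ?_
  have hz0 := hρ.snd_ne_zero_of_mem_crossingSet hz
  have hit := hρ.hit_of_mem_crossingSet hz
  have e : ∀ t : ℝ, (N ∩ Z ×ˢ univ).indicator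
      (fun z => (lineLen Z z)⁻¹ * f (crossing ρ s ς z)) (flow t z) =
      (N.indicator f z * (lineLen Z z)⁻¹) * Z.indicator (1 : Space d → ℝ≥0∞) (flow t z).1 := by
    intro t
    by_cases hzN : z ∈ N
    swap
    · rw [indicator_of_notMem (fun h => hzN ((hinv t z).1 h.1)), indicator_of_notMem hzN]
      simp
    by_cases hzZ : (flow t z).1 ∈ Z
    · rw [indicator_of_mem (show flow t z ∈ N ∩ Z ×ˢ univ from ⟨(hinv t z).2 hzN, hzZ, trivial⟩),
        indicator_of_mem hzN, indicator_of_mem hzZ, lineLen_flow, hρ.crossing_flow hς hz0 hit,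
        hρ.crossing_self hς hz, Pi.one_apply, mul_one, mul_comm]
    · rw [indicator_of_notMem (fun h => hzZ h.2.1), indicator_of_notMem hzZ, mul_zero]
  simp only [e]
  rw [hρ.lintegral_indicator_flow hZ, mul_assoc]
  exact mul_le_of_le_one_right zero_le (ENNReal.inv_mul_le_one _)

/-- Integrability of `lineOp P w` over the incoming boundary. -/
theorem lintegral_crossing_lineOp_lt_top [IsFiniteMeasure m] (hp : 1 ≤ p) {s : ℝ} (hs : -1 < s)
    (hZ : MeasurableSet Z) (hb : Bornology.IsBounded Z) {c : ℝ} (hc0 : 0 < c)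
    (hc : ∀ᵐ v ∂m, c ≤ ‖v‖) (P : Set (Space d × Space d)) {w : Space d × Space d → ℝ}
    (hw : Measurable w) (hsupp : ∀ z, z.1 ∉ Z → w z = 0)
    (hwp : MemLp w (ENNReal.ofReal p) ((volume : Measure (Space d)).prod m)) {ς : ℝ}
    (hς : ς = 1 ∨ ς = -1) :
    ∫⁻ z in crossingSet ρ s ς, ‖lineOp P w z‖ₑ ^ p ∂(levelMeasure ρ s m) < ⊤ := by
  obtain ⟨C, hC⟩ := hρ.exists_levelMeasure_bounds hs
  obtain ⟨L, -, hL⟩ := exists_lineLen_le hb hc0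
  have hfin : (L : ℝ≥0∞) ^ (p - 1) ≠ ⊤ :=
    (ENNReal.rpow_lt_top_of_nonneg (by linarith) ENNReal.coe_ne_top).ne
  calc _ ≤ ∫⁻ z in crossingSet ρ s ς, (L : ℝ≥0∞) ^ (p - 1) * (∫⁻ t : ℝ, ‖w (flow t z)‖ₑ ^ p)
        ∂(levelMeasure ρ s m) := by
        refine lintegral_mono_ae (ae_restrict_of_ae ?_)
        filter_upwards [hρ.ae_levelMeasure_of_ae hs hc] with z hz
        refine (enorm_lineOp_rpow_le P hZ hw hsupp hp z).trans (mul_le_mul_left ?_ _)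
        exact ENNReal.rpow_le_rpow (hL z hz).1 (by linarith)
    _ ≤ (L : ℝ≥0∞) ^ (p - 1) * (C * ∫⁻ z, ‖w z‖ₑ ^ p ∂((volume : Measure (Space d)).prod m)) := by
        rw [lintegral_const_mul' _ _ hfin]
        exact mul_le_mul_right (hC m ς hς (fun z => ‖w z‖ₑ ^ p) (hw.enorm.pow_const p)).1 _
    _ < ⊤ := ENNReal.mul_lt_top hfin.lt_top (ENNReal.mul_lt_top ENNReal.coe_lt_top
        ((memLp_iff_lintegral_lt_top hp hwp.1).1 hwp))

/-- Integrability of a line-invariant function over the incoming boundary. -/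
theorem lintegral_crossing_invariant_lt_top [IsFiniteMeasure m] {s : ℝ} (hs : -1 < s)
    {c : ℝ} (hc0 : 0 < c) (hc : ∀ᵐ v ∂m, c ≤ ‖v‖) {A : Space d × Space d → ℝ} (hA : Measurable A)
    (hinv : ∀ t z, A (flow t z) = A z)
    (hAp : ∫⁻ z, (lineLen (sublevel ρ s) z)⁻¹ * ‖A z‖ₑ ^ p ∂(phaseMeasure (sublevel ρ s) m) < ⊤)
    {ς : ℝ} (hς : ς = 1 ∨ ς = -1) :
    ∫⁻ z in crossingSet ρ s ς, ‖A z‖ₑ ^ p ∂(levelMeasure ρ s m) < ⊤ := by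
  obtain ⟨C, hC⟩ := hρ.exists_levelMeasure_bounds hs
  have hZo := hρ.isOpen_sublevel s
  have hZ := hZo.measurableSet
  obtain ⟨L, -, hL⟩ := exists_lineLen_le (hρ.isBounded_sublevel s) hc0
  set F : Space d × Space d → ℝ≥0∞ := (sublevel ρ s ×ˢ univ).indicator fun z =>
    (lineLen (sublevel ρ s) z)⁻¹ * ‖A z‖ₑ ^ p with hF
  have hFm : Measurable F := ((measurable_lineLen hZ).inv.mul (hA.enorm.pow_const p)).indicator
    (hZ.prod MeasurableSet.univ)
  calc _ ≤ ∫⁻ z in crossingSet ρ s ς, (∫⁻ t : ℝ, F (flow t z)) ∂(levelMeasure ρ s m) := by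
        refine setLIntegral_mono_ae' (hρ.measurableSet_crossingSet s ς) ?_
        filter_upwards [hρ.ae_levelMeasure_of_ae hs hc] with z hzc hz
        have e : ∀ t : ℝ, F (flow t z) = (‖A z‖ₑ ^ p * (lineLen (sublevel ρ s) z)⁻¹) *
            (sublevel ρ s).indicator (1 : Space d → ℝ≥0∞) (flow t z).1 := by
          intro t
          by_cases hzZ : (flow t z).1 ∈ sublevel ρ s
          · rw [hF, indicator_of_mem (show flow t z ∈ sublevel ρ s ×ˢ univ from ⟨hzZ, trivial⟩),
              indicator_of_mem hzZ, lineLen_flow, hinv, Pi.one_apply, mul_one, mul_comm]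
          · rw [hF, indicator_of_notMem (fun h => hzZ h.1), indicator_of_notMem hzZ, mul_zero]
        simp only [e]
        rw [hρ.lintegral_indicator_flow hZ, mul_assoc]
        obtain ⟨t, ht⟩ := hρ.hit_of_mem_crossingSet hz
        have h0 : lineLen (sublevel ρ s) z ≠ 0 := by
          rw [← lineLen_flow (sublevel ρ s) t z]
          exact (lineLen_pos hZo (hρ.isBounded_sublevel s) ht (ne_zero_of_le_norm hc0 hzc)).ne'
        rw [ENNReal.inv_mul_cancel h0 ((hL z hzc).1.trans_lt ENNReal.coe_lt_top).ne, mul_one]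
    _ ≤ C * ∫⁻ z, F z ∂((volume : Measure (Space d)).prod m) := (hC m ς hς F hFm).1
    _ < ⊤ := by
        refine ENNReal.mul_lt_top ENNReal.coe_lt_top ?_
        rwa [hF, lintegral_indicator (hZ.prod MeasurableSet.univ), ← phaseMeasure_eq_restrict]

end IsConvexProfile

end Transport

/-! ### Extension of the boundary data into the shell. -/

namespace Transport

variable {d : ℕ} {V : Set (Space d)} {m : Measure (Space d)} {p : ℝ} {ρ : Space d → ℝ}

theorem exists_flow_lt_flow_iff (s h : ℝ) (z : Space d × Space d) :
    (∃ t : ℝ, ρ (flow t (flow h z)).1 < s) ↔ ∃ t : ℝ, ρ (flow t z).1 < s := by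
  constructor
  · rintro ⟨t, ht⟩
    exact ⟨t + h, by rwa [flow_flow] at ht⟩
  · rintro ⟨t, ht⟩
    exact ⟨t - h, by rwa [flow_flow, sub_add_cancel]⟩

/-- The points whose line misses `Z_s`. -/
def missing (ρ : Space d → ℝ) (s : ℝ) : Set (Space d × Space d) :=
  {z | ∀ t : ℝ, ¬ ρ (flow t z).1 < s}

theorem missing_eq_compl (s : ℝ) : missing ρ s = {z | ∃ t : ℝ, ρ (flow t z).1 < s}ᶜ := by
  ext z
  simp [missing]

theorem flow_mem_missing_iff (s h : ℝ) (z : Space d × Space d) :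
    flow h z ∈ missing ρ s ↔ z ∈ missing ρ s := by
  rw [missing_eq_compl]
  exact not_congr (exists_flow_lt_flow_iff s h z)

namespace IsConvexProfile

variable (hρ : IsConvexProfile ρ)
include hρ

theorem measurableSet_missing (s : ℝ) : MeasurableSet (missing ρ s) := by
  rw [missing_eq_compl]
  exact (hρ.isOpen_hit s).measurableSet.compl

theorem mem_grazing_iff {s₂ s₁ : ℝ} (hs : -1 < s₂) (z : Space d × Space d) :
    z ∈ grazing ρ V s₂ s₁ ↔ z ∈ crossingSet ρ s₂ (-1) ∧ z.2 ∈ V ∧ z ∈ missing ρ s₁ := by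
  have h1 : z ∈ crossingSet ρ s₂ (-1) ↔ ρ z.1 = s₂ ∧ fderiv ℝ ρ z.1 z.2 < 0 := by
    refine and_congr_right fun _ => ?_
    rw [neg_one_mul, neg_pos]
  have h2 : z ∈ grazing ρ V s₂ s₁ ↔ z ∈ incoming (sublevel ρ s₂) V ∧ z ∈ missing ρ s₁ := Iff.rfl
  rw [h2, h1, hρ.mem_incoming_iff hs]
  tauto

theorem measurableSet_grazing (hV : MeasurableSet V) {s₂ : ℝ} (hs : -1 < s₂) (s₁ : ℝ) :
    MeasurableSet (grazing ρ V s₂ s₁) := by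
  have : grazing ρ V s₂ s₁ = crossingSet ρ s₂ (-1) ∩ (Prod.snd ⁻¹' V ∩ missing ρ s₁) := by
    ext z; exact hρ.mem_grazing_iff hs z
  rw [this]
  exact (hρ.measurableSet_crossingSet _ _).inter
    ((measurable_snd hV).inter (hρ.measurableSet_missing s₁))

theorem mem_frontier_prod_iff {s : ℝ} (hs : -1 < s) (z : Space d × Space d) :
    z ∈ frontier (sublevel ρ s) ×ˢ V ↔ ρ z.1 = s ∧ z.2 ∈ V := by
  rw [hρ.frontier_sublevel hs]
  exact Iff.rfl

/-- A critical point of ρ along a line is a minimum along it, so it cannot have ρ ≥ 0 on a line that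
reaches ρ < 0. -/
theorem fderiv_ne_zero_of_hit {z : Space d × Space d} (h0 : 0 ≤ ρ z.1)
    (h : ∃ t : ℝ, ρ (flow t z).1 < 0) : fderiv ℝ ρ z.1 z.2 ≠ 0 := by
  intro hD
  obtain ⟨t, ht⟩ := h
  have := hρ.first_order_flow z 0 t
  rw [flow_zero, hD] at this
  linarith

theorem continuous_fderiv_flow (z : Space d × Space d) :
    Continuous fun t : ℝ => fderiv ℝ ρ (flow t z).1 (flow t z).2 := by
  have h := hρ.continuous_fderiv
  simp only [flow_fst, flow_snd]
  fun_prop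

/-- Extension of the data `β` on `∂Z_0` and `γ` on the entrance points of the lines missing
`Z_{1-ε}`, constant along segments in the shell. -/
theorem exists_extension_of_traces [IsFiniteMeasure m] (hp : 1 ≤ p)
    (hV : ∀ᵐ v ∂m, v ∈ V) {c : ℝ} (hc0 : 0 < c) (hcV : ∀ v ∈ V, c ≤ ‖v‖)
    {ε : ℝ} (hε : ε < 1) {β γ : Space d × Space d → ℝ} (hβ : Measurable β) (hγ : Measurable γ)
    (hβp : ∫⁻ z in frontier (sublevel ρ 0) ×ˢ V, ‖β z‖ₑ ^ p ∂(levelMeasure ρ 0 m) < ⊤)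
    (hγp : ∫⁻ z in grazing ρ V 1 (1 - ε), ‖γ z‖ₑ ^ p ∂(levelMeasure ρ 1 m) < ⊤) :
    ∃ U : Space d × Space d → ℝ, Measurable U ∧
      ∫⁻ z, (lineLen (sublevel ρ 1) z)⁻¹ * ‖U z‖ₑ ^ p ∂(phaseMeasure (shell ρ) m) < ⊤ ∧
      (∀ z, z.1 ∈ shell ρ → z.2 ∈ V → ∀ᶠ t in 𝓝 (0 : ℝ), U (flow t z) = U z) ∧
      (∀ z ∈ crossingSet ρ 0 1, ∀ᶠ t in 𝓝[>] (0 : ℝ), U (flow t z) = β z) ∧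
      (∀ z ∈ crossingSet ρ 0 (-1), ∀ᶠ t in 𝓝[>] (0 : ℝ), U (flow (-t) z) = β z) ∧
      (∀ z ∈ crossingSet ρ 1 (-1), z ∈ missing ρ (1 - ε) → ∀ t : ℝ, U (flow t z) = γ z) := by
  have hp0 : 0 < p := by linarith
  set H : Set (Space d × Space d) := {z | ∃ t : ℝ, ρ (flow t z).1 < 0} with hH
  set D : Set (Space d × Space d) := {z | 0 < fderiv ℝ ρ z.1 z.2} with hD
  set N := missing ρ (1 - ε) with hN
  have hHm : MeasurableSet H := (hρ.isOpen_hit 0).measurableSet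
  have hDm : MeasurableSet D := measurableSet_lt measurable_const hρ.measurable_fderiv_apply
  have hNm : MeasurableSet N := hρ.measurableSet_missing _
  have hHN : ∀ z ∈ N, z ∉ H := by
    rintro z hz ⟨t, ht⟩
    exact hz t (by linarith)
  have hHf : ∀ t z, flow t z ∈ H ↔ z ∈ H := fun t z => exists_flow_lt_flow_iff 0 t z
  have hNf : ∀ t z, flow t z ∈ N ↔ z ∈ N := fun t z => flow_mem_missing_iff (1 - ε) t z
  have h1 : (1 : ℝ) = 1 ∨ (1 : ℝ) = -1 := Or.inl rfl
  have h2 : (-1 : ℝ) = 1 ∨ (-1 : ℝ) = -1 := Or.inr rfl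
  have b1m := hβ.comp (hρ.measurable_crossing 0 1)
  have b2m := hβ.comp (hρ.measurable_crossing 0 (-1))
  have gm := hγ.comp (hρ.measurable_crossing 1 (-1))
  -- Lines meeting Z_0 carry the exit value of β where ρ increases and the entrance value where it
  -- does not; the change occurs inside Z_0, so it is invisible in the shell. Lines missing Z_{1-ε}
  -- carry γ, all others zero.
  set U : Space d × Space d → ℝ := fun z =>
    (H ∩ D).indicator (fun z => β (crossing ρ 0 1 z)) z +
    (H \ D).indicator (fun z => β (crossing ρ 0 (-1) z)) z +
    N.indicator (fun z => γ (crossing ρ 1 (-1) z)) z with hU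
  have U1 : ∀ z ∈ H, z ∈ D → U z = β (crossing ρ 0 1 z) := fun z h h' => by
    have hzN : z ∉ N := fun hN => hHN z hN h
    simp [hU, indicator, h, h', hzN]
  have U2 : ∀ z ∈ H, z ∉ D → U z = β (crossing ρ 0 (-1) z) := fun z h h' => by
    have hzN : z ∉ N := fun hN => hHN z hN h
    simp [hU, indicator, h, h', hzN]
  have U3 : ∀ z ∈ N, U z = γ (crossing ρ 1 (-1) z) := fun z h => by
    simp [hU, indicator, h, hHN z h]
  have U4 : ∀ z, z ∉ H → z ∉ N → U z = 0 := fun z h h' => by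
    simp [hU, indicator, h, h']
  have hZm : MeasurableSet (sublevel ρ 1) := (hρ.isOpen_sublevel 1).measurableSet
  refine ⟨U, ?_, ?_, ?_, ?_, ?_, ?_⟩
  · exact ((b1m.indicator (hHm.inter hDm)).add (b2m.indicator (hHm.diff hDm))).add
      (gm.indicator hNm)
  · obtain ⟨C, hC⟩ := hρ.exists_lintegral_crossing_le (s := 0) (by norm_num) hZm
    obtain ⟨C', hC'⟩ := hρ.exists_lintegral_crossing_le (s := 1) (by norm_num) hZm
    have hm0 : ∀ᵐ v ∂m, v ≠ 0 := hV.mono fun v hv => ne_zero_of_le_norm hc0 (hcV v hv)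
    have hm : Measurable fun z => ‖β z‖ₑ ^ p := hβ.enorm.pow_const p
    have hm' : Measurable fun z => ‖γ z‖ₑ ^ p := hγ.enorm.pow_const p
    have e1 := hC m hm0 1 h1 univ MeasurableSet.univ (by simp) _ hm
    have e2 := hC m hm0 (-1) h2 univ MeasurableSet.univ (by simp) _ hm
    have e3 := hC' m hm0 (-1) h2 N hNm hNf _ hm'
    have fin : ∀ ς : ℝ, ∫⁻ z in crossingSet ρ 0 ς, (univ : Set (Space d × Space d)).indicator
        (fun z => ‖β z‖ₑ ^ p) z ∂(levelMeasure ρ 0 m) < ⊤ := by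
      intro ς
      simp only [indicator_univ]
      refine lt_of_le_of_lt (lintegral_mono' (Measure.restrict_mono_ae ?_) le_rfl) hβp
      filter_upwards [hρ.ae_levelMeasure_of_ae (by norm_num) hV] with z hzV hz
      exact (hρ.mem_frontier_prod_iff (by norm_num) z).2 ⟨hz.1, hzV⟩
    have fin' : ∫⁻ z in crossingSet ρ 1 (-1), N.indicator (fun z => ‖γ z‖ₑ ^ p) z
        ∂(levelMeasure ρ 1 m) < ⊤ := by
      rw [lintegral_indicator hNm, Measure.restrict_restrict hNm]
      refine lt_of_le_of_lt (lintegral_mono' (Measure.restrict_mono_ae ?_) le_rfl) hγp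
      filter_upwards [hρ.ae_levelMeasure_of_ae (by norm_num) hV] with z hzV hz
      exact (hρ.mem_grazing_iff (by norm_num) z).2 ⟨hz.2, hzV, hz.1⟩
    have t1 := e1.trans_lt (ENNReal.mul_lt_top ENNReal.coe_lt_top (fin 1))
    have t2 := e2.trans_lt (ENNReal.mul_lt_top ENNReal.coe_lt_top (fin (-1)))
    have t3 := e3.trans_lt (ENNReal.mul_lt_top ENNReal.coe_lt_top fin')
    rw [← lintegral_indicator hHm] at t1 t2
    rw [← lintegral_indicator (hρ.isOpen_hit 1).measurableSet] at t3
    have lm : Measurable fun z => (lineLen (sublevel ρ 1) z)⁻¹ := (measurable_lineLen hZm).inv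
    have hZu : MeasurableSet (sublevel ρ 1 ×ˢ (univ : Set (Space d))) :=
      hZm.prod MeasurableSet.univ
    rw [phaseMeasure_eq_restrict]
    rw [← lintegral_indicator (hρ.isOpen_shell.measurableSet.prod MeasurableSet.univ)]
    have t := ENNReal.add_lt_top.2 ⟨ENNReal.add_lt_top.2 ⟨t1, t2⟩, t3⟩
    rw [← lintegral_add_right, ← lintegral_add_right] at t
    rotate_left
    · exact ((lm.mul (gm.enorm.pow_const p)).indicator (hNm.inter hZu)).indicator
        (hρ.isOpen_hit 1).measurableSet
    · exact ((lm.mul (b2m.enorm.pow_const p)).indicator (MeasurableSet.univ.inter hZu)).indicator hHm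
    refine (lintegral_mono fun z => ?_).trans_lt t
    by_cases hz : z ∈ shell ρ ×ˢ (univ : Set (Space d))
    swap
    · rw [indicator_of_notMem hz]; exact zero_le
    rw [indicator_of_mem hz]
    have hz1 : z ∈ sublevel ρ 1 ×ˢ (univ : Set (Space d)) := ⟨hz.1.1, trivial⟩
    have hzu : z ∈ univ ∩ sublevel ρ 1 ×ˢ (univ : Set (Space d)) := ⟨trivial, hz1⟩
    by_cases hzH : z ∈ H
    · refine le_trans ?_ (le_add_of_nonneg_right zero_le)
      rw [indicator_of_mem hzH, indicator_of_mem hzH, indicator_of_mem hzu, indicator_of_mem hzu]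
      by_cases hzD : z ∈ D
      · rw [U1 z hzH hzD]; exact le_add_of_nonneg_right zero_le
      · rw [U2 z hzH hzD]; exact le_add_of_nonneg_left zero_le
    · refine le_trans ?_ (le_add_of_nonneg_left zero_le)
      by_cases hzN : z ∈ N
      · have hz2 : z ∈ {z : Space d × Space d | ∃ t : ℝ, ρ (flow t z).1 < 1} :=
          ⟨0, by rw [flow_zero]; exact hz1.1⟩
        rw [U3 z hzN, indicator_of_mem hz2, indicator_of_mem (show z ∈ N ∩ _ from ⟨hzN, hz1⟩)]
      · rw [U4 z hzH hzN]
        simp [hp0]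
  · intro z hz hzV
    have hz0 := ne_zero_of_le_norm hc0 (hcV _ hzV)
    have hz' := hz
    rw [hρ.shell_eq] at hz'
    have hz1 : 0 < ρ z.1 := hz'.1
    by_cases hzH : z ∈ H
    · have hne := hρ.fderiv_ne_zero_of_hit hz1.le hzH
      have hcont := (hρ.continuous_fderiv_flow z).tendsto 0
      rw [flow_zero] at hcont
      rcases hne.lt_or_gt with h | h
      · filter_upwards [hcont.eventually_lt_const h] with t ht
        rw [U2 _ ((hHf t z).2 hzH) (fun h' => lt_asymm ht h'), U2 z hzH (fun h' => lt_asymm h h'),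
          hρ.crossing_flow h2 hz0 hzH]
      · filter_upwards [hcont.eventually_const_lt h] with t ht
        rw [U1 _ ((hHf t z).2 hzH) ht, U1 z hzH h, hρ.crossing_flow h1 hz0 hzH]
    · refine Eventually.of_forall fun t => ?_
      by_cases hzN : z ∈ N
      · rw [U3 _ ((hNf t z).2 hzN), U3 z hzN, hρ.crossing_flow h2 hz0
          ⟨0, by rw [flow_zero]; exact hz'.2⟩]
      · rw [U4 z hzH hzN, U4 _ (fun h => hzH ((hHf t z).1 h)) (fun h => hzN ((hNf t z).1 h))]
  · intro z hz
    have hz0 := hρ.snd_ne_zero_of_mem_crossingSet hz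
    have hzH : z ∈ H := hρ.hit_of_mem_crossingSet hz
    have hcont := (hρ.continuous_fderiv_flow z).tendsto 0
    rw [flow_zero] at hcont
    have h : 0 < fderiv ℝ ρ z.1 z.2 := by simpa using hz.2
    filter_upwards [nhdsWithin_le_nhds (hcont.eventually_const_lt h)] with t ht
    rw [U1 _ ((hHf t z).2 hzH) ht, hρ.crossing_flow h1 hz0 hzH, hρ.crossing_self h1 hz]
  · intro z hz
    have hz0 := hρ.snd_ne_zero_of_mem_crossingSet hz
    have hzH : z ∈ H := hρ.hit_of_mem_crossingSet hz
    have hcont : Tendsto (fun t : ℝ => fderiv ℝ ρ (flow (-t) z).1 (flow (-t) z).2) (𝓝 0)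
        (𝓝 (fderiv ℝ ρ (flow (-0) z).1 (flow (-0) z).2)) :=
      ((hρ.continuous_fderiv_flow z).comp continuous_neg).tendsto 0
    rw [neg_zero, flow_zero] at hcont
    have h : fderiv ℝ ρ z.1 z.2 < 0 := by simpa using hz.2
    filter_upwards [nhdsWithin_le_nhds (hcont.eventually_lt_const h)] with t ht
    rw [U2 _ ((hHf _ z).2 hzH) (fun h' => lt_asymm ht h'), hρ.crossing_flow h2 hz0 hzH,
      hρ.crossing_self h2 hz]
  · intro z hz hzN t
    have hz0 := hρ.snd_ne_zero_of_mem_crossingSet hz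
    rw [U3 _ ((hNf t z).2 hzN), hρ.crossing_flow h2 hz0 (hρ.hit_of_mem_crossingSet hz),
      hρ.crossing_self h2 hz]

end IsConvexProfile

end Transport

/-! ### Solutions on the shell, and continuation of inner solutions. -/

namespace Transport

variable {d : ℕ} {V X Z : Set (Space d)} {m : Measure (Space d)} {p : ℝ} {ρ : Space d → ℝ}
  {σ : Space d × Space d → ℝ} {k : Space d → Space d → Space d → ℝ}

theorem BoundedAbsorption.mono [SFinite m] (h : BoundedAbsorption Z m σ) (hXZ : X ⊆ Z) :
    BoundedAbsorption X m σ :=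
  h.mono_measure (phaseMeasure_mono hXZ m)

theorem AdmissibleScattering.mono [SFinite m] (h : AdmissibleScattering Z m p k) (hXZ : X ⊆ Z) :
    AdmissibleScattering X m p k := by
  have h1 : ((volume : Measure (Space d)).restrict X).prod (m.prod m) ≤
      ((volume : Measure (Space d)).restrict Z).prod (m.prod m) := by
    rw [← Measure.restrict_univ (μ := m.prod m), Measure.prod_restrict, Measure.prod_restrict]
    exact Measure.restrict_mono (prod_mono hXZ subset_rfl) le_rfl
  refine ⟨fun hp => (h.1 hp).mono_measure h1, fun hp => ?_⟩
  obtain ⟨h2, C, hC⟩ := h.2 hp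
  exact ⟨h2.mono_measure h1, C, ae_mono (Measure.restrict_mono hXZ le_rfl) hC⟩

namespace IsConvexProfile

variable (hρ : IsConvexProfile ρ)
include hρ

theorem isTransportSolution_shell [IsFiniteMeasure m] (hp : 1 ≤ p) (hV : ∀ᵐ v ∂m, v ∈ V) {c R : ℝ}
    (hc0 : 0 < c) (hR0 : 0 < R) (hcR : ∀ v ∈ V, c ≤ ‖v‖ ∧ ‖v‖ ≤ R)
    (hσ : BoundedAbsorption (shell ρ) m σ) (hk : AdmissibleScattering (shell ρ) m p k) {ε : ℝ}
    (hsol : IsShellSolvable ρ m p σ k ε) {U : Space d × Space d → ℝ} (hU : Measurable U)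
    (hloc : ∀ z, z.1 ∈ shell ρ → z.2 ∈ V → ∀ᶠ t in 𝓝 (0 : ℝ), U (flow t z) = U z)
    (hUp : ∫⁻ z, (lineLen (sublevel ρ 1) z)⁻¹ * ‖U z‖ₑ ^ p ∂(phaseMeasure (shell ρ) m) < ⊤) :
    ∃ w : Space d × Space d → ℝ, Measurable w ∧ (∀ z, z.1 ∉ shell ρ → w z = 0) ∧
      Integrable w ((volume : Measure (Space d)).prod m) ∧
      IsTransportSolution (shell ρ) V m p σ k (U + lineOp (forwardSet ρ ε) w) := by
  have hc : ∀ᵐ v ∂m, c ≤ ‖v‖ := hV.mono fun v hv => (hcR v hv).1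
  have hXZ : shell ρ ⊆ sublevel ρ 1 := sdiff_subset
  have hb := hρ.isBounded_sublevel 1
  obtain ⟨C, hC0, hC⟩ := hρ.exists_lineLen_le_travelTime_shell hc0 hR0
  obtain ⟨w, hw, hw0, hwp, heq⟩ := hsol U
    (memLp_of_lineLen_inv hp hb hc0 hc hU.aestronglyMeasurable hUp)
  refine ⟨w, hw, hw0, integrable_of_support hp hρ.isOpen_shell.measurableSet (hb.subset hXZ) hw hw0
    hwp, ?_⟩
  refine isTransportSolution_add_lineOp hp hρ.isOpen_shell
    (hρ.isOpen_sublevel 1).measurableSet hb hXZ hV hc0 hc hC0 ?_ hσ hk hU hloc hUp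
    (hρ.measurableSet_forwardSet ε) hw (fun z hz => hw0 z fun h => hz (hXZ h)) hwp heq
  filter_upwards [ae_phaseMeasure_mem (m := m) hρ.isOpen_shell.measurableSet,
    ae_phaseMeasure_of_ae (X := shell ρ) (ae_snd_of_ae hV)] with z hz hzV
  exact hC z (hcR _ hzV).1 (hcR _ hzV).2 hz

/-- Solutions on the shell with prescribed traces on the inner boundary and on the grazing set. -/
theorem exists_isTransportSolution_of_traces (hp : 1 ≤ p) (hVs : IsVelocitySpace V m)
    (hσ : BoundedAbsorption (shell ρ) m σ) (hk : AdmissibleScattering (shell ρ) m p k) {ε : ℝ}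
    (hε1 : ε < 1) (hsol : IsShellSolvable ρ m p σ k ε) {β γ : Space d × Space d → ℝ}
    (hβ : MemLp β (ENNReal.ofReal p)
      ((boundaryMeasure (sublevel ρ 0) m).restrict (frontier (sublevel ρ 0) ×ˢ V)))
    (hγ : MemLp γ (ENNReal.ofReal p)
      ((boundaryMeasure (sublevel ρ 1) m).restrict (grazing ρ V 1 (1 - ε)))) :
    ∃ u, IsTransportSolution (shell ρ) V m p σ k u ∧
      HasTraceOn (shell ρ) V m u (frontier (sublevel ρ 0) ×ˢ V) β ∧
      HasTraceOn (shell ρ) V m u (grazing ρ V 1 (1 - ε)) γ := by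
  have := hVs.isFiniteMeasure
  have hVm := hVs.measurableSet
  have hV := hVs.ae_mem
  obtain ⟨c, R, hc0, hR0, hcR⟩ := hVs.exists_norm_bounds
  have h01 : (-1 : ℝ) < 0 := by norm_num
  have h11 : (-1 : ℝ) < 1 := by norm_num
  have hS0 : MeasurableSet (frontier (sublevel ρ 0) ×ˢ V) :=
    isClosed_frontier.measurableSet.prod hVm
  have hS1 := hρ.measurableSet_grazing hVm h11 (1 - ε)
  rw [hρ.boundaryMeasure_sublevel h01] at hβ
  rw [hρ.boundaryMeasure_sublevel h11] at hγ
  set β' := hβ.1.mk β with hβ'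
  set γ' := hγ.1.mk γ with hγ'
  have hββ' := hβ.1.ae_eq_mk
  have hγγ' := hγ.1.ae_eq_mk
  have hβp := (memLp_iff_lintegral_lt_top hp hβ.1.stronglyMeasurable_mk.aestronglyMeasurable).1
    (hβ.ae_eq hββ')
  have hγp := (memLp_iff_lintegral_lt_top hp hγ.1.stronglyMeasurable_mk.aestronglyMeasurable).1
    (hγ.ae_eq hγγ')
  obtain ⟨U, hU, hUp, hloc, hU1, hU2, hU3⟩ := hρ.exists_extension_of_traces hp hV hc0
    (fun v hv => (hcR v hv).1) hε1 hβ.1.stronglyMeasurable_mk.measurable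
    hγ.1.stronglyMeasurable_mk.measurable hβp hγp
  obtain ⟨w, hw, hw0, hwi, hsolu⟩ := hρ.isTransportSolution_shell hp hV hc0 hR0 hcR hσ hk hsol hU
    hloc hUp
  have hP := hρ.measurableSet_forwardSet ε
  refine ⟨_, hsolu, hasTraceOn_add_lineOp hP hw ?_, hasTraceOn_add_lineOp hP hw ?_⟩
  · rw [hρ.restrict_boundaryMeasure_shell (s := 0) (Or.inl rfl) hS0
      (fun z hz => ((hρ.mem_frontier_prod_iff h01 z).1 hz).1)]
    filter_upwards [hββ', ae_restrict_mem hS0,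
      ae_restrict_of_ae (hρ.ae_integrable_of_crossing h01 hw hwi)] with z hz hzS hzi
    have hz0 := ((hρ.mem_frontier_prod_iff h01 z).1 hzS).1
    -- The line integral vanishes on the inner boundary, so the trace is that of U.
    rw [hρ.lineOp_eq_zero_of_nonpos hε1 hw0 hz0.le, sub_zero, hz, hρ.mem_incoming_shell_iff,
      hρ.mem_outgoing_shell_iff]
    constructor
    · rintro ⟨-, ⟨-, h⟩ | ⟨h, -⟩⟩
      · exact ⟨hzi hz0 h.ne', hU1 z ⟨hz0, by simpa using h⟩⟩
      · linarith
    · rintro ⟨-, ⟨-, h⟩ | ⟨h, -⟩⟩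
      · exact ⟨hzi hz0 h.ne, hU2 z ⟨hz0, by simpa using h⟩⟩
      · linarith
  · rw [hρ.restrict_boundaryMeasure_shell (s := 1) (Or.inr rfl) hS1
      (fun z hz => ((hρ.mem_grazing_iff h11 z).1 hz).1.1)]
    filter_upwards [hγγ', ae_restrict_mem hS1,
      ae_restrict_of_ae (hρ.ae_integrable_of_crossing h11 hw hwi)] with z hz hzS hzi
    obtain ⟨hzc, -, hzm⟩ := (hρ.mem_grazing_iff h11 z).1 hzS
    have hD : fderiv ℝ ρ z.1 z.2 < 0 := by simpa using hzc.2
    rw [hρ.lineOp_eq_zero_of_grazing (fun y hy => hw0 y fun h => hy h.1) hzc hzm, sub_zero, hz]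
    refine ⟨fun _ => ⟨hzi hzc.1 hD.ne, Eventually.of_forall (hU3 z hzc hzm)⟩, fun h => ?_⟩
    rw [hρ.mem_outgoing_shell_iff] at h
    rcases h with ⟨-, ⟨h, -⟩ | ⟨-, h⟩⟩
    · have := hzc.1; linarith
    · linarith

/-- The two pieces cover Z_1 up to the level set ρ = 0, which is null as the frontier of a convex
set. -/
theorem ae_phaseMeasure_sublevel_one [IsFiniteMeasure m] {Q : Space d × Space d → Prop}
    (h0 : ∀ᵐ z ∂(phaseMeasure (sublevel ρ 0) m), Q z) (h1 : ∀ᵐ z ∂(phaseMeasure (shell ρ) m), Q z) :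
    ∀ᵐ z ∂(phaseMeasure (sublevel ρ 1) m), Q z := by
  rw [phaseMeasure_eq_restrict] at h0 h1 ⊢
  rw [ae_restrict_iff' ((hρ.isOpen_sublevel 0).measurableSet.prod MeasurableSet.univ)] at h0
  rw [ae_restrict_iff' (hρ.isOpen_shell.measurableSet.prod MeasurableSet.univ)] at h1
  rw [ae_restrict_iff' ((hρ.isOpen_sublevel 1).measurableSet.prod MeasurableSet.univ)]
  have h2 : ∀ᵐ x ∂(volume : Measure (Space d)), ρ x ≠ 0 := by
    have := hρ.volume_level (s := 0) (by norm_num)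
    rw [measure_eq_zero_iff_ae_notMem] at this
    exact this
  have h3 : ∀ᵐ z ∂((volume : Measure (Space d)).prod m), ρ z.1 ≠ 0 :=
    Measure.quasiMeasurePreserving_fst.ae h2
  filter_upwards [h0, h1, h3] with z hz0 hz1 hz hzZ
  rcases hz.lt_or_gt with h | h
  · exact hz0 ⟨h, trivial⟩
  · refine hz1 ⟨?_, trivial⟩
    rw [hρ.shell_eq]
    exact ⟨h, hzZ.1⟩

/-- A solution on the inner domain extends to a solution on the outer domain. -/
theorem exists_extension_of_inner [IsFiniteMeasure m] (hp : 1 ≤ p) (hV : ∀ᵐ v ∂m, v ∈ V) {c : ℝ}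
    (hc0 : 0 < c) (hc : ∀ᵐ v ∂m, c ≤ ‖v‖)
    (hσ : BoundedAbsorption (sublevel ρ 1) m σ) (hk : AdmissibleScattering (sublevel ρ 1) m p k)
    {ε : ℝ} (hε1 : ε < 1) (hsol : IsShellSolvable ρ m p σ k ε) {A w₀ : Space d × Space d → ℝ}
    (hA : Measurable A) (hinv : ∀ t z, A (flow t z) = A z)
    (hAp : ∫⁻ z, (lineLen (sublevel ρ 1) z)⁻¹ * ‖A z‖ₑ ^ p ∂(phaseMeasure (sublevel ρ 1) m) < ⊤)
    (hw₀ : Measurable w₀) (hw₀0 : ∀ z, z.1 ∉ sublevel ρ 0 → w₀ z = 0)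
    (hw₀p : MemLp w₀ (ENNReal.ofReal p) ((volume : Measure (Space d)).prod m))
    (heq : ∀ᵐ z ∂(phaseMeasure (sublevel ρ 0) m),
      w₀ z = collision m σ k (A + lineOp (forwardSet ρ ε) w₀) z) :
    ∃ w : Space d × Space d → ℝ, Measurable w ∧ (∀ z, z.1 ∉ sublevel ρ 1 → w z = 0) ∧
      MemLp w (ENNReal.ofReal p) ((volume : Measure (Space d)).prod m) ∧
      IsTransportSolution (sublevel ρ 1) V m p σ k (A + lineOp (forwardSet ρ ε) w) ∧
      w =ᵐ[phaseMeasure (sublevel ρ 1) m] collision m σ k (A + lineOp (forwardSet ρ ε) w) ∧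
      A + lineOp (forwardSet ρ ε) w =ᵐ[phaseMeasure (sublevel ρ 0) m]
        A + lineOp (forwardSet ρ ε) w₀ := by
  have hXZ : shell ρ ⊆ sublevel ρ 1 := sdiff_subset
  have h0Z : sublevel ρ 0 ⊆ sublevel ρ 1 := fun x hx =>
    lt_trans (show ρ x < 0 from hx) zero_lt_one
  have hb := hρ.isBounded_sublevel 1
  have hZo := hρ.isOpen_sublevel 1
  have hZm := hZo.measurableSet
  have hP := hρ.measurableSet_forwardSet ε
  have hv0 : ∀ᵐ v ∂m, v ≠ 0 := hc.mono fun v hv => ne_zero_of_le_norm hc0 hv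
  have hw₀Z : ∀ z, z.1 ∉ sublevel ρ 1 → w₀ z = 0 := fun z hz => hw₀0 z fun h => hz (h0Z h)
  have hlp := lintegral_lineLen_inv_lineOp_lt_top hp hZm hb hc0 hc (P := forwardSet ρ ε) hw₀ hw₀Z hw₀p
  have hU : MemLp (A + lineOp (forwardSet ρ ε) w₀) (ENNReal.ofReal p) (phaseMeasure (shell ρ) m) :=
    ((memLp_of_lineLen_inv hp hb hc0 hc hA.aestronglyMeasurable hAp).add
      (memLp_of_lineLen_inv hp hb hc0 hc (measurable_lineOp hP hw₀).aestronglyMeasurable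
        hlp)).mono_measure (phaseMeasure_mono hXZ m)
  -- The invariant part and the inner source together form the free term of the shell problem. The
  -- total source will be w₀ + w₁, with disjoint supports.
  obtain ⟨w₁, hw₁, hw₁0, hw₁p, heq₁⟩ := hsol _ hU
  have hw₁Z : ∀ z, z.1 ∉ sublevel ρ 1 → w₁ z = 0 := fun z hz => hw₁0 z fun h => hz (hXZ h)
  have hadd : ∀ᵐ z ∂((volume : Measure (Space d)).prod m), lineOp (forwardSet ρ ε) (w₀ + w₁) z =
      lineOp (forwardSet ρ ε) w₀ z + lineOp (forwardSet ρ ε) w₁ z := by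
    filter_upwards [ae_integrable_flow hp hZm hb hv0 hw₀ hw₀Z hw₀p,
      ae_integrable_flow hp hZm hb hv0 hw₁ hw₁Z hw₁p] with z h1 h2
    exact lineOp_add hP hw₀ hw₁ h1 h2
  -- Influence from the shell never reaches Z_0, so the inner solution survives the addition of w₁.
  have e0 : A + lineOp (forwardSet ρ ε) (w₀ + w₁) =ᵐ[phaseMeasure (sublevel ρ 0) m]
      A + lineOp (forwardSet ρ ε) w₀ := by
    filter_upwards [ae_phaseMeasure_of_ae (X := sublevel ρ 0) hadd,
      ae_phaseMeasure_mem (m := m) (hρ.isOpen_sublevel 0).measurableSet] with z hz hz0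
    simp only [Pi.add_apply]
    rw [hz, hρ.lineOp_eq_zero_of_nonpos hε1 hw₁0 (show ρ z.1 < 0 from hz0).le, add_zero]
  have e1 : A + lineOp (forwardSet ρ ε) (w₀ + w₁) =ᵐ[phaseMeasure (shell ρ) m]
      A + lineOp (forwardSet ρ ε) w₀ + lineOp (forwardSet ρ ε) w₁ := by
    filter_upwards [ae_phaseMeasure_of_ae (X := shell ρ) hadd] with z hz
    simp only [Pi.add_apply]
    rw [hz, add_assoc]
  have hwZ : ∀ z, z.1 ∉ sublevel ρ 1 → (w₀ + w₁) z = 0 := fun z hz => by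
    rw [Pi.add_apply, hw₀Z z hz, hw₁Z z hz, add_zero]
  have heqZ : w₀ + w₁ =ᵐ[phaseMeasure (sublevel ρ 1) m]
      collision m σ k (A + lineOp (forwardSet ρ ε) (w₀ + w₁)) := by
    refine hρ.ae_phaseMeasure_sublevel_one ?_ ?_
    · filter_upwards [heq, collision_congr (σ := σ) (k := k) e0,
        ae_phaseMeasure_mem (m := m) (hρ.isOpen_sublevel 0).measurableSet] with z hz hz2 hzZ
      have hw1 : w₁ z = 0 := hw₁0 z fun h => by
        rw [hρ.shell_eq] at h
        exact lt_asymm h.1 hzZ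
      rw [hz2, ← hz, Pi.add_apply, hw1, add_zero]
    · filter_upwards [heq₁, collision_congr (σ := σ) (k := k) e1,
        ae_phaseMeasure_mem (m := m) hρ.isOpen_shell.measurableSet] with z hz hz2 hzX
      have hw0 : w₀ z = 0 := hw₀0 z fun h => by
        rw [hρ.shell_eq] at hzX
        exact lt_asymm hzX.1 h
      rw [hz2, ← hz, Pi.add_apply, hw0, zero_add]
  refine ⟨w₀ + w₁, hw₀.add hw₁, hwZ, hw₀p.add hw₁p, ?_, heqZ, e0⟩
  refine isTransportSolution_add_lineOp hp hZo hZm hb subset_rfl hV hc0 hc one_pos ?_ hσ hk hA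
    (fun z _ _ => Eventually.of_forall fun t => hinv t z) hAp hP (hw₀.add hw₁) hwZ (hw₀p.add hw₁p) heqZ
  filter_upwards [ae_phaseMeasure_mem (m := m) hZm,
    ae_phaseMeasure_of_ae (X := sublevel ρ 1) (ae_snd_of_ae hv0)] with z hz hz0
  rw [ENNReal.coe_one, one_mul]
  exact lineLen_le_ofReal_travelTime hZo hb (hρ.convex_sublevel 1) hz hz0

end IsConvexProfile

end Transport

/-! ### Decomposition of solutions into an invariant part and a line integral. -/

namespace Transport

variable {d : ℕ} {V Z Z' : Set (Space d)} {m : Measure (Space d)} {p : ℝ} {ρ : Space d → ℝ}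
  {σ : Space d × Space d → ℝ} {k : Space d → Space d → Space d → ℝ}

theorem lintegral_indicator_lineLen_inv (hZ : MeasurableSet Z) (z : Space d × Space d) :
    ∫⁻ t : ℝ, (Z ×ˢ univ).indicator (fun z => (lineLen Z z)⁻¹) (flow t z) =
      (lineLen Z z)⁻¹ * lineLen Z z := by
  nth_rewrite 2 [lineLen_eq_lintegral hZ z]
  rw [← lintegral_const_mul]
  · refine lintegral_congr fun t => ?_
    by_cases ht : (flow t z).1 ∈ Z
    · rw [indicator_of_mem (show flow t z ∈ Z ×ˢ univ from ⟨ht, trivial⟩), indicator_of_mem ht,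
        lineLen_flow, Pi.one_apply, mul_one]
    · rw [indicator_of_notMem (fun h => ht h.1), indicator_of_notMem ht, mul_zero]
  · exact (measurable_one.indicator hZ).comp (measurable_fst.comp (measurable_flow_left z))

/-- Comparison of weighted integrals of a line-invariant function over two domains. -/
theorem lintegral_lineLen_inv_invariant_le [SFinite m] (hZ : IsOpen Z) (hb : Bornology.IsBounded Z)
    (hZ' : MeasurableSet Z') {c : ℝ} (hc0 : 0 < c) (hc : ∀ᵐ v ∂m, c ≤ ‖v‖)
    {H : Set (Space d × Space d)} (hH : MeasurableSet H)
    (hHZ : ∀ z ∈ H, ∃ t : ℝ, (flow t z).1 ∈ Z)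
    {F : Space d × Space d → ℝ≥0∞} (hF : Measurable F) (hinv : ∀ t z, F (flow t z) = F z) :
    ∫⁻ z in H ∩ Z' ×ˢ univ, (lineLen Z' z)⁻¹ * F z ∂((volume : Measure (Space d)).prod m) ≤
      ∫⁻ z in Z ×ˢ univ, (lineLen Z z)⁻¹ * F z ∂((volume : Measure (Space d)).prod m) := by
  obtain ⟨L, -, hL⟩ := exists_lineLen_le hb hc0
  have hZu : MeasurableSet (Z ×ˢ (univ : Set (Space d))) := hZ.measurableSet.prod MeasurableSet.univ
  have hZu' : MeasurableSet (Z' ×ˢ (univ : Set (Space d))) := hZ'.prod MeasurableSet.univ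
  have hm := measurable_lineLen hZ.measurableSet
  have hm' := measurable_lineLen hZ'
  rw [← lintegral_indicator (hH.inter hZu'), ← lintegral_indicator hZu]
  set a : Space d × Space d → ℝ≥0∞ := fun z =>
    F z * (Z' ×ˢ univ).indicator (fun z => (lineLen Z' z)⁻¹) z with ha
  set b : Space d × Space d → ℝ≥0∞ := (Z ×ˢ univ).indicator (fun z => (lineLen Z z)⁻¹) with hbdef
  have ham : Measurable a := hF.mul (hm'.inv.indicator hZu')
  have hbm : Measurable b := hm.inv.indicator hZu
  -- The normalized density b of the chord in Z has line integral one on lines meeting Z. Exchanging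
  -- the integrals lets the chord in Z' be integrated out instead.
  calc _ ≤ ∫⁻ z, a z * (∫⁻ s : ℝ, b (flow s z)) ∂((volume : Measure (Space d)).prod m) := by
        refine lintegral_mono_ae ?_
        have hc' : ∀ᵐ z ∂((volume : Measure (Space d)).prod m), c ≤ ‖z.2‖ :=
          Measure.quasiMeasurePreserving_snd.ae hc
        filter_upwards [hc'] with z hz
        by_cases hzH : z ∈ H ∩ Z' ×ˢ (univ : Set (Space d))
        swap
        · rw [indicator_of_notMem hzH]; exact zero_le
        obtain ⟨t, ht⟩ := hHZ z hzH.1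
        have h0 : lineLen Z z ≠ 0 := by
          rw [← lineLen_flow Z t z]
          exact (lineLen_pos hZ hb ht (ne_zero_of_le_norm hc0 hz)).ne'
        rw [indicator_of_mem hzH, lintegral_indicator_lineLen_inv hZ.measurableSet,
          ENNReal.inv_mul_cancel h0 ((hL z hz).1.trans_lt ENNReal.coe_lt_top).ne, mul_one, ha]
        simp only
        rw [indicator_of_mem hzH.2, mul_comm]
    _ = ∫⁻ z, b z * (∫⁻ s : ℝ, a (flow s z)) ∂((volume : Measure (Space d)).prod m) :=
        lintegral_mul_lintegral_flow ham hbm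
    _ ≤ _ := by
        refine lintegral_mono fun z => ?_
        have e : ∫⁻ s : ℝ, a (flow s z) ≤ F z := by
          simp only [ha, hinv]
          rw [lintegral_const_mul, lintegral_indicator_lineLen_inv hZ']
          · exact mul_le_of_le_one_right zero_le (ENNReal.inv_mul_le_one _)
          · exact (hm'.inv.indicator hZu').comp (measurable_flow_left z)
        by_cases hz : z ∈ Z ×ˢ (univ : Set (Space d))
        · rw [hbdef, indicator_of_mem hz, indicator_of_mem hz]
          exact mul_le_mul_right e _
        · rw [hbdef, indicator_of_notMem hz, indicator_of_notMem hz, zero_mul]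

/-- Membership in W^p gives measurability of the weighted function only; positivity of the travel
time allows the weight to be divided out. -/
theorem aestronglyMeasurable_of_travelTime_rpow [IsFiniteMeasure m] (hZ : IsOpen Z)
    (hb : Bornology.IsBounded Z) (h0 : ∀ᵐ v ∂m, v ≠ 0) (q : ℝ) {u : Space d × Space d → ℝ}
    (hu : AEStronglyMeasurable (fun z => travelTime Z z ^ q * u z) (phaseMeasure Z m)) :
    AEStronglyMeasurable u (phaseMeasure Z m) := by
  have hτm := aestronglyMeasurable_travelTime (m := m) hZ hb h0
  have h1 : AEStronglyMeasurable (fun z => travelTime Z z ^ (-q) * (travelTime Z z ^ q * u z))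
      (phaseMeasure Z m) := (hτm.aemeasurable.pow_const _).aestronglyMeasurable.mul hu
  refine h1.congr ?_
  filter_upwards [ae_phaseMeasure_of_ae (X := Z) (ae_snd_of_ae h0),
    ae_phaseMeasure_mem (m := m) hZ.measurableSet] with z hz hzZ
  have hτ := travelTime_pos hZ hb hzZ hz
  rw [← mul_assoc, ← Real.rpow_add hτ, neg_add_cancel, Real.rpow_zero, one_mul]

theorem lintegral_lineLen_inv_lt_top_of_memLp [IsFiniteMeasure m] (hp : 1 ≤ p) (hZ : IsOpen Z)
    (hb : Bornology.IsBounded Z) (h0 : ∀ᵐ v ∂m, v ≠ 0) {u : Space d × Space d → ℝ}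
    (hu : MemLp (fun z => travelTime Z z ^ (-(1 / p)) * u z) (ENNReal.ofReal p) (phaseMeasure Z m)) :
    ∫⁻ z, (lineLen Z z)⁻¹ * ‖u z‖ₑ ^ p ∂(phaseMeasure Z m) < ⊤ := by
  have hp0 : 0 < p := by linarith
  refine lt_of_le_of_lt (lintegral_mono_ae ?_) ((memLp_iff_lintegral_lt_top hp hu.1).1 hu)
  filter_upwards [ae_phaseMeasure_of_ae (X := Z) (ae_snd_of_ae h0),
    ae_phaseMeasure_mem (m := m) hZ.measurableSet] with z hz hzZ
  rw [enorm_travelTime_rpow_mul hp (travelTime_pos hZ hb hzZ hz), neg_mul, one_div,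
    inv_mul_cancel₀ hp0.ne', ENNReal.rpow_neg_one]
  exact mul_le_mul_left (ENNReal.inv_le_inv.2
    (ofReal_travelTime_le_lineLen hZ hb subset_rfl hzZ hz)) _

theorem lintegral_enorm_add_rpow_lt_top {α : Type*} [MeasurableSpace α] {ν : Measure α} (hp : 1 ≤ p)
    {f g : α → ℝ} (hf : Measurable f) (hfp : ∫⁻ a, ‖f a‖ₑ ^ p ∂ν < ⊤)
    (hgp : ∫⁻ a, ‖g a‖ₑ ^ p ∂ν < ⊤) : ∫⁻ a, ‖(f + g) a‖ₑ ^ p ∂ν < ⊤ := by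
  calc _ ≤ ∫⁻ a, 2 ^ (p - 1) * (‖f a‖ₑ ^ p + ‖g a‖ₑ ^ p) ∂ν := by
        refine lintegral_mono fun a => ?_
        have := enorm_sub_rpow_le hp (f a) (-g a)
        rwa [sub_neg_eq_add, enorm_neg] at this
    _ < ⊤ := by
        rw [lintegral_const_mul' _ _ (by finiteness), lintegral_add_left (hf.enorm.pow_const p)]
        exact ENNReal.mul_lt_top (by finiteness) (ENNReal.add_lt_top.2 ⟨hfp, hgp⟩)

/-- A transport solution on a convex domain is the sum of a function which is constant along lines
and of the line integral of its source. -/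
theorem IsTransportSolution.exists_decomposition [IsFiniteMeasure m] (hp : 1 ≤ p) (hZ : IsOpen Z)
    (hb : Bornology.IsBounded Z) (hconv : Convex ℝ Z) {O F : Set (Space d)} (hO : IsOpen O)
    (hF : IsClosed F) (hVOF : V = O ∩ F) (hV : ∀ᵐ v ∂m, v ∈ V) {c : ℝ} (hc0 : 0 < c)
    (hc : ∀ᵐ v ∂m, c ≤ ‖v‖) (hσ : BoundedAbsorption Z m σ) (hk : AdmissibleScattering Z m p k)
    {P : Set (Space d × Space d)} (hP : MeasurableSet P) {u : Space d × Space d → ℝ}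
    (hu : IsTransportSolution Z V m p σ k u) :
    ∃ A w : Space d × Space d → ℝ, Measurable A ∧ (∀ t z, A (flow t z) = A z) ∧
      ∫⁻ z, (lineLen Z z)⁻¹ * ‖A z‖ₑ ^ p ∂(phaseMeasure Z m) < ⊤ ∧
      Measurable w ∧ (∀ z, z.1 ∉ Z → w z = 0) ∧
      MemLp w (ENNReal.ofReal p) ((volume : Measure (Space d)).prod m) ∧
      u =ᵐ[phaseMeasure Z m] A + lineOp P w ∧
      w =ᵐ[phaseMeasure Z m] collision m σ k (A + lineOp P w) := by
  have := isFiniteMeasure_phaseMeasure (m := m) hb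
  have hp0 : 0 < p := by linarith
  have hp1 : 1 ≤ ENNReal.ofReal p := by simpa using hp
  have h0 : ∀ᵐ v ∂m, v ≠ 0 := hc.mono fun v hv => ne_zero_of_le_norm hc0 hv
  have hZm := hZ.measurableSet
  obtain ⟨w', ⟨hweak, hup, -⟩, heq⟩ := hu
  have hum := aestronglyMeasurable_of_travelTime_rpow hZ hb h0 _ hup.1
  have hul := lintegral_lineLen_inv_lt_top_of_memLp hp hZ hb h0 hup
  have huL := memLp_of_lineLen_inv hp hb hc0 hc hum hul
  obtain ⟨K, hK⟩ := exists_collision_bound hp hσ hk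
  obtain ⟨-, hcm, hcp⟩ := hK u huL
  have hcL : MemLp (collision m σ k u) (ENNReal.ofReal p) (phaseMeasure Z m) :=
    (memLp_iff_lintegral_lt_top hp hcm).2 (hcp.trans_lt (ENNReal.mul_lt_top ENNReal.coe_lt_top
      ((memLp_iff_lintegral_lt_top hp hum).1 huL)))
  have hw'c : w' =ᵐ[phaseMeasure Z m] collision m σ k u := by
    filter_upwards [heq] with z hz
    rw [collision, ← hz.2]
    ring
  -- the source
  set w : Space d × Space d → ℝ := (Z ×ˢ univ).indicator (hcm.mk _) with hw
  have hwm : Measurable w := hcm.stronglyMeasurable_mk.measurable.indicator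
    (hZm.prod MeasurableSet.univ)
  have hw0 : ∀ z, z.1 ∉ Z → w z = 0 := fun z hz => indicator_of_notMem (fun h => hz h.1) _
  have hwc : w =ᵐ[phaseMeasure Z m] collision m σ k u := by
    filter_upwards [hcm.ae_eq_mk, ae_phaseMeasure_mem (m := m) hZm] with z hz hzZ
    rw [hz, hw, indicator_of_mem (show z ∈ Z ×ˢ univ from ⟨hzZ, trivial⟩)]
  have hwZ : MemLp w (ENNReal.ofReal p) (phaseMeasure Z m) := hcL.ae_eq hwc.symm
  have hwp := memLp_volume_prod hp hZm hwm hw0 hwZ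
  have hwi := integrable_of_support hp hZm hb hwm hw0 hwp
  have hlm := measurable_lineOp hP hwm
  have hll := lintegral_lineLen_inv_lineOp_lt_top hp hZm hb hc0 hc (P := P) hwm hw0 hwp
  have hlL := memLp_of_lineLen_inv hp hb hc0 hc hlm.aestronglyMeasurable hll
  -- the invariant part
  set u' := hum.mk u with hu'
  have huu' : u =ᵐ[phaseMeasure Z m] u' := hum.ae_eq_mk
  have hu'm : Measurable u' := hum.stronglyMeasurable_mk.measurable
  set D : Space d × Space d → ℝ := u' - lineOp P w with hD
  have hDm : Measurable D := hu'm.sub hlm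
  have huL' := huL.ae_eq huu'
  have hDi : Integrable D (phaseMeasure Z m) := (huL'.sub hlL).integrable hp1
  have hDweak : HasWeakTransportDeriv Z V m D fun _ => 0 := by
    have hwi' : Integrable w (phaseMeasure Z m) := hwZ.integrable hp1
    have h1 := HasWeakTransportDeriv.sub hZ hV (hweak.congr huu' (hw'c.trans hwc.symm))
      (hasWeakTransportDeriv_lineOp hZ hb hV hc0 hc hP hwm hwi) (huL'.integrable hp1)
      (hlL.integrable hp1) hwi' hwi'
    refine h1.congr (EventuallyEq.refl _ _) (Eventually.of_forall fun z => ?_)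
    simp
  -- The chord average supplies a representative that is invariant at every point, not just almost
  -- everywhere.
  have hDA := ae_eq_chordAverage hZ hb hconv hO hF hVOF hV hc0 hc hDm hDi hDweak
  have huA : u =ᵐ[phaseMeasure Z m] chordAverage Z D + lineOp P w := by
    filter_upwards [huu', hDA] with z h1 h2
    rw [Pi.add_apply, ← h2, h1, hD, Pi.sub_apply, sub_add_cancel]
  refine ⟨chordAverage Z D, w, measurable_chordAverage hZm hDm, chordAverage_flow Z D, ?_, hwm,
    hw0, hwp, huA, hwc.trans (collision_congr huA)⟩
  have lm : Measurable fun z => (lineLen Z z)⁻¹ := (measurable_lineLen hZm).inv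
  calc _ ≤ ∫⁻ z, 2 ^ (p - 1) * ((lineLen Z z)⁻¹ * ‖u z‖ₑ ^ p + (lineLen Z z)⁻¹ *
        ‖lineOp P w z‖ₑ ^ p) ∂(phaseMeasure Z m) := by
        refine lintegral_mono_ae ?_
        filter_upwards [hDA, huu'] with z hz hz2
        rw [← hz, ← mul_add, mul_left_comm, hD, Pi.sub_apply, ← hz2]
        exact mul_le_mul_right (enorm_sub_rpow_le hp _ _) _
    _ < ⊤ := by
        have lm' : Measurable fun z => (lineLen Z z)⁻¹ * ‖lineOp P w z‖ₑ ^ p :=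
          lm.mul (hlm.enorm.pow_const p)
        rw [lintegral_const_mul' _ _ (by finiteness), lintegral_add_right _ lm']
        exact ENNReal.mul_lt_top (by finiteness) (ENNReal.add_lt_top.2 ⟨hul, hll⟩)

end Transport

/-! ### Exact boundary control. -/

namespace Transport

variable {d : ℕ} {V : Set (Space d)} {m : Measure (Space d)} {p : ℝ} {ρ : Space d → ℝ}
  {σ : Space d × Space d → ℝ} {k : Space d → Space d → Space d → ℝ}

theorem flow_of_snd_eq_zero {z : Space d × Space d} (hz : z.2 = 0) (t : ℝ) : flow t z = z := by
  ext1
  · rw [flow_fst, hz, smul_zero, add_zero]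
  · rfl

namespace IsConvexProfile

variable (hρ : IsConvexProfile ρ)
include hρ

/-- A line-invariant function with prescribed values on the lines meeting `Z_0` and prescribed
incoming data on the lines missing `Z_{1-ε}`. -/
theorem exists_invariant_extension [IsFiniteMeasure m] (hp : 1 ≤ p)
    (hV : ∀ᵐ v ∂m, v ∈ V) {c : ℝ} (hc0 : 0 < c) (hc : ∀ᵐ v ∂m, c ≤ ‖v‖)
    {ε : ℝ} (hε : ε < 1) {A₀ γ : Space d × Space d → ℝ} (hA₀ : Measurable A₀)
    (hinv : ∀ t z, A₀ (flow t z) = A₀ z)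
    (hA₀p : ∫⁻ z, (lineLen (sublevel ρ 0) z)⁻¹ * ‖A₀ z‖ₑ ^ p ∂(phaseMeasure (sublevel ρ 0) m) < ⊤)
    (hγ : Measurable γ)
    (hγp : ∫⁻ z in grazing ρ V 1 (1 - ε), ‖γ z‖ₑ ^ p ∂(levelMeasure ρ 1 m) < ⊤) :
    ∃ A : Space d × Space d → ℝ, Measurable A ∧ (∀ t z, A (flow t z) = A z) ∧
      ∫⁻ z, (lineLen (sublevel ρ 1) z)⁻¹ * ‖A z‖ₑ ^ p ∂(phaseMeasure (sublevel ρ 1) m) < ⊤ ∧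
      (∀ z, z.1 ∈ sublevel ρ 0 → A z = A₀ z) ∧
      (∀ z ∈ crossingSet ρ 1 (-1), z ∈ missing ρ (1 - ε) → A z = γ z) := by
  have hp0 : 0 < p := by linarith
  set H : Set (Space d × Space d) := {z | ∃ t : ℝ, ρ (flow t z).1 < 0} with hH
  set H₁ : Set (Space d × Space d) := {z | ∃ t : ℝ, ρ (flow t z).1 < 1} with hH₁
  set N := missing ρ (1 - ε) with hN
  have hHm : MeasurableSet H := (hρ.isOpen_hit 0).measurableSet
  have hH₁m : MeasurableSet H₁ := (hρ.isOpen_hit 1).measurableSet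
  have hNm : MeasurableSet N := hρ.measurableSet_missing _
  have hHN : ∀ z ∈ N, z ∉ H := by
    rintro z hz ⟨t, ht⟩
    exact hz t (by linarith)
  have hHf : ∀ t z, flow t z ∈ H ↔ z ∈ H := fun t z => exists_flow_lt_flow_iff 0 t z
  have hH₁f : ∀ t z, flow t z ∈ H₁ ↔ z ∈ H₁ := fun t z => exists_flow_lt_flow_iff 1 t z
  have hNf : ∀ t z, flow t z ∈ N ↔ z ∈ N := fun t z => flow_mem_missing_iff (1 - ε) t z
  have h2 : (-1 : ℝ) = 1 ∨ (-1 : ℝ) = -1 := Or.inr rfl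
  have gm := hγ.comp (hρ.measurable_crossing 1 (-1))
  -- Unlike the extension into the shell, this function is constant on whole lines. The intersection
  -- with H₁ keeps γ on lines that have an entrance point.
  set A : Space d × Space d → ℝ := fun z =>
    H.indicator A₀ z + (N ∩ H₁).indicator (fun z => γ (crossing ρ 1 (-1) z)) z with hA
  have A1 : ∀ z ∈ H, A z = A₀ z := fun z h => by
    have hzN : z ∉ N := fun hN => hHN z hN h
    simp [hA, indicator, h, hzN]
  have A2 : ∀ z ∈ N, z ∈ H₁ → A z = γ (crossing ρ 1 (-1) z) := fun z h h' => by
    simp [hA, indicator, h, h', hHN z h]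
  have A3 : ∀ z, z ∉ H → ¬ (z ∈ N ∧ z ∈ H₁) → A z = 0 := fun z h h' => by
    have : z ∉ N ∩ H₁ := h'
    simp only [hA, indicator_of_notMem h, indicator_of_notMem this, add_zero]
  have hZm : MeasurableSet (sublevel ρ 1) := (hρ.isOpen_sublevel 1).measurableSet
  have hZu : MeasurableSet (sublevel ρ 1 ×ˢ (univ : Set (Space d))) := hZm.prod MeasurableSet.univ
  refine ⟨A, (hA₀.indicator hHm).add (gm.indicator (hNm.inter hH₁m)), ?_, ?_, ?_, ?_⟩
  · intro t z
    by_cases hz0 : z.2 = 0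
    · rw [flow_of_snd_eq_zero hz0]
    by_cases hzH : z ∈ H
    · rw [A1 z hzH, A1 _ ((hHf t z).2 hzH), hinv]
    · by_cases hzN : z ∈ N ∧ z ∈ H₁
      · rw [A2 z hzN.1 hzN.2, A2 _ ((hNf t z).2 hzN.1) ((hH₁f t z).2 hzN.2),
          hρ.crossing_flow h2 hz0 hzN.2]
      · rw [A3 z hzH hzN, A3 _ (fun h => hzH ((hHf t z).1 h))
          (fun h => hzN ⟨(hNf t z).1 h.1, (hH₁f t z).1 h.2⟩)]
  · obtain ⟨C, hC⟩ := hρ.exists_lintegral_crossing_le (s := 1) (by norm_num) hZm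
    have hm0 : ∀ᵐ v ∂m, v ≠ 0 := hc.mono fun v hv => ne_zero_of_le_norm hc0 hv
    have e3 := hC m hm0 (-1) h2 N hNm hNf _ (hγ.enorm.pow_const p)
    have fin' : ∫⁻ z in crossingSet ρ 1 (-1), N.indicator (fun z => ‖γ z‖ₑ ^ p) z
        ∂(levelMeasure ρ 1 m) < ⊤ := by
      rw [lintegral_indicator hNm, Measure.restrict_restrict hNm]
      refine lt_of_le_of_lt (lintegral_mono' (Measure.restrict_mono_ae ?_) le_rfl) hγp
      filter_upwards [hρ.ae_levelMeasure_of_ae (by norm_num) hV] with z hzV hz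
      exact (hρ.mem_grazing_iff (by norm_num) z).2 ⟨hz.2, hzV, hz.1⟩
    have t3 := e3.trans_lt (ENNReal.mul_lt_top ENNReal.coe_lt_top fin')
    rw [← lintegral_indicator hH₁m] at t3
    have t1 : ∫⁻ z, (H ∩ sublevel ρ 1 ×ˢ univ).indicator
        (fun z => (lineLen (sublevel ρ 1) z)⁻¹ * ‖A₀ z‖ₑ ^ p) z
        ∂((volume : Measure (Space d)).prod m) < ⊤ := by
      rw [lintegral_indicator (hHm.inter hZu)]
      refine (lintegral_lineLen_inv_invariant_le (hρ.isOpen_sublevel 0) (hρ.isBounded_sublevel 0)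
        hZm hc0 hc hHm (fun z hz => hz) (hA₀.enorm.pow_const p)
        (fun t z => by rw [hinv])).trans_lt ?_
      rwa [← phaseMeasure_eq_restrict]
    have lm : Measurable fun z => (lineLen (sublevel ρ 1) z)⁻¹ := (measurable_lineLen hZm).inv
    have t := ENNReal.add_lt_top.2 ⟨t1, t3⟩
    rw [← lintegral_add_left] at t
    swap
    · exact (lm.mul (hA₀.enorm.pow_const p)).indicator (hHm.inter hZu)
    rw [phaseMeasure_eq_restrict, ← lintegral_indicator hZu]
    refine (lintegral_mono fun z => ?_).trans_lt t
    by_cases hz : z ∈ sublevel ρ 1 ×ˢ (univ : Set (Space d))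
    swap
    · rw [indicator_of_notMem hz]; exact zero_le
    rw [indicator_of_mem hz]
    by_cases hzH : z ∈ H
    · refine le_trans ?_ (le_add_of_nonneg_right zero_le)
      rw [indicator_of_mem (show z ∈ H ∩ _ from ⟨hzH, hz⟩), A1 z hzH]
    · refine le_trans ?_ (le_add_of_nonneg_left zero_le)
      by_cases hzN : z ∈ N
      · have hz2 : z ∈ H₁ := ⟨0, by rw [flow_zero]; exact hz.1⟩
        rw [A2 z hzN hz2, indicator_of_mem hz2, indicator_of_mem (show z ∈ N ∩ _ from ⟨hzN, hz⟩)]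
      · rw [A3 z hzH fun h => hzN h.1]
        simp [hp0]
  · intro z hz
    exact A1 z ⟨0, by rw [flow_zero]; exact hz⟩
  · intro z hz hzN
    rw [A2 z hzN (hρ.hit_of_mem_crossingSet hz), hρ.crossing_self h2 hz]

/-- Exact boundary control of the solutions on the inner domain. -/
theorem exists_boundary_control (hp : 1 ≤ p) (hVs : IsVelocitySpace V m)
    (hσ : BoundedAbsorption (sublevel ρ 1) m σ) (hk : AdmissibleScattering (sublevel ρ 1) m p k)
    {ε : ℝ} (hε1 : ε < 1) (hsol : IsShellSolvable ρ m p σ k ε) {u₀ γ : Space d × Space d → ℝ}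
    (hu₀ : IsTransportSolution (sublevel ρ 0) V m p σ k u₀)
    (hγ : MemLp γ (ENNReal.ofReal p)
      ((boundaryMeasure (sublevel ρ 1) m).restrict (grazing ρ V 1 (1 - ε)))) :
    ∃ u g, IsTransportSolution (sublevel ρ 1) V m p σ k u ∧
      u =ᵐ[phaseMeasure (sublevel ρ 0) m] u₀ ∧
      MemLp g (ENNReal.ofReal p)
        ((boundaryMeasure (sublevel ρ 1) m).restrict (incoming (sublevel ρ 1) V)) ∧
      HasTraceOn (sublevel ρ 1) V m u (incoming (sublevel ρ 1) V) g ∧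
      HasTraceOn (sublevel ρ 1) V m u (grazing ρ V 1 (1 - ε)) γ := by
  have := hVs.isFiniteMeasure
  have hVm := hVs.measurableSet
  have hV := hVs.ae_mem
  obtain ⟨c, R, hc0, hR0, hcR⟩ := hVs.exists_norm_bounds
  obtain ⟨O, F, hO, hF, hVOF⟩ := hVs.exists_locallyClosed
  have hc : ∀ᵐ v ∂m, c ≤ ‖v‖ := hV.mono fun v hv => (hcR v hv).1
  have h11 : (-1 : ℝ) < 1 := by norm_num
  have h2 : (-1 : ℝ) = 1 ∨ (-1 : ℝ) = -1 := Or.inr rfl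
  have h0Z : sublevel ρ 0 ⊆ sublevel ρ 1 := fun x hx =>
    lt_trans (show ρ x < 0 from hx) zero_lt_one
  have hP := hρ.measurableSet_forwardSet ε
  have hZm := (hρ.isOpen_sublevel 1).measurableSet
  have hZb := hρ.isBounded_sublevel 1
  have hS1 := hρ.measurableSet_grazing hVm h11 (1 - ε)
  rw [hρ.boundaryMeasure_sublevel h11] at hγ
  have hγγ' := hγ.1.ae_eq_mk
  have hγp := (memLp_iff_lintegral_lt_top hp hγ.1.stronglyMeasurable_mk.aestronglyMeasurable).1
    (hγ.ae_eq hγγ')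
  -- The inner solution is decomposed with the same `forwardSet` as on the shell, so that the two
  -- line integrals add.
  obtain ⟨A₀, w₀, hA₀, hA₀inv, hA₀p, hw₀, hw₀0, hw₀p, hu₀A, hw₀c⟩ :=
    hu₀.exists_decomposition hp (hρ.isOpen_sublevel 0) (hρ.isBounded_sublevel 0)
      (hρ.convex_sublevel 0) hO hF hVOF hV hc0 hc (hσ.mono h0Z) (hk.mono h0Z) hP
  obtain ⟨A, hA, hAinv, hAp, hAA₀, hAγ⟩ := hρ.exists_invariant_extension hp hV hc0 hc hε1 hA₀
    hA₀inv hA₀p hγ.1.stronglyMeasurable_mk.measurable hγp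
  have hAe : A + lineOp (forwardSet ρ ε) w₀ =ᵐ[phaseMeasure (sublevel ρ 0) m]
      A₀ + lineOp (forwardSet ρ ε) w₀ := by
    filter_upwards [ae_phaseMeasure_mem (m := m) (hρ.isOpen_sublevel 0).measurableSet] with z hz
    rw [Pi.add_apply, Pi.add_apply, hAA₀ z hz]
  obtain ⟨w, hw, hw0, hwp, hsolu, -, hue⟩ := hρ.exists_extension_of_inner hp hV hc0 hc hσ hk hε1
    hsol hA hAinv hAp hw₀ hw₀0 hw₀p (hw₀c.trans (collision_congr hAe).symm)
  have hwi := integrable_of_support hp hZm hZb hw hw0 hwp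
  have hlm := measurable_lineOp hP hw
  have hincm : incoming (sublevel ρ 1) V = crossingSet ρ 1 (-1) ∩ Prod.snd ⁻¹' V := by
    ext z
    rw [hρ.mem_incoming_iff h11]
    simp only [crossingSet, mem_inter_iff, mem_preimage]
    constructor
    · rintro ⟨h1, h2, h3⟩
      exact ⟨⟨h1, by linarith⟩, h2⟩
    · rintro ⟨⟨h1, h3⟩, h2⟩
      exact ⟨h1, h2, by linarith⟩
  have hincms : MeasurableSet (incoming (sublevel ρ 1) V) := by
    rw [hincm]
    exact (hρ.measurableSet_crossingSet _ _).inter (measurable_snd hVm)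
  have hout : ∀ z ∈ crossingSet ρ 1 (-1), z ∉ outgoing (sublevel ρ 1) V := by
    intro z hz h
    have h3 := ((hρ.mem_outgoing_iff h11 V z).1 h).2.2
    have := hz.2
    linarith
  -- The solution is defined pointwise and is continuous along integrable lines, so the control g is
  -- the same function read on the incoming boundary.
  refine ⟨A + lineOp (forwardSet ρ ε) w, A + lineOp (forwardSet ρ ε) w, hsolu,
    hue.trans (hAe.trans hu₀A.symm), ?_, hasTraceOn_add_lineOp hP hw ?_,
    hasTraceOn_add_lineOp hP hw ?_⟩
  · rw [hρ.boundaryMeasure_sublevel h11,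
      memLp_iff_lintegral_lt_top hp (hA.add hlm).aestronglyMeasurable]
    refine lt_of_le_of_lt (lintegral_mono' (Measure.restrict_mono
      (hincm.trans_subset inter_subset_left) le_rfl) le_rfl) ?_
    exact lintegral_enorm_add_rpow_lt_top hp hA
      (hρ.lintegral_crossing_invariant_lt_top h11 hc0 hc hA hAinv hAp h2)
      (hρ.lintegral_crossing_lineOp_lt_top hp h11 hZm hZb hc0 hc _ hw hw0 hwp h2)
  · rw [hρ.boundaryMeasure_sublevel h11]
    filter_upwards [ae_restrict_mem hincms,
      ae_restrict_of_ae (hρ.ae_integrable_of_crossing h11 hw hwi)] with z hzS hzi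
    rw [hincm] at hzS
    have hD : fderiv ℝ ρ z.1 z.2 < 0 := by have := hzS.1.2; linarith
    refine ⟨fun _ => ⟨hzi hzS.1.1 hD.ne, Eventually.of_forall fun t => ?_⟩,
      fun h => absurd h (hout z hzS.1)⟩
    rw [hAinv, Pi.add_apply, add_sub_cancel_right]
  · rw [hρ.boundaryMeasure_sublevel h11]
    filter_upwards [hγγ', ae_restrict_mem hS1,
      ae_restrict_of_ae (hρ.ae_integrable_of_crossing h11 hw hwi)] with z hz hzS hzi
    obtain ⟨hzc, -, hzm⟩ := (hρ.mem_grazing_iff h11 z).1 hzS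
    have hD : fderiv ℝ ρ z.1 z.2 < 0 := by have := hzc.2; linarith
    rw [hρ.lineOp_eq_zero_of_grazing hw0 hzc hzm, sub_zero, hz]
    exact ⟨fun _ => ⟨hzi hzc.1 hD.ne, Eventually.of_forall fun t => by
      rw [hAinv, hAγ z hzc hzm]⟩, fun h => absurd h (hout z hzc)⟩

end IsConvexProfile

end Transport

/-! ### Failure of unique continuation. -/

namespace Transport

variable {d : ℕ} {V : Set (Space d)} {m : Measure (Space d)} {p : ℝ} {ρ : Space d → ℝ}
  {σ : Space d × Space d → ℝ} {k : Space d → Space d → Space d → ℝ}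

theorem exists_ne_zero_inner_eq_zero (hd : 2 ≤ d) (v : Space d) :
    ∃ e : Space d, e ≠ 0 ∧ inner ℝ e v = (0 : ℝ) := by
  have h : (Submodule.span ℝ {v})ᗮ ≠ ⊥ := by
    intro h
    rw [Submodule.orthogonal_eq_bot_iff] at h
    have h1 := finrank_span_le_card (R := ℝ) ({v} : Set (Space d))
    rw [h, finrank_top, finrank_euclideanSpace_fin] at h1
    simp at h1
    omega
  obtain ⟨e, he, he0⟩ := Submodule.exists_mem_ne_zero_of_ne_bot h
  exact ⟨e, he0, by
    rw [real_inner_comm]; exact Submodule.mem_orthogonal_singleton_iff_inner_right.1 he⟩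

theorem lineOp_zero (P : Set (Space d × Space d)) : lineOp P 0 = 0 := by
  ext z
  simp [lineOp]

theorem collision_zero : collision m σ k 0 = 0 := by
  ext z
  simp [collision]

namespace IsConvexProfile

variable (hρ : IsConvexProfile ρ)
include hρ

/-- In dimension at least two, every direction is tangent to every level set. -/
theorem exists_tangent (hd : 2 ≤ d) {s : ℝ} (hs : -1 < s) (v : Space d) :
    ∃ x, ρ x = s ∧ fderiv ℝ ρ x v = 0 := by
  obtain ⟨e, he, hev⟩ := exists_ne_zero_inner_eq_zero hd v
  -- A linear functional orthogonal to v is maximized over {ρ ≤ s}. At the maximizer no direction in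
  -- its kernel can decrease ρ, and this applies to both v and -v.
  obtain ⟨x, hx, hmax⟩ := (hρ.isCompact_le s).exists_isMaxOn
    ⟨0, show ρ 0 ≤ s by rw [hρ.value_zero]; exact hs.le⟩
    (f := fun y => inner ℝ e y) (by fun_prop)
  have key : ∀ y, ρ y < s → inner ℝ e y < inner ℝ e x := by
    intro y hy
    have h1 : Tendsto (fun t : ℝ => ρ (y + t • e)) (𝓝[>] 0) (𝓝 (ρ y)) := by
      have := hρ.continuous
      have h2 : Continuous fun t : ℝ => ρ (y + t • e) := by fun_prop
      simpa using (h2.tendsto 0).mono_left nhdsWithin_le_nhds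
    obtain ⟨t, ht, ht0⟩ := ((h1.eventually_lt_const hy).and self_mem_nhdsWithin).exists
    have h3 := hmax (show ρ (y + t • e) ≤ s from ht.le)
    change inner ℝ e (y + t • e) ≤ inner ℝ e x at h3
    rw [inner_add_right, inner_smul_right] at h3
    have h4 : 0 < t * inner ℝ e e := mul_pos ht0 (real_inner_self_pos.2 he)
    linarith
  have hxs : ρ x = s := le_antisymm hx (not_lt.1 fun h => (key x h).false)
  have aux : ∀ w, inner ℝ e w = (0 : ℝ) → ¬ fderiv ℝ ρ x w < 0 := by
    intro w hw h
    obtain ⟨t, ht⟩ := (hρ.eventually_lt_of_fderiv_neg h).exists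
    have := key _ (hxs ▸ ht)
    rw [inner_add_right, inner_smul_right, hw, mul_zero, add_zero] at this
    exact this.false
  refine ⟨x, hxs, le_antisymm ?_ (not_lt.1 (aux v hev))⟩
  have := aux (-v) (by rw [inner_neg_right, hev, neg_zero])
  rw [map_neg] at this
  linarith

/-- In dimension at least two, the lines meeting `Z_1` and missing `Z_s` have positive measure. -/
theorem measure_missing_pos [IsFiniteMeasure m] (hd : 2 ≤ d) (hVs : IsVelocitySpace V m)
    (hVne : V.Nonempty) {s : ℝ} (hs : -1 < s) (hs1 : s < 1) :
    phaseMeasure (sublevel ρ 1) m (missing ρ s) ≠ 0 := by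
  obtain ⟨c, R, hc0, hR0, hcV⟩ := hVs.exists_norm_bounds
  obtain ⟨L, -, hL⟩ := exists_lineLen_le (hρ.isBounded_sublevel 1) hc0
  obtain ⟨v₀, hv₀⟩ := hVne
  -- The tangent point is taken on a level strictly between s and 1, leaving room to perturb both x
  -- and v.
  obtain ⟨x₀, hx₀, hxv⟩ := hρ.exists_tangent hd (s := (s + 1) / 2) (by linarith) v₀
  -- By the tangent inequality, and since two points of a chord of Z_1 differ in time by at most L,
  -- positivity of this quantity minus s keeps the whole chord above s. The condition is open and
  -- holds at the tangent point.
  have hcont : Continuous fun z : Space d × Space d => ρ z.1 - L * |fderiv ℝ ρ z.1 z.2| :=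
    (hρ.continuous.comp continuous_fst).sub (hρ.continuous_fderiv_apply.abs.const_mul _)
  have hmem : ∀ᶠ z in 𝓝 (x₀, v₀), s < ρ z.1 - L * |fderiv ℝ ρ z.1 z.2| ∧ z.1 ∈ sublevel ρ 1 := by
    refine (hcont.tendsto (x₀, v₀) |>.eventually_const_lt ?_).and ?_
    · simp only [hx₀, hxv, abs_zero, mul_zero, sub_zero]; linarith
    · refine continuous_fst.continuousAt.eventually_mem ((hρ.isOpen_sublevel 1).mem_nhds ?_)
      change ρ x₀ < 1
      linarith
  rw [nhds_prod_eq] at hmem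
  obtain ⟨S, hS, T, hT, hST⟩ := Filter.mem_prod_iff.1 hmem
  obtain ⟨O₁, hO₁, hO₁o, hx1⟩ := mem_nhds_iff.1 hS
  obtain ⟨O₂, hO₂, hO₂o, hv2⟩ := mem_nhds_iff.1 hT
  have h1 : 0 < volume O₁ := hO₁o.measure_pos _ ⟨x₀, hx1⟩
  have h2 : 0 < m O₂ := hVs.measure_pos hO₂o ⟨v₀, hv2, hv₀⟩
  intro h0
  have hsub : (O₁ ×ˢ O₂ : Set (Space d × Space d)) ≤ᵐ[phaseMeasure (sublevel ρ 1) m]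
      missing ρ s := by
    filter_upwards [ae_phaseMeasure_of_ae (X := sublevel ρ 1) (ae_snd_of_ae hVs.ae_mem)]
      with z hzV hz t ht
    have hzST := hST (show z ∈ S ×ˢ T from ⟨hO₁ hz.1, hO₂ hz.2⟩)
    have ht1 : (flow t z).1 ∈ sublevel ρ 1 := show ρ (flow t z).1 < 1 by linarith
    have htL := (hL z (hcV _ hzV).1).2 t hzST.2 ht1
    have h3 := hρ.first_order_flow z 0 t
    rw [flow_zero, sub_zero] at h3
    have h4 : |t * fderiv ℝ ρ z.1 z.2| ≤ L * |fderiv ℝ ρ z.1 z.2| := by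
      rw [abs_mul]
      exact mul_le_mul_of_nonneg_right htL (abs_nonneg _)
    have h5 := neg_abs_le (t * fderiv ℝ ρ z.1 z.2)
    have h6 : s < ρ z.1 - L * |fderiv ℝ ρ z.1 z.2| := hzST.1
    linarith
  have h3 : phaseMeasure (sublevel ρ 1) m (O₁ ×ˢ O₂) = 0 :=
    le_antisymm ((measure_mono_ae hsub).trans h0.le) zero_le
  have hO₁Z : O₁ ⊆ sublevel ρ 1 := fun x hx =>
    (hST (show (x, v₀) ∈ S ×ˢ T from ⟨hO₁ hx, hO₂ hv2⟩)).2
  rw [phaseMeasure, Measure.prod_prod, Measure.restrict_apply hO₁o.measurableSet,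
    inter_eq_left.2 hO₁Z] at h3
  exact (ENNReal.mul_pos h1.ne' h2.ne').ne' h3

/-- The zero solution on Z_0 is continued with an invariant part supported on the lines missing
Z_{1-ε}. Vanishing of the result would force its source, then its line integral, and finally that
invariant part to vanish. -/
theorem exists_not_unique_continuation (hd : 2 ≤ d) (hp : 1 ≤ p) (hVs : IsVelocitySpace V m)
    (hVne : V.Nonempty) (hσ : BoundedAbsorption (sublevel ρ 1) m σ)
    (hk : AdmissibleScattering (sublevel ρ 1) m p k) {ε : ℝ} (hε0 : 0 < ε) (hε1 : ε < 1)
    (hsol : IsShellSolvable ρ m p σ k ε) :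
    ∃ u, IsTransportSolution (sublevel ρ 1) V m p σ k u ∧
      u =ᵐ[phaseMeasure (sublevel ρ 0) m] 0 ∧ ¬ u =ᵐ[phaseMeasure (sublevel ρ 1) m] 0 := by
  have := hVs.isFiniteMeasure
  obtain ⟨c, R, hc0, hR0, hcV⟩ := hVs.exists_norm_bounds
  have hc : ∀ᵐ v ∂m, c ≤ ‖v‖ := hVs.ae_mem.mono fun v hv => (hcV v hv).1
  have hZ := hρ.isOpen_sublevel 1
  have hb := hρ.isBounded_sublevel 1
  have := isFiniteMeasure_phaseMeasure (m := m) hb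
  obtain ⟨L, -, hL⟩ := exists_lineLen_le hb hc0
  have hLae : ∀ᵐ z ∂(phaseMeasure (sublevel ρ 1) m), lineLen (sublevel ρ 1) z ≤ L :=
    (ae_phaseMeasure_of_ae (ae_snd_of_ae hc)).mono fun z hz => (hL z hz).1
  -- The chord length is chosen as value because it makes the weighted integrand at most
  -- lineLen^(p-1), which is bounded for every p ≥ 1.
  set A : Space d × Space d → ℝ :=
    (missing ρ (1 - ε)).indicator fun z => (lineLen (sublevel ρ 1) z).toReal with hA
  have hinv : ∀ t z, A (flow t z) = A z := by
    intro t z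
    by_cases h : z ∈ missing ρ (1 - ε)
    · rw [hA, indicator_of_mem h, indicator_of_mem ((flow_mem_missing_iff _ t z).2 h), lineLen_flow]
    · rw [hA, indicator_of_notMem h,
        indicator_of_notMem fun h' => h ((flow_mem_missing_iff _ t z).1 h')]
  have hA0 : A =ᵐ[phaseMeasure (sublevel ρ 0) m] 0 := by
    filter_upwards [ae_phaseMeasure_mem (m := m) (hρ.isOpen_sublevel 0).measurableSet] with z hz
    have h0 : z ∉ missing ρ (1 - ε) := fun h => by
      have h1 : ρ z.1 < 0 := hz
      refine h 0 ?_
      rw [flow_zero]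
      linarith
    exact indicator_of_notMem h0 _
  have hAp : ∫⁻ z, (lineLen (sublevel ρ 1) z)⁻¹ * ‖A z‖ₑ ^ p
      ∂(phaseMeasure (sublevel ρ 1) m) < ⊤ := by
    calc _ ≤ ∫⁻ _, (L : ℝ≥0∞) ^ (p - 1) ∂(phaseMeasure (sublevel ρ 1) m) := by
          refine lintegral_mono_ae ?_
          filter_upwards [hLae] with z hz
          have hA' : ‖A z‖ₑ ≤ lineLen (sublevel ρ 1) z := by
            by_cases h : z ∈ missing ρ (1 - ε)
            · rw [hA, indicator_of_mem h, Real.enorm_of_nonneg ENNReal.toReal_nonneg]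
              exact ENNReal.ofReal_toReal_le
            · rw [hA, indicator_of_notMem h, enorm_zero]; exact zero_le
          calc _ ≤ (lineLen (sublevel ρ 1) z)⁻¹ *
                (lineLen (sublevel ρ 1) z * lineLen (sublevel ρ 1) z ^ (p - 1)) := by
                gcongr
                calc _ ≤ lineLen (sublevel ρ 1) z ^ (1 + (p - 1)) := by
                      rw [add_sub_cancel]
                      exact ENNReal.rpow_le_rpow hA' (by linarith)
                  _ = _ := by
                      rw [ENNReal.rpow_add_of_nonneg _ _ zero_le_one (by linarith),
                        ENNReal.rpow_one]
            _ ≤ lineLen (sublevel ρ 1) z ^ (p - 1) := by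
                rw [← mul_assoc]
                exact mul_le_of_le_one_left zero_le (ENNReal.inv_mul_le_one _)
            _ ≤ _ := ENNReal.rpow_le_rpow hz (by linarith)
      _ < ⊤ := by
          rw [lintegral_const]
          exact ENNReal.mul_lt_top (ENNReal.rpow_lt_top_of_nonneg (by linarith)
            ENNReal.coe_ne_top) (measure_lt_top _ _)
  have heq : ∀ᵐ z ∂(phaseMeasure (sublevel ρ 0) m),
      (0 : Space d × Space d → ℝ) z = collision m σ k (A + lineOp (forwardSet ρ ε) 0) z := by
    have h := collision_congr (m := m) (σ := σ) (k := k) hA0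
    rw [collision_zero] at h
    rw [lineOp_zero, add_zero]
    exact h.symm
  obtain ⟨w, hw, hw0, -, hsolu, hwc, hu0⟩ := hρ.exists_extension_of_inner hp hVs.ae_mem hc0 hc hσ hk
    hε1 hsol (((measurable_lineLen hZ.measurableSet).ennreal_toReal).indicator
      (hρ.measurableSet_missing _)) hinv hAp (w₀ := 0) measurable_zero (fun _ _ => rfl)
    MemLp.zero' heq
  refine ⟨_, hsolu, ?_, fun hu => ?_⟩
  · rw [lineOp_zero, add_zero] at hu0
    exact hu0.trans hA0
  -- The source is the collision term of u, so it vanishes together with u.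
  have hw1 : w =ᵐ[phaseMeasure (sublevel ρ 1) m] 0 := by
    have h := collision_congr (m := m) (σ := σ) (k := k) hu
    rw [collision_zero] at h
    exact hwc.trans h
  have hw2 : ∀ᵐ z ∂((volume : Measure (Space d)).prod m), w z = 0 := by
    rw [phaseMeasure_eq_restrict] at hw1
    have h := (ae_restrict_iff' (hZ.measurableSet.prod MeasurableSet.univ)).1 hw1
    filter_upwards [h] with z hz
    by_cases hzZ : z.1 ∈ sublevel ρ 1
    · exact hz ⟨hzZ, trivial⟩
    · exact hw0 z hzZ
  have hop : ∀ᵐ z ∂(phaseMeasure (sublevel ρ 1) m), lineOp (forwardSet ρ ε) w z = 0 := by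
    refine ae_phaseMeasure_of_ae ?_
    filter_upwards [ae_ae_flow hw2] with z hz
    unfold lineOp
    refine integral_eq_zero_of_ae ?_
    filter_upwards [hz] with s hs
    rw [hs, mul_zero, Pi.zero_apply]
  refine hρ.measure_missing_pos hd hVs hVne (s := 1 - ε) (by linarith) (by linarith)
    (measure_eq_zero_iff_ae_notMem.2 ?_)
  filter_upwards [hu, hop, hLae, ae_phaseMeasure_mem (m := m) hZ.measurableSet,
    ae_phaseMeasure_of_ae (X := sublevel ρ 1) (ae_snd_of_ae hc)] with z hz h1 h2 hzZ hzc hzm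
  rw [Pi.add_apply, h1, add_zero, indicator_of_mem hzm] at hz
  exact (ENNReal.toReal_pos (lineLen_pos hZ hb hzZ (ne_zero_of_le_norm hc0 hzc)).ne'
    (h2.trans_lt ENNReal.coe_lt_top).ne).ne' hz

end IsConvexProfile

end Transport

theorem theorem4p2 (d : ℕ) (hd : 1 ≤ d) (p : ℝ) (hp : 1 ≤ p)
    (V : Set (Space d)) (m : Measure (Space d)) (hV : IsVelocitySpace V m)
    (ρ : Space d → ℝ) (hρ : IsConvexProfile ρ)
    (σ : Space d × Space d → ℝ) (hσ : BoundedAbsorption (shell ρ) m σ)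
    (k : Space d → Space d → Space d → ℝ) (hk : AdmissibleScattering (shell ρ) m p k) :
    ∃ ε : ℝ, 0 < ε ∧ ε < 1 ∧
      -- solutions on the shell with prescribed traces
      (∀ β γ : Space d × Space d → ℝ,
        MemLp β (ENNReal.ofReal p)
          ((boundaryMeasure (sublevel ρ 0) m).restrict (frontier (sublevel ρ 0) ×ˢ V)) →
        MemLp γ (ENNReal.ofReal p)
          ((boundaryMeasure (sublevel ρ 1) m).restrict (grazing ρ V 1 (1 - ε))) →
        ∃ u, IsTransportSolution (shell ρ) V m p σ k u ∧
          HasTraceOn (shell ρ) V m u (frontier (sublevel ρ 0) ×ˢ V) β ∧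
          HasTraceOn (shell ρ) V m u (grazing ρ V 1 (1 - ε)) γ) ∧
      (BoundedAbsorption (sublevel ρ 1) m σ → AdmissibleScattering (sublevel ρ 1) m p k →
        -- exact boundary control of solutions on the inner domain
        (∀ u₀ γ : Space d × Space d → ℝ,
          IsTransportSolution (sublevel ρ 0) V m p σ k u₀ →
          MemLp γ (ENNReal.ofReal p)
            ((boundaryMeasure (sublevel ρ 1) m).restrict (grazing ρ V 1 (1 - ε))) →
          ∃ u g, IsTransportSolution (sublevel ρ 1) V m p σ k u ∧
            u =ᵐ[phaseMeasure (sublevel ρ 0) m] u₀ ∧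
            MemLp g (ENNReal.ofReal p)
              ((boundaryMeasure (sublevel ρ 1) m).restrict (incoming (sublevel ρ 1) V)) ∧
            HasTraceOn (sublevel ρ 1) V m u (incoming (sublevel ρ 1) V) g ∧
            HasTraceOn (sublevel ρ 1) V m u (grazing ρ V 1 (1 - ε)) γ) ∧
        -- failure of unique continuation
        (2 ≤ d → V.Nonempty →
          ∃ w, IsTransportSolution (sublevel ρ 1) V m p σ k w ∧
            w =ᵐ[phaseMeasure (sublevel ρ 0) m] 0 ∧
            ¬ w =ᵐ[phaseMeasure (sublevel ρ 1) m] 0)) := by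
  obtain ⟨c, R, hc0, -, hcV⟩ := hV.exists_norm_bounds
  have := hV.isFiniteMeasure
  -- A single ε serves all three claims: it comes from solvability on the shell, and the hypotheses
  -- on Z_1 enter only after it is fixed.
  obtain ⟨ε, hε0, hε1, hsol⟩ := hρ.exists_isShellSolvable hp hc0
    (hV.ae_mem.mono fun v hv => (hcV v hv).1) hσ hk
  exact ⟨ε, hε0, hε1,
    fun β γ hβ hγ => hρ.exists_isTransportSolution_of_traces hp hV hσ hk hε1 hsol hβ hγ,
    fun hσ' hk' =>
      ⟨fun u₀ γ hu₀ hγ => hρ.exists_boundary_control hp hV hσ' hk' hε1 hsol hu₀ hγ,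
        fun hd2 hVne =>
          hρ.exists_not_unique_continuation hd2 hp hV hVne hσ' hk' hε0 hε1 hsol⟩⟩
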